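/- Let $K$ be an algebraically closed field, let $n\ge 1$, and suppose that $\operatorname{char}K\neq 2$ and that $\operatorname{char}K$ divides $2n+1$. Let $\Lambda=P(\mathbb L_n)$ be the preprojective $K$-algebra of the graph $\mathbb L_n$, i.e. the line with vertices $1,\dots,n$ and one loop at the vertex $1$: it is the path algebra of the quiver with one loop $\epsilon=\bar\epsilon$ at $1$ and arrows $a_i:i\to i+1$, $\bar a_i:i+1\to i$ $(1\le i\le n-1)$, modulo the relations $\sum_{a:\,i(a)=i}a\bar a=0$, one for each vertex $i$, the sum being over the arrows $a$ with origin $i(a)=i$ (and $\bar{\bar a}=a$). Let $HH^*(\Lambda)=\bigoplus_{i\ge 0}\operatorname{Ext}^i_{\Lambda\otimes_K\Lambda^{op}}(\Lambda,\Lambda)$ be its Hochschild cohomology algebra with the Yoneda product. Then $HH^*(\Lambda)$ is isomorphic, as a graded $K$-algebra, to the graded commutative algebra given by a) Generators: $x_0,x_1,\dots,x_n,\ y,\ z_1,\dots,z_n,\ t_1,\dots,t_{n-1},\ \gamma,\ h$, with degrees $\deg x_i=0$, $\deg y=1$, $\deg z_j=2$, $\deg t_k=3$, $\deg\gamma=4$,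 $\deg h=6$. b) Relations: i) $x_i\xi=0$ for $i=1,\dots,n$ and each generator $\xi$; ii) $x_0^n=y^2=x_0z_j=x_0t_i=yt_i=t_it_k=0$ for $j=1,\dots,n$ and $i,k=1,\dots,n-1$; iii) $z_jz_k=(-1)^{k-j+1}(2j-1)(n-k+1)\,x_0^{n-1}\gamma$ for $1\le j\le k\le n$; iv) $z_j\gamma=(-1)^j(n-j+1)\,x_0^{n-1}h$ for $j=1,\dots,n$; v) $\gamma^2=z_1h$; vi) $yz_j=(-1)^{j-1}(2j-1)\,yz_1$ for $j=1,\dots,n$; vii) $z_kt_j=\delta_{jk}\,x_0^{n-1}y\gamma$ for $k=1,\dots,n$ and $j=1,\dots,n-1$; viii) $t_j\gamma=\delta_{1j}\,x_0^{n-1}yh$ for $j=1,\dots,n-1$. -/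

import Mathlib

open CategoryTheory TensorProduct
open scoped DirectSum

universe u

/-! ### Preprojective algebras of graphs -/

/-- A nonoriented graph without multiple edges, in which loops are allowed. -/
structure LoopGraph (V : Type) where
  /-- `Adj i j` : there is an edge (a loop, if `i = j`) between `i` and `j`. -/
  Adj : V → V → Prop
  symm : ∀ {i j : V}, Adj i j → Adj j i

/-- The vertices and the arrows of the quiver of a graph: every edge between different vertices
`i`, `j` gives two opposite arrows `i → j` and `j → i`, every loop gives one arrow. -/
inductive QuiverGen {V : Type} (Δ : LoopGraph V) : Type
  /-- the trivial path at the vertex `i` -/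
  | vertex (i : V) : QuiverGen Δ
  /-- the arrow from `i` to `j` -/
  | arrow (i j : V) (h : Δ.Adj i j) : QuiverGen Δ

/-- The relations of the preprojective algebra. The first five present the path algebra of the
quiver (paths are written from left to right); the last one is the preprojective relation
`∑ a * ā = 0`, where `a` runs over the arrows with origin `i`. The bar of the arrow `i → j` is the
arrow `j → i`, and a loop is its own bar. -/
inductive PreprojectiveRel (K : Type u) [Field K] {V : Type} [Fintype V] (Δ : LoopGraph V)
    [DecidableRel Δ.Adj] :
    FreeAlgebra K (QuiverGen Δ) → FreeAlgebra K (QuiverGen Δ) → Prop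
  | vertex_mul_self (i : V) :
      PreprojectiveRel K Δ
        (FreeAlgebra.ι K (.vertex i) * FreeAlgebra.ι K (.vertex i))
        (FreeAlgebra.ι K (.vertex i))
  | vertex_mul_vertex (i j : V) (h : i ≠ j) :
      PreprojectiveRel K Δ
        (FreeAlgebra.ι K (.vertex i) * FreeAlgebra.ι K (.vertex j)) 0
  | sum_vertex :
      PreprojectiveRel K Δ (∑ i : V, FreeAlgebra.ι K (.vertex i)) 1
  | vertex_mul_arrow (i j : V) (h : Δ.Adj i j) :
      PreprojectiveRel K Δ
        (FreeAlgebra.ι K (.vertex i) * FreeAlgebra.ι K (.arrow i j h))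
        (FreeAlgebra.ι K (.arrow i j h))
  | arrow_mul_vertex (i j : V) (h : Δ.Adj i j) :
      PreprojectiveRel K Δ
        (FreeAlgebra.ι K (.arrow i j h) * FreeAlgebra.ι K (.vertex j))
        (FreeAlgebra.ι K (.arrow i j h))
  | preprojective (i : V) :
      PreprojectiveRel K Δ
        (∑ j : {j : V // Δ.Adj i j},
          FreeAlgebra.ι K (.arrow i j.1 j.2) * FreeAlgebra.ι K (.arrow j.1 i (Δ.symm j.2))) 0

/-- The preprojective algebra `P(Δ)` of a finite graph `Δ` over `K`. -/
abbrev PreprojectiveAlgebra (K : Type u) [Field K] {V : Type} [Fintype V] (Δ : LoopGraph V)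
    [DecidableRel Δ.Adj] : Type u :=
  RingQuot (PreprojectiveRel K Δ)

/-- The graph `𝕃ₙ` : a line with `n` vertices and one loop at its first vertex. -/
def graphL (n : ℕ) : LoopGraph (Fin n) where
  Adj i j := (i : ℕ) + 1 = j ∨ (j : ℕ) + 1 = i ∨ ((i : ℕ) = 0 ∧ (j : ℕ) = 0)
  symm h := by tauto

instance (n : ℕ) : DecidableRel (graphL n).Adj := fun i j =>
  inferInstanceAs
    (Decidable ((i : ℕ) + 1 = j ∨ (j : ℕ) + 1 = i ∨ ((i : ℕ) = 0 ∧ (j : ℕ) = 0)))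

/-! ### The Hochschild cohomology algebra -/

section Hochschild

variable (K : Type u) [Field K] (A : Type u) [Ring A] [Algebra K A]

/-- The regular bimodule `A`, as a module over the enveloping algebra `A ⊗ Aᵒᵖ`,
with `(a ⊗ bᵒᵖ) • m = a * m * b`. -/
noncomputable def regularBimodule : ModuleCat.{u} (A ⊗[K] Aᵐᵒᵖ) :=
  letI : Module (A ⊗[K] Aᵐᵒᵖ) A := TensorProduct.Algebra.module
  ModuleCat.of (A ⊗[K] Aᵐᵒᵖ) A

/-- The `i`-th Hochschild cohomology space `HHⁱ(A) = Extⁱ(A, A)` over the enveloping algebra. -/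
def HH (i : ℕ) : Type u :=
  Abelian.Ext.{u} (regularBimodule K A) (regularBimodule K A) i

noncomputable instance (i : ℕ) : AddCommGroup (HH K A i) :=
  inferInstanceAs (AddCommGroup (Abelian.Ext.{u} (regularBimodule K A) (regularBimodule K A) i))

noncomputable instance (i : ℕ) : Module K (HH K A i) :=
  inferInstanceAs (Module K (Abelian.Ext.{u} (regularBimodule K A) (regularBimodule K A) i))

variable {K A}

/-- The Yoneda product `α β` (first `β`, then `α`) in Hochschild cohomology. -/
noncomputable def HH.yoneda {i j : ℕ} (α : HH K A i) (β : HH K A j) : HH K A (i + j) :=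
  Abelian.Ext.comp (X := regularBimodule K A) (Y := regularBimodule K A)
    (Z := regularBimodule K A) β α (add_comm j i)

/-- The identity of `A`, as an element of `HH⁰(A)`. -/
noncomputable def HH.one : HH K A 0 :=
  Abelian.Ext.mk₀ (𝟙 (regularBimodule K A))

variable (K A)

noncomputable instance : GradedMonoid.GMul (HH K A) where
  mul α β := HH.yoneda α β

noncomputable instance : GradedMonoid.GOne (HH K A) where
  one := HH.one

theorem HH.mk_comp_one {i j : ℕ} (h : i + 0 = j)
    (α : Abelian.Ext.{u} (regularBimodule K A) (regularBimodule K A) i) :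
    (GradedMonoid.mk j (α.comp (Abelian.Ext.mk₀ (𝟙 (regularBimodule K A))) h) :
      GradedMonoid (HH K A)) = GradedMonoid.mk i α := by
  obtain rfl : i = j := h
  exact congrArg (GradedMonoid.mk (A := HH K A) i) (Abelian.Ext.comp_mk₀_id α)

theorem HH.mk_one_comp {i j : ℕ} (h : 0 + i = j)
    (α : Abelian.Ext.{u} (regularBimodule K A) (regularBimodule K A) i) :
    (GradedMonoid.mk j ((Abelian.Ext.mk₀ (𝟙 (regularBimodule K A))).comp α h) :
      GradedMonoid (HH K A)) = GradedMonoid.mk i α := by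
  obtain rfl : i = j := (zero_add i).symm.trans h
  exact congrArg (GradedMonoid.mk (A := HH K A) i) (Abelian.Ext.mk₀_id_comp α)

theorem HH.mk_comp {i j c d : ℕ} (hc : i + j = c) (hd : i + j = d)
    (α : Abelian.Ext.{u} (regularBimodule K A) (regularBimodule K A) i)
    (β : Abelian.Ext.{u} (regularBimodule K A) (regularBimodule K A) j) :
    (GradedMonoid.mk c (α.comp β hc) : GradedMonoid (HH K A)) =
      GradedMonoid.mk d (α.comp β hd) := by
  subst hc hd
  rfl

noncomputable instance : DirectSum.GRing (HH K A) where
  mul_zero α := Abelian.Ext.zero_comp _ _ _ _ (add_comm _ _)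
  zero_mul β := Abelian.Ext.comp_zero _ _ _ _ (add_comm _ _)
  mul_add α β γ := Abelian.Ext.add_comp _ _ _ (add_comm _ _)
  add_mul α β γ := Abelian.Ext.comp_add _ _ _ (add_comm _ _)
  one_mul := fun ⟨i, α⟩ => HH.mk_comp_one K A (add_comm i 0) α
  mul_one := fun ⟨i, α⟩ => HH.mk_one_comp K A (add_comm 0 i) α
  mul_assoc := fun ⟨i, α⟩ ⟨j, β⟩ ⟨k, γ⟩ =>
    (congrArg (GradedMonoid.mk (A := HH K A) (i + j + k))
      (Abelian.Ext.comp_assoc (a₂₃ := i + j) (a₁₂ := j + k) γ β α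
        (add_comm k j) (add_comm j i) (by omega)).symm).trans
      (HH.mk_comp K A (by omega) (add_comm (j + k) i) _ _)
  natCast m := m • HH.one
  natCast_zero := zero_nsmul _
  natCast_succ m := succ_nsmul _ _
  intCast m := m • HH.one
  intCast_ofNat m := natCast_zsmul _ _
  intCast_negSucc_ofNat m := negSucc_zsmul _ _

theorem HH.smul_yoneda (c : K) {i j : ℕ} (α : HH K A i) (β : HH K A j) :
    HH.yoneda (c • α) β = c • HH.yoneda α β :=
  Abelian.Ext.comp_smul (X := regularBimodule K A) (Y := regularBimodule K A)
    (Z := regularBimodule K A) β α _ c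

theorem HH.yoneda_smul (c : K) {i j : ℕ} (α : HH K A i) (β : HH K A j) :
    HH.yoneda α (c • β) = c • HH.yoneda α β :=
  Abelian.Ext.smul_comp (X := regularBimodule K A) (Y := regularBimodule K A)
    (Z := regularBimodule K A) β α _ c

theorem HH.mk_smul_one_yoneda (c : K) {i : ℕ} (α : HH K A i) :
    (GradedMonoid.mk (0 + i) (HH.yoneda (c • HH.one) α) : GradedMonoid (HH K A)) =
      GradedMonoid.mk i (c • α) := by
  refine Eq.trans ?_ (HH.mk_comp_one K A (add_comm i 0) (c • α))
  refine congrArg (GradedMonoid.mk (A := HH K A) (0 + i)) ?_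
  exact (HH.smul_yoneda K A c HH.one α).trans (Abelian.Ext.smul_comp _ _ _ c).symm

theorem HH.mk_yoneda_smul_one (c : K) {i : ℕ} (α : HH K A i) :
    (GradedMonoid.mk (i + 0) (HH.yoneda α (c • HH.one)) : GradedMonoid (HH K A)) =
      GradedMonoid.mk i (c • α) := by
  refine Eq.trans ?_ (HH.mk_one_comp K A (add_comm 0 i) (c • α))
  refine congrArg (GradedMonoid.mk (A := HH K A) (i + 0)) ?_
  exact (HH.yoneda_smul K A c α HH.one).trans (Abelian.Ext.comp_smul _ _ _ c).symm

noncomputable instance : DirectSum.GAlgebra K (HH K A) where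
  toFun :=
    { toFun := fun c => c • (HH.one : HH K A 0)
      map_zero' := zero_smul _ _
      map_add' := fun c d => add_smul c d _ }
  map_one := by
    change (1 : K) • (HH.one : HH K A 0) = HH.one
    exact one_smul _ _
  map_mul c d :=
    (congrArg (GradedMonoid.mk (A := HH K A) 0) (mul_smul c d (HH.one : HH K A 0))).trans
      (HH.mk_smul_one_yoneda K A c (d • HH.one)).symm
  commutes := fun c ⟨_, α⟩ =>
    (HH.mk_smul_one_yoneda K A c α).trans (HH.mk_yoneda_smul_one K A c α).symm
  smul_def := fun c ⟨_, α⟩ => (HH.mk_smul_one_yoneda K A c α).symm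

/-- The Hochschild cohomology algebra `HH^*(A) = ⨁ᵢ HHⁱ(A)` with the Yoneda product. -/
abbrev HHAlgebra : Type u := ⨁ i, HH K A i

/-- The homogeneous component `HHᵈ(A)` as a subspace of `HH^*(A)`. -/
noncomputable def HHAlgebra.component (d : ℕ) : Submodule K (HHAlgebra K A) :=
  LinearMap.range (DirectSum.lof K ℕ (HH K A) d)

end Hochschild

/-! ### The algebra given by generators and relations -/

/-- The generators `x₀, …, xₙ`, `y`, `z₁, …, zₙ`, `t₁, …, tₙ₋₁`, `γ`, `h`. The generators `zⱼ` and
`tⱼ` are indexed by `Fin`, with `z j` and `t j` standing for the generators number `j + 1`. -/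
inductive Gen (n : ℕ) : Type
  | x (i : Fin (n + 1)) : Gen n
  | y : Gen n
  | z (j : Fin n) : Gen n
  | t (j : Fin (n - 1)) : Gen n
  | γ : Gen n
  | h : Gen n

/-- The degrees of the generators. -/
def Gen.deg {n : ℕ} : Gen n → ℕ
  | .x _ => 0
  | .y => 1
  | .z _ => 2
  | .t _ => 3
  | .γ => 4
  | .h => 6

/-- The number in `{1, …, m}` of an element of `Fin m`. -/
def Fin.pos1 {m : ℕ} (j : Fin m) : ℕ := (j : ℕ) + 1

/-- A generator, as an element of the free algebra. -/
noncomputable def genι (K : Type u) [Field K] {n : ℕ} (g : Gen n) : FreeAlgebra K (Gen n) :=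
  FreeAlgebra.ι K g

/-- The relations: graded commutativity of the generators, and the specific relations. -/
inductive GenRel (K : Type u) [Field K] (n : ℕ) :
    FreeAlgebra K (Gen n) → FreeAlgebra K (Gen n) → Prop
  | graded_comm (a b : Gen n) :
      GenRel K n (genι K a * genι K b) ((-1 : K) ^ (a.deg * b.deg) • (genι K b * genι K a))
  /-- `xᵢ ξ = 0` for `i = 1, …, n` and every generator `ξ` -/
  | x_mul (i : Fin (n + 1)) (hi : 1 ≤ (i : ℕ)) (ξ : Gen n) :
      GenRel K n (genι K (.x i) * genι K ξ) 0
  | x_zero_pow : GenRel K n (genι K (.x 0) ^ n) 0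
  | y_sq : GenRel K n (genι K .y ^ 2) 0
  | x_zero_mul_z (j : Fin n) : GenRel K n (genι K (.x 0) * genι K (.z j)) 0
  | x_zero_mul_t (i : Fin (n - 1)) : GenRel K n (genι K (.x 0) * genι K (.t i)) 0
  | y_mul_t (i : Fin (n - 1)) : GenRel K n (genι K .y * genι K (.t i)) 0
  | t_mul_t (i k : Fin (n - 1)) : GenRel K n (genι K (.t i) * genι K (.t k)) 0
  /-- `zⱼ zₖ = (-1)^(k-j+1) (2j-1) (n-k+1) x₀^(n-1) γ` for `1 ≤ j ≤ k ≤ n` -/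
  | z_mul_z (j k : Fin n) (hjk : j ≤ k) :
      GenRel K n (genι K (.z j) * genι K (.z k))
        (((-1 : K) ^ (k.pos1 - j.pos1 + 1) * (2 * (j.pos1 : K) - 1) * ((n : K) - k.pos1 + 1)) •
          (genι K (.x 0) ^ (n - 1) * genι K .γ))
  /-- `zⱼ γ = (-1)^j (n-j+1) x₀^(n-1) h` -/
  | z_mul_γ (j : Fin n) :
      GenRel K n (genι K (.z j) * genι K .γ)
        (((-1 : K) ^ j.pos1 * ((n : K) - j.pos1 + 1)) •
          (genι K (.x 0) ^ (n - 1) * genι K .h))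
  /-- `γ² = z₁ h` -/
  | γ_sq (j : Fin n) (hj : j.pos1 = 1) :
      GenRel K n (genι K .γ ^ 2) (genι K (.z j) * genι K .h)
  /-- `y zⱼ = (-1)^(j-1) (2j-1) y z₁` -/
  | y_mul_z (i j : Fin n) (hi : i.pos1 = 1) :
      GenRel K n (genι K .y * genι K (.z j))
        (((-1 : K) ^ (j.pos1 - 1) * (2 * (j.pos1 : K) - 1)) • (genι K .y * genι K (.z i)))
  /-- `zₖ tⱼ = δⱼₖ x₀^(n-1) y γ` -/
  | z_mul_t (k : Fin n) (j : Fin (n - 1)) :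
      GenRel K n (genι K (.z k) * genι K (.t j))
        ((if j.pos1 = k.pos1 then (1 : K) else 0) •
          (genι K (.x 0) ^ (n - 1) * genι K .y * genι K .γ))
  /-- `tⱼ γ = δ₁ⱼ x₀^(n-1) y h` -/
  | t_mul_γ (j : Fin (n - 1)) :
      GenRel K n (genι K (.t j) * genι K .γ)
        ((if j.pos1 = 1 then (1 : K) else 0) •
          (genι K (.x 0) ^ (n - 1) * genι K .y * genι K .h))

/-- The graded commutative algebra given by the generators and relations above. -/
abbrev PresentedAlgebra (K : Type u) [Field K] (n : ℕ) : Type u :=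
  RingQuot (GenRel K n)

/-- The class of a generator in the presented algebra. -/
noncomputable def PresentedAlgebra.gen (K : Type u) [Field K] {n : ℕ} (g : Gen n) :
    PresentedAlgebra K n :=
  RingQuot.mkAlgHom K (GenRel K n) (genι K g)

/-- The homogeneous component of degree `d` of the presented algebra: the span of the products of
generators of total degree `d`. -/
noncomputable def PresentedAlgebra.component (K : Type u) [Field K] (n d : ℕ) :
    Submodule K (PresentedAlgebra K n) :=
  Submodule.span K
    {a | ∃ l : List (Gen n), (l.map Gen.deg).sum = d ∧ (l.map (PresentedAlgebra.gen K)).prod = a}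

/-! Everything is computed from an explicit periodic bimodule resolution of the algebra.

After a change of signs of the arrows, the preprojective relations say that all walks of length `d`
from `i` to `j` have one common value `B i j d` (vertices are numbered from `0`). It vanishes as
soon as the walk can be rerouted through the absent vertex `n`; the remaining values form a basis,
as the regular representation shows (`AlgL.regularRep_walk`). The sum of the coefficients at the
socle elements `B i i (2 * n - 1)` is a symmetric form `τ`, for which `B i j d` is dual to `B j i (2
* n - 1 - d)`. `WalkAlgebra` records these facts together with the sum `D` of the arrows.

Let `μ` multiply degree `d` by `(-1) ^ d`. The resolution has three kinds of differentials: the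
commutator with `D`, the anticommutator with `D` (the linearised preprojective relation), and the
element `ω` corresponding to `μ` under the isomorphism of the enveloping algebra with `End A` given
by `τ`. The third syzygy is the algebra twisted by `μ`, so the differentials repeat up to a twist
after three steps and exactly after six. Exactness has three sources: the algebra is generated by
the vertices and `D`, derivations are determined by admissible values at `D`, and a `μ`-semilinear
map is determined by its value at `1` (`exact_at_zero`, `exact_at_one`, `exact_at_two`).

Cochains are elements of the algebra itself, and the cohomology is found by walking along the line.
The explicit cocycles `rep` span it in positive degrees as soon as `2` is invertible
(`cocyc_succ_le`), and the elements `test` pair with them as a dual basis while killing coboundaries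
(`τ_rep_mul_test`, `τ_bdry_mul_test`). There are `n` classes in every positive degree; in degree
zero the socle adds `n` more.

A product is computed by lifting its right factor to a chain map (`cl_mul`). Such lifts are explicit
for central elements, for the Euler derivation (degree one), for socle elements (degree three), for
a twisted derivation (degree four) and for the period (degree six). The right products with the
classes `z_j` are deduced instead: `t_i z_j` by comparing two homotopic lifts
(`τ_smul_soc_of_isLift`), the others by associativity, since multiplying by `y`, by `z_l` or by
`t_l` detects the unknown coefficients.

The characteristic enters through `n = -1/2`. The products `z_j y` are given by the matrix `-(-1) ^
(l + j) * (n - max l j) * (2 * min l j + 1)`, which then has rank one (`eulerLift_two_smul_e`). So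
all the `y z_j` are proportional, and because their common direction has a nonzero last coordinate,
`y z_1` takes the place of a further generator `t_n`.

Finally, the relations reduce every word to a combination of normal monomials
(`Holds.lift_mem_monSpan`), and the homomorphism `presentedHom` sends the normal monomials
bijectively to a basis of the cohomology. -/

/-! ### Extensions and iterated syzygies -/

section Syzygies

universe v w w'

variable {C : Type v} [Category.{w} C] [Abelian C] [HasExt.{w'} C]

/-- A chain of short exact sequences `0 ⟶ Ω (k + 1) ⟶ P k ⟶ Ω k ⟶ 0` with projective middle terms. -/
structure SyzygyChain (C : Type v) [Category.{w} C] [Abelian C] where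
  Ω : ℕ → C
  P : ℕ → C
  ι (k : ℕ) : Ω (k + 1) ⟶ P k
  π (k : ℕ) : P k ⟶ Ω k
  zero (k : ℕ) : ι k ≫ π k = 0
  exact (k : ℕ) : (ShortComplex.mk (ι k) (π k) (zero k)).ShortExact
  proj (k : ℕ) : Projective (P k)

namespace SyzygyChain

open Abelian

variable (R : SyzygyChain C)

/-- The class in `Extᵏ(Ω 0, Ω k)` of the iterated extension. -/
noncomputable def syzygyClass : ∀ k : ℕ, Ext.{w'} (R.Ω 0) (R.Ω k) k
  | 0 => Ext.mk₀ (𝟙 _)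
  | k + 1 => (syzygyClass k).comp (R.exact k).extClass rfl

/-- The class in `Extᵏ(Ω 0, Y)` of a morphism from the `k`-th syzygy to `Y`. -/
noncomputable def homClass {Y : C} (k : ℕ) (f : R.Ω k ⟶ Y) : Ext.{w'} (R.Ω 0) Y k :=
  (R.syzygyClass k).comp (Ext.mk₀ f) (add_zero k)

theorem homClass_add {Y : C} (k : ℕ) (f g : R.Ω k ⟶ Y) :
    R.homClass k (f + g) = R.homClass k f + R.homClass k g := by
  simp [homClass, Ext.mk₀_add]

theorem homClass_zero {Y : C} (k : ℕ) : R.homClass k (0 : R.Ω k ⟶ Y) = 0 := by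
  simp [homClass]

theorem homClass_smul {K : Type*} [CommRing K] [Linear K C] {Y : C} (k : ℕ) (c : K)
    (f : R.Ω k ⟶ Y) : R.homClass k (c • f) = c • R.homClass k f := by
  simp [homClass, Ext.mk₀_smul]

/-- Dimension shifting: to cross one short exact sequence, a class only has to vanish on the
projective middle term, and it does because its degree there is positive. -/
theorem exists_syzygyClass_comp {Y : C} (r : ℕ) : ∀ (j k : ℕ) (h : j + r = k)
    (α : Ext.{w'} (R.Ω 0) Y k), ∃ β : Ext.{w'} (R.Ω j) Y r, (R.syzygyClass j).comp β h = α := by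
  intro j
  induction j generalizing r with
  | zero =>
    intro k h α
    obtain rfl : r = k := by omega
    exact ⟨α, by simp [syzygyClass]⟩
  | succ j ih =>
    intro k h α
    obtain ⟨β, rfl⟩ := ih (r + 1) k (by omega) α
    have := R.proj j
    obtain ⟨β', rfl⟩ := Ext.contravariant_sequence_exact₃ (R.exact j) Y β
      (Ext.eq_zero_of_projective (P := R.P j) _) (n₀ := r) (by omega)
    exact ⟨β', Ext.comp_assoc _ _ _ _ _ (by omega)⟩

theorem homClass_surjective {Y : C} (k : ℕ) (α : Ext.{w'} (R.Ω 0) Y k) :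
    ∃ f, R.homClass k f = α := by
  obtain ⟨β, hβ⟩ := R.exists_syzygyClass_comp 0 k k rfl α
  obtain ⟨f, rfl⟩ := (Ext.mk₀_bijective _ _).2 β
  exact ⟨f, hβ⟩

/-- The injective half of dimension shifting. It needs positive degree: in degree zero a morphism
that extends to the projective term dies, which is what `homClass_succ_eq_zero_iff` measures. -/
theorem eq_zero_of_syzygyClass_comp {Y : C} (j : ℕ) : ∀ (r k : ℕ) (h : j + (r + 1) = k)
    (β : Ext.{w'} (R.Ω j) Y (r + 1)), (R.syzygyClass j).comp β h = 0 → β = 0 := by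
  induction j with
  | zero =>
    intro r k h β hβ
    obtain rfl : r + 1 = k := by omega
    simpa [syzygyClass] using hβ
  | succ j ih =>
    intro r k h β hβ
    rw [syzygyClass, Ext.comp_assoc (a₂₃ := (r + 1) + 1) _ _ _ _ (by omega) (by omega)] at hβ
    obtain ⟨x, rfl⟩ := Ext.contravariant_sequence_exact₁ (R.exact j) Y β _ (ih _ _ _ _ hβ)
    have := R.proj j
    rw [Ext.eq_zero_of_projective (P := R.P j) x, Ext.comp_zero]

theorem homClass_succ_eq_zero_iff {Y : C} (k : ℕ) (f : R.Ω (k + 1) ⟶ Y) :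
    R.homClass (k + 1) f = 0 ↔ ∃ g : R.P k ⟶ Y, R.ι k ≫ g = f := by
  constructor
  · intro h
    rw [homClass, syzygyClass, Ext.comp_assoc_of_third_deg_zero] at h
    obtain ⟨x, hx⟩ := Ext.contravariant_sequence_exact₁ (R.exact k) Y (Ext.mk₀ f) (add_zero 1)
      (R.eq_zero_of_syzygyClass_comp k 0 _ _ _ h)
    obtain ⟨g, rfl⟩ := (Ext.mk₀_bijective _ _).2 x
    exact ⟨g, (Ext.mk₀_bijective _ _).1 (by simpa using hx)⟩
  · rintro ⟨g, rfl⟩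
    rw [homClass, syzygyClass, Ext.comp_assoc_of_third_deg_zero, ← Ext.mk₀_comp_mk₀,
      ← Ext.comp_assoc_of_second_deg_zero, (R.exact k).extClass_comp, Ext.zero_comp, Ext.comp_zero]

theorem homClass_zero_injective {Y : C} (f : R.Ω 0 ⟶ Y) (h : R.homClass 0 f = 0) : f = 0 := by
  apply (Ext.mk₀_bijective _ _).1
  simpa [homClass, syzygyClass] using h

/-- The product of the classes of morphisms `g : Ω j ⟶ Ω 0`, `f : Ω i ⟶ Y` is computed by
lifting `g` along the syzygies. -/
theorem homClass_comp {Y : C} (i j : ℕ) (f : R.Ω i ⟶ Y) (G : ∀ k, R.Ω (j + k) ⟶ R.Ω k)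
    (Gp : ∀ k, R.P (j + k) ⟶ R.P k) (hι : ∀ k, R.ι (j + k) ≫ Gp k = G (k + 1) ≫ R.ι k)
    (hπ : ∀ k, R.π (j + k) ≫ G k = Gp k ≫ R.π k) :
    (R.homClass j (G 0)).comp (R.homClass i f) rfl = R.homClass (j + i) (G i ≫ f) := by
  -- Naturality of the extension class moves the lift past one syzygy at a time.
  have key : ∀ k, (R.homClass j (G 0)).comp (R.syzygyClass k) rfl = R.homClass (j + k) (G k) := by
    intro k
    induction k with
    | zero => simp [syzygyClass]
    | succ k ih =>
      rw [syzygyClass, ← Ext.comp_assoc (a₁₂ := j + k) _ _ _ rfl rfl (by omega), ih, homClass, homClass,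
        Ext.comp_assoc_of_second_deg_zero]
      have := (R.exact (j + k)).extClass_naturality (R.exact k)
        { τ₁ := G (k + 1), τ₂ := Gp k, τ₃ := G k, comm₁₂ := (hι k).symm, comm₂₃ := (hπ k).symm }
      dsimp at this
      rw [← this]
      exact (Ext.comp_assoc_of_third_deg_zero _ _ _ _).symm
  conv_lhs => rw [homClass.eq_def R i]
  rw [← Ext.comp_assoc_of_third_deg_zero, key, homClass, Ext.comp_assoc_of_third_deg_zero,
    Ext.mk₀_comp_mk₀]
  rfl

end SyzygyChain

end Syzygies

/-! ### Resolutions by left ideals generated by idempotents -/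

/-- A projective resolution of a cyclic module `X = S x` whose terms are the left ideals `S (e k)`
for idempotents `e k`; the differentials are the right multiplications by the elements `d k`. -/
structure IdempotentResolution (S : Type u) [Ring S] (X : Type u) [AddCommGroup X] [Module S X] where
  e : ℕ → S
  d : ℕ → S
  x : X
  e_mul_e (k : ℕ) : e k * e k = e k
  e_mul_d (k : ℕ) : e (k + 1) * d k = d k
  d_mul_e (k : ℕ) : d k * e k = d k
  e_smul_x : e 0 • x = x
  d_mul_d (k : ℕ) : d (k + 1) * d k = 0
  d_smul_x : d 0 • x = 0
  exists_smul_eq (m : X) : ∃ s : S, s • x = m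
  exact_zero (s : S) (hs : s * e 0 = s) (h : s • x = 0) : ∃ t, s = t * d 0
  exact_succ (k : ℕ) (s : S) (hs : s * e (k + 1) = s) (h : s * d k = 0) : ∃ t, s = t * d (k + 1)

namespace IdempotentResolution

variable {S : Type u} [Ring S] {X : Type u} [AddCommGroup X] [Module S X]
variable (R : IdempotentResolution S X)

theorem mem_span_e {k : ℕ} {s : S} : s ∈ Ideal.span {R.e k} ↔ s * R.e k = s := by
  rw [Ideal.mem_span_singleton']
  constructor
  · rintro ⟨a, rfl⟩
    rw [mul_assoc, R.e_mul_e]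
  · exact fun h => ⟨s, h⟩

/-- The `k`-th term of the resolution. -/
def proj (k : ℕ) : ModuleCat.{u} S := ModuleCat.of S (Ideal.span {R.e k})

/-- The syzygies of the resolution. -/
def syz : ℕ → ModuleCat.{u} S
  | 0 => ModuleCat.of S X
  | k + 1 => ModuleCat.of S (Ideal.span {R.d k})

theorem span_d_le (k : ℕ) : Ideal.span {R.d k} ≤ Ideal.span {R.e k} := by
  rw [Ideal.span_le, Set.singleton_subset_iff]
  exact R.mem_span_e.2 (R.d_mul_e k)

/-- The inclusion of a syzygy. -/
def incl (k : ℕ) : R.syz (k + 1) ⟶ R.proj k :=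
  ModuleCat.ofHom (Submodule.inclusion (R.span_d_le k))

/-- The projection to a syzygy. -/
def toSyz : ∀ k : ℕ, R.proj k ⟶ R.syz k
  | 0 => ModuleCat.ofHom ((LinearMap.toSpanSingleton S X R.x).comp (Submodule.subtype _))
  | k + 1 => ModuleCat.ofHom (LinearMap.codRestrict (Ideal.span {R.d k})
      ((LinearMap.toSpanSingleton S S (R.d k)).comp (Submodule.subtype _))
      (fun s => Ideal.mem_span_singleton'.2 ⟨s.1, rfl⟩))

theorem exact_syz (k : ℕ) (s : S) (hs : s ∈ Ideal.span {R.e k}) :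
    (R.toSyz k).hom ⟨s, hs⟩ = 0 ↔ s ∈ Ideal.span {R.d k} := by
  rw [Ideal.mem_span_singleton']
  have hs' := R.mem_span_e.1 hs
  cases k with
  | zero =>
    constructor
    · intro h
      obtain ⟨t, ht⟩ := R.exact_zero s hs' h
      exact ⟨t, ht.symm⟩
    · rintro ⟨t, rfl⟩
      change (t * R.d 0) • R.x = 0
      rw [mul_smul, R.d_smul_x, smul_zero]
  | succ k =>
    constructor
    · intro h
      obtain ⟨t, ht⟩ := R.exact_succ k s hs' (congrArg Subtype.val h)
      exact ⟨t, ht.symm⟩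
    · rintro ⟨t, rfl⟩
      apply Subtype.ext
      change (t * R.d (k + 1)) * R.d k = 0
      rw [mul_assoc, R.d_mul_d, mul_zero]

theorem toSyz_surjective (k : ℕ) : Function.Surjective (R.toSyz k).hom := by
  cases k with
  | zero =>
    intro m
    obtain ⟨s, hs⟩ := R.exists_smul_eq m
    refine ⟨⟨s * R.e 0, R.mem_span_e.2 (by rw [mul_assoc, R.e_mul_e])⟩, ?_⟩
    change (s * R.e 0) • R.x = m
    rw [mul_smul, R.e_smul_x, hs]
  | succ k =>
    rintro ⟨m, hm⟩
    obtain ⟨s, rfl⟩ := Ideal.mem_span_singleton'.1 hm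
    refine ⟨⟨s * R.e (k + 1), R.mem_span_e.2 (by rw [mul_assoc, R.e_mul_e])⟩, Subtype.ext ?_⟩
    change (s * R.e (k + 1)) * R.d k = s * R.d k
    rw [mul_assoc, R.e_mul_d]

theorem incl_toSyz (k : ℕ) : R.incl k ≫ R.toSyz k = 0 := by
  ext s
  exact (R.exact_syz k s.1 (R.span_d_le k s.2)).2 s.2

theorem projective_proj (k : ℕ) : Projective (R.proj k) := by
  apply (IsProjective.iff_projective _).1
  refine Module.Projective.of_split (Submodule.subtype (Ideal.span {R.e k}))
    (LinearMap.codRestrict _ (LinearMap.toSpanSingleton S S (R.e k))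
      (fun s => Ideal.mem_span_singleton'.2 ⟨s, rfl⟩)) ?_
  ext s
  exact R.mem_span_e.1 s.2

/-- The chain of syzygies of the resolution. -/
noncomputable def chain : SyzygyChain (ModuleCat.{u} S) where
  Ω := R.syz
  P := R.proj
  ι := R.incl
  π := R.toSyz
  zero := R.incl_toSyz
  proj := R.projective_proj
  exact k :=
    { exact := by
        rw [ShortComplex.moduleCat_exact_iff]
        rintro ⟨s, hs⟩ h
        exact ⟨⟨s, (R.exact_syz k s hs).1 h⟩, rfl⟩
      mono_f := (ModuleCat.mono_iff_injective _).2 (Submodule.inclusion_injective (R.span_d_le k))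
      epi_g := (ModuleCat.epi_iff_surjective _).2 (R.toSyz_surjective k) }

/-- The evaluation of an element of `X` at the `k`-th term of the resolution. -/
def eval (k : ℕ) (f : X) : R.proj k ⟶ ModuleCat.of S X :=
  ModuleCat.ofHom ((LinearMap.toSpanSingleton S X f).comp (Submodule.subtype _))

theorem eval_apply (k : ℕ) (f : X) (s : S) (hs : s ∈ Ideal.span {R.e k}) :
    (R.eval k f).hom ⟨s, hs⟩ = s • f := rfl

/-- The element `f` of `X` is a cocycle which represents the extension class `ξ`. -/
def Represents (k : ℕ) (f : X)
    (ξ : Abelian.Ext.{u} (ModuleCat.of S X) (ModuleCat.of S X) k) : Prop :=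
  R.e k • f = f ∧ ∃ φ : R.syz k ⟶ ModuleCat.of S X,
    R.toSyz k ≫ φ = R.eval k f ∧ R.chain.homClass (Y := ModuleCat.of S X) k φ = ξ

variable {R}

theorem hom_toSyz {k : ℕ} {f : X} {φ : R.syz k ⟶ ModuleCat.of S X}
    (h : R.toSyz k ≫ φ = R.eval k f) (s : S) (hs : s ∈ Ideal.span {R.e k}) :
    φ.hom ((R.toSyz k).hom ⟨s, hs⟩) = s • f := by
  rw [← R.eval_apply k f s hs, ← h]
  rfl

theorem Represents.e_smul {k : ℕ} {f : X} {ξ} (h : R.Represents k f ξ) : R.e k • f = f := h.1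

theorem Represents.d_smul {k : ℕ} {f : X} {ξ} (h : R.Represents k f ξ) : R.d k • f = 0 := by
  obtain ⟨_, φ, hφ, _⟩ := h
  have hd : R.d k ∈ Ideal.span {R.e k} := R.mem_span_e.2 (R.d_mul_e k)
  rw [← hom_toSyz hφ (R.d k) hd, (R.exact_syz k _ hd).2 (Ideal.mem_span_singleton_self _), map_zero]

theorem exists_represents {k : ℕ} {f : X} (he : R.e k • f = f) (hd : R.d k • f = 0) :
    ∃ ξ, R.Represents k f ξ := by
  have h0 : R.incl k ≫ R.eval k f = 0 := by
    ext ⟨s, hs⟩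
    obtain ⟨t, rfl⟩ := Ideal.mem_span_singleton'.1 hs
    change (t * R.d k) • f = 0
    rw [mul_smul, hd, smul_zero]
  have hex := (R.chain.exact k)
  have := hex.epi_g
  exact ⟨_, he, hex.exact.desc (R.eval k f) h0, hex.exact.g_desc (R.eval k f) h0, rfl⟩

-- A morphism out of the left ideal `S e` is determined by the image of `e`; this image is the
-- representing element.
variable (R) in
theorem exists_represents_class (k : ℕ)
    (ξ : Abelian.Ext.{u} (ModuleCat.of S X) (ModuleCat.of S X) k) :
    ∃ f, R.Represents k f ξ := by
  obtain ⟨φ, hφ⟩ := R.chain.homClass_surjective (Y := ModuleCat.of S X) k ξ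
  have he : R.e k ∈ Ideal.span {R.e k} := R.mem_span_e.2 (R.e_mul_e k)
  let ψ : R.proj k ⟶ ModuleCat.of S X := R.toSyz k ≫ φ
  have key : ∀ (s : S) (hs : s ∈ Ideal.span {R.e k}), ψ.hom ⟨s, hs⟩ = s • ψ.hom ⟨R.e k, he⟩ := by
    intro s hs
    refine Eq.trans ?_ (ψ.hom.map_smul s ⟨R.e k, he⟩)
    exact congrArg ψ.hom (Subtype.ext (R.mem_span_e.1 hs).symm)
  refine ⟨ψ.hom ⟨R.e k, he⟩, (key _ _).symm, φ, ?_, hφ⟩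
  ext ⟨s, hs⟩
  exact key s hs

theorem Represents.add {k : ℕ} {f g : X} {ξ ζ} (hf : R.Represents k f ξ)
    (hg : R.Represents k g ζ) : R.Represents k (f + g) (ξ + ζ) := by
  obtain ⟨hf, φ, hφ, rfl⟩ := hf
  obtain ⟨hg, ψ, hψ, rfl⟩ := hg
  refine ⟨by rw [smul_add, hf, hg], φ + ψ, ?_, SyzygyChain.homClass_add _ _ _ _⟩
  rw [Preadditive.comp_add, hφ, hψ]
  ext s
  exact (smul_add _ _ _).symm

theorem represents_zero (k : ℕ) : R.Represents k 0 0 :=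
  ⟨smul_zero _, 0, by ext s; exact (smul_zero s.1).symm, SyzygyChain.homClass_zero _ _⟩

theorem Represents.smul {K : Type*} [Field K] [Algebra K S] {k : ℕ} {f : X} {ξ} (c : K)
    (hf : R.Represents k f ξ) : R.Represents k (algebraMap K S c • f) (c • ξ) := by
  obtain ⟨hf, φ, hφ, rfl⟩ := hf
  refine ⟨by rw [smul_smul, ← Algebra.commutes, ← smul_smul, hf], c • φ, ?_,
    SyzygyChain.homClass_smul _ _ _ _⟩
  rw [Linear.comp_smul, hφ]
  ext ⟨s, hs⟩
  change algebraMap K S c • (s • f) = s • (algebraMap K S c • f)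
  rw [smul_smul, smul_smul, Algebra.commutes]

theorem Represents.unique {k : ℕ} {f : X} {ξ ζ} (hf : R.Represents k f ξ)
    (hg : R.Represents k f ζ) : ξ = ζ := by
  obtain ⟨_, φ, hφ, rfl⟩ := hf
  obtain ⟨_, ψ, hψ, rfl⟩ := hg
  have := (R.chain.exact k).epi_g
  congr 1
  exact (cancel_epi (R.chain.π k)).1 (hφ.trans hψ.symm)

theorem Represents.eq_zero_iff_zero {f : X} {ξ} (hf : R.Represents 0 f ξ) : ξ = 0 ↔ f = 0 := by
  constructor
  · rintro rfl
    obtain ⟨he, φ, hφ, h0⟩ := hf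
    obtain rfl := R.chain.homClass_zero_injective _ h0
    have := hom_toSyz hφ (R.e 0) (R.mem_span_e.2 (R.e_mul_e 0))
    rw [he] at this
    exact this.symm
  · rintro rfl
    exact hf.unique (represents_zero 0)

/-- A class is trivial when its morphism extends to the `k`-th projective, and such an extension is
given by its value `g` at `R.e k`. -/
theorem Represents.eq_zero_iff_succ {k : ℕ} {f : X} {ξ} (hf : R.Represents (k + 1) f ξ) :
    ξ = 0 ↔ ∃ g : X, f = R.d k • g := by
  have hd : R.d k ∈ Ideal.span {R.e k} := R.mem_span_e.2 (R.d_mul_e k)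
  have h1 : R.e (k + 1) ∈ Ideal.span {R.e (k + 1)} := R.mem_span_e.2 (R.e_mul_e _)
  obtain ⟨he, φ, hφ, rfl⟩ := hf
  refine (R.chain.homClass_succ_eq_zero_iff _ _).trans ?_
  constructor
  · rintro ⟨g, rfl⟩
    have hek : R.e k ∈ Ideal.span {R.e k} := R.mem_span_e.2 (R.e_mul_e k)
    refine ⟨g.hom ⟨R.e k, hek⟩, ?_⟩
    have := hom_toSyz hφ (R.e (k + 1)) h1
    rw [he] at this
    rw [← this]
    refine Eq.trans ?_ (g.hom.map_smul (R.d k) ⟨R.e k, hek⟩)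
    refine congrArg g.hom (Subtype.ext ?_)
    change R.e (k + 1) * R.d k = R.d k * R.e k
    rw [R.e_mul_d, R.d_mul_e]
  · rintro ⟨g, rfl⟩
    refine ⟨R.eval k g, ?_⟩
    have := (R.chain.exact (k + 1)).epi_g
    refine (cancel_epi (R.chain.π (k + 1))).1 (Eq.trans ?_ hφ.symm)
    ext ⟨s, hs⟩
    exact mul_smul s (R.d k) g

variable (R) in
/-- A chain map of degree `-j` of the resolution to itself, given by right multiplications. -/
structure IsLift (j : ℕ) (G : ℕ → S) : Prop where
  e_mul (k : ℕ) : R.e (j + k) * G k = G k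
  mul_e (k : ℕ) : G k * R.e k = G k
  comm (k : ℕ) : R.d (j + k) * G k = G (k + 1) * R.d k

theorem IsLift.comp {i j : ℕ} {F G : ℕ → S} (hG : R.IsLift j G) (hF : R.IsLift i F) :
    R.IsLift (j + i) (fun k => G (i + k) * F k) where
  e_mul k := by rw [← mul_assoc, add_assoc, hG.e_mul]
  mul_e k := by rw [mul_assoc, hF.mul_e]
  comm k := by
    rw [← mul_assoc, add_assoc, hG.comm, mul_assoc, hF.comm, ← mul_assoc]
    rfl

/-- Right multiplication by `G k` is a chain map, and by `comm` it carries the ideal of `d (j + k)`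
into that of `d k`, so it restricts to the syzygies and `homClass_comp` applies. -/
theorem Represents.comp {i j : ℕ} {f : X} {G : ℕ → S} {α β} (hβ : R.Represents j (G 0 • R.x) β)
    (hα : R.Represents i f α) (hG : R.IsLift j G) :
    R.Represents (j + i) (G i • f) (β.comp α rfl) := by
  obtain ⟨_, φ, hφ, rfl⟩ := hβ
  obtain ⟨hf, ψ, hψ, rfl⟩ := hα
  have hmem : ∀ k s, s ∈ Ideal.span {R.e (j + k)} → s * G k ∈ Ideal.span {R.e k} := by
    intro k s _
    rw [R.mem_span_e, mul_assoc, hG.mul_e]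
  have hmem' : ∀ k s, s ∈ Ideal.span {R.d (j + k)} → s * G k ∈ Ideal.span {R.d k} := by
    intro k s hs
    obtain ⟨t, rfl⟩ := Ideal.mem_span_singleton'.1 hs
    rw [mul_assoc, hG.comm, ← mul_assoc]
    exact Ideal.mem_span_singleton'.2 ⟨_, rfl⟩
  let Gp : ∀ k, R.proj (j + k) ⟶ R.proj k := fun k =>
    ModuleCat.ofHom (LinearMap.restrict (LinearMap.toSpanSingleton S S (G k)) (hmem k))
  -- The zeroth syzygy is `X` itself and not an ideal, so there the lift has to be the given
  -- morphism `φ`.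
  let Go : ∀ k, R.syz (j + k) ⟶ R.syz k := fun k => match k with
    | 0 => φ
    | k + 1 => ModuleCat.ofHom (LinearMap.restrict (LinearMap.toSpanSingleton S S (G k)) (hmem' k))
  have key := R.chain.homClass_comp (Y := ModuleCat.of S X) i j ψ Go Gp (fun k => rfl) (fun k => by
    cases k with
    | zero =>
      refine hφ.trans ?_
      ext ⟨s, hs⟩
      exact (mul_smul s (G 0) R.x).symm
    | succ k =>
      ext ⟨s, hs⟩
      apply Subtype.ext
      change (s * R.d (j + k)) * G k = (s * G (k + 1)) * R.d k
      rw [mul_assoc, hG.comm, mul_assoc])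
  refine ⟨by rw [smul_smul, hG.e_mul], Go i ≫ ψ, ?_, key.symm⟩
  have hπ : R.toSyz (j + i) ≫ Go i = Gp i ≫ R.toSyz i := by
    cases i with
    | zero =>
      refine hφ.trans ?_
      ext ⟨s, hs⟩
      exact (mul_smul s (G 0) R.x).symm
    | succ k =>
      ext ⟨s, hs⟩
      apply Subtype.ext
      change (s * R.d (j + k)) * G k = (s * G (k + 1)) * R.d k
      rw [mul_assoc, hG.comm, mul_assoc]
  rw [← Category.assoc, hπ, Category.assoc, hψ]
  ext ⟨s, hs⟩
  exact mul_smul s (G i) f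

/-- The comparison theorem for projective resolutions, in terms of elements: exactness supplies the
next component from the previous one. -/
theorem exists_isLift {j : ℕ} {f : X} (he : R.e j • f = f) (hd : R.d j • f = 0) :
    ∃ G, R.IsLift j G ∧ G 0 • R.x = f := by
  -- In degree zero the action on the generator `R.x` plays the role of the preceding differential.
  let killed : ℕ → S → Prop := fun k s => match k with
    | 0 => s • R.x = 0
    | k + 1 => s * R.d k = 0
  let Q : ℕ → S → Prop := fun k g =>
    R.e (j + k) * g = g ∧ g * R.e k = g ∧ killed k (R.d (j + k) * g)
  have step : ∀ k g, Q k g → ∃ g', Q (k + 1) g' ∧ R.d (j + k) * g = g' * R.d k := by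
    rintro k g ⟨h1, h2, h3⟩
    have : ∃ t, R.d (j + k) * g = t * R.d k := by
      cases k with
      | zero => exact R.exact_zero _ (by rw [mul_assoc, h2]) h3
      | succ k => exact R.exact_succ k _ (by rw [mul_assoc, h2]) h3
    obtain ⟨t, ht⟩ := this
    -- Cutting `t` down by the idempotents makes it a map between the correct projectives without
    -- changing the product.
    have ht' : R.d (j + k) * g = (R.e (j + k + 1) * t * R.e (k + 1)) * R.d k := by
      rw [mul_assoc, R.e_mul_d, mul_assoc, ← ht, ← mul_assoc, R.e_mul_d]
    refine ⟨R.e (j + k + 1) * t * R.e (k + 1), ⟨?_, ?_, ?_⟩, ht'⟩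
    · rw [← add_assoc, ← mul_assoc, ← mul_assoc, R.e_mul_e]
    · rw [mul_assoc, R.e_mul_e]
    · change _ * _ * R.d k = 0
      rw [mul_assoc, ← ht', ← mul_assoc, ← add_assoc, R.d_mul_d, zero_mul]
  obtain ⟨s, hs⟩ := R.exists_smul_eq f
  have h0 : (R.e j * s * R.e 0) • R.x = f := by
    rw [mul_smul, R.e_smul_x, mul_smul, hs, he]
  have hQ0 : Q 0 (R.e j * s * R.e 0) := by
    refine ⟨?_, ?_, ?_⟩
    · rw [← mul_assoc, ← mul_assoc, add_zero, R.e_mul_e]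
    · rw [mul_assoc, R.e_mul_e]
    · change (_ * _) • R.x = 0
      rw [mul_smul, h0, add_zero, hd]
  choose! next hnext using step
  let G : ∀ k, {g : S // Q k g} := fun k =>
    Nat.rec ⟨_, hQ0⟩ (fun k g => ⟨next k g.1, (hnext k g.1 g.2).1⟩) k
  exact ⟨fun k => (G k).1, ⟨fun k => (G k).2.1, fun k => (G k).2.2.1,
    fun k => (hnext k (G k).1 (G k).2).2⟩, h0⟩

theorem IsLift.exists_homotopy {j : ℕ} {F G : ℕ → S} (hF : R.IsLift (j + 1) F)
    (hG : R.IsLift (j + 1) G) {g : X} (h : F 0 • R.x - G 0 • R.x = R.d j • g) (k : ℕ) :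
    ∃ s t, F k - G k = R.d (j + k) * s + t * R.d k := by
  -- The normalisation of `t` is carried along because exactness in the next step applies only to
  -- elements fixed by the idempotent.
  suffices ∃ s t, t * R.e (k + 1) = t ∧ F k - G k = R.d (j + k) * s + t * R.d k by
    obtain ⟨s, t, -, h⟩ := this
    exact ⟨s, t, h⟩
  induction k with
  | zero =>
    obtain ⟨s, hs⟩ := R.exists_smul_eq g
    obtain ⟨t, ht⟩ := R.exact_zero (F 0 - G 0 - R.d j * (s * R.e 0))
      (by simp only [sub_mul, hF.mul_e, hG.mul_e, mul_assoc, R.e_mul_e])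
      (by rw [sub_smul, sub_smul, h, mul_smul, mul_smul, R.e_smul_x, hs, sub_self])
    refine ⟨s * R.e 0, t * R.e 1, by rw [mul_assoc, R.e_mul_e], ?_⟩
    rw [mul_assoc t, R.e_mul_d, ← ht, add_zero]
    abel
  | succ k ih =>
    obtain ⟨s, t, ht, hst⟩ := ih
    obtain ⟨t', ht'⟩ := R.exact_succ k (F (k + 1) - G (k + 1) - R.d (j + (k + 1)) * t)
      (by simp only [sub_mul, hF.mul_e, hG.mul_e, mul_assoc, ht])
      (by
        rw [sub_mul, sub_mul, ← hF.comm, ← hG.comm, ← mul_sub, hst, mul_add, ← mul_assoc,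
          show j + 1 + k = j + k + 1 by omega, R.d_mul_d, zero_mul, zero_add, mul_assoc]
        exact sub_self _)
    refine ⟨t, t' * R.e (k + 1 + 1), by rw [mul_assoc, R.e_mul_e], ?_⟩
    rw [mul_assoc t', R.e_mul_d, ← ht']
    abel

end IdempotentResolution

/-! ### Walks on a line with a loop -/

/-- There is a walk of length `d` from `i` to `j` on the infinite line `0, 1, 2, …` with a loop
at `0`. -/
def IsWalk (i j d : ℕ) : Prop :=
  (i ≤ j + d ∧ j ≤ i + d ∧ (i + j + d) % 2 = 0) ∨ (i + j + 1 ≤ d ∧ (i + j + d) % 2 = 1)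

/-- The walks of length `d` from `i` to `j` are nonzero in the preprojective algebra of `𝕃ₙ`. -/
def IsBasic (n i j d : ℕ) : Prop :=
  i < n ∧ j < n ∧ ((i ≤ j + d ∧ j ≤ i + d ∧ d + i + j + 2 ≤ 2 * n ∧ (i + j + d) % 2 = 0) ∨
    (i + j + 1 ≤ d ∧ d + i + 1 ≤ 2 * n + j ∧ d + j + 1 ≤ 2 * n + i ∧ (i + j + d) % 2 = 1))

instance (i j d : ℕ) : Decidable (IsWalk i j d) := by unfold IsWalk; infer_instance

instance (n i j d : ℕ) : Decidable (IsBasic n i j d) := by unfold IsBasic; infer_instance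

theorem IsBasic.isWalk {n i j d : ℕ} (h : IsBasic n i j d) : IsWalk i j d := by
  unfold IsBasic at h; unfold IsWalk; omega

theorem IsWalk.trans {i j l d d' : ℕ} (h : IsWalk i j d) (h' : IsWalk j l d') :
    IsWalk i l (d + d') := by
  unfold IsWalk at *; omega

/-- Complementing the length exchanges the two parity cases and their inequalities. This symmetry of
the basis is the combinatorial form of the nondegeneracy of the trace form. -/
theorem isBasic_dual {n i j d : ℕ} (hd : d < 2 * n) :
    IsBasic n j i (2 * n - 1 - d) ↔ IsBasic n i j d := by
  unfold IsBasic; omega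

theorem IsBasic.lt {n i j d : ℕ} (h : IsBasic n i j d) : d < 2 * n := by
  unfold IsBasic at h; omega

/-- The generators of the preprojective algebra of `𝕃ₙ`, with signs such that the relations become
commutation relations. -/
structure LineSystem (n : ℕ) (A : Type*) [Ring A] where
  e : ℕ → A
  p : ℕ → A
  q : ℕ → A
  ε : A
  e_mul_e (i : ℕ) : e i * e i = e i
  e_mul_e_ne (i j : ℕ) (h : i ≠ j) : e i * e j = 0
  e_eq_zero (i : ℕ) (h : n ≤ i) : e i = 0
  e_mul_p (i : ℕ) : e i * p i = p i
  p_mul_e (i : ℕ) : p i * e (i + 1) = p i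
  e_mul_q (i : ℕ) : e (i + 1) * q i = q i
  q_mul_e (i : ℕ) : q i * e i = q i
  e_mul_ε : e 0 * ε = ε
  ε_mul_e : ε * e 0 = ε
  ε_mul_ε : ε * ε = p 0 * q 0
  q_mul_p (i : ℕ) : q i * p i = p (i + 1) * q (i + 1)

namespace LineSystem

variable {n : ℕ} {A : Type*} [Ring A] (L : LineSystem n A)

/-- The common value of all walks of length `d` from `i` to `j`. -/
def walk (i : ℕ) : ℕ → ℕ → A
  | j, 0 => if i = j then L.e i else 0
  | j, d + 1 =>
    if 1 ≤ j ∧ IsWalk i (j - 1) d then walk i (j - 1) d * L.p (j - 1)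
    else if IsWalk i (j + 1) d then walk i (j + 1) d * L.q j
    else if j = 0 ∧ IsWalk i 0 d then walk i 0 d * L.ε else 0

theorem walk_zero (i j : ℕ) : L.walk i j 0 = if i = j then L.e i else 0 := by
  rw [walk]

theorem walk_mul_p {i j d : ℕ} (h : IsWalk i j d) :
    L.walk i j d * L.p j = L.walk i (j + 1) (d + 1) := by
  rw [walk.eq_def L i (j + 1) (d + 1)]
  simp [h]

/-- The recursion for `walk` prefers a final upward step. When both final steps are possible,
`q_mul_p` interchanges them one step earlier. -/
theorem walk_mul_q {i j d : ℕ} (h : IsWalk i (j + 1) d) :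
    L.walk i (j + 1) d * L.q j = L.walk i j (d + 1) := by
  induction d generalizing j with
  | zero =>
    have h1 : ¬ IsWalk i (j - 1) 0 := by unfold IsWalk at *; omega
    rw [walk.eq_def L i j (0 + 1)]
    simp [h, h1]
  | succ d ih =>
    rw [walk.eq_def L i j (d + 1 + 1)]
    by_cases h1 : 1 ≤ j ∧ IsWalk i (j - 1) (d + 1)
    · obtain ⟨j, rfl⟩ : ∃ k, j = k + 1 := ⟨j - 1, by omega⟩
      have h2 : IsWalk i (j + 1) d := by
        rw [Nat.add_sub_cancel] at h1
        unfold IsWalk at *; omega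
      simp only [Nat.add_sub_cancel, if_pos (show 1 ≤ j + 1 ∧ IsWalk i j (d + 1) from h1)]
      rw [← ih h2, mul_assoc, L.q_mul_p, ← L.walk_mul_p h2, mul_assoc]
    · simp only [if_neg h1, if_pos h]

/-- Here the competing final step is downward from vertex `1`, and the relation `ε_mul_ε` trades it
for the loop. -/
theorem walk_mul_ε {i d : ℕ} (h : IsWalk i 0 d) : L.walk i 0 d * L.ε = L.walk i 0 (d + 1) := by
  induction d with
  | zero =>
    have h1 : ¬ IsWalk i 1 0 := by unfold IsWalk at *; omega
    rw [walk.eq_def L i 0 (0 + 1)]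
    simp [h, h1]
  | succ d ih =>
    rw [walk.eq_def L i 0 (d + 1 + 1)]
    by_cases h1 : IsWalk i 1 (d + 1)
    · have h2 : IsWalk i 0 d := by unfold IsWalk at *; omega
      simp only [if_pos h1, zero_add, nonpos_iff_eq_zero, one_ne_zero, false_and, if_false]
      rw [← ih h2, mul_assoc, L.ε_mul_ε, ← mul_assoc, L.walk_mul_p h2]
    · simp [h1, h]

theorem walk_succ_cases {i j d : ℕ} (h : IsWalk i j (d + 1)) :
    (∃ k, j = k + 1 ∧ IsWalk i k d) ∨ IsWalk i (j + 1) d ∨ (j = 0 ∧ IsWalk i 0 d) := by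
  by_contra hc
  rw [not_or, not_or] at hc
  have h1 : ¬ (1 ≤ j ∧ IsWalk i (j - 1) d) := fun h' => hc.1 ⟨j - 1, by omega, h'.2⟩
  have h2 := hc.2
  clear hc
  unfold IsWalk at *
  omega

theorem walk_eq_zero {i j d : ℕ} (h : ¬ IsWalk i j d) : L.walk i j d = 0 := by
  cases d with
  | zero =>
    rw [walk_zero, if_neg]
    unfold IsWalk at h; omega
  | succ d =>
    rw [walk, if_neg, if_neg, if_neg] <;> intro h' <;> unfold IsWalk at * <;> omega

theorem walk_mul_e (i j d : ℕ) : L.walk i j d * L.e j = L.walk i j d := by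
  by_cases h : IsWalk i j d
  · cases d with
    | zero =>
      rw [walk_zero]
      split_ifs with h
      · rw [h, L.e_mul_e]
      · rw [zero_mul]
    | succ d =>
      rcases walk_succ_cases h with ⟨k, rfl, hk⟩ | hk | ⟨rfl, hk⟩
      · rw [← L.walk_mul_p hk, mul_assoc, L.p_mul_e]
      · rw [← L.walk_mul_q hk, mul_assoc, L.q_mul_e]
      · rw [← L.walk_mul_ε hk, mul_assoc, L.ε_mul_e]
  · rw [L.walk_eq_zero h, zero_mul]

theorem e_mul_walk (i j d : ℕ) : L.e i * L.walk i j d = L.walk i j d := by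
  induction d generalizing j with
  | zero =>
    rw [walk_zero]
    split_ifs with h
    · rw [L.e_mul_e]
    · rw [mul_zero]
  | succ d ih =>
    by_cases h : IsWalk i j (d + 1)
    · rcases walk_succ_cases h with ⟨k, rfl, hk⟩ | hk | ⟨rfl, hk⟩
      · rw [← L.walk_mul_p hk, ← mul_assoc, ih]
      · rw [← L.walk_mul_q hk, ← mul_assoc, ih]
      · rw [← L.walk_mul_ε hk, ← mul_assoc, ih]
    · rw [L.walk_eq_zero h, mul_zero]

theorem walk_mul_walk {i j l d d' : ℕ} (h : IsWalk i j d) (h' : IsWalk j l d') :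
    L.walk i j d * L.walk j l d' = L.walk i l (d + d') := by
  induction d' generalizing l with
  | zero =>
    obtain rfl : j = l := by unfold IsWalk at h'; omega
    rw [walk_zero, if_pos rfl, walk_mul_e, add_zero]
  | succ d' ih =>
    rcases walk_succ_cases h' with ⟨k, rfl, hk⟩ | hk | ⟨rfl, hk⟩
    · rw [← L.walk_mul_p hk, ← mul_assoc, ih hk, L.walk_mul_p (h.trans hk), add_assoc]
    · rw [← L.walk_mul_q hk, ← mul_assoc, ih hk, L.walk_mul_q (h.trans hk), add_assoc]
    · rw [← L.walk_mul_ε hk, ← mul_assoc, ih hk, L.walk_mul_ε (h.trans hk), add_assoc]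

/-- A walk which is too long to be basic can be rerouted through the vertex `n`, where the
idempotent is zero. -/
theorem walk_eq_zero_of_not_isBasic {i j d : ℕ} (h : ¬ IsBasic n i j d) : L.walk i j d = 0 := by
  by_cases hw : IsWalk i j d
  · by_cases hi : n ≤ i
    · rw [← L.e_mul_walk, L.e_eq_zero i hi, zero_mul]
    by_cases hj : n ≤ j
    · rw [← L.walk_mul_e, L.e_eq_zero j hj, mul_zero]
    obtain ⟨a, b, rfl, ha, hb⟩ : ∃ a b, d = a + b ∧ IsWalk i n a ∧ IsWalk n j b := by
      by_cases hp : (i + j + d) % 2 = 0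
      · refine ⟨n - i, d - (n - i), ?_⟩
        unfold IsWalk IsBasic at *; omega
      -- For odd parity the route must use the loop as well as the vertex `n`; the shortest such
      -- route takes the loop on the side of the smaller endpoint.
      · by_cases hij : i ≤ j
        · refine ⟨n + i + 1, d - (n + i + 1), ?_⟩
          unfold IsWalk IsBasic at *; omega
        · refine ⟨n - i, d - (n - i), ?_⟩
          unfold IsWalk IsBasic at *; omega
    rw [← L.walk_mul_walk ha hb, ← L.walk_mul_e i n, L.e_eq_zero n le_rfl, mul_zero, zero_mul]
  · exact L.walk_eq_zero hw

theorem walk_mul_walk_of_isBasic {i j l d d' : ℕ} (h : IsBasic n i j d) (h' : IsBasic n j l d') :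
    L.walk i j d * L.walk j l d' = L.walk i l (d + d') :=
  L.walk_mul_walk h.isWalk h'.isWalk

theorem walk_mul_walk_ne {i j k l d d' : ℕ} (h : j ≠ k) :
    L.walk i j d * L.walk k l d' = 0 := by
  rw [← L.walk_mul_e, ← L.e_mul_walk k, mul_assoc, ← mul_assoc (L.e j), L.e_mul_e_ne j k h,
    zero_mul, mul_zero]

theorem walk_self_zero (i : ℕ) : L.walk i i 0 = L.e i := by
  rw [walk_zero, if_pos rfl]

theorem walk_p (i : ℕ) : L.walk i (i + 1) 1 = L.p i := by
  rw [← L.walk_mul_p (d := 0) (by unfold IsWalk; omega), walk_self_zero, e_mul_p]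

theorem walk_q (i : ℕ) : L.walk (i + 1) i 1 = L.q i := by
  rw [← L.walk_mul_q (d := 0) (by unfold IsWalk; omega), walk_self_zero, e_mul_q]

theorem walk_ε : L.walk 0 0 1 = L.ε := by
  rw [← L.walk_mul_ε (d := 0) (by unfold IsWalk; omega), walk_self_zero, e_mul_ε]

/-- A basic walk has a first step after which the rest is still basic. This permits induction on the
length in the left regular representation. -/
theorem _root_.IsBasic.exists_left {n i j d : ℕ} (h : IsBasic n i j (d + 1)) :
    ∃ k, (k = i + 1 ∨ i = k + 1 ∨ (i = 0 ∧ k = 0)) ∧ IsBasic n k j d := by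
  by_cases hk : i = 0 ∧ (i + j + d) % 2 = 0
  · exact ⟨0, by omega, by unfold IsBasic at *; omega⟩
  · by_cases hk' : 1 ≤ i ∧ ((i + j + d) % 2 = 0 ∨ j ≤ i + d)
    · exact ⟨i - 1, by omega, by unfold IsBasic at *; omega⟩
    · exact ⟨i + 1, by omega, by unfold IsBasic at *; omega⟩

end LineSystem

/-! ### The preprojective algebra of `𝕃ₙ` -/

section EnvelopingAlgebra

variable (K : Type u) [Field K]

/-- The enveloping algebra of an algebra. -/
def Env (A : Type u) [Ring A] [Algebra K A] : Type u := A ⊗[K] Aᵐᵒᵖ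

variable {A : Type u} [Ring A] [Algebra K A]

noncomputable instance : Ring (Env K A) := inferInstanceAs (Ring (A ⊗[K] Aᵐᵒᵖ))

noncomputable instance : Algebra K (Env K A) := inferInstanceAs (Algebra K (A ⊗[K] Aᵐᵒᵖ))

noncomputable instance : Module (Env K A) A :=
  letI : Module (A ⊗[K] Aᵐᵒᵖ) A := TensorProduct.Algebra.module
  inferInstanceAs (Module (A ⊗[K] Aᵐᵒᵖ) A)

/-- The inclusion of the left factor. -/
noncomputable def Env.inl : A →ₐ[K] Env K A :=
  (Algebra.TensorProduct.includeLeft : A →ₐ[K] A ⊗[K] Aᵐᵒᵖ)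

/-- The inclusion of the right factor. -/
noncomputable def Env.inr : Aᵐᵒᵖ →ₐ[K] Env K A :=
  (Algebra.TensorProduct.includeRight : Aᵐᵒᵖ →ₐ[K] A ⊗[K] Aᵐᵒᵖ)

/-- The element `u ⊗ vᵒᵖ` of the enveloping algebra. -/
noncomputable def bi (u v : A) : Env K A := Env.inl K u * Env.inr K (MulOpposite.op v)

theorem Env.commute (u v : A) : Env.inl K u * Env.inr K (MulOpposite.op v) =
    Env.inr K (MulOpposite.op v) * Env.inl K u := by
  change (u ⊗ₜ[K] (1 : Aᵐᵒᵖ)) * ((1 : A) ⊗ₜ[K] MulOpposite.op v) =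
    ((1 : A) ⊗ₜ[K] MulOpposite.op v) * (u ⊗ₜ[K] (1 : Aᵐᵒᵖ))
  simp

theorem bi_eq_tmul (u v : A) : bi K u v = (u ⊗ₜ[K] MulOpposite.op v : A ⊗[K] Aᵐᵒᵖ) := by
  change (u ⊗ₜ[K] (1 : Aᵐᵒᵖ)) * ((1 : A) ⊗ₜ[K] MulOpposite.op v) = u ⊗ₜ[K] MulOpposite.op v
  simp

theorem bi_smul_eq (u v m : A) : bi K u v • m = u * m * v := by
  rw [bi_eq_tmul]
  letI : Module (A ⊗[K] Aᵐᵒᵖ) A := TensorProduct.Algebra.module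
  change (u ⊗ₜ[K] MulOpposite.op v : A ⊗[K] Aᵐᵒᵖ) • m = u * m * v
  rw [TensorProduct.Algebra.smul_def]
  simp [mul_assoc]

theorem env_induction {p : Env K A → Prop} (h0 : p 0) (h1 : ∀ u v, p (bi K u v))
    (h2 : ∀ s t, p s → p t → p (s + t)) (s : Env K A) : p s := by
  refine TensorProduct.induction_on (R := K) (M := A) (N := Aᵐᵒᵖ) (motive := p) s h0
    (fun u v => ?_) h2
  have := h1 u v.unop
  rw [bi_eq_tmul] at this
  exact this

theorem bi_mul_bi (u v u' v' : A) : bi K u v * bi K u' v' = bi K (u * u') (v' * v) := by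
  rw [bi, bi, bi, map_mul, MulOpposite.op_mul, map_mul, mul_assoc, mul_assoc, ← mul_assoc (Env.inr K _),
    ← Env.commute, mul_assoc]

theorem bi_one_one : bi K (1 : A) 1 = 1 := by simp [bi]

theorem bi_add (u v w : A) : bi K u (v + w) = bi K u v + bi K u w := by
  simp [bi, mul_add]

theorem add_bi (u v w : A) : bi K (u + v) w = bi K u w + bi K v w := by
  simp [bi, add_mul]

theorem bi_zero (u : A) : bi K u 0 = 0 := by simp [bi]

theorem zero_bi (u : A) : bi K 0 u = 0 := by simp [bi]

theorem bi_zero_smul {N : Type*} [AddCommGroup N] [Module (Env K A) N] (u : A) (m : N) :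
    bi K u 0 • m = 0 := by rw [bi_zero, zero_smul]

theorem zero_bi_smul {N : Type*} [AddCommGroup N] [Module (Env K A) N] (u : A) (m : N) :
    bi K 0 u • m = 0 := by rw [zero_bi, zero_smul]

theorem bi_sum {ι : Type*} (s : Finset ι) (u : A) (f : ι → A) :
    bi K u (∑ i ∈ s, f i) = ∑ i ∈ s, bi K u (f i) := by
  rw [bi, Finset.op_sum, map_sum, Finset.mul_sum]; rfl

theorem sum_bi {ι : Type*} (s : Finset ι) (u : A) (f : ι → A) :
    bi K (∑ i ∈ s, f i) u = ∑ i ∈ s, bi K (f i) u := by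
  simp [bi, map_sum, Finset.sum_mul]

theorem smul_bi (c : K) (u v : A) : bi K (c • u) v = c • bi K u v := by
  simp [bi]

theorem bi_smul (c : K) (u v : A) : bi K u (c • v) = c • bi K u v := by
  simp [bi]

theorem neg_bi (u v : A) : bi K (-u) v = -bi K u v := by
  simp [bi]

theorem algebraMap_mul_bi (c : K) (u v : A) : algebraMap K (Env K A) c * bi K u v = bi K (c • u) v := by
  rw [← Algebra.smul_def, smul_bi]

theorem bi_smul_right (c : K) (u v : A) : bi K u (c • v) = bi K (c • u) v := by
  rw [smul_bi, bi_smul]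

theorem algebraMap_env_smul (c : K) (m : A) : algebraMap K (Env K A) c • m = c • m := by
  have h : algebraMap K (Env K A) c = bi K (c • 1) 1 := by
    rw [← algebraMap_mul_bi, bi_one_one, mul_one]
  rw [h, bi_smul_eq, smul_mul_assoc, one_mul, mul_one]

end EnvelopingAlgebra

/-- The facts on the preprojective algebra of `𝕃ₙ` which determine its Hochschild cohomology: the
basis of walks `B i j d`, the trace form `τ`, the sum `D` of the arrows and the universal property
for derivations. -/
structure WalkAlgebra (K : Type u) [Field K] (n : ℕ) (A : Type u) [Ring A] [Algebra K A] where
  B : ℕ → ℕ → ℕ → A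
  τ : A →ₗ[K] K
  B_mul_B (i j k l d d' : ℕ) : B i j d * B k l d' =
    if j = k ∧ IsBasic n i j d ∧ IsBasic n k l d' then B i l (d + d') else 0
  B_eq_zero (i j d : ℕ) (h : ¬ IsBasic n i j d) : B i j d = 0
  span_B : Submodule.span K {a | ∃ i j d, a = B i j d} = ⊤
  sum_B : ∑ i ∈ Finset.range n, B i i 0 = 1
  τ_B (i j d : ℕ) : τ (B i j d) = if i = j ∧ d + 1 = 2 * n ∧ i < n then 1 else 0
  D : A
  D_eq : D = B 0 0 1 +
    ∑ i ∈ Finset.range n, ((-1 : K) ^ (i + 1) • B i (i + 1) 1 + B (i + 1) i 1)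
  generate (T : Subalgebra K A) (h : ∀ i, B i i 0 ∈ T) (hD : D ∈ T) : T = ⊤
  exists_derivation (N : Type u) [AddCommGroup N] [Module (Env K A) N] (ν : N)
    (h1 : bi K (B 0 0 0) (B 0 0 0) • ν + ∑ i ∈ Finset.range n, (bi K (B i i 0) (B (i + 1) (i + 1) 0) • ν +
      bi K (B (i + 1) (i + 1) 0) (B i i 0) • ν) = ν)
    (h2 : ∑ i ∈ Finset.range n, bi K (B i i 0) (B i i 0) • (bi K D 1 • ν + bi K 1 D • ν) = 0) :
    ∃ Δ : A →+ N, (∀ u v, Δ (u * v) = bi K u 1 • Δ v + bi K 1 v • Δ u) ∧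
      (∀ c : K, Δ (algebraMap K A c) = 0) ∧ (∀ i, Δ (B i i 0) = 0) ∧ Δ D = ν

section Preprojective

variable (K : Type u) [Field K] (n : ℕ)

/-- The preprojective algebra of `𝕃ₙ`. -/
abbrev AlgL : Type u := PreprojectiveAlgebra K (graphL n)

namespace AlgL

variable {n}

/-- The trivial path at a vertex. -/
noncomputable def vtx (i : Fin n) : AlgL K n :=
  RingQuot.mkAlgHom K _ (FreeAlgebra.ι K (.vertex i))

/-- The arrow from `i` to `j`, or zero. -/
noncomputable def arr (i j : Fin n) : AlgL K n :=
  if h : (graphL n).Adj i j then RingQuot.mkAlgHom K _ (FreeAlgebra.ι K (.arrow i j h)) else 0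

variable {K}

theorem arr_of_adj {i j : Fin n} (h : (graphL n).Adj i j) :
    arr K i j = RingQuot.mkAlgHom K _ (FreeAlgebra.ι K (.arrow i j h)) := dif_pos h

theorem arr_of_not_adj {i j : Fin n} (h : ¬ (graphL n).Adj i j) : arr K i j = 0 := dif_neg h

theorem vtx_mul_vtx (i j : Fin n) : vtx K i * vtx K j = if i = j then vtx K i else 0 := by
  split_ifs with h
  · subst h
    rw [vtx, ← map_mul]
    exact RingQuot.mkAlgHom_rel K (.vertex_mul_self i)
  · rw [vtx, vtx, ← map_mul, RingQuot.mkAlgHom_rel K (.vertex_mul_vertex i j h), map_zero]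

theorem sum_vtx : ∑ i : Fin n, vtx K i = 1 := by
  have := RingQuot.mkAlgHom_rel K (PreprojectiveRel.sum_vertex (K := K) (Δ := graphL n))
  simpa [vtx] using this

theorem vtx_mul_arr (i j : Fin n) : vtx K i * arr K i j = arr K i j := by
  by_cases h : (graphL n).Adj i j
  · rw [arr_of_adj h, vtx, ← map_mul, RingQuot.mkAlgHom_rel K (.vertex_mul_arrow i j h)]
  · rw [arr_of_not_adj h, mul_zero]

theorem arr_mul_vtx (i j : Fin n) : arr K i j * vtx K j = arr K i j := by
  by_cases h : (graphL n).Adj i j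
  · rw [arr_of_adj h, vtx, ← map_mul, RingQuot.mkAlgHom_rel K (.arrow_mul_vertex i j h)]
  · rw [arr_of_not_adj h, zero_mul]

theorem sum_arr_mul_arr (i : Fin n) : ∑ j, arr K i j * arr K j i = 0 := by
  have h := RingQuot.mkAlgHom_rel K (PreprojectiveRel.preprojective (K := K) (Δ := graphL n) i)
  rw [map_zero, map_sum] at h
  rw [← h, ← Finset.sum_subset (Finset.subset_univ (Finset.univ.filter fun j => (graphL n).Adj i j))]
  · rw [Finset.sum_subtype (p := fun j => (graphL n).Adj i j) _ (by simp)]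
    refine Finset.sum_congr rfl fun j _ => ?_
    rw [arr_of_adj j.2, arr_of_adj ((graphL n).symm j.2), map_mul]
  · intro j _ hj
    rw [arr_of_not_adj (by simpa using hj), zero_mul]

section Lift

variable {C : Type*} [Ring C] [Algebra K C] (v : Fin n → C) (a : Fin n → Fin n → C)

/-- The homomorphism given by the values at the generators. -/
noncomputable def lift (hv : ∀ i j, v i * v j = if i = j then v i else 0) (hs : ∑ i, v i = 1)
    (hva : ∀ i j, v i * a i j = a i j) (hav : ∀ i j, a i j * v j = a i j)
    (ha : ∀ i j, ¬ (graphL n).Adj i j → a i j = 0) (haa : ∀ i, ∑ j, a i j * a j i = 0) :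
    AlgL K n →ₐ[K] C :=
  RingQuot.liftAlgHom K ⟨FreeAlgebra.lift K fun g => match g with
    | .vertex i => v i
    | .arrow i j _ => a i j, by
    intro x y h
    cases h with
    | vertex_mul_self i => simp [hv]
    | vertex_mul_vertex i j h => simp [hv, h]
    | sum_vertex => simp [hs]
    | vertex_mul_arrow i j h => simp [hva]
    | arrow_mul_vertex i j h => simp [hav]
    | preprojective i =>
      simp only [map_sum, map_mul, FreeAlgebra.lift_ι_apply, map_zero]
      rw [← haa i,
        ← Finset.sum_subset (Finset.subset_univ (Finset.univ.filter fun j => (graphL n).Adj i j))]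
      · rw [Finset.sum_subtype (p := fun j => (graphL n).Adj i j) _ (by simp)]
      · intro j _ hj
        rw [ha i j (by simpa using hj), zero_mul]⟩

variable {v a} (hv : ∀ i j, v i * v j = if i = j then v i else 0) (hs : ∑ i, v i = 1)
    (hva : ∀ i j, v i * a i j = a i j) (hav : ∀ i j, a i j * v j = a i j)
    (ha : ∀ i j, ¬ (graphL n).Adj i j → a i j = 0) (haa : ∀ i, ∑ j, a i j * a j i = 0)

theorem lift_vtx (i : Fin n) : lift (K := K) v a hv hs hva hav ha haa (vtx K i) = v i := by
  rw [lift, vtx, RingQuot.liftAlgHom_mkAlgHom_apply]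
  simp

theorem lift_arr (i j : Fin n) : lift (K := K) v a hv hs hva hav ha haa (arr K i j) = a i j := by
  by_cases h : (graphL n).Adj i j
  · rw [lift, arr_of_adj h, RingQuot.liftAlgHom_mkAlgHom_apply]
    simp
  · rw [arr_of_not_adj h, map_zero, ha i j h]

end Lift

theorem subalgebra_eq_top (T : Subalgebra K (AlgL K n)) (hv : ∀ i, vtx K i ∈ T)
    (ha : ∀ i j, arr K i j ∈ T) : T = ⊤ := by
  rw [eq_top_iff]
  rintro x -
  obtain ⟨y, rfl⟩ := RingQuot.mkAlgHom_surjective K (PreprojectiveRel K (graphL n)) x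
  induction y using FreeAlgebra.induction with
  | grade0 r => rw [AlgHom.commutes]; exact T.algebraMap_mem r
  | grade1 g =>
    cases g with
    | vertex i => exact hv i
    | arrow i j h => rw [← arr_of_adj h]; exact ha i j
  | mul a b ha hb => rw [map_mul]; exact T.mul_mem ha hb
  | add a b ha hb => rw [map_add]; exact T.add_mem ha hb

end AlgL

end Preprojective

/-! ### Derivations from the preprojective algebra to bimodules -/

namespace AlgL

variable {K : Type u} [Field K] {n : ℕ}

section Derivation

variable {N : Type u} [AddCommGroup N] [Module (Env K (AlgL K n)) N]

/-- A derivation is an algebra homomorphism to the trivial square zero extension lifting the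
identity. The second component of the preprojective relation is exactly `haa`. -/
theorem exists_derivation_of_arr (ν : Fin n → Fin n → N)
    (hl : ∀ i j, bi K (vtx K i) 1 • ν i j = ν i j) (hr : ∀ i j, bi K 1 (vtx K j) • ν i j = ν i j)
    (ha : ∀ i j, ¬ (graphL n).Adj i j → ν i j = 0)
    (haa : ∀ i, ∑ j, (bi K (arr K i j) 1 • ν j i + bi K 1 (arr K j i) • ν i j) = 0) :
    ∃ Δ : AlgL K n →+ N, (∀ u v, Δ (u * v) = bi K u 1 • Δ v + bi K 1 v • Δ u) ∧
      (∀ c : K, Δ (algebraMap K _ c) = 0) ∧ (∀ i, Δ (vtx K i) = 0) ∧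
      ∀ i j, Δ (arr K i j) = ν i j := by
  letI : Module (AlgL K n) N :=
    Module.compHom N (Env.inl K : AlgL K n →ₐ[K] _).toRingHom
  letI : Module (AlgL K n)ᵐᵒᵖ N :=
    Module.compHom N (Env.inr K : (AlgL K n)ᵐᵒᵖ →ₐ[K] _).toRingHom
  letI : Module K N := Module.compHom N (algebraMap K (Env K (AlgL K n)))
  have left_smul : ∀ (u : AlgL K n) (m : N), u • m = bi K u 1 • m :=
    fun u m => by rw [bi, MulOpposite.op_one, map_one, mul_one]; rfl
  have right_smul : ∀ (u : AlgL K n) (m : N), MulOpposite.op u • m = bi K 1 u • m :=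
    fun u m => by rw [bi, map_one, one_mul]; rfl
  have K_smul : ∀ (c : K) (m : N), c • m = algebraMap K (Env K (AlgL K n)) c • m :=
    fun c m => rfl
  have : SMulCommClass (AlgL K n) (AlgL K n)ᵐᵒᵖ N := ⟨fun u v m => by
    obtain ⟨v, rfl⟩ := MulOpposite.op_surjective v
    rw [left_smul, right_smul, right_smul, left_smul, smul_smul, smul_smul, bi_mul_bi, bi_mul_bi]
    simp⟩
  have : IsScalarTower K (AlgL K n) N := ⟨fun c u m => by
    rw [left_smul, left_smul, K_smul, smul_smul, algebraMap_mul_bi]⟩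
  have : IsScalarTower K (AlgL K n)ᵐᵒᵖ N := ⟨fun c u m => by
    obtain ⟨u, rfl⟩ := MulOpposite.op_surjective u
    rw [← MulOpposite.op_smul, right_smul, right_smul, K_smul, smul_smul,
      algebraMap_mul_bi, bi_smul_right]⟩
  let φ : AlgL K n →ₐ[K] TrivSqZeroExt (AlgL K n) N := lift
    (fun i => TrivSqZeroExt.inl (vtx K i))
    (fun i j => TrivSqZeroExt.inl (arr K i j) + TrivSqZeroExt.inr (ν i j))
    (fun i j => by
      rw [← TrivSqZeroExt.inl_mul, vtx_mul_vtx]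
      split_ifs <;> simp)
    (by
      rw [← TrivSqZeroExt.inl_one, ← sum_vtx]
      exact (map_sum (TrivSqZeroExt.inlHom (AlgL K n) N) _ _).symm)
    (fun i j => by
      ext <;> simp [vtx_mul_arr, left_smul, hl])
    (fun i j => by
      ext <;> simp [arr_mul_vtx, right_smul, hr])
    (fun i j h => by simp [arr_of_not_adj h, ha i j h])
    (fun i => by
      ext
      · simpa [TrivSqZeroExt.fst_sum] using sum_arr_mul_arr i
      · simpa [TrivSqZeroExt.snd_sum, left_smul, right_smul] using haa i)
  have hv : ∀ i, φ (vtx K i) = TrivSqZeroExt.inl (vtx K i) := fun i => lift_vtx _ _ _ _ _ _ i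
  have harr : ∀ i j, φ (arr K i j) = TrivSqZeroExt.inl (arr K i j) + TrivSqZeroExt.inr (ν i j) :=
    fun i j => lift_arr _ _ _ _ _ _ i j
  -- The first component is the identity on generators, hence everywhere; this is what turns
  -- multiplicativity of `φ` into the Leibniz rule.
  have hfst : ∀ u, (φ u).fst = u := by
    intro u
    have htop := subalgebra_eq_top (AlgHom.equalizer ((TrivSqZeroExt.fstHom K (AlgL K n) N).comp φ)
      (AlgHom.id K _)) (fun i => by simp [AlgHom.mem_equalizer, hv])
      (fun i j => by simp [AlgHom.mem_equalizer, harr])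
    have : u ∈ AlgHom.equalizer ((TrivSqZeroExt.fstHom K (AlgL K n) N).comp φ)
      (AlgHom.id K _) := htop ▸ Algebra.mem_top
    exact this
  refine ⟨(TrivSqZeroExt.sndHom (AlgL K n) N).toAddMonoidHom.comp
    φ.toRingHom.toAddMonoidHom, fun u v => ?_, fun c => ?_, fun i => ?_, fun i j => ?_⟩
  · change (φ (u * v)).snd = _ • (φ v).snd + _ • (φ u).snd
    rw [map_mul, TrivSqZeroExt.snd_mul, hfst, hfst, left_smul, right_smul]
  · change (φ (algebraMap K _ c)).snd = 0
    rw [AlgHom.commutes]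
    exact TrivSqZeroExt.snd_inl _ _
  · change (φ (vtx K i)).snd = 0
    rw [hv, TrivSqZeroExt.snd_inl]
  · change (φ (arr K i j)).snd = _
    rw [harr]
    simp

end Derivation

end AlgL

/-! ### Signed arrows and the left regular representation -/

namespace AlgL

variable (K : Type u) [Field K] (n : ℕ)

/-- The vertices, indexed by natural numbers. -/
noncomputable def vtxN (i : ℕ) : AlgL K n := if h : i < n then vtx K ⟨i, h⟩ else 0

/-- The arrows, indexed by natural numbers. -/
noncomputable def arrN (i j : ℕ) : AlgL K n :=
  if h : i < n ∧ j < n then arr K ⟨i, h.1⟩ ⟨j, h.2⟩ else 0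

variable {K n}

theorem vtxN_val (i : Fin n) : vtxN K n i = vtx K i := dif_pos i.2

theorem arrN_val (i j : Fin n) : arrN K n i j = arr K i j := dif_pos ⟨i.2, j.2⟩

theorem vtxN_eq_zero {i : ℕ} (h : n ≤ i) : vtxN K n i = 0 := dif_neg (by omega)

theorem vtxN_mul_vtxN (i j : ℕ) : vtxN K n i * vtxN K n j = if i = j then vtxN K n i else 0 := by
  by_cases hi : i < n
  · by_cases hj : j < n
    · lift i to Fin n using hi
      lift j to Fin n using hj
      simp only [vtxN_val, vtx_mul_vtx, Fin.val_inj]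
    · rw [vtxN_eq_zero (not_lt.1 hj), mul_zero, if_neg (by omega)]
  · rw [vtxN_eq_zero (not_lt.1 hi), zero_mul, ite_self]

theorem vtxN_mul_arrN (i j : ℕ) : vtxN K n i * arrN K n i j = arrN K n i j := by
  by_cases h : i < n ∧ j < n
  · lift i to Fin n using h.1
    lift j to Fin n using h.2
    rw [vtxN_val, arrN_val, vtx_mul_arr]
  · rw [arrN, dif_neg h, mul_zero]

theorem arrN_mul_vtxN (i j : ℕ) : arrN K n i j * vtxN K n j = arrN K n i j := by
  by_cases h : i < n ∧ j < n
  · lift i to Fin n using h.1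
    lift j to Fin n using h.2
    rw [vtxN_val, arrN_val, arr_mul_vtx]
  · rw [arrN, dif_neg h, zero_mul]

theorem arrN_eq_zero {i j : ℕ} (h : ¬ (i + 1 = j ∨ j + 1 = i ∨ (i = 0 ∧ j = 0))) :
    arrN K n i j = 0 := by
  rw [arrN]
  split_ifs
  · exact arr_of_not_adj h
  · rfl

theorem sum_arrN_mul_arrN (i : ℕ) :
    ∑ j ∈ Finset.range n, arrN K n i j * arrN K n j i = 0 := by
  by_cases h : i < n
  · lift i to Fin n using h
    rw [← Fin.sum_univ_eq_sum_range (fun j => arrN K n i j * arrN K n j i)]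
    simpa only [arrN_val] using sum_arr_mul_arr i
  · simp [arrN, h]

theorem arrN_relation (i : ℕ) : arrN K n (i + 1) i * arrN K n i (i + 1) +
    arrN K n (i + 1) (i + 2) * arrN K n (i + 2) (i + 1) = 0 := by
  rw [← sum_arrN_mul_arrN (K := K) (n := n) (i + 1)]
  -- The range is enlarged so that it contains both neighbours even when they lie outside the graph;
  -- the extra terms are zero.
  have h1 : ∑ j ∈ Finset.range n, arrN K n (i + 1) j * arrN K n j (i + 1) =
      ∑ j ∈ Finset.range (n + (i + 3)), arrN K n (i + 1) j * arrN K n j (i + 1) := by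
    refine Finset.sum_subset (Finset.range_mono (by omega)) fun j _ hj => ?_
    rw [Finset.mem_range] at hj
    rw [arrN, dif_neg (by omega), zero_mul]
  have h2 : ∑ j ∈ ({i, i + 2} : Finset ℕ), arrN K n (i + 1) j * arrN K n j (i + 1) =
      ∑ j ∈ Finset.range (n + (i + 3)), arrN K n (i + 1) j * arrN K n j (i + 1) := by
    refine Finset.sum_subset ?_ fun j _ hj => ?_
    · intro j hj
      simp only [Finset.mem_insert, Finset.mem_singleton] at hj
      rw [Finset.mem_range]; omega
    · simp only [Finset.mem_insert, Finset.mem_singleton] at hj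
      rw [arrN_eq_zero (by omega), zero_mul]
  rw [h1, ← h2, Finset.sum_pair (by omega)]

theorem arrN_relation_zero : arrN K n 0 0 * arrN K n 0 0 + arrN K n 0 1 * arrN K n 1 0 = 0 := by
  rw [← sum_arrN_mul_arrN (K := K) (n := n) 0]
  have h1 : ∑ j ∈ Finset.range n, arrN K n 0 j * arrN K n j 0 =
      ∑ j ∈ Finset.range (n + 2), arrN K n 0 j * arrN K n j 0 := by
    refine Finset.sum_subset (Finset.range_mono (by omega)) fun j _ hj => ?_
    rw [Finset.mem_range] at hj
    rw [arrN, dif_neg (by omega), zero_mul]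
  have h2 : ∑ j ∈ ({0, 1} : Finset ℕ), arrN K n 0 j * arrN K n j 0 =
      ∑ j ∈ Finset.range (n + 2), arrN K n 0 j * arrN K n j 0 := by
    refine Finset.sum_subset ?_ fun j _ hj => ?_
    · intro j hj
      simp only [Finset.mem_insert, Finset.mem_singleton] at hj
      rw [Finset.mem_range]; omega
    · simp only [Finset.mem_insert, Finset.mem_singleton] at hj
      rw [arrN_eq_zero (by omega), zero_mul]
  rw [h1, ← h2, Finset.sum_pair (by omega)]

variable (K n) in
/-- The arrows with signs. -/
noncomputable def lineSystem : LineSystem n (AlgL K n) where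
  e := vtxN K n
  -- Only upward arrows are rescaled. The alternating sign absorbs the minus sign that each
  -- preprojective relation produces, including the one at the loop.
  p i := (-1 : K) ^ (i + 1) • arrN K n i (i + 1)
  q i := arrN K n (i + 1) i
  ε := arrN K n 0 0
  e_mul_e i := by rw [vtxN_mul_vtxN, if_pos rfl]
  e_mul_e_ne i j h := by rw [vtxN_mul_vtxN, if_neg h]
  e_eq_zero _ h := vtxN_eq_zero h
  e_mul_p i := by rw [mul_smul_comm, vtxN_mul_arrN]
  p_mul_e i := by rw [smul_mul_assoc, arrN_mul_vtxN]
  e_mul_q i := vtxN_mul_arrN _ _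
  q_mul_e i := arrN_mul_vtxN _ _
  e_mul_ε := vtxN_mul_arrN _ _
  ε_mul_e := arrN_mul_vtxN _ _
  ε_mul_ε := by
    rw [eq_neg_of_add_eq_zero_left arrN_relation_zero, smul_mul_assoc, zero_add, pow_one]
    exact (neg_one_smul K _).symm
  q_mul_p i := by
    rw [mul_smul_comm, eq_neg_of_add_eq_zero_left (arrN_relation i), smul_mul_assoc, pow_succ _ (i + 1),
      mul_neg_one]
    exact (smul_neg _ _).trans (neg_smul _ _).symm

/-- The operators of the left regular representation, in the coordinates given by walks. -/
noncomputable def shift (i j : Fin n) : Module.End K (Fin n → ℕ → ℕ → K) where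
  toFun f a b d := if a = i ∧ (graphL n).Adj i j ∧ IsBasic n i b d ∧ 1 ≤ d ∧ IsBasic n j b (d - 1)
    then (if (i : ℕ) + 1 = j then (-1) ^ ((i : ℕ) + 1) else 1) * f j b (d - 1) else 0
  map_add' f g := by
    ext a b d
    dsimp
    split_ifs <;> ring
  map_smul' c f := by
    ext a b d
    simp only [Pi.smul_apply, smul_eq_mul, RingHom.id_apply]
    split_ifs <;> ring

/-- The projection to the part of the left regular representation at a vertex. -/
noncomputable def vertexProj (i : Fin n) : Module.End K (Fin n → ℕ → ℕ → K) where
  toFun f a b d := if a = i then f a b d else 0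
  map_add' f g := by
    ext a b d
    dsimp
    split_ifs <;> ring
  map_smul' c f := by
    ext a b d
    simp only [Pi.smul_apply, smul_eq_mul, RingHom.id_apply]
    split_ifs <;> ring

theorem vertexProj_apply (i : Fin n) (f : Fin n → ℕ → ℕ → K) (a : Fin n) (b d : ℕ) :
    vertexProj i f a b d = if a = i then f a b d else 0 := rfl

theorem shift_apply (i j : Fin n) (f : Fin n → ℕ → ℕ → K) (a : Fin n) (b d : ℕ) :
    shift i j f a b d =
      if a = i ∧ (graphL n).Adj i j ∧ IsBasic n i b d ∧ 1 ≤ d ∧ IsBasic n j b (d - 1)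
      then (if (i : ℕ) + 1 = j then (-1) ^ ((i : ℕ) + 1) else 1) * f j b (d - 1) else 0 := rfl

/-- If both lengths are basic then `i` is not the last vertex, so it has two neighbours, one of them
being `0` itself at the loop. Both intermediate walks are basic and contribute opposite signs. -/
theorem sum_sign_eq_zero {i : Fin n} {b d : ℕ} (h : IsBasic n i b (d + 2)) (h' : IsBasic n i b d) :
    ∑ j : Fin n, (if (graphL n).Adj i j ∧ IsBasic n j b (d + 1) then
      (if (i : ℕ) + 1 = j then (-1 : K) ^ ((i : ℕ) + 1) else 1) *
        (if (j : ℕ) + 1 = i then (-1 : K) ^ ((j : ℕ) + 1) else 1) else 0) = 0 := by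
  obtain ⟨i, hi⟩ := i
  have hn : i + 1 < n := by
    dsimp only at h h'
    unfold IsBasic at h h'; omega
  cases i with
  | zero =>
    rw [Finset.sum_eq_add (⟨0, hi⟩ : Fin n) ⟨1, hn⟩ (by simp)]
    · have h0 : IsBasic n 0 b (d + 1) := by
        dsimp only at h h'
        unfold IsBasic at *; omega
      have h1 : IsBasic n 1 b (d + 1) := by
        dsimp only at h h'
        unfold IsBasic at *; omega
      simp [graphL, h0, h1]
    · rintro ⟨j, hj⟩ - ⟨h0, h1⟩
      have hj0 : j ≠ 0 := fun h => h0 (Fin.ext h)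
      have hj1 : j ≠ 1 := fun h => h1 (Fin.ext h)
      rw [if_neg]
      rintro ⟨h, -⟩
      simp only [graphL] at h
      omega
    · simp
    · simp
  | succ i =>
    rw [Finset.sum_eq_add (⟨i, by omega⟩ : Fin n) ⟨i + 2, hn⟩ (by simp)]
    · have h0 : IsBasic n i b (d + 1) := by
        dsimp only at h h'
        unfold IsBasic at *; omega
      have h1 : IsBasic n (i + 2) b (d + 1) := by
        dsimp only at h h'
        unfold IsBasic at *; omega
      have h2 : i + 1 + 1 ≠ i := by omega
      simp [graphL, h0, h1, h2, pow_succ, ← mul_pow]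
    · rintro ⟨j, hj⟩ - ⟨h0, h1⟩
      have hj0 : j ≠ i := fun h => h0 (Fin.ext h)
      have hj1 : j ≠ i + 2 := fun h => h1 (Fin.ext h)
      rw [if_neg]
      rintro ⟨h, -⟩
      simp only [graphL] at h
      omega
    · simp
    · simp

variable (K n) in
/-- The left regular representation, in the coordinates given by walks. -/
noncomputable def regularRep : AlgL K n →ₐ[K] Module.End K (Fin n → ℕ → ℕ → K) :=
  lift vertexProj shift
    (fun i j => by
      refine LinearMap.ext fun f => funext fun a => funext fun b => funext fun d => ?_
      simp only [Module.End.mul_apply, vertexProj_apply]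
      split_ifs with h1 h2 h3 h3
      · rw [vertexProj_apply, if_pos h1]
      · exact absurd (h1.symm.trans h2) h3
      · exact absurd (h1.trans h3) h2
      · rfl
      · rw [vertexProj_apply, if_neg h1]
      · rfl)
    (by
      refine LinearMap.ext fun f => funext fun a => funext fun b => funext fun d => ?_
      simp [LinearMap.sum_apply, Finset.sum_apply, vertexProj_apply])
    (fun i j => by
      refine LinearMap.ext fun f => funext fun a => funext fun b => funext fun d => ?_
      simp only [Module.End.mul_apply, vertexProj_apply, shift_apply]
      split_ifs <;> simp_all)
    (fun i j => by
      refine LinearMap.ext fun f => funext fun a => funext fun b => funext fun d => ?_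
      simp [vertexProj_apply, shift_apply])
    (fun i j h => by
      refine LinearMap.ext fun f => funext fun a => funext fun b => funext fun d => ?_
      simp [shift_apply, h])
    (fun i => by
      refine LinearMap.ext fun f => funext fun a => funext fun b => funext fun d => ?_
      simp only [LinearMap.sum_apply, Finset.sum_apply, Module.End.mul_apply, LinearMap.zero_apply,
        Pi.zero_apply]
      -- Outside this case the truncation to basic labels makes every summand vanish by itself.
      by_cases h : a = i ∧ 2 ≤ d ∧ IsBasic n i b d ∧ IsBasic n i b (d - 2)
      · obtain ⟨rfl, hd, h1, h2⟩ := h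
        obtain ⟨d, rfl⟩ : ∃ k, d = k + 2 := ⟨d - 2, by omega⟩
        rw [Nat.add_sub_cancel] at h2
        rw [← mul_zero (f a b d), ← sum_sign_eq_zero (K := K) h1 h2, Finset.mul_sum]
        refine Finset.sum_congr rfl fun j _ => ?_
        have hsymm : (graphL n).Adj a j → (graphL n).Adj j a := (graphL n).symm
        by_cases h3 : (graphL n).Adj a j ∧ IsBasic n j b (d + 1)
        · simp [shift_apply, h1, h2, h3, hsymm h3.1]
          ring
        · rw [if_neg h3, mul_zero]
          simp only [shift_apply]
          exact if_neg fun h4 => h3 ⟨h4.2.1, h4.2.2.2.2⟩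
      · refine Finset.sum_eq_zero fun j _ => ?_
        rw [shift_apply]
        split_ifs with h1
        · rw [shift_apply j i, if_neg, mul_zero]
          intro h2
          apply h
          refine ⟨h1.1, by omega, h1.2.2.1, ?_⟩
          rw [show d - 2 = d - 1 - 1 by omega]
          exact h2.2.2.2.2
        · rw [shift_apply j i, if_neg, mul_zero]
          intro h2
          apply h
          refine ⟨h1.1, by omega, h1.2.2.1, ?_⟩
          rw [show d - 2 = d - 1 - 1 by omega]
          exact h2.2.2.2.2
        · rfl)

end AlgL

/-! ### Coordinates of walks, the trace form and the walk algebra structure -/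

namespace AlgL

variable (K : Type u) [Field K] (n : ℕ)

/-- The value of a walk. -/
noncomputable abbrev walk (i j d : ℕ) : AlgL K n := (lineSystem K n).walk i j d

/-- The coordinates of the unit element in the regular representation. -/
def oneCoord (a : Fin n) (b d : ℕ) : K := if (a : ℕ) = b ∧ d = 0 then 1 else 0

variable {K n}

theorem regularRep_vtx (i : Fin n) : regularRep K n (vtx K i) = vertexProj i :=
  lift_vtx _ _ _ _ _ _ i

theorem regularRep_arr (i j : Fin n) : regularRep K n (arr K i j) = shift i j :=
  lift_arr _ _ _ _ _ _ i j

theorem walk_one {i k : Fin n} (h : (graphL n).Adj i k) : walk K n i k 1 =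
    (if (i : ℕ) + 1 = k then (-1 : K) ^ ((i : ℕ) + 1) else 1) • arr K i k := by
  obtain ⟨i, hi⟩ := i
  obtain ⟨k, hk⟩ := k
  rcases h with h | h | ⟨h1, h2⟩
  · dsimp only at h
    subst h
    rw [walk, LineSystem.walk_p]
    simp only [if_pos]
    rw [← arrN_val]
    rfl
  · dsimp only at h
    subst h
    rw [walk, LineSystem.walk_q, if_neg (by dsimp only; omega), one_smul, ← arrN_val]
    rfl
  · dsimp only at h1 h2
    subst h1 h2
    rw [walk, LineSystem.walk_ε, if_neg (by dsimp only; omega), one_smul, ← arrN_val]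
    rfl

/-- Basic walks act on the unit vector by distinct coordinate vectors. This is the only place where
walks are shown not to collapse, and the trace is read off from it. -/
theorem regularRep_walk (i j d : ℕ) : regularRep K n (walk K n i j d) (oneCoord K n) =
    fun (a : Fin n) b d' => if (a : ℕ) = i ∧ b = j ∧ d' = d ∧ IsBasic n i j d then 1 else 0 := by
  by_cases h : IsBasic n i j d
  · induction d generalizing i with
    | zero =>
      obtain rfl : i = j := by unfold IsBasic at h; omega
      have hi : i < n := h.1
      rw [walk, LineSystem.walk_self_zero]
      change regularRep K n (vtxN K n i) _ = _
      lift i to Fin n using hi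
      rw [vtxN_val, regularRep_vtx]
      funext a b d
      rw [vertexProj_apply, oneCoord]
      simp only [h, and_true, Fin.val_inj]
      by_cases ha : a = i
      · subst ha
        simp [eq_comm]
      · simp [ha]
    | succ d ih =>
      obtain ⟨k, hk, hb⟩ := h.exists_left
      have hi : i < n := h.1
      have hkn : k < n := hb.1
      have hw : walk K n i j (d + 1) = walk K n i k 1 * walk K n k j d := by
        rw [walk, walk, walk, LineSystem.walk_mul_walk _ _ hb.isWalk, add_comm]
        unfold IsWalk; omega
      rw [hw, map_mul, Module.End.mul_apply, ih k hb]
      lift i to Fin n using hi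
      lift k to Fin n using hkn
      have hadj : (graphL n).Adj i k := by
        change (i : ℕ) + 1 = k ∨ (k : ℕ) + 1 = i ∨ ((i : ℕ) = 0 ∧ (k : ℕ) = 0)
        omega
      rw [walk_one hadj, map_smul, regularRep_arr]
      funext a b d'
      simp only [LinearMap.smul_apply, Pi.smul_apply, shift_apply, smul_eq_mul, true_and]
      by_cases hc : (a : ℕ) = i ∧ b = j ∧ d' = d + 1
      · obtain ⟨ha, rfl, rfl⟩ := hc
        obtain rfl := Fin.ext ha
        simp only [hadj, h, hb, Nat.add_sub_cancel, true_and, and_true, if_true,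
          le_add_iff_nonneg_left, zero_le, mul_one]
        split_ifs
        · rw [← mul_pow]; simp
        · simp
      · have hc' : ¬ ((a : ℕ) = i ∧ b = j ∧ d' = d + 1 ∧ IsBasic n i j (d + 1)) :=
          fun h' => hc ⟨h'.1, h'.2.1, h'.2.2.1⟩
        by_cases h1 : a = i ∧ (graphL n).Adj i k ∧ IsBasic n i b d' ∧ 1 ≤ d' ∧ IsBasic n k b (d' - 1)
        · have h2 : ¬ (b = j ∧ d' - 1 = d ∧ IsBasic n k j d) := fun h2 =>
            hc ⟨by rw [h1.1], h2.1, by omega⟩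
          simp only [if_pos h1, if_neg h2, if_neg hc', mul_zero]
        · simp only [if_neg h1, if_neg hc', mul_zero]
  · rw [walk, LineSystem.walk_eq_zero_of_not_isBasic _ h]
    funext a b d'
    simp [h]

variable (K n) in
/-- The trace form: the sum of the coefficients of the socle elements. -/
noncomputable def trace : AlgL K n →ₗ[K] K where
  toFun u := ∑ i : Fin n, regularRep K n u (oneCoord K n) i i (2 * n - 1)
  map_add' u v := by simp [Finset.sum_add_distrib]
  map_smul' c u := by simp [Finset.mul_sum]

theorem trace_walk (i j d : ℕ) :
    trace K n (walk K n i j d) = if i = j ∧ d + 1 = 2 * n ∧ i < n then 1 else 0 := by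
  change ∑ a : Fin n, regularRep K n (walk K n i j d) (oneCoord K n) a a (2 * n - 1) = _
  rw [regularRep_walk]
  by_cases h : i = j ∧ d + 1 = 2 * n ∧ i < n
  · obtain ⟨rfl, hd, hi⟩ := h
    have hb : IsBasic n i i d := by unfold IsBasic; omega
    rw [if_pos ⟨rfl, hd, hi⟩, Finset.sum_eq_single ⟨i, hi⟩]
    · exact if_pos ⟨rfl, rfl, by omega, hb⟩
    · intro a _ ha
      refine if_neg ?_
      rintro ⟨h1, -⟩
      exact ha (Fin.ext h1)
    · simp
  · rw [if_neg h]
    refine Finset.sum_eq_zero fun a _ => if_neg ?_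
    rintro ⟨h1, h2, h3, h4⟩
    have := a.2
    have := h4.lt
    omega

variable (K n) in
/-- The sum of the arrows. -/
noncomputable def arrSum : AlgL K n := walk K n 0 0 1 +
    ∑ i ∈ Finset.range n, ((-1 : K) ^ (i + 1) • walk K n i (i + 1) 1 + walk K n (i + 1) i 1)

theorem neg_one_pow_smul_walk (i : ℕ) :
    (-1 : K) ^ (i + 1) • walk K n i (i + 1) 1 = arrN K n i (i + 1) := by
  rw [walk, LineSystem.walk_p]
  change _ • (_ • arrN K n i (i + 1)) = _
  rw [smul_smul, ← mul_pow]
  simp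

theorem arrSum_eq : arrSum K n = arrN K n 0 0 +
    ∑ i ∈ Finset.range n, (arrN K n i (i + 1) + arrN K n (i + 1) i) := by
  rw [arrSum]
  congr 1
  · exact LineSystem.walk_ε _
  · refine Finset.sum_congr rfl fun i _ => ?_
    rw [neg_one_pow_smul_walk]
    congr 1
    exact LineSystem.walk_q _ _

theorem vtxN_mul_arrN_mul (i j k l : ℕ) : vtxN K n i * arrN K n k l * vtxN K n j =
    if i = k ∧ l = j then arrN K n k l else 0 := by
  rw [← arrN_mul_vtxN, ← vtxN_mul_arrN k l, ← mul_assoc, ← mul_assoc, vtxN_mul_vtxN, mul_assoc,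
    vtxN_mul_vtxN]
  by_cases h1 : i = k
  · by_cases h2 : l = j
    · subst h1 h2
      rw [if_pos rfl, if_pos rfl, if_pos ⟨rfl, rfl⟩]
    · rw [if_neg h2, mul_zero, if_neg (fun h => h2 h.2)]
  · rw [if_neg h1, zero_mul, zero_mul, if_neg (fun h => h1 h.1)]

/-- All arrows are corners of their sum, so later arguments need only the vertices and the single
element `D`. -/
theorem vtx_mul_arrSum_mul_vtx (i j : Fin n) : vtx K i * arrSum K n * vtx K j = arr K i j := by
  rw [arrSum_eq, ← vtxN_val, ← vtxN_val, ← arrN_val]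
  simp only [mul_add, add_mul, Finset.mul_sum, Finset.sum_mul, vtxN_mul_arrN_mul]
  by_cases h : (graphL n).Adj i j
  · have hi := i.2
    have hj := j.2
    rcases h with h | h | ⟨h1, h2⟩
    · rw [if_neg (by omega), zero_add, Finset.sum_eq_single (i : ℕ)]
      · rw [if_pos ⟨rfl, h⟩, if_neg (by omega), add_zero, h]
      · intro k _ hk
        rw [if_neg (by omega), if_neg (by omega), add_zero]
      · intro hi'; exact absurd (Finset.mem_range.2 hi) hi'
    · rw [if_neg (by omega), zero_add, Finset.sum_eq_single (j : ℕ)]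
      · rw [if_neg (by omega), if_pos ⟨h.symm, rfl⟩, zero_add, h]
      · intro k _ hk
        rw [if_neg (by omega), if_neg (by omega), add_zero]
      · intro hi'; exact absurd (Finset.mem_range.2 hj) hi'
    · rw [if_pos ⟨h1, h2.symm⟩, Finset.sum_eq_zero, h1, h2, add_zero]
      intro k _
      rw [if_neg (by omega), if_neg (by omega), add_zero]
  · have h' : ¬ ((i : ℕ) + 1 = j ∨ (j : ℕ) + 1 = i ∨ ((i : ℕ) = 0 ∧ (j : ℕ) = 0)) := h
    rw [if_neg (by omega), arrN_eq_zero h', Finset.sum_eq_zero, add_zero]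
    intro k _
    rw [if_neg (by omega), if_neg (by omega), add_zero]

theorem arrSum_eq_sum_arr : arrSum K n = ∑ i : Fin n, ∑ j : Fin n, arr K i j := by
  simp only [← vtx_mul_arrSum_mul_vtx, ← Finset.mul_sum, ← Finset.sum_mul, sum_vtx, one_mul, mul_one]

theorem span_walk : Submodule.span K {a : AlgL K n | ∃ i j d, a = walk K n i j d} = ⊤ := by
  set M := Submodule.span K {a : AlgL K n | ∃ i j d, a = walk K n i j d} with hM
  have hone : (1 : AlgL K n) ∈ M := by
    rw [← sum_vtx]
    refine Submodule.sum_mem _ fun i _ => Submodule.subset_span ⟨i, i, 0, ?_⟩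
    rw [walk, LineSystem.walk_self_zero, ← vtxN_val]
    rfl
  have hsucc : ∀ (i j : Fin n), ∃ c : K, arr K i j = c • walk K n i j 1 := by
    intro i j
    by_cases h : (graphL n).Adj i j
    · refine ⟨if (i : ℕ) + 1 = j then (-1 : K) ^ ((i : ℕ) + 1) else 1, ?_⟩
      rw [walk_one h, smul_smul]
      split_ifs
      · rw [← mul_pow]; simp
      · simp
    · exact ⟨0, by rw [arr_of_not_adj h, zero_smul]⟩
  have hwalk : ∀ i j k l d d', walk K n i j d * walk K n k l d' ∈ M := by
    intro i j k l d d'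
    by_cases hjk : j = k
    · subst hjk
      by_cases h1 : IsWalk i j d
      · by_cases h2 : IsWalk j l d'
        · rw [walk, walk, LineSystem.walk_mul_walk _ h1 h2]
          exact Submodule.subset_span ⟨_, _, _, rfl⟩
        · rw [walk, walk, LineSystem.walk_eq_zero _ h2, mul_zero]
          exact M.zero_mem
      · rw [walk, walk, LineSystem.walk_eq_zero _ h1, zero_mul]
        exact M.zero_mem
    · rw [walk, walk, LineSystem.walk_mul_walk_ne _ hjk]
      exact M.zero_mem
  let T : Subalgebra K (AlgL K n) := 
    { M.toAddSubmonoid with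
      mul_mem' := by
        intro a b ha hb
        have : M * M ≤ M := by
          rw [hM, Submodule.span_mul_span, Submodule.span_le]
          rintro _ ⟨_, ⟨i, j, d, rfl⟩, _, ⟨k, l, d', rfl⟩, rfl⟩
          exact hwalk i j k l d d'
        exact this (Submodule.mul_mem_mul ha hb)
      algebraMap_mem' := fun r => by
        rw [Algebra.algebraMap_eq_smul_one]
        exact M.smul_mem r hone }
  have hT : T = ⊤ := subalgebra_eq_top T
    (fun i => Submodule.subset_span ⟨i, i, 0, by
      rw [walk, LineSystem.walk_self_zero, ← vtxN_val]
      rfl⟩)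
    (fun i j => by
      obtain ⟨c, hc⟩ := hsucc i j
      rw [hc]
      exact M.smul_mem c (Submodule.subset_span ⟨i, j, 1, rfl⟩))
  rw [eq_top_iff]
  rintro x -
  have : x ∈ T := hT ▸ Algebra.mem_top
  exact this

theorem walk_self_zero (i : Fin n) : walk K n i i 0 = vtx K i := by
  rw [walk, LineSystem.walk_self_zero, ← vtxN_val]
  rfl

variable (K n) in
/-- The preprojective algebra of `𝕃ₙ` as an algebra with a basis of walks. -/
noncomputable def walkAlgebra : WalkAlgebra K n (AlgL K n) where
  B := walk K n
  τ := trace K n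
  B_mul_B i j k l d d' := by
    split_ifs with h
    · obtain ⟨rfl, h1, h2⟩ := h
      exact LineSystem.walk_mul_walk_of_isBasic _ h1 h2
    · by_cases hjk : j = k
      · by_cases h1 : IsBasic n i j d
        · have h2 : ¬ IsBasic n k l d' := fun h2 => h ⟨hjk, h1, h2⟩
          rw [walk, walk, LineSystem.walk_eq_zero_of_not_isBasic _ h2, mul_zero]
        · rw [walk, walk, LineSystem.walk_eq_zero_of_not_isBasic _ h1, zero_mul]
      · exact LineSystem.walk_mul_walk_ne _ hjk
  B_eq_zero i j d h := LineSystem.walk_eq_zero_of_not_isBasic _ h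
  span_B := span_walk
  sum_B := by
    rw [← Fin.sum_univ_eq_sum_range (fun i => walk K n i i 0), ← sum_vtx]
    exact Finset.sum_congr rfl fun i _ => walk_self_zero i
  τ_B := trace_walk
  D := arrSum K n
  D_eq := rfl
  generate T h hD := by
    refine subalgebra_eq_top T (fun i => ?_) fun i j => ?_
    · rw [← walk_self_zero]
      exact h i
    · rw [← vtx_mul_arrSum_mul_vtx, ← walk_self_zero, ← walk_self_zero]
      exact T.mul_mem (T.mul_mem (h i) hD) (h j)
  exists_derivation N _ _ ν h1 h2 := by
    have hw : ∀ i, walk K n i i 0 = vtxN K n i := fun i => LineSystem.walk_self_zero _ i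
    simp only [hw] at h1 h2
    obtain ⟨Δ, h3, h4, h5, h6⟩ := exists_derivation_of_arr
      -- The prescribed value at `D` is split into its corners, which become the values at the
      -- arrows.
      (fun i j : Fin n => bi K (vtx K i) (vtx K j) • ν)
      (fun i j => by rw [smul_smul, bi_mul_bi, vtx_mul_vtx]; simp)
      (fun i j => by rw [smul_smul, bi_mul_bi, vtx_mul_vtx]; simp)
      -- Condition `h1` says that `ν` is supported on pairs of adjacent vertices, so the other
      -- corners vanish.
      (fun i j h => by
        have h' : ¬ ((i : ℕ) + 1 = j ∨ (j : ℕ) + 1 = i ∨ ((i : ℕ) = 0 ∧ (j : ℕ) = 0)) := h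
        rw [← h1, ← vtxN_val, ← vtxN_val, smul_add, Finset.smul_sum, smul_smul, bi_mul_bi,
          vtxN_mul_vtxN, vtxN_mul_vtxN]
        have hz : bi K (if (i : ℕ) = 0 then vtxN K n i else 0)
            (if 0 = (j : ℕ) then vtxN K n 0 else 0) • ν = 0 := by
          by_cases hi : (i : ℕ) = 0
          · rw [if_neg (show ¬ 0 = (j : ℕ) by omega), bi_zero_smul]
          · rw [if_neg hi, zero_bi_smul]
        rw [hz, zero_add]
        refine Finset.sum_eq_zero fun k _ => ?_
        rw [smul_add, smul_smul, smul_smul, bi_mul_bi, bi_mul_bi, vtxN_mul_vtxN, vtxN_mul_vtxN,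
          vtxN_mul_vtxN, vtxN_mul_vtxN]
        by_cases hik : (i : ℕ) = k
        · rw [if_neg (show ¬ (i : ℕ) = k + 1 by omega), if_neg (show ¬ k + 1 = (j : ℕ) by omega),
            bi_zero_smul, zero_bi_smul, add_zero]
        · rw [if_neg hik]
          by_cases hik' : (i : ℕ) = k + 1
          · rw [if_neg (show ¬ k = (j : ℕ) by omega), zero_bi_smul, bi_zero_smul, add_zero]
          · rw [if_neg hik', zero_bi_smul, zero_bi_smul, add_zero])
      -- Summing the corners over `j` restores `D`, and the required relation becomes the corner of
      -- `h2` at the vertex `i`.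
      (fun i => by
        have key : ∀ j, bi K (arr K i j) 1 • bi K (vtx K j) (vtx K i) • ν +
            bi K 1 (arr K j i) • bi K (vtx K i) (vtx K j) • ν =
            bi K (arr K i j) (vtx K i) • ν + bi K (vtx K i) (arr K j i) • ν := by
          intro j
          rw [smul_smul, smul_smul, bi_mul_bi, bi_mul_bi, arr_mul_vtx, vtx_mul_arr, mul_one, one_mul]
        rw [Finset.sum_congr rfl fun j _ => key j, Finset.sum_add_distrib, ← Finset.sum_smul,
          ← Finset.sum_smul, ← sum_bi, ← bi_sum]
        have hl : ∑ j, arr K i j = vtx K i * arrSum K n := by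
          simp only [← vtx_mul_arrSum_mul_vtx, ← Finset.mul_sum, sum_vtx, mul_one]
        have hr : ∑ j, arr K j i = arrSum K n * vtx K i := by
          simp only [← vtx_mul_arrSum_mul_vtx, ← Finset.sum_mul, sum_vtx, one_mul]
        have := congrArg (fun m => bi K (vtx K i) (vtx K i) • m) h2
        simp only [Finset.smul_sum, smul_zero] at this
        rw [Finset.sum_eq_single (i : ℕ)] at this
        · rw [vtxN_val, smul_smul, bi_mul_bi, vtx_mul_vtx, if_pos rfl, smul_add, smul_smul, smul_smul,
            bi_mul_bi, bi_mul_bi, mul_one, one_mul] at this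
          rw [hl, hr, this]
        · intro k _ hk
          rw [smul_smul, bi_mul_bi, ← vtxN_val, vtxN_mul_vtxN, if_neg (Ne.symm hk), zero_bi_smul]
        · intro hi
          exact absurd (Finset.mem_range.2 i.2) hi)
    refine ⟨Δ, h3, h4, fun i => ?_, ?_⟩
    · by_cases hi : i < n
      · exact (congrArg Δ (walk_self_zero ⟨i, hi⟩)).trans (h5 ⟨i, hi⟩)
      · rw [hw, vtxN_eq_zero (not_lt.1 hi), map_zero]
    · rw [arrSum_eq_sum_arr, map_sum]
      simp only [map_sum, h6]
      simp only [← Finset.sum_smul, ← bi_sum, ← sum_bi, sum_vtx, bi_one_one, one_smul]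

end AlgL

/-! ### The trace form and the gradation of a walk algebra -/

namespace WalkAlgebra

variable {K : Type u} [Field K] {n : ℕ} {A : Type u} [Ring A] [Algebra K A]
  (W : WalkAlgebra K n A)

theorem B_mul_B_of_basic {i j l d d' : ℕ} (h : IsBasic n i j d) (h' : IsBasic n j l d') :
    W.B i j d * W.B j l d' = W.B i l (d + d') := by
  rw [W.B_mul_B, if_pos ⟨rfl, h, h'⟩]

theorem B_mul_B_of_ne {i j k l d d' : ℕ} (h : j ≠ k) : W.B i j d * W.B k l d' = 0 := by
  rw [W.B_mul_B, if_neg fun h' => h h'.1]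

theorem B_of_two_mul_le {i j d : ℕ} (h : 2 * n ≤ d) : W.B i j d = 0 :=
  W.B_eq_zero _ _ _ fun h' => absurd h'.lt (by omega)

@[elab_as_elim]
theorem induction {p : A → Prop} (hB : ∀ i j d, IsBasic n i j d → p (W.B i j d)) (h0 : p 0)
    (hadd : ∀ a b, p a → p b → p (a + b)) (hsmul : ∀ (c : K) a, p a → p (c • a)) (a : A) : p a := by
  have ha : a ∈ Submodule.span K {a | ∃ i j d, a = W.B i j d} := by rw [W.span_B]; trivial
  induction ha using Submodule.span_induction with
  | mem x hx =>
    obtain ⟨i, j, d, rfl⟩ := hx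
    by_cases h : IsBasic n i j d
    · exact hB i j d h
    · rwa [W.B_eq_zero i j d h]
  | zero => exact h0
  | add x y _ _ hx hy => exact hadd x y hx hy
  | smul c x _ hx => exact hsmul c x hx

/-- The basis is self-dual up to reversal and complementary length; symmetry and nondegeneracy of
`τ` are read off from this formula. -/
theorem τ_B_mul_B (i j k l d d' : ℕ) : W.τ (W.B i j d * W.B k l d') =
    if j = k ∧ i = l ∧ d + d' + 1 = 2 * n ∧ IsBasic n i j d then 1 else 0 := by
  rw [W.B_mul_B]
  split_ifs with h1 h2 h2
  · rw [W.τ_B, if_pos ⟨h2.2.1, h2.2.2.1, h2.2.2.2.1⟩]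
  · rw [W.τ_B, if_neg]
    rintro ⟨h3, h4, h5⟩
    exact h2 ⟨h1.1, h3, h4, h1.2.1⟩
  · exfalso
    obtain ⟨rfl, rfl, h3, h4⟩ := h2
    refine h1 ⟨rfl, h4, ?_⟩
    have := (isBasic_dual h4.lt).2 h4
    rwa [show 2 * n - 1 - d = d' by omega] at this
  · rw [map_zero]

theorem τ_mul_comm (u v : A) : W.τ (u * v) = W.τ (v * u) := by
  induction u using W.induction with
  | hB i j d h =>
    induction v using W.induction with
    | hB k l d' h' =>
      rw [W.τ_B_mul_B, W.τ_B_mul_B]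
      refine if_congr ?_ rfl rfl
      constructor
      · rintro ⟨rfl, rfl, h3, -⟩; exact ⟨rfl, rfl, by omega, h'⟩
      · rintro ⟨rfl, rfl, h3, -⟩; exact ⟨rfl, rfl, by omega, h⟩
    | h0 => simp
    | hadd a b ha hb => rw [mul_add, add_mul, map_add, map_add, ha, hb]
    | hsmul c a ha => rw [mul_smul_comm, smul_mul_assoc, map_smul, map_smul, ha]
  | h0 => simp
  | hadd a b ha hb => rw [mul_add, add_mul, map_add, map_add, ha, hb]
  | hsmul c a ha => rw [mul_smul_comm, smul_mul_assoc, map_smul, map_smul, ha]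

theorem hom_ext {M : Type*} [AddCommMonoid M] [Module K M] {f g : A →ₗ[K] M}
    (h : ∀ i j d, IsBasic n i j d → f (W.B i j d) = g (W.B i j d)) : f = g := by
  ext a
  induction a using W.induction with
  | hB i j d hb => exact h i j d hb
  | h0 => simp
  | hadd a b ha hb => rw [map_add, map_add, ha, hb]
  | hsmul c a ha => rw [map_smul, map_smul, ha]

/-- The labels of the basis. -/
def idx (n : ℕ) : Finset (ℕ × ℕ × ℕ) :=
  (Finset.range n ×ˢ Finset.range n ×ˢ Finset.range (2 * n)).filter
    fun t => IsBasic n t.1 t.2.1 t.2.2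

theorem mem_idx {t : ℕ × ℕ × ℕ} : t ∈ idx n ↔ IsBasic n t.1 t.2.1 t.2.2 := by
  unfold idx
  rw [Finset.mem_filter, Finset.mem_product, Finset.mem_product, Finset.mem_range,
    Finset.mem_range, Finset.mem_range]
  exact ⟨fun h => h.2, fun h => ⟨⟨h.1, h.2.1, h.lt⟩, h⟩⟩

/-- The basis element with a given label. -/
def b (t : ℕ × ℕ × ℕ) : A := W.B t.1 t.2.1 t.2.2

theorem b_mk (i j d : ℕ) : W.b (i, j, d) = W.B i j d := rfl

/-- The element of the dual basis with a given label. -/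
def bd (t : ℕ × ℕ × ℕ) : A := W.B t.2.1 t.1 (2 * n - 1 - t.2.2)

theorem sum_idx_B {M : Type*} [AddCommMonoid M] [Module K M] {i j d : ℕ} (h : IsBasic n i j d)
    (f : ℕ × ℕ × ℕ → M) :
    ∑ t ∈ idx n, W.τ (W.B i j d * W.b t) • f t = f (j, i, 2 * n - 1 - d) := by
  have hd := h.lt
  rw [Finset.sum_eq_single (j, i, 2 * n - 1 - d)]
  · rw [b, W.τ_B_mul_B, if_pos ⟨rfl, rfl, by dsimp only; omega, h⟩, one_smul]
  · rintro ⟨k, l, d'⟩ ht hne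
    rw [b, W.τ_B_mul_B, if_neg, zero_smul]
    rintro ⟨h1, h2, h3, -⟩
    dsimp only at h1 h2 h3
    subst h1 h2
    exact hne (by rw [show d' = 2 * n - 1 - d by omega])
  · intro hn
    exact absurd (mem_idx.2 ((isBasic_dual hd).2 h)) hn

/-- The linear map which multiplies the basis elements of degree `d` by `f d`. -/
noncomputable def scale (f : ℕ → K) : A →ₗ[K] A :=
  ∑ t ∈ idx n, (W.τ.comp (LinearMap.mulRight K (W.b t))).smulRight
    (f (2 * n - 1 - t.2.2) • W.bd t)

theorem scale_apply (f : ℕ → K) (a : A) : W.scale f a =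
    ∑ t ∈ idx n, W.τ (a * W.b t) • f (2 * n - 1 - t.2.2) • W.bd t := by
  simp [scale, LinearMap.sum_apply]

theorem scale_B (f : ℕ → K) (i j d : ℕ) : W.scale f (W.B i j d) = f d • W.B i j d := by
  by_cases h : IsBasic n i j d
  · have hd := h.lt
    rw [scale_apply, W.sum_idx_B h, bd]
    dsimp only
    rw [show 2 * n - 1 - (2 * n - 1 - d) = d by omega]
  · rw [W.B_eq_zero i j d h, map_zero, smul_zero]

theorem sum_τ_smul_bd (a : A) : ∑ t ∈ idx n, W.τ (a * W.b t) • W.bd t = a := by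
  have h : W.scale (fun _ => 1) = LinearMap.id := W.hom_ext fun i j d _ => by
    rw [W.scale_B, one_smul, LinearMap.id_apply]
  have := congrArg (fun f : A →ₗ[K] A => f a) h
  simpa [scale_apply] using this

theorem ext_τ {a a' : A} (h : ∀ i j d, IsBasic n i j d → W.τ (a * W.B i j d) =
    W.τ (a' * W.B i j d)) : a = a' := by
  rw [← W.sum_τ_smul_bd a, ← W.sum_τ_smul_bd a']
  refine Finset.sum_congr rfl fun t ht => ?_
  rw [b, h _ _ _ (mem_idx.1 ht)]

theorem eq_zero_of_τ {a : A} (h : ∀ i j d, IsBasic n i j d → W.τ (a * W.B i j d) = 0) : a = 0 :=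
  W.ext_τ fun i j d hb => by rw [h i j d hb, zero_mul, map_zero]

/-- The idempotent of a vertex. -/
def e (i : ℕ) : A := W.B i i 0

theorem isBasic_zero {i : ℕ} : IsBasic n i i 0 ↔ i < n := by
  unfold IsBasic; omega

theorem e_mul_B (i k l d : ℕ) : W.e i * W.B k l d = if i = k then W.B k l d else 0 := by
  rw [e, W.B_mul_B]
  by_cases h : IsBasic n k l d
  · by_cases hik : i = k
    · subst hik
      rw [if_pos ⟨rfl, isBasic_zero.2 h.1, h⟩, if_pos rfl, zero_add]
    · rw [if_neg fun h' => hik h'.1, if_neg hik]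
  · rw [if_neg fun h' => h h'.2.2, W.B_eq_zero k l d h, ite_self]

theorem B_mul_e (i k l d : ℕ) : W.B k l d * W.e i = if l = i then W.B k l d else 0 := by
  rw [e, W.B_mul_B]
  by_cases h : IsBasic n k l d
  · by_cases hik : l = i
    · subst hik
      rw [if_pos ⟨rfl, h, isBasic_zero.2 h.2.1⟩, if_pos rfl, add_zero]
    · rw [if_neg fun h' => hik h'.1, if_neg hik]
  · rw [if_neg fun h' => h h'.2.1, W.B_eq_zero k l d h, ite_self]

theorem e_mul_e (i j : ℕ) : W.e i * W.e j = if i = j then W.e i else 0 := by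
  rw [show W.e j = W.B j j 0 from rfl, e_mul_B]
  by_cases h : i = j
  · subst h; rfl
  · rw [if_neg h, if_neg h]

theorem e_mul_self (i : ℕ) : W.e i * W.e i = W.e i := by rw [e_mul_e, if_pos rfl]

theorem e_eq_zero {i : ℕ} (h : n ≤ i) : W.e i = 0 :=
  W.B_eq_zero _ _ _ fun h' => absurd (isBasic_zero.1 h') (by omega)

theorem sum_e : ∑ i ∈ Finset.range n, W.e i = 1 := W.sum_B

/-- The automorphism which multiplies the elements of degree `d` by `(-1) ^ d`. -/
noncomputable def μ : A →ₐ[K] A :=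
  AlgHom.ofLinearMap (W.scale fun d => (-1) ^ d)
    (by
      rw [← W.sum_B, map_sum]
      refine Finset.sum_congr rfl fun i _ => ?_
      rw [W.scale_B, pow_zero, one_smul])
    (fun u v => by
      induction u using W.induction with
      | hB i j d h =>
        induction v using W.induction with
        | hB k l d' h' =>
          rw [W.scale_B, W.scale_B, smul_mul_smul_comm, ← pow_add, W.B_mul_B]
          split_ifs
          · rw [W.scale_B]
          · rw [map_zero, smul_zero]
        | h0 => simp
        | hadd a b ha hb => rw [mul_add, map_add, map_add, mul_add, ha, hb]
        | hsmul c a ha => rw [mul_smul_comm, map_smul, map_smul, mul_smul_comm, ha]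
      | h0 => simp
      | hadd a b ha hb => rw [add_mul, map_add, map_add, add_mul, ha, hb]
      | hsmul c a ha => rw [smul_mul_assoc, map_smul, map_smul, smul_mul_assoc, ha])

theorem μ_B (i j d : ℕ) : W.μ (W.B i j d) = (-1 : K) ^ d • W.B i j d := W.scale_B _ i j d

theorem μ_e (i : ℕ) : W.μ (W.e i) = W.e i := by
  rw [e, μ_B, pow_zero, one_smul]

theorem μ_μ (a : A) : W.μ (W.μ a) = a := by
  have h : W.μ.toLinearMap.comp W.μ.toLinearMap = LinearMap.id := W.hom_ext fun i j d _ => by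
    rw [LinearMap.comp_apply, AlgHom.toLinearMap_apply, AlgHom.toLinearMap_apply, μ_B, map_smul,
      μ_B, smul_smul, ← mul_pow, neg_mul_neg, one_mul, one_pow, one_smul, LinearMap.id_apply]
  exact congrArg (fun f : A →ₗ[K] A => f a) h

/-- The Euler derivation, which multiplies the elements of degree `d` by `d`. -/
noncomputable def euler : A →ₗ[K] A := W.scale fun d => (d : K)

theorem euler_B (i j d : ℕ) : W.euler (W.B i j d) = (d : K) • W.B i j d := W.scale_B _ i j d

theorem euler_mul (u v : A) : W.euler (u * v) = W.euler u * v + u * W.euler v := by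
  induction u using W.induction with
  | hB i j d h =>
    induction v using W.induction with
    | hB k l d' h' =>
      rw [W.euler_B, W.euler_B, smul_mul_assoc, mul_smul_comm, ← add_smul, W.B_mul_B]
      split_ifs
      · rw [W.euler_B, Nat.cast_add]
      · rw [map_zero, smul_zero]
    | h0 => simp
    | hadd a b ha hb => rw [mul_add, map_add, map_add, mul_add, mul_add, ha, hb]; abel
    | hsmul c a ha => rw [mul_smul_comm, map_smul, map_smul, mul_smul_comm, mul_smul_comm, ha,
        smul_add]
  | h0 => simp
  | hadd a b ha hb => rw [add_mul, map_add, map_add, add_mul, add_mul, ha, hb]; abel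
  | hsmul c a ha => rw [smul_mul_assoc, map_smul, map_smul, smul_mul_assoc, smul_mul_assoc, ha,
      smul_add]

theorem μ_D : W.μ W.D = -W.D := by
  simp only [W.D_eq, map_add, map_sum, map_smul, μ_B, pow_one, neg_smul, one_smul, neg_add,
    smul_neg, ← Finset.sum_neg_distrib]

theorem euler_D : W.euler W.D = W.D := by
  simp only [W.D_eq, map_add, map_sum, map_smul, euler_B, Nat.cast_one, one_smul]

theorem euler_e (i : ℕ) : W.euler (W.e i) = 0 := by
  rw [e, euler_B, Nat.cast_zero, zero_smul]

theorem isBasic_up {k : ℕ} : IsBasic n k (k + 1) 1 ↔ k + 1 < n := by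
  unfold IsBasic; omega

theorem isBasic_down {k : ℕ} : IsBasic n (k + 1) k 1 ↔ k + 1 < n := by
  unfold IsBasic; omega

theorem isBasic_loop (hn : 0 < n) : IsBasic n 0 0 1 := by
  unfold IsBasic; omega

/-- The upward arrows are the rescaled ones, so only they carry a sign here. A step to a vertex
outside the graph gives a zero `B`, so the last vertex needs no separate case. -/
theorem D_mul_B {i j d : ℕ} (h : IsBasic n i j d) : W.D * W.B i j d =
    (if i = 0 then W.B 0 j (d + 1) else (-1 : K) ^ i • W.B (i - 1) j (d + 1)) +
      W.B (i + 1) j (d + 1) := by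
  have h1 := h.1
  rw [W.D_eq, add_mul, Finset.sum_mul]
  have key : ∀ k ∈ Finset.range n, ((-1 : K) ^ (k + 1) • W.B k (k + 1) 1 + W.B (k + 1) k 1) *
      W.B i j d = (if k + 1 = i then (-1 : K) ^ i • W.B (i - 1) j (d + 1) else 0) +
        if k = i then W.B (i + 1) j (d + 1) else 0 := by
    intro k _
    rw [add_mul, smul_mul_assoc]
    congr 1
    · split_ifs with hk
      · subst hk
        rw [W.B_mul_B_of_basic (isBasic_up.2 h1) h, Nat.add_sub_cancel, add_comm 1 d]
      · rw [W.B_mul_B_of_ne hk, smul_zero]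
    · split_ifs with hk
      · subst hk
        by_cases hk : k + 1 < n
        · rw [W.B_mul_B_of_basic (isBasic_down.2 hk) h, add_comm 1 d]
        · rw [W.B_eq_zero (k + 1) k 1 fun h' => hk h'.1, zero_mul,
            W.B_eq_zero (k + 1) j _ fun h' => hk h'.1]
      · rw [W.B_mul_B_of_ne hk]
  rw [Finset.sum_congr rfl key, Finset.sum_add_distrib, Finset.sum_ite_eq' (Finset.range n) i,
    if_pos (Finset.mem_range.2 h1), ← add_assoc]
  congr 1
  by_cases hi : i = 0
  · subst hi
    rw [W.B_mul_B_of_basic (isBasic_loop h1) h, if_pos rfl, add_comm 1 d,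
      Finset.sum_eq_zero fun k _ => if_neg (Nat.succ_ne_zero k), add_zero]
  · obtain ⟨k, rfl⟩ : ∃ k, i = k + 1 := ⟨i - 1, by omega⟩
    rw [W.B_mul_B_of_ne (Nat.succ_ne_zero k).symm, zero_add, if_neg hi]
    simp only [add_left_inj]
    rw [Finset.sum_ite_eq' (Finset.range n) k, if_pos (Finset.mem_range.2 (by omega))]

theorem B_mul_D {i j d : ℕ} (h : IsBasic n i j d) : W.B i j d * W.D =
    (if j = 0 then W.B i 0 (d + 1) else W.B i (j - 1) (d + 1)) +
      (-1 : K) ^ (j + 1) • W.B i (j + 1) (d + 1) := by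
  have h1 := h.2.1
  rw [W.D_eq, mul_add, Finset.mul_sum]
  have key : ∀ k ∈ Finset.range n, W.B i j d *
      ((-1 : K) ^ (k + 1) • W.B k (k + 1) 1 + W.B (k + 1) k 1) =
      (if k + 1 = j then W.B i (j - 1) (d + 1) else 0) +
        if k = j then (-1 : K) ^ (j + 1) • W.B i (j + 1) (d + 1) else 0 := by
    intro k _
    rw [mul_add, mul_smul_comm, add_comm]
    congr 1
    · split_ifs with hk
      · subst hk
        rw [W.B_mul_B_of_basic h (isBasic_down.2 h1), Nat.add_sub_cancel]
      · rw [W.B_mul_B_of_ne (Ne.symm hk)]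
    · split_ifs with hk
      · subst hk
        by_cases hk : k + 1 < n
        · rw [W.B_mul_B_of_basic h (isBasic_up.2 hk)]
        · rw [W.B_eq_zero k (k + 1) 1 fun h' => hk h'.2.1, mul_zero,
            W.B_eq_zero i (k + 1) _ fun h' => hk h'.2.1]
      · rw [W.B_mul_B_of_ne (Ne.symm hk), smul_zero]
  rw [Finset.sum_congr rfl key, Finset.sum_add_distrib, Finset.sum_ite_eq' (Finset.range n) j,
    if_pos (Finset.mem_range.2 h1), ← add_assoc]
  congr 1
  by_cases hj : j = 0
  · subst hj
    rw [W.B_mul_B_of_basic h (isBasic_loop h1), if_pos rfl,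
      Finset.sum_eq_zero fun k _ => if_neg (Nat.succ_ne_zero k), add_zero]
  · obtain ⟨k, rfl⟩ : ∃ k, j = k + 1 := ⟨j - 1, by omega⟩
    rw [W.B_mul_B_of_ne (Nat.succ_ne_zero k), zero_add, if_neg hj]
    simp only [add_left_inj]
    rw [Finset.sum_ite_eq' (Finset.range n) k, if_pos (Finset.mem_range.2 (by omega))]

/-- Two vertices are joined by an edge of `𝕃ₙ`. -/
def Nbr (i j : ℕ) : Prop := i + 1 = j ∨ j + 1 = i ∨ (i = 0 ∧ j = 0)

instance (i j : ℕ) : Decidable (Nbr i j) := by unfold Nbr; infer_instance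

theorem e_mul_D_mul_e {i j : ℕ} (h : ¬ Nbr i j) : W.e i * W.D * W.e j = 0 := by
  by_cases hi : i < n
  · unfold Nbr at h
    rw [e, W.B_mul_D (isBasic_zero.2 hi), add_mul, smul_mul_assoc, W.B_mul_e j i (i + 1),
      if_neg (show ¬ i + 1 = j by omega), smul_zero, add_zero]
    split_ifs
    · rw [W.B_mul_e, if_neg (by omega)]
    · rw [W.B_mul_e, if_neg (by omega)]
  · rw [W.e_eq_zero (by omega), zero_mul, zero_mul]

/-- This is the preprojective relation at `i` in terms of `D`: the two ways out and back cancel, and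
both are zero at the last vertex. -/
theorem e_mul_D_mul_D_mul_e (i : ℕ) : W.e i * (W.D * W.D) * W.e i = 0 := by
  by_cases hi : i < n
  · have h1 : W.e i * W.D = (if i = 0 then W.B i 0 1 else W.B i (i - 1) 1) +
      (-1 : K) ^ (i + 1) • W.B i (i + 1) 1 := W.B_mul_D (isBasic_zero.2 hi)
    have h2 : W.D * W.e i = (if i = 0 then W.B 0 i 1 else (-1 : K) ^ i • W.B (i - 1) i 1) +
      W.B (i + 1) i 1 := W.D_mul_B (isBasic_zero.2 hi)
    rw [← mul_assoc, mul_assoc, h1, h2]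
    by_cases h0 : i = 0
    · subst h0
      rw [if_pos rfl, if_pos rfl, add_mul, mul_add, mul_add, smul_mul_assoc, smul_mul_assoc,
        W.B_mul_B_of_basic (isBasic_loop hi) (isBasic_loop hi), W.B_mul_B_of_ne (by omega),
        W.B_mul_B_of_ne (by omega), W.B_mul_B]
      by_cases h1 : 1 < n
      · rw [if_pos ⟨rfl, isBasic_up.2 h1, isBasic_down.2 h1⟩]
        simp
      · rw [if_neg fun h' => h1 h'.2.1.2.1, W.B_of_two_mul_le (by omega)]
        simp
    · obtain ⟨k, rfl⟩ : ∃ k, i = k + 1 := ⟨i - 1, by omega⟩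
      rw [if_neg h0, if_neg h0, add_mul, mul_add, mul_add, smul_mul_assoc, smul_mul_assoc,
        Nat.add_sub_cancel, mul_smul_comm, mul_smul_comm,
        W.B_mul_B_of_basic (isBasic_down.2 hi) (isBasic_up.2 hi),
        W.B_mul_B_of_ne (show k ≠ k + 1 + 1 by omega),
        W.B_mul_B_of_ne (show k + 1 + 1 ≠ k by omega), W.B_mul_B]
      by_cases h1 : k + 2 < n
      · rw [if_pos ⟨rfl, isBasic_up.2 h1, isBasic_down.2 h1⟩, pow_succ _ (k + 1)]
        simp
      · rw [if_neg fun h' => h1 h'.2.1.2.1, W.B_eq_zero (k + 1) (k + 1) (1 + 1) (by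
          unfold IsBasic; omega)]
        simp
  · rw [W.e_eq_zero (by omega), zero_mul, zero_mul]

end WalkAlgebra

/-! ### The minimal bimodule resolution of a walk algebra -/

namespace WalkAlgebra

variable {K : Type u} [Field K] {n : ℕ} {A : Type u} [Ring A] [Algebra K A]
  (W : WalkAlgebra K n A)

/-- The identification of the enveloping algebra with the linear endomorphisms of `A` given by the
trace form. -/
noncomputable def contr : Env K A →ₗ[K] (A →ₗ[K] A) :=
  (TensorProduct.lift
    { toFun := fun u =>
        { toFun := fun v => (W.τ.comp (LinearMap.mulLeft K v.unop)).smulRight u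
          map_add' := fun v w => by ext; simp [add_mul, add_smul]
          map_smul' := fun c v => by ext; simp [mul_smul] }
      map_add' := fun u v => by ext; simp
      map_smul' := fun c v => by ext; simp [smul_comm c] } : A ⊗[K] Aᵐᵒᵖ →ₗ[K] (A →ₗ[K] A))

theorem contr_bi (u v w : A) : W.contr (bi K u v) w = W.τ (v * w) • u := by
  rw [bi_eq_tmul]
  exact congrFun (congrArg DFunLike.coe (TensorProduct.lift.tmul u (MulOpposite.op v))) w

/-- The element of the enveloping algebra corresponding to an endomorphism. -/
noncomputable def kernel (φ : A →ₗ[K] A) : Env K A := ∑ t ∈ idx n, bi K (φ (W.b t)) (W.bd t)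

theorem kernel_contr (s : Env K A) : W.kernel (W.contr s) = s := by
  induction s using env_induction with
  | h0 => simp [kernel, zero_bi]
  | h1 u v =>
    unfold kernel
    simp only [contr_bi, ← bi_smul_right, ← bi_sum, W.sum_τ_smul_bd]
  | h2 s t hs ht =>
    conv_rhs => rw [← hs, ← ht]
    simp only [kernel, map_add, LinearMap.add_apply, add_bi, Finset.sum_add_distrib]

theorem contr_injective {s t : Env K A} (h : ∀ a, W.contr s a = W.contr t a) : s = t := by
  rw [← W.kernel_contr s, ← W.kernel_contr t, LinearMap.ext h]

theorem contr_kernel (φ : A →ₗ[K] A) (a : A) : W.contr (W.kernel φ) a = φ a := by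
  conv_rhs => rw [← W.sum_τ_smul_bd a]
  induction a using W.induction with
  | hB i j d h =>
    have hd := h.lt
    rw [W.sum_idx_B h, kernel, map_sum, LinearMap.sum_apply, bd]
    dsimp only
    rw [show 2 * n - 1 - (2 * n - 1 - d) = d by omega, Finset.sum_eq_single (i, j, d)]
    · rw [contr_bi, bd, b, W.τ_B_mul_B, if_pos, one_smul]
      exact ⟨rfl, rfl, by dsimp only; omega, (isBasic_dual hd).2 h⟩
    · rintro ⟨k, l, d'⟩ ht hne
      have hd' := (mem_idx.1 ht).lt
      rw [contr_bi, bd, W.τ_B_mul_B, if_neg, zero_smul]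
      rintro ⟨h1, h2, h3, -⟩
      dsimp only at h1 h2 h3 hd'
      subst h1 h2
      exact hne (by rw [show d' = d by omega])
    · intro hn
      exact absurd (mem_idx.2 h) hn
  | h0 => simp
  | hadd a b ha hb =>
    rw [map_add, ha, hb, ← map_add, W.sum_τ_smul_bd, W.sum_τ_smul_bd, W.sum_τ_smul_bd]
  | hsmul c a ha =>
    rw [map_smul, ha, ← map_smul, W.sum_τ_smul_bd, W.sum_τ_smul_bd]

theorem contr_bi_mul (u v : A) (s : Env K A) (a : A) :
    W.contr (bi K u v * s) a = u * W.contr s (v * a) := by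
  induction s using env_induction with
  | h0 => simp
  | h1 u' v' => rw [bi_mul_bi, contr_bi, contr_bi, mul_smul_comm, mul_assoc]
  | h2 s t hs ht => rw [mul_add, map_add, map_add, LinearMap.add_apply, LinearMap.add_apply,
      mul_add, hs, ht]

/-- By the symmetry of `τ`, right multiplication in the enveloping algebra acts on the right of both
argument and value. Identities between differentials thereby become identities between linear maps
of `A`. -/
theorem contr_mul_bi (u v : A) (s : Env K A) (a : A) :
    W.contr (s * bi K u v) a = W.contr s (a * v) * u := by
  induction s using env_induction with
  | h0 => simp
  | h1 u' v' =>
    rw [bi_mul_bi, contr_bi, contr_bi, smul_mul_assoc, mul_assoc, W.τ_mul_comm, mul_assoc]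
  | h2 s t hs ht => rw [add_mul, map_add, map_add, LinearMap.add_apply, LinearMap.add_apply,
      add_mul, hs, ht]

/-- The automorphism `μ ⊗ 1` of the enveloping algebra. -/
noncomputable def twist : Env K A →ₐ[K] Env K A :=
  (Algebra.TensorProduct.map W.μ (AlgHom.id K Aᵐᵒᵖ) : A ⊗[K] Aᵐᵒᵖ →ₐ[K] A ⊗[K] Aᵐᵒᵖ)

theorem twist_bi (u v : A) : W.twist (bi K u v) = bi K (W.μ u) v := by
  rw [bi_eq_tmul, bi_eq_tmul]
  exact Algebra.TensorProduct.map_tmul _ _ _ _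

theorem twist_twist (s : Env K A) : W.twist (W.twist s) = s := by
  induction s using env_induction with
  | h0 => rw [map_zero, map_zero]
  | h1 u v => rw [twist_bi, twist_bi, μ_μ]
  | h2 s t hs ht => rw [map_add, map_add, hs, ht]

theorem contr_twist (s : Env K A) (a : A) : W.contr (W.twist s) a = W.μ (W.contr s a) := by
  induction s using env_induction with
  | h0 => simp
  | h1 u v => rw [twist_bi, contr_bi, contr_bi, map_smul]
  | h2 s t hs ht => rw [map_add, map_add, map_add, LinearMap.add_apply, LinearMap.add_apply,
      map_add, hs, ht]

/-- The derivation `euler ⊗ 1` of the enveloping algebra. -/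
noncomputable def leftEuler : Env K A →ₗ[K] Env K A :=
  (LinearMap.rTensor Aᵐᵒᵖ W.euler : A ⊗[K] Aᵐᵒᵖ →ₗ[K] A ⊗[K] Aᵐᵒᵖ)

theorem leftEuler_bi (u v : A) : W.leftEuler (bi K u v) = bi K (W.euler u) v := by
  rw [bi_eq_tmul, bi_eq_tmul]
  exact LinearMap.rTensor_tmul _ _ _ _

theorem leftEuler_mul (s t : Env K A) :
    W.leftEuler (s * t) = W.leftEuler s * t + s * W.leftEuler t := by
  induction s using env_induction with
  | h0 => simp
  | h1 u v =>
    induction t using env_induction with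
    | h0 => simp
    | h1 u' v' =>
      rw [bi_mul_bi, leftEuler_bi, leftEuler_bi, leftEuler_bi, bi_mul_bi, bi_mul_bi, euler_mul,
        add_bi]
    | h2 s t hs ht => rw [mul_add, map_add, map_add, hs, ht, mul_add, mul_add]; abel
  | h2 s s' hs hs' => rw [add_mul, map_add, map_add, hs, hs', add_mul, add_mul]; abel

/-- The idempotent of pairs of equal vertices. -/
noncomputable def E0 : Env K A := ∑ i ∈ Finset.range n, bi K (W.e i) (W.e i)

/-- The idempotent of pairs of vertices joined by an edge. -/
noncomputable def E1 : Env K A := bi K (W.e 0) (W.e 0) + ∑ i ∈ Finset.range n,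
  (bi K (W.e i) (W.e (i + 1)) + bi K (W.e (i + 1)) (W.e i))

theorem bi_e_mul_bi_e (k l i j : ℕ) : bi K (W.e k) (W.e l) * bi K (W.e i) (W.e j) =
    if k = i ∧ l = j then bi K (W.e k) (W.e l) else 0 := by
  rw [bi_mul_bi, e_mul_e, e_mul_e]
  by_cases h1 : k = i
  · by_cases h2 : l = j
    · subst h1 h2; simp
    · rw [if_neg (Ne.symm h2), if_neg (fun h : k = i ∧ l = j => h2 h.2), bi_zero]
  · rw [if_neg h1, if_neg (fun h : k = i ∧ l = j => h1 h.1), zero_bi]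

theorem bi_e_mul_E0 (k l : ℕ) : bi K (W.e k) (W.e l) * W.E0 =
    if k = l then bi K (W.e k) (W.e l) else 0 := by
  rw [E0, Finset.mul_sum]
  simp only [bi_e_mul_bi_e]
  split_ifs with h
  · subst h
    by_cases hk : k < n
    · rw [Finset.sum_eq_single k, if_pos ⟨rfl, rfl⟩]
      · intro j _ hj
        rw [if_neg fun h => hj h.1.symm]
      · intro h
        exact absurd (Finset.mem_range.2 hk) h
    · rw [W.e_eq_zero (by omega), zero_bi]
      simp
  · exact Finset.sum_eq_zero fun i _ => if_neg (by omega)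

theorem bi_e_mul_E1 (k l : ℕ) : bi K (W.e k) (W.e l) * W.E1 =
    if Nbr k l then bi K (W.e k) (W.e l) else 0 := by
  rw [E1, mul_add, Finset.mul_sum]
  simp only [mul_add, bi_e_mul_bi_e]
  rw [Finset.sum_add_distrib]
  by_cases hk : k < n ∧ l < n
  · have h1 : ∑ i ∈ Finset.range n, (if k = i ∧ l = i + 1 then bi K (W.e k) (W.e l) else 0) =
        if k + 1 = l then bi K (W.e k) (W.e l) else 0 := by
      rw [Finset.sum_eq_single k]
      · exact if_congr (by omega) rfl rfl
      · intro i _ hi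
        rw [if_neg fun h => hi h.1.symm]
      · intro h
        exact absurd (Finset.mem_range.2 hk.1) h
    have h2 : ∑ i ∈ Finset.range n, (if k = i + 1 ∧ l = i then bi K (W.e k) (W.e l) else 0) =
        if l + 1 = k then bi K (W.e k) (W.e l) else 0 := by
      rw [Finset.sum_eq_single l]
      · exact if_congr (by omega) rfl rfl
      · intro i _ hi
        rw [if_neg fun h => hi h.2.symm]
      · intro h
        exact absurd (Finset.mem_range.2 hk.2) h
    rw [h1, h2]
    unfold Nbr
    by_cases h3 : k + 1 = l
    · simp [h3, show ¬ (k = 0 ∧ l = 0) by omega, show ¬ l + 1 = k by omega]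
    · by_cases h4 : l + 1 = k
      · simp [h4, show ¬ (k = 0 ∧ l = 0) by omega, show ¬ k + 1 = l by omega]
      · simp [h3, h4]
  · have : bi K (W.e k) (W.e l) = 0 := by
      rcases not_and_or.1 hk with h | h
      · rw [W.e_eq_zero (by omega), zero_bi]
      · rw [W.e_eq_zero (by omega) (i := l), bi_zero]
    simp [this]

theorem E0_mul_bi_e (k l : ℕ) : W.E0 * bi K (W.e k) (W.e l) =
    if k = l then bi K (W.e k) (W.e l) else 0 := by
  rw [← bi_e_mul_E0, E0, Finset.mul_sum, Finset.sum_mul]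
  refine Finset.sum_congr rfl fun i _ => ?_
  rw [bi_e_mul_bi_e, bi_e_mul_bi_e]
  by_cases h : i = k ∧ i = l
  · obtain ⟨rfl, rfl⟩ := h; rfl
  · rw [if_neg h, if_neg fun h' => h ⟨h'.1.symm, h'.2.symm⟩]

theorem bi_e_commute (i j k l : ℕ) : bi K (W.e i) (W.e j) * bi K (W.e k) (W.e l) =
    bi K (W.e k) (W.e l) * bi K (W.e i) (W.e j) := by
  rw [bi_e_mul_bi_e, bi_e_mul_bi_e]
  by_cases h : i = k ∧ j = l
  · obtain ⟨rfl, rfl⟩ := h; rfl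
  · rw [if_neg h, if_neg fun h' => h ⟨h'.1.symm, h'.2.symm⟩]

theorem E1_mul_bi_e (k l : ℕ) : W.E1 * bi K (W.e k) (W.e l) =
    if Nbr k l then bi K (W.e k) (W.e l) else 0 := by
  rw [← bi_e_mul_E1, E1, mul_add, add_mul, Finset.mul_sum, Finset.sum_mul, W.bi_e_commute 0 0]
  congr 1
  refine Finset.sum_congr rfl fun i _ => ?_
  rw [mul_add, add_mul, W.bi_e_commute, W.bi_e_commute k l (i + 1)]

theorem E0_mul_E0 : W.E0 * W.E0 = W.E0 := by
  conv_lhs => enter [1]; rw [E0]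
  rw [Finset.sum_mul, E0]
  refine Finset.sum_congr rfl fun i _ => ?_
  rw [← E0, bi_e_mul_E0, if_pos rfl]

theorem E1_mul_E1 : W.E1 * W.E1 = W.E1 := by
  conv_lhs => enter [1]; rw [E1]
  rw [add_mul, Finset.sum_mul, bi_e_mul_E1, if_pos (by unfold Nbr; omega)]
  conv_rhs => rw [E1]
  congr 1
  refine Finset.sum_congr rfl fun i _ => ?_
  rw [add_mul, bi_e_mul_E1, bi_e_mul_E1, if_pos (by unfold Nbr; omega),
    if_pos (by unfold Nbr; omega)]

theorem E0_smul (a : A) : W.E0 • a = ∑ i ∈ Finset.range n, W.e i * a * W.e i := by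
  rw [E0, Finset.sum_smul]
  simp only [bi_smul_eq]

theorem E0_smul_one : W.E0 • (1 : A) = 1 := by
  rw [E0_smul]
  simp only [mul_one, e_mul_self, W.sum_e]

theorem twist_E0 : W.twist W.E0 = W.E0 := by
  rw [E0, map_sum]
  simp only [twist_bi, μ_e]

theorem twist_E1 : W.twist W.E1 = W.E1 := by
  rw [E1, map_add, map_sum]
  simp only [map_add, twist_bi, μ_e]

theorem leftEuler_E0 : W.leftEuler W.E0 = 0 := by
  rw [E0, map_sum]
  simp only [leftEuler_bi, euler_e, zero_bi, Finset.sum_const_zero]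

theorem leftEuler_E1 : W.leftEuler W.E1 = 0 := by
  rw [E1, map_add, map_sum]
  simp only [map_add, leftEuler_bi, euler_e, zero_bi, add_zero, Finset.sum_const_zero]

theorem contr_E0_mul (s : Env K A) (a : A) :
    W.contr (W.E0 * s) a = ∑ i ∈ Finset.range n, W.e i * W.contr s (W.e i * a) := by
  rw [E0, Finset.sum_mul, map_sum, LinearMap.sum_apply]
  simp only [contr_bi_mul]

theorem contr_mul_E0 (s : Env K A) (a : A) :
    W.contr (s * W.E0) a = ∑ i ∈ Finset.range n, W.contr s (a * W.e i) * W.e i := by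
  rw [E0, Finset.mul_sum, map_sum, LinearMap.sum_apply]
  simp only [contr_mul_bi]

theorem eq_sum_e_mul (a : A) : a = ∑ i ∈ Finset.range n, W.e i * a := by
  rw [← Finset.sum_mul, W.sum_e, one_mul]

theorem eq_sum_mul_e (a : A) : a = ∑ i ∈ Finset.range n, a * W.e i := by
  rw [← Finset.mul_sum, W.sum_e, mul_one]

/-- Left multiplication by `D`. -/
noncomputable def dl : Env K A := bi K W.D 1

/-- Right multiplication by `D`. -/
noncomputable def dr : Env K A := bi K 1 W.D

theorem dl_mul_dr : W.dl * W.dr = W.dr * W.dl := by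
  rw [dl, dr, bi_mul_bi, bi_mul_bi, one_mul, mul_one]

theorem E0_mul_dl_mul_E1 : W.E0 * W.dl * W.E1 = W.E0 * W.dl := by
  rw [E0, Finset.sum_mul, Finset.sum_mul]
  refine Finset.sum_congr rfl fun i _ => ?_
  rw [dl, bi_mul_bi, one_mul, W.eq_sum_mul_e (W.e i * W.D), sum_bi, Finset.sum_mul]
  refine Finset.sum_congr rfl fun j _ => ?_
  have h : bi K (W.e i * W.D * W.e j) (W.e i) =
      bi K (W.e i * W.D * W.e j) (W.e i) * bi K (W.e j) (W.e i) := by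
    rw [bi_mul_bi, mul_assoc _ (W.e j), e_mul_self, e_mul_self]
  rw [h, mul_assoc, bi_e_mul_E1]
  split_ifs with hn
  · rfl
  · rw [W.e_mul_D_mul_e (fun h' => hn (by unfold Nbr at h' ⊢; omega)), zero_bi, zero_mul, zero_mul]

theorem E0_mul_dr_mul_E1 : W.E0 * W.dr * W.E1 = W.E0 * W.dr := by
  rw [E0, Finset.sum_mul, Finset.sum_mul]
  refine Finset.sum_congr rfl fun i _ => ?_
  rw [dr, bi_mul_bi, mul_one, W.eq_sum_e_mul (W.D * W.e i), bi_sum, Finset.sum_mul]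
  refine Finset.sum_congr rfl fun j _ => ?_
  have h : bi K (W.e i) (W.e j * (W.D * W.e i)) =
      bi K (W.e i) (W.e j * (W.D * W.e i)) * bi K (W.e i) (W.e j) := by
    rw [bi_mul_bi, ← mul_assoc (W.e j) (W.e j), e_mul_self, e_mul_self]
  rw [h, mul_assoc, bi_e_mul_E1]
  split_ifs with hn
  · rfl
  · rw [← mul_assoc, W.e_mul_D_mul_e (fun h' => hn (by unfold Nbr at h' ⊢; omega)), bi_zero,
      zero_mul, zero_mul]

theorem E1_mul_dl_mul_E0 : W.E1 * W.dl * W.E0 = W.dl * W.E0 := by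
  rw [E0, Finset.mul_sum, Finset.mul_sum]
  refine Finset.sum_congr rfl fun i _ => ?_
  rw [dl, mul_assoc, bi_mul_bi, mul_one, W.eq_sum_e_mul (W.D * W.e i), sum_bi, Finset.mul_sum]
  refine Finset.sum_congr rfl fun j _ => ?_
  have h : bi K (W.e j * (W.D * W.e i)) (W.e i) =
      bi K (W.e j) (W.e i) * bi K (W.e j * (W.D * W.e i)) (W.e i) := by
    rw [bi_mul_bi, ← mul_assoc (W.e j) (W.e j), e_mul_self, e_mul_self]
  rw [h, ← mul_assoc, E1_mul_bi_e]
  split_ifs with hn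
  · rfl
  · rw [← mul_assoc, W.e_mul_D_mul_e hn, zero_bi, mul_zero, mul_zero]

theorem E1_mul_dr_mul_E0 : W.E1 * W.dr * W.E0 = W.dr * W.E0 := by
  rw [E0, Finset.mul_sum, Finset.mul_sum]
  refine Finset.sum_congr rfl fun i _ => ?_
  rw [dr, mul_assoc, bi_mul_bi, one_mul, W.eq_sum_mul_e (W.e i * W.D), bi_sum, Finset.mul_sum]
  refine Finset.sum_congr rfl fun j _ => ?_
  have h : bi K (W.e i) (W.e i * W.D * W.e j) =
      bi K (W.e i) (W.e j) * bi K (W.e i) (W.e i * W.D * W.e j) := by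
    rw [bi_mul_bi, mul_assoc _ (W.e j), e_mul_self, e_mul_self]
  rw [h, ← mul_assoc, E1_mul_bi_e]
  split_ifs with hn
  · rfl
  · rw [W.e_mul_D_mul_e hn, bi_zero, mul_zero, mul_zero]

theorem E0_mul_dl_mul_dl_mul_E0 : W.E0 * (W.dl * W.dl) * W.E0 = 0 := by
  conv_lhs => enter [1, 1]; rw [E0]
  rw [Finset.sum_mul, Finset.sum_mul]
  refine Finset.sum_eq_zero fun i _ => ?_
  rw [dl, bi_mul_bi, bi_mul_bi, mul_one, one_mul, E0, Finset.mul_sum]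
  refine Finset.sum_eq_zero fun j _ => ?_
  rw [bi_mul_bi, e_mul_e]
  split_ifs with h
  · rw [h, e_mul_D_mul_D_mul_e, zero_bi]
  · rw [bi_zero]

theorem E0_mul_dr_mul_dr_mul_E0 : W.E0 * (W.dr * W.dr) * W.E0 = 0 := by
  conv_lhs => enter [1, 1]; rw [E0]
  rw [Finset.sum_mul, Finset.sum_mul]
  refine Finset.sum_eq_zero fun i _ => ?_
  rw [dr, bi_mul_bi, bi_mul_bi, mul_one, mul_one, E0, Finset.mul_sum]
  refine Finset.sum_eq_zero fun j _ => ?_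
  rw [bi_mul_bi, e_mul_e]
  split_ifs with h
  · rw [← h, ← mul_assoc, e_mul_D_mul_D_mul_e, bi_zero]
  · rw [zero_bi]

theorem twist_dl : W.twist W.dl = -W.dl := by rw [dl, twist_bi, μ_D, neg_bi]

theorem twist_dr : W.twist W.dr = W.dr := by rw [dr, twist_bi, map_one]

theorem euler_one : W.euler 1 = 0 := by
  rw [← W.sum_e, map_sum]
  exact Finset.sum_eq_zero fun i _ => W.euler_e i

theorem leftEuler_dl : W.leftEuler W.dl = W.dl := by rw [dl, leftEuler_bi, euler_D]

theorem leftEuler_dr : W.leftEuler W.dr = 0 := by rw [dr, leftEuler_bi, euler_one, zero_bi]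

theorem contr_dl_mul (s : Env K A) (a : A) : W.contr (W.dl * s) a = W.D * W.contr s a := by
  rw [dl, contr_bi_mul, one_mul]

theorem contr_dr_mul (s : Env K A) (a : A) : W.contr (W.dr * s) a = W.contr s (W.D * a) := by
  rw [dr, contr_bi_mul, one_mul]

theorem contr_mul_dl (s : Env K A) (a : A) : W.contr (s * W.dl) a = W.contr s a * W.D := by
  rw [dl, contr_mul_bi, mul_one]

theorem contr_mul_dr (s : Env K A) (a : A) : W.contr (s * W.dr) a = W.contr s (a * W.D) := by
  rw [dr, contr_mul_bi, mul_one]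

theorem dl_smul (a : A) : W.dl • a = W.D * a := by rw [dl, bi_smul_eq, mul_one]

theorem dr_smul (a : A) : W.dr • a = a * W.D := by rw [dr, bi_smul_eq, one_mul]

/-- The element `∑ (-1) ^ d B i j d ⊗ B j i (2 n - 1 - d)`. -/
noncomputable def ω : Env K A := W.kernel W.μ.toLinearMap

theorem contr_ω (a : A) : W.contr W.ω a = W.μ a := by rw [ω, contr_kernel]; rfl

theorem E0_mul_ω : W.E0 * W.ω = W.ω := by
  refine W.contr_injective fun a => ?_
  simp only [contr_E0_mul, contr_ω, map_mul, μ_e, ← mul_assoc, e_mul_self]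
  exact (W.eq_sum_e_mul _).symm

theorem ω_mul_E0 : W.ω * W.E0 = W.ω := by
  refine W.contr_injective fun a => ?_
  simp only [contr_mul_E0, contr_ω, map_mul, μ_e, mul_assoc, e_mul_self]
  exact (W.eq_sum_mul_e _).symm

/-- The idempotents of the resolution. -/
noncomputable def idem : ℕ → Env K A
  | 0 => W.E0
  | 1 => W.E1
  | 2 => W.E0
  | k + 3 => idem k

/-- The differentials of the resolution. -/
noncomputable def diff : ℕ → Env K A
  | 0 => (W.dl - W.dr) * W.E0
  | 1 => W.E0 * (W.dl + W.dr)
  | 2 => W.ω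
  | k + 3 => W.twist (diff k)

theorem idem_add_three (k : ℕ) : W.idem (k + 3) = W.idem k := rfl

theorem diff_add_three (k : ℕ) : W.diff (k + 3) = W.twist (W.diff k) := rfl

theorem diff_add_six (k : ℕ) : W.diff (k + 6) = W.diff k := by
  rw [show k + 6 = k + 3 + 3 from rfl, diff_add_three, diff_add_three, twist_twist]

theorem twist_idem (k : ℕ) : W.twist (W.idem k) = W.idem k := by
  induction k using Nat.strong_induction_on with
  | _ k ih =>
    match k, ih with
    | 0, _ => exact W.twist_E0
    | 1, _ => exact W.twist_E1
    | 2, _ => exact W.twist_E0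
    | k + 3, ih => exact ih k (by omega)

/-- An induction with the period three. -/
theorem three_induction {p : ℕ → Prop} (h0 : p 0) (h1 : p 1) (h2 : p 2)
    (h3 : ∀ k, p k → p (k + 3)) (k : ℕ) : p k := by
  induction k using Nat.strong_induction_on with
  | _ k ih =>
    match k, ih with
    | 0, _ => exact h0
    | 1, _ => exact h1
    | 2, _ => exact h2
    | k + 3, ih => exact h3 k (ih k (by omega))

theorem idem_mul_idem (k : ℕ) : W.idem k * W.idem k = W.idem k :=
  three_induction (p := fun k => W.idem k * W.idem k = W.idem k) W.E0_mul_E0 W.E1_mul_E1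
    W.E0_mul_E0 (fun _ h => h) k

theorem idem_mul_diff (k : ℕ) : W.idem (k + 1) * W.diff k = W.diff k :=
  three_induction (p := fun k => W.idem (k + 1) * W.diff k = W.diff k)
    (by
      change W.E1 * ((W.dl - W.dr) * W.E0) = (W.dl - W.dr) * W.E0
      rw [sub_mul, mul_sub, ← mul_assoc, ← mul_assoc, E1_mul_dl_mul_E0, E1_mul_dr_mul_E0])
    (by
      change W.E0 * (W.E0 * (W.dl + W.dr)) = W.E0 * (W.dl + W.dr)
      rw [← mul_assoc, E0_mul_E0])
    W.E0_mul_ω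
    (fun k h => by
      change W.idem (k + 1) * W.twist (W.diff k) = W.twist (W.diff k)
      rw [← W.twist_idem (k + 1), ← map_mul, h]) k

theorem diff_mul_idem (k : ℕ) : W.diff k * W.idem k = W.diff k :=
  three_induction (p := fun k => W.diff k * W.idem k = W.diff k)
    (by
      change (W.dl - W.dr) * W.E0 * W.E0 = (W.dl - W.dr) * W.E0
      rw [mul_assoc, E0_mul_E0])
    (by
      change W.E0 * (W.dl + W.dr) * W.E1 = W.E0 * (W.dl + W.dr)
      rw [mul_add, add_mul, E0_mul_dl_mul_E1, E0_mul_dr_mul_E1])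
    W.ω_mul_E0
    (fun k h => by
      change W.twist (W.diff k) * W.idem k = W.twist (W.diff k)
      rw [← W.twist_idem k, ← map_mul, h]) k

theorem diff_mul_diff (k : ℕ) : W.diff (k + 1) * W.diff k = 0 :=
  three_induction (p := fun k => W.diff (k + 1) * W.diff k = 0)
    (by
      change W.E0 * (W.dl + W.dr) * ((W.dl - W.dr) * W.E0) = 0
      -- Left and right multiplication commute, so only squares of `D` on one side remain, and the
      -- preprojective relation kills them between copies of `E0`.
      have h : (W.dl + W.dr) * (W.dl - W.dr) = W.dl * W.dl - W.dr * W.dr := by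
        rw [add_mul, mul_sub, mul_sub, W.dl_mul_dr]; abel
      rw [mul_assoc, ← mul_assoc (W.dl + W.dr), h, sub_mul, mul_sub, ← mul_assoc W.E0 (W.dl * W.dl),
        ← mul_assoc W.E0 (W.dr * W.dr), E0_mul_dl_mul_dl_mul_E0, E0_mul_dr_mul_dr_mul_E0, sub_zero])
    (by
      change W.ω * (W.E0 * (W.dl + W.dr)) = 0
      rw [← mul_assoc, ω_mul_E0]
      -- Under `contr` the claim is `μ a * D + μ (a * D) = 0`, which holds because `μ` changes the
      -- sign of `D`.
      refine W.contr_injective fun a => ?_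
      rw [mul_add, map_add, LinearMap.add_apply, contr_mul_dl, contr_mul_dr, contr_ω, contr_ω,
        map_mul, μ_D, mul_neg, add_neg_cancel, map_zero, LinearMap.zero_apply])
    (by
      change W.twist ((W.dl - W.dr) * W.E0) * W.ω = 0
      rw [map_mul, twist_E0, mul_assoc, E0_mul_ω, map_sub, twist_dl, twist_dr]
      refine W.contr_injective fun a => ?_
      rw [sub_mul, neg_mul, map_sub, map_neg, LinearMap.sub_apply, LinearMap.neg_apply,
        contr_dl_mul, contr_dr_mul, contr_ω, contr_ω, map_mul, μ_D, neg_mul, sub_neg_eq_add,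
        neg_add_cancel, map_zero, LinearMap.zero_apply])
    (fun k h => by
      change W.twist (W.diff (k + 1)) * W.twist (W.diff k) = 0
      rw [← map_mul, h, map_zero]) k

theorem diff_zero_smul_one : W.diff 0 • (1 : A) = 0 := by
  change ((W.dl - W.dr) * W.E0) • (1 : A) = 0
  rw [mul_smul, E0_smul_one, sub_smul, dl_smul, dr_smul, mul_one, one_mul, sub_self]

end WalkAlgebra

/-! ### Exactness of the resolution -/

namespace WalkAlgebra

variable {K : Type u} [Field K] {n : ℕ} {A : Type u} [Ring A] [Algebra K A]
  (W : WalkAlgebra K n A)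

/-- The elements `u` with this property form a subalgebra, by the telescoping of `uv ⊗ 1 - 1 ⊗ uv`;
it contains the vertices and `D`. -/
theorem bi_sub_bi_mul_E0_mem (u : A) :
    ∃ t : Env K A, (bi K u 1 - bi K 1 u) * W.E0 = t * W.diff 0 := by
  let T : Subalgebra K A :=
    { carrier := {u | ∃ t : Env K A, (bi K u 1 - bi K 1 u) * W.E0 = t * W.diff 0}
      add_mem' := by
        rintro a b ⟨s, hs⟩ ⟨t, ht⟩
        refine ⟨s + t, ?_⟩
        rw [add_mul, ← hs, ← ht, add_bi, bi_add, ← add_mul]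
        congr 1
        abel
      mul_mem' := by
        rintro a b ⟨s, hs⟩ ⟨t, ht⟩
        refine ⟨bi K a 1 * t + bi K 1 b * s, ?_⟩
        rw [add_mul, mul_assoc, mul_assoc, ← hs, ← ht, ← mul_assoc, ← mul_assoc, ← add_mul]
        congr 1
        rw [mul_sub, mul_sub, bi_mul_bi, bi_mul_bi, bi_mul_bi, bi_mul_bi]
        simp only [one_mul, mul_one]
        abel
      algebraMap_mem' := by
        intro c
        refine ⟨0, ?_⟩
        rw [Algebra.algebraMap_eq_smul_one, smul_bi, bi_smul, sub_self, zero_mul, zero_mul] }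
  have hT : T = ⊤ := by
    refine W.generate T (fun i => ⟨0, ?_⟩) ⟨1, (one_mul _).symm⟩
    rw [zero_mul, E0, Finset.mul_sum]
    refine Finset.sum_eq_zero fun j _ => ?_
    change (bi K (W.e i) 1 - bi K 1 (W.e i)) * _ = 0
    rw [sub_mul, bi_mul_bi, bi_mul_bi, one_mul, mul_one, e_mul_e, e_mul_e]
    by_cases h : i = j
    · subst h; simp
    · rw [if_neg h, if_neg (Ne.symm h), zero_bi, bi_zero, sub_zero]
  have : u ∈ T := by rw [hT]; trivial
  exact this

theorem mul_E0_sub_mem (s : Env K A) :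
    ∃ t : Env K A, s * W.E0 - bi K 1 (s • (1 : A)) * W.E0 = t * W.diff 0 := by
  induction s using env_induction with
  | h0 => exact ⟨0, by rw [zero_smul, bi_zero, zero_mul, sub_zero, zero_mul]⟩
  | h1 u v =>
    obtain ⟨t, ht⟩ := W.bi_sub_bi_mul_E0_mem u
    refine ⟨bi K 1 v * t, ?_⟩
    rw [mul_assoc, ← ht, sub_mul, mul_sub, ← mul_assoc, ← mul_assoc, bi_mul_bi, bi_mul_bi,
      bi_smul_eq]
    simp only [one_mul, mul_one]
  | h2 s s' hs hs' =>
    obtain ⟨t, ht⟩ := hs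
    obtain ⟨t', ht'⟩ := hs'
    refine ⟨t + t', ?_⟩
    rw [add_mul, add_mul, ← ht, ← ht', add_smul, bi_add, add_mul]
    abel

theorem exact_at_zero (s : Env K A) (h : s * W.E0 = s) (h0 : s • (1 : A) = 0) :
    ∃ t, s = t * W.diff 0 := by
  obtain ⟨t, ht⟩ := W.mul_E0_sub_mem s
  rw [h, h0, bi_zero, zero_mul, sub_zero] at ht
  exact ⟨t, ht⟩

/-- In the quotient by the left ideal `I` of `diff 1`, the class of `E1` is an admissible value at
`D` of a derivation. The map `u ⊗ v ↦ Δ(u) v` built from it inverts `diff 0` modulo `I`, so an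
element killed by `diff 0` lies in `I`. -/
theorem exact_at_one (s : Env K A) (h : s * W.E1 = s) (h0 : s * W.diff 0 = 0) :
    ∃ t, s = t * W.diff 1 := by
  let I : Submodule (Env K A) (Env K A) := Submodule.span (Env K A) {W.diff 1}
  let π : Env K A →ₗ[Env K A] Env K A ⧸ I := I.mkQ
  have hπ : ∀ s : Env K A, π s = s • π 1 := fun s => by rw [← map_smul, smul_eq_mul, mul_one]
  have hd : π (W.diff 1) = 0 :=
    (Submodule.Quotient.mk_eq_zero I).2 (Submodule.mem_span_singleton_self _)
  obtain ⟨Δ, hmul, hK, he, hD⟩ := W.exists_derivation (Env K A ⧸ I) (π W.E1)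
    (by
      simp only [← map_smul, smul_eq_mul, ← map_sum, ← map_add, ← add_mul, ← Finset.sum_mul]
      exact congrArg π W.E1_mul_E1)
    (by
      simp only [← map_smul, smul_eq_mul, ← map_sum, ← map_add, ← add_mul, ← Finset.sum_mul]
      -- The relation required of a derivation is precisely that `diff 1` vanishes in the quotient.
      refine Eq.trans (congrArg π ?_) hd
      change W.E0 * ((W.dl + W.dr) * W.E1) = W.E0 * (W.dl + W.dr)
      rw [← mul_assoc]
      exact W.diff_mul_idem 1)
  have hsmul : ∀ (c : K) u, Δ (c • u) = algebraMap K (Env K A) c • Δ u := fun c u => by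
    rw [Algebra.smul_def, hmul, hK, smul_zero, add_zero, Algebra.algebraMap_eq_smul_one, smul_bi,
      bi_one_one, Algebra.algebraMap_eq_smul_one]
  let σ : Env K A →+ Env K A ⧸ I :=
    (TensorProduct.liftAddHom
      { toFun := fun u =>
          { toFun := fun v => bi K 1 v.unop • Δ u
            map_zero' := by rw [MulOpposite.unop_zero, bi_zero, zero_smul]
            map_add' := fun v w => by rw [MulOpposite.unop_add, bi_add, add_smul] }
        map_zero' := by ext; simp
        map_add' := fun u v => by ext; simp }
      (fun c u v => by
        change bi K 1 v.unop • Δ (c • u) = bi K 1 (c • v).unop • Δ u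
        rw [hsmul, smul_smul, MulOpposite.unop_smul, bi_smul, ← Algebra.commutes, Algebra.smul_def])
      : A ⊗[K] Aᵐᵒᵖ →+ Env K A ⧸ I)
  have hσ : ∀ u v, σ (bi K u v) = bi K 1 v • Δ u := fun u v => by
    rw [bi_eq_tmul]; rfl
  have he' : ∀ u i, Δ (u * W.e i) = bi K 1 (W.e i) • Δ u := fun u i => by
    rw [hmul, show Δ (W.e i) = 0 from he i, smul_zero, zero_add]
  have hσE : ∀ u v, σ (bi K u v * W.E0) = bi K 1 v • Δ u := fun u v => by
    rw [E0, Finset.mul_sum, map_sum]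
    have : ∀ i ∈ Finset.range n, σ (bi K u v * bi K (W.e i) (W.e i)) =
        bi K 1 (W.e i * v) • Δ u := fun i _ => by
      rw [bi_mul_bi, hσ, he', smul_smul, bi_mul_bi, one_mul, ← mul_assoc, e_mul_self]
    rw [Finset.sum_congr rfl this, ← Finset.sum_smul, ← bi_sum, ← W.eq_sum_e_mul]
  -- By the Leibniz rule, `Δ(u D) - Δ(u) D = u Δ(D)`.
  have key : ∀ s : Env K A, σ (s * W.diff 0) = π (s * W.E1) := by
    intro s
    induction s using env_induction with
    | h0 => rw [zero_mul, zero_mul, map_zero, map_zero]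
    | h1 u v =>
      change σ (bi K u v * ((W.dl - W.dr) * W.E0)) = _
      rw [← mul_assoc, mul_sub, dl, dr, bi_mul_bi, bi_mul_bi, one_mul, mul_one, sub_mul, map_sub,
        hσE, hσE, hmul, hD, smul_add, smul_smul, smul_smul, bi_mul_bi, bi_mul_bi]
      simp only [one_mul, mul_one]
      rw [add_sub_cancel_right, ← map_smul, smul_eq_mul]
    | h2 s t hs ht => rw [add_mul, add_mul, map_add, map_add, hs, ht]
  have h1 := key s
  rw [h0, map_zero, h] at h1
  obtain ⟨t, ht⟩ := Submodule.mem_span_singleton.1 ((Submodule.Quotient.mk_eq_zero I).1 h1.symm)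
  exact ⟨t, ht.symm⟩

theorem contr_mul_e_of_mul_E0 {s : Env K A} (h : s * W.E0 = s) (a : A) (i : ℕ) :
    W.contr s (a * W.e i) = W.contr s a * W.e i := by
  have key : ∀ a, W.contr s a = ∑ i ∈ Finset.range n, W.contr s (a * W.e i) * W.e i := fun a => by
    conv_lhs => rw [← h]
    rw [contr_mul_E0]
  by_cases hi : i < n
  · rw [key a, key (a * W.e i), Finset.sum_mul, Finset.sum_eq_single i, Finset.sum_eq_single i]
    · rw [mul_assoc, e_mul_self, mul_assoc (W.contr s _), e_mul_self]
    · intro j _ hj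
      rw [mul_assoc, e_mul_e, if_neg hj, mul_zero]
    · intro hn
      exact absurd (Finset.mem_range.2 hi) hn
    · intro j _ hj
      rw [mul_assoc, e_mul_e, if_neg (Ne.symm hj), mul_zero, map_zero, zero_mul]
    · intro hn
      exact absurd (Finset.mem_range.2 hi) hn
  · rw [W.e_eq_zero (by omega), mul_zero, mul_zero, map_zero]

/-- Being killed by `diff 1` means that `W.contr s` is right semilinear over `μ` at `D`, hence
everywhere by generation. Such a map is `u ↦ W.contr s 1 * μ u`, that is, a left multiple of `ω`. -/
theorem exact_at_two (s : Env K A) (h : s * W.E0 = s) (h0 : s * W.diff 1 = 0) :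
    ∃ t, s = t * W.diff 2 := by
  have hD : ∀ a, W.contr s (a * W.D) = W.contr s a * W.μ W.D := fun a => by
    have h1 : s * (W.E0 * (W.dl + W.dr)) = 0 := h0
    rw [← mul_assoc, h] at h1
    have h2 : W.contr (s * (W.dl + W.dr)) a = 0 := by rw [h1, map_zero, LinearMap.zero_apply]
    rw [mul_add, map_add, LinearMap.add_apply, contr_mul_dl, contr_mul_dr] at h2
    rw [μ_D, mul_neg]
    exact eq_neg_of_add_eq_zero_right h2
  let T : Subalgebra K A :=
    { carrier := {u | ∀ a, W.contr s (a * u) = W.contr s a * W.μ u}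
      add_mem' := by
        intro u v hu hv a
        rw [mul_add, map_add, hu, hv, map_add, mul_add]
      mul_mem' := by
        intro u v hu hv a
        rw [← mul_assoc, hv, hu, map_mul, mul_assoc]
      algebraMap_mem' := by
        intro c a
        rw [AlgHom.commutes, ← Algebra.commutes, ← Algebra.commutes, ← Algebra.smul_def,
          ← Algebra.smul_def, map_smul] }
  have hT : T = ⊤ := W.generate T (fun i a => by
    change W.contr s (a * W.e i) = _ * W.μ (W.e i)
    rw [W.contr_mul_e_of_mul_E0 h, μ_e]) hD
  have hT' : ∀ u, W.contr s u = W.contr s 1 * W.μ u := fun u => by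
    have hu : u ∈ T := by rw [hT]; trivial
    have := hu 1
    rwa [one_mul] at this
  refine ⟨bi K (W.contr s 1) 1, W.contr_injective fun a => ?_⟩
  rw [contr_bi_mul, hT']
  change _ = W.contr s 1 * W.contr W.ω (1 * a)
  rw [contr_ω, one_mul]

theorem contr_mul_ω (s : Env K A) (a : A) :
    W.contr (s * W.ω) a = W.μ (W.twist s • (1 : A)) * W.μ a := by
  induction s using env_induction with
  | h0 => simp
  | h1 u v => rw [contr_bi_mul, contr_ω, twist_bi, bi_smul_eq, mul_one, map_mul, map_mul, μ_μ,
      mul_assoc]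
  | h2 s t hs ht => rw [add_mul, map_add, LinearMap.add_apply, hs, ht, map_add, add_smul, map_add,
      add_mul]

/-- The product `s * ω` vanishes only if the twist of `s` kills `1`. So this is exactness at the
start of the resolution, transported by the twist. -/
theorem exact_at_three (s : Env K A) (h : s * W.E0 = s) (h0 : s * W.diff 2 = 0) :
    ∃ t, s = t * W.diff 3 := by
  have h1 : W.twist s • (1 : A) = 0 := by
    have h2 := W.contr_mul_ω s 1
    have h3 : s * W.ω = 0 := h0
    rw [h3, map_zero, LinearMap.zero_apply, map_one, mul_one] at h2
    rw [← W.μ_μ (W.twist s • (1 : A)), ← h2, map_zero]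
  obtain ⟨t, ht⟩ := W.exact_at_zero (W.twist s) (by rw [← W.twist_E0, ← map_mul, h]) h1
  refine ⟨W.twist t, ?_⟩
  rw [← W.twist_twist s, ht, map_mul]
  rfl

/-- The resolution of a walk algebra by projective bimodules. -/
noncomputable def resolution : IdempotentResolution (Env K A) A where
  e := W.idem
  d := W.diff
  x := 1
  e_mul_e := W.idem_mul_idem
  e_mul_d := W.idem_mul_diff
  d_mul_e := W.diff_mul_idem
  e_smul_x := W.E0_smul_one
  d_mul_d := W.diff_mul_diff
  d_smul_x := W.diff_zero_smul_one
  exists_smul_eq m := ⟨bi K m 1, by rw [bi_smul_eq, mul_one, mul_one]⟩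
  exact_zero := W.exact_at_zero
  exact_succ k := three_induction
    (p := fun k => ∀ s, s * W.idem (k + 1) = s → s * W.diff k = 0 → ∃ t, s = t * W.diff (k + 1))
    W.exact_at_one W.exact_at_two W.exact_at_three
    (fun k ih s h h0 => by
      obtain ⟨t, ht⟩ := ih (W.twist s)
        (by rw [← W.twist_idem (k + 1), ← map_mul]; exact congrArg W.twist h)
        (by
          rw [← W.twist_twist (W.diff k), ← map_mul]
          exact (congrArg W.twist h0).trans (map_zero _))
      refine ⟨W.twist t, ?_⟩
      rw [← W.twist_twist s, ht, map_mul]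
      rfl) k

end WalkAlgebra

/-! ### Counting basis elements -/

section Counting

variable {R : Type*} [CommRing R]

/-- The lengths avoiding the loop parity form an arithmetic progression of step two, and the other
basic lengths are their complements in `2 * n - 1`. -/
theorem sum_isBasic {n i j : ℕ} (hi : i < n) (hj : j < n) (f : ℕ → R) :
    ∑ d ∈ Finset.range (2 * n), (if IsBasic n i j d then f d else 0) =
      ∑ t ∈ Finset.range (n - max i j), (f (max i j - min i j + 2 * t) +
        f (2 * n - 1 - (max i j - min i j + 2 * t))) := by
  obtain ⟨M, m, hM, hm, hMm⟩ : ∃ M m, max i j = M ∧ min i j = m ∧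
      (i ≤ j ∧ M = j ∧ m = i ∨ j ≤ i ∧ M = i ∧ m = j) :=
    ⟨_, _, rfl, rfl, by rcases le_total i j with h | h <;> simp [h]⟩
  rw [hM, hm]
  clear hM hm
  have h1 : ∑ d ∈ Finset.range (2 * n) with
      (IsBasic n i j d ∧ (i + j + d) % 2 = 0), f d =
      ∑ t ∈ Finset.range (n - M), f (M - m + 2 * t) := by
    refine Finset.sum_nbij' (fun d => (d - (M - m)) / 2)
      (fun t => M - m + 2 * t) ?_ ?_ ?_ ?_ ?_
    · intro d hd
      simp only [Finset.mem_filter, Finset.mem_range] at hd ⊢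
      unfold IsBasic at hd
      omega
    · intro t ht
      simp only [Finset.mem_filter, Finset.mem_range] at ht ⊢
      unfold IsBasic
      omega
    · intro d hd
      simp only [Finset.mem_filter, Finset.mem_range] at hd
      unfold IsBasic at hd
      omega
    · intro t ht
      rw [Finset.mem_range] at ht
      omega
    · intro d hd
      simp only [Finset.mem_filter, Finset.mem_range] at hd
      unfold IsBasic at hd
      congr 1
      omega
  have h2 : ∑ d ∈ Finset.range (2 * n) with
      (IsBasic n i j d ∧ ¬ (i + j + d) % 2 = 0), f d =
      ∑ t ∈ Finset.range (n - M), f (2 * n - 1 - (M - m + 2 * t)) := by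
    refine Finset.sum_nbij' (fun d => (2 * n - 1 - d - (M - m)) / 2)
      (fun t => 2 * n - 1 - (M - m + 2 * t)) ?_ ?_ ?_ ?_ ?_
    · intro d hd
      simp only [Finset.mem_filter, Finset.mem_range] at hd ⊢
      unfold IsBasic at hd
      omega
    · intro t ht
      simp only [Finset.mem_filter, Finset.mem_range] at ht ⊢
      unfold IsBasic
      omega
    · intro d hd
      simp only [Finset.mem_filter, Finset.mem_range] at hd
      unfold IsBasic at hd
      omega
    · intro t ht
      simp only [Finset.mem_range] at ht ⊢
      omega
    · intro d hd
      simp only [Finset.mem_filter, Finset.mem_range] at hd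
      unfold IsBasic at hd
      congr 1
      omega
  rw [Finset.sum_add_distrib, ← h1, ← h2, ← Finset.sum_filter,
    ← Finset.sum_filter_add_sum_filter_not (Finset.filter _ _) (fun d => (i + j + d) % 2 = 0),
    Finset.filter_filter, Finset.filter_filter]

theorem sum_isBasic_one {n i j : ℕ} (hi : i < n) (hj : j < n) :
    ∑ d ∈ Finset.range (2 * n), (if IsBasic n i j d then (1 : R) else 0) =
      2 * ((n : R) - max i j) := by
  rw [sum_isBasic hi hj, Finset.sum_const, Finset.card_range, nsmul_eq_mul, Nat.cast_sub (by omega)]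
  push_cast
  ring

theorem neg_one_pow_sub {k d : ℕ} (h : d < 2 * k) : (-1 : R) ^ (2 * k - 1 - d) = -(-1) ^ d := by
  have h1 : (-1 : R) ^ (2 * k - 1 - d) * (-1) ^ d = -1 := by
    rw [← pow_add, show 2 * k - 1 - d + d = 2 * (k - 1) + 1 by omega, pow_succ, pow_mul]
    simp
  have h2 : (-1 : R) ^ d * (-1) ^ d = 1 := by rw [← mul_pow]; simp
  calc (-1 : R) ^ (2 * k - 1 - d) = (-1 : R) ^ (2 * k - 1 - d) * ((-1) ^ d * (-1) ^ d) := by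
        rw [h2, mul_one]
    _ = -(-1) ^ d := by rw [← mul_assoc, h1, neg_one_mul]

theorem sum_isBasic_sign {n i j : ℕ} (hi : i < n) (hj : j < n) :
    ∑ d ∈ Finset.range (2 * n), (if IsBasic n i j d then (-1 : R) ^ d else 0) = 0 := by
  rw [sum_isBasic hi hj]
  refine Finset.sum_eq_zero fun t ht => ?_
  rw [Finset.mem_range] at ht
  rw [neg_one_pow_sub (by omega), add_neg_cancel]

/-- Complementary lengths have opposite signs, so each pair leaves the difference of its two
lengths, and these differences form an arithmetic progression. -/
theorem sum_isBasic_sign_mul {n i j : ℕ} (hi : i < n) (hj : j < n) :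
    ∑ d ∈ Finset.range (2 * n), (if IsBasic n i j d then (-1 : R) ^ d * d else 0) =
      -((-1) ^ (i + j) * ((n : R) - max i j) * (2 * min i j + 1)) := by
  have hs : (-1 : R) ^ (i + j) = (-1) ^ (max i j - min i j) := by
    rw [show i + j = max i j - min i j + 2 * min i j by omega, pow_add, pow_mul]
    simp
  have key : ∀ t ∈ Finset.range (n - max i j),
      ((-1 : R) ^ (max i j - min i j + 2 * t) * ((max i j - min i j + 2 * t : ℕ) : R) +
        (-1 : R) ^ (2 * n - 1 - (max i j - min i j + 2 * t)) *
          ((2 * n - 1 - (max i j - min i j + 2 * t) : ℕ) : R)) =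
      (-1) ^ (i + j) * (2 * (max i j - min i j : ℕ) + 1 - 2 * n + 4 * t) := by
    intro t ht
    rw [Finset.mem_range] at ht
    rw [neg_one_pow_sub (by omega), pow_add, pow_mul, hs, Nat.cast_sub (by omega),
      Nat.cast_sub (by omega)]
    push_cast
    simp only [even_two, Even.neg_pow, one_pow]
    ring
  have hsum : ∀ N : ℕ, ∑ t ∈ Finset.range N, (4 * (t : R)) = 2 * N * (N - 1) := by
    intro N
    induction N with
    | zero => simp
    | succ N ih => rw [Finset.sum_range_succ, ih]; push_cast; ring
  rw [sum_isBasic hi hj, Finset.sum_congr rfl key, ← Finset.mul_sum, Finset.sum_add_distrib, hsum,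
    Finset.sum_const, Finset.card_range, nsmul_eq_mul, Nat.cast_sub (by omega),
    Nat.cast_sub (by omega)]
  ring

end Counting

namespace WalkAlgebra

variable {K : Type u} [Field K] {n : ℕ} {A : Type u} [Ring A] [Algebra K A]
  (W : WalkAlgebra K n A)

/-! ### Central elements and socle elements -/

/-- The generators of the socle. -/
def soc (i : ℕ) : A := W.B i i (2 * n - 1)

/-- The powers of the element `∑ B i i 2` of the center. -/
def xpow (m : ℕ) : A := ∑ i ∈ Finset.range n, W.B i i (2 * m)

theorem xpow_mul_B {k l d : ℕ} (m : ℕ) (h : IsBasic n k l d) :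
    W.xpow m * W.B k l d = W.B k l (2 * m + d) := by
  rw [xpow, Finset.sum_mul, Finset.sum_eq_single k]
  · rw [W.B_mul_B]
    split_ifs with h1
    · rfl
    · rw [W.B_eq_zero]
      intro h2
      refine h1 ⟨rfl, ?_, h⟩
      unfold IsBasic at *
      omega
  · intro i _ hi
    exact W.B_mul_B_of_ne hi
  · intro hk
    exact absurd (Finset.mem_range.2 h.1) hk

theorem B_mul_xpow {k l d : ℕ} (m : ℕ) (h : IsBasic n k l d) :
    W.B k l d * W.xpow m = W.B k l (2 * m + d) := by
  rw [xpow, Finset.mul_sum, Finset.sum_eq_single l]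
  · rw [W.B_mul_B]
    split_ifs with h1
    · rw [add_comm]
    · rw [W.B_eq_zero]
      intro h2
      refine h1 ⟨rfl, h, ?_⟩
      unfold IsBasic at *
      omega
  · intro i _ hi
    exact W.B_mul_B_of_ne (Ne.symm hi)
  · intro hk
    exact absurd (Finset.mem_range.2 h.2.1) hk

theorem xpow_mul (m : ℕ) (a : A) : W.xpow m * a = a * W.xpow m := by
  induction a using W.induction with
  | hB k l d h => rw [W.xpow_mul_B m h, W.B_mul_xpow m h]
  | h0 => simp
  | hadd a b ha hb => rw [mul_add, add_mul, ha, hb]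
  | hsmul c a ha => rw [mul_smul_comm, smul_mul_assoc, ha]

theorem xpow_zero : W.xpow 0 = 1 := W.sum_B

theorem xpow_add (m m' : ℕ) : W.xpow m * W.xpow m' = W.xpow (m + m') := by
  rw [show W.xpow m' = ∑ i ∈ Finset.range n, W.B i i (2 * m') from rfl, Finset.mul_sum]
  refine Finset.sum_congr rfl fun i _ => ?_
  rw [mul_add]
  by_cases h : IsBasic n i i (2 * m')
  · rw [W.xpow_mul_B m h]
  · rw [W.B_eq_zero _ _ _ h, mul_zero, W.B_eq_zero]
    unfold IsBasic at *
    omega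

theorem xpow_eq_zero {m : ℕ} (h : n ≤ m) : W.xpow m = 0 :=
  Finset.sum_eq_zero fun _ _ => W.B_of_two_mul_le (by omega)

theorem μ_xpow (m : ℕ) : W.μ (W.xpow m) = W.xpow m := by
  rw [xpow, map_sum]
  refine Finset.sum_congr rfl fun i _ => ?_
  rw [μ_B, pow_mul]
  simp

theorem soc_mul_B (i k l d : ℕ) : W.soc i * W.B k l d =
    if i = k ∧ k = l ∧ d = 0 then W.soc i else 0 := by
  rw [soc, W.B_mul_B]
  by_cases hd : d = 0
  · subst hd
    by_cases h : i = k ∧ k = l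
    · obtain ⟨rfl, rfl⟩ := h
      by_cases hi : i < n
      · rw [if_pos ⟨rfl, by unfold IsBasic; omega, isBasic_zero.2 hi⟩, add_zero]
        simp
      · rw [W.B_eq_zero i i _ fun h' => hi h'.1]
        simp [soc, W.B_eq_zero i i (2 * n - 1) fun h' => hi h'.1]
    · rw [if_neg, if_neg (fun h' => h ⟨h'.1, h'.2.1⟩)]
      rintro ⟨h1, -, h2⟩
      refine h ⟨h1, ?_⟩
      unfold IsBasic at h2
      omega
  · rw [if_neg (fun h : i = k ∧ k = l ∧ d = 0 => hd h.2.2), W.B_of_two_mul_le (by omega), ite_self]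

theorem B_mul_soc (i k l d : ℕ) : W.B k l d * W.soc i =
    if i = k ∧ k = l ∧ d = 0 then W.soc i else 0 := by
  rw [soc, W.B_mul_B]
  by_cases hd : d = 0
  · subst hd
    by_cases h : i = k ∧ k = l
    · obtain ⟨rfl, rfl⟩ := h
      by_cases hi : i < n
      · rw [if_pos ⟨rfl, isBasic_zero.2 hi, by unfold IsBasic; omega⟩, zero_add]
        simp
      · rw [W.B_eq_zero i i _ fun h' => hi h'.1]
        simp [soc, W.B_eq_zero i i (2 * n - 1) fun h' => hi h'.1]
    · rw [if_neg, if_neg (fun h' => h ⟨h'.1, h'.2.1⟩)]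
      rintro ⟨h1, h2, -⟩
      refine h ?_
      unfold IsBasic at h2
      omega
  · rw [if_neg (fun h : i = k ∧ k = l ∧ d = 0 => hd h.2.2), W.B_of_two_mul_le (by omega), ite_self]

theorem soc_mul (i : ℕ) (a : A) : W.soc i * a = a * W.soc i := by
  induction a using W.induction with
  | hB k l d h => rw [soc_mul_B, B_mul_soc]
  | h0 => simp
  | hadd a b ha hb => rw [mul_add, add_mul, ha, hb]
  | hsmul c a ha => rw [mul_smul_comm, smul_mul_assoc, ha]

theorem soc_mul_μ (i : ℕ) (a : A) : W.soc i * W.μ a = W.soc i * a := by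
  induction a using W.induction with
  | hB k l d h =>
    rw [μ_B, mul_smul_comm, soc_mul_B]
    split_ifs with h
    · rw [h.2.2, pow_zero, one_smul]
    · rw [smul_zero]
  | h0 => simp
  | hadd a b ha hb => rw [map_add, mul_add, mul_add, ha, hb]
  | hsmul c a ha => rw [map_smul, mul_smul_comm, mul_smul_comm, ha]

theorem soc_mul_D (hn : 0 < n) (i : ℕ) : W.soc i * W.D = 0 := by
  by_cases hi : i < n
  · rw [soc, W.B_mul_D (by unfold IsBasic; omega)]
    split_ifs <;>
    rw [W.B_of_two_mul_le (by omega), W.B_of_two_mul_le (by omega), smul_zero, add_zero]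
  · rw [soc, W.B_eq_zero i i _ fun h' => hi h'.1, zero_mul]

theorem D_mul_soc (hn : 0 < n) (i : ℕ) : W.D * W.soc i = 0 := by
  rw [← soc_mul, W.soc_mul_D hn]

theorem soc_mul_soc (i j : ℕ) (hn : 0 < n) : W.soc i * W.soc j = 0 := by
  rw [show W.soc j = W.B j j (2 * n - 1) from rfl, soc_mul_B, if_neg (by omega)]

theorem soc_mul_e (i j : ℕ) : W.soc i * W.e j = if i = j then W.soc i else 0 := by
  rw [e, soc_mul_B]
  simp

theorem soc_mul_xpow (i m : ℕ) (hm : m ≠ 0) : W.soc i * W.xpow m = 0 := by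
  rw [xpow, Finset.mul_sum]
  refine Finset.sum_eq_zero fun j _ => ?_
  rw [soc_mul_B, if_neg (by omega)]

theorem bi_central_mul {c : A} (hc : ∀ a, c * a = a * c) (s : Env K A) :
    bi K c 1 * s = s * bi K c 1 := by
  induction s using env_induction with
  | h0 => rw [mul_zero, zero_mul]
  | h1 u v => rw [bi_mul_bi, bi_mul_bi, mul_one, one_mul, hc]
  | h2 s t hs ht => rw [mul_add, add_mul, hs, ht]

/-- Socle elements kill positive degrees, so they do not see the difference between `u` and `μ u`.
-/
theorem twist_mul_bi_soc (i : ℕ) (s : Env K A) :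
    W.twist s * bi K (W.soc i) 1 = bi K (W.soc i) 1 * s := by
  induction s using env_induction with
  | h0 => rw [map_zero, mul_zero, zero_mul]
  | h1 u v => rw [twist_bi, bi_mul_bi, bi_mul_bi, mul_one, one_mul, ← soc_mul, soc_mul_μ]
  | h2 s t hs ht => rw [map_add, mul_add, add_mul, hs, ht]

/-! ### The action of the differentials -/

/-- A basis element and its dual have total length `2 * n - 1`, so anything of positive length
placed between them gives zero. A vertex gives socle elements, with coefficients counting walks by
length. -/
theorem kernel_scale_smul_B (f : ℕ → K) {i d : ℕ} (h : IsBasic n i i d) :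
    W.kernel (W.scale f) • W.B i i d = if d = 0 then ∑ l ∈ Finset.range n,
      (∑ d' ∈ Finset.range (2 * n), if IsBasic n l i d' then f d' else 0) • W.soc l else 0 := by
  rw [kernel, Finset.sum_smul]
  simp only [bi_smul_eq, b, bd, scale_B, smul_mul_assoc]
  split_ifs with hd
  · subst hd
    rw [idx, Finset.sum_filter, Finset.sum_product]
    refine Finset.sum_congr rfl fun l _ => ?_
    rw [Finset.sum_product, Finset.sum_smul, Finset.sum_eq_single i]
    · refine Finset.sum_congr rfl fun d' hd' => ?_
      split_ifs with hb
      · rw [W.B_mul_B_of_basic hb h, W.B_mul_B_of_basic (by simpa using hb)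
          ((isBasic_dual hb.lt).2 hb), soc]
        congr 2
        have := hb.lt
        omega
      · rw [zero_smul]
    · intro j _ hj
      refine Finset.sum_eq_zero fun d' _ => ?_
      rw [W.B_mul_B_of_ne hj, zero_mul, smul_zero, ite_self]
    · intro hi
      exact absurd (Finset.mem_range.2 h.1) hi
  · refine Finset.sum_eq_zero fun t ht => ?_
    have hb := mem_idx.1 ht
    have hlt := hb.lt
    rw [W.B_mul_B]
    split_ifs with h1
    · rw [W.B_mul_B]
      split_ifs with h2
      · rw [W.B_of_two_mul_le (by omega), smul_zero]
      · rw [smul_zero]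
    · rw [zero_mul, smul_zero]

theorem twist_ω : W.twist W.ω = W.kernel (W.scale fun _ => 1) := by
  refine W.contr_injective fun a => ?_
  rw [contr_twist, contr_ω, μ_μ, contr_kernel]
  conv_lhs => rw [← W.sum_τ_smul_bd a]
  rw [scale_apply]
  simp only [one_smul]

theorem leftEuler_ω : W.leftEuler W.ω = W.kernel (W.scale fun d => (-1) ^ d * d) := by
  have h : W.scale (fun d => (-1) ^ d * (d : K)) = W.euler.comp W.μ.toLinearMap :=
    W.hom_ext fun i j d _ => by
      rw [scale_B, LinearMap.comp_apply, AlgHom.toLinearMap_apply, μ_B, map_smul, euler_B,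
        smul_smul]
  rw [h, ω, kernel, kernel, map_sum]
  refine Finset.sum_congr rfl fun t _ => ?_
  rw [leftEuler_bi]
  rfl

end WalkAlgebra

/-! ### Explicit chain maps -/

namespace WalkAlgebra

variable {K : Type u} [Field K] {n : ℕ} {A : Type u} [Ring A] [Algebra K A]
  (W : WalkAlgebra K n A)

theorem isLift_central {c : A} (hc : ∀ a, c * a = a * c) :
    W.resolution.IsLift 0 fun k => bi K c 1 * W.idem k where
  e_mul k := by
    change W.idem (0 + k) * (bi K c 1 * W.idem k) = _
    rw [zero_add, ← mul_assoc, ← bi_central_mul hc, mul_assoc, idem_mul_idem]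
  mul_e k := by
    change bi K c 1 * W.idem k * W.idem k = _
    rw [mul_assoc, idem_mul_idem]
  comm k := by
    change W.diff (0 + k) * (bi K c 1 * W.idem k) = bi K c 1 * W.idem (k + 1) * W.diff k
    rw [zero_add, ← mul_assoc, ← bi_central_mul hc, mul_assoc, mul_assoc, diff_mul_idem,
      idem_mul_diff]

/-- Three steps shift the differentials by a twist, and multiplication by a socle element absorbs
that twist. -/
theorem isLift_soc (i : ℕ) : W.resolution.IsLift 3 fun k => bi K (W.soc i) 1 * W.idem k where
  e_mul k := by
    change W.idem (3 + k) * (bi K (W.soc i) 1 * W.idem k) = _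
    rw [add_comm 3 k, idem_add_three, ← mul_assoc, ← bi_central_mul (W.soc_mul i), mul_assoc,
      idem_mul_idem]
  mul_e k := by
    change bi K (W.soc i) 1 * W.idem k * W.idem k = _
    rw [mul_assoc, idem_mul_idem]
  comm k := by
    change W.diff (3 + k) * (bi K (W.soc i) 1 * W.idem k) = bi K (W.soc i) 1 * W.idem (k + 1) * W.diff k
    rw [add_comm 3 k, diff_add_three, ← mul_assoc, twist_mul_bi_soc, mul_assoc, mul_assoc,
      diff_mul_idem, idem_mul_diff]

theorem idem_add_six (k : ℕ) : W.idem (k + 6) = W.idem k := rfl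

theorem isLift_period : W.resolution.IsLift 6 W.idem where
  e_mul k := by
    change W.idem (6 + k) * W.idem k = _
    rw [add_comm 6 k, idem_add_six, idem_mul_idem]
  mul_e k := W.idem_mul_idem k
  comm k := by
    change W.diff (6 + k) * W.idem k = W.idem (k + 1) * W.diff k
    rw [add_comm 6 k, diff_add_six, diff_mul_idem, idem_mul_diff]

theorem leftEuler_idem (k : ℕ) : W.leftEuler (W.idem k) = 0 :=
  three_induction (p := fun k => W.leftEuler (W.idem k) = 0) W.leftEuler_E0 W.leftEuler_E1
    W.leftEuler_E0 (fun _ h => h) k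

/-- The chain map induced by the Euler derivation. -/
noncomputable def eulerLift (k : ℕ) : Env K A := (-1 : K) ^ k • W.leftEuler (W.diff k)

/-- Applying the derivation `leftEuler` to `diff (k + 1) * diff k = 0` gives commutation up to a
sign, and the factor `(-1) ^ k` removes the sign. -/
theorem isLift_euler : W.resolution.IsLift 1 W.eulerLift where
  e_mul k := by
    change W.idem (1 + k) * ((-1 : K) ^ k • W.leftEuler (W.diff k)) =
      (-1 : K) ^ k • W.leftEuler (W.diff k)
    have h := congrArg W.leftEuler (W.idem_mul_diff k)
    rw [leftEuler_mul, leftEuler_idem, zero_mul, zero_add] at h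
    rw [add_comm 1 k, mul_smul_comm, h]
  mul_e k := by
    change (-1 : K) ^ k • W.leftEuler (W.diff k) * W.idem k = (-1 : K) ^ k • W.leftEuler (W.diff k)
    have h := congrArg W.leftEuler (W.diff_mul_idem k)
    rw [leftEuler_mul, leftEuler_idem, mul_zero, add_zero] at h
    rw [smul_mul_assoc, h]
  comm k := by
    change W.diff (1 + k) * ((-1 : K) ^ k • W.leftEuler (W.diff k)) =
      (-1 : K) ^ (k + 1) • W.leftEuler (W.diff (k + 1)) * W.diff k
    have h := congrArg W.leftEuler (W.diff_mul_diff k)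
    rw [leftEuler_mul, map_zero] at h
    rw [add_comm 1 k, mul_smul_comm, smul_mul_assoc, eq_neg_of_add_eq_zero_left h, pow_succ]
    simp

/-- The algebra as a bimodule, with the left action twisted by `μ`. -/
def LeftTwisted (_ : WalkAlgebra K n A) : Type u := A

noncomputable instance : AddCommGroup W.LeftTwisted := inferInstanceAs (AddCommGroup A)

noncomputable instance : Module (Env K A) W.LeftTwisted :=
  (Module.compHom A W.twist.toRingHom : Module (Env K A) A)

/-- The identity map to the twisted bimodule. -/
def leftTwistedEquiv : A ≃+ W.LeftTwisted := AddEquiv.refl A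

theorem bi_smul_leftTwisted (u v m : A) :
    bi K u v • W.leftTwistedEquiv m = W.leftTwistedEquiv (W.μ u * m * v) := by
  change (W.twist (bi K u v) • m : A) = _
  rw [twist_bi, bi_smul_eq]
  rfl

/-- With the left action twisted, left multiplication by `D` changes sign, so the value `-e 0`
satisfies the relation at the loop because its two terms cancel. Applying `μ` to values moves the
twist to the right. -/
theorem exists_twisted_derivation : ∃ F : A →ₗ[K] A,
    (∀ u v, F (u * v) = u * F v + F u * W.μ v) ∧ (∀ i, F (W.e i) = 0) ∧ F W.D = -W.e 0 := by
  obtain ⟨Δ, hmul, hK, he, hD⟩ := W.exists_derivation W.LeftTwisted (W.leftTwistedEquiv (-W.e 0))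
    (by
      simp only [bi_smul_leftTwisted, ← map_add, ← map_sum]
      congr 1
      change W.μ (W.e 0) * (-W.e 0) * W.e 0 + ∑ i ∈ Finset.range n,
        (W.μ (W.e i) * (-W.e 0) * W.e (i + 1) + W.μ (W.e (i + 1)) * (-W.e 0) * W.e i) = -W.e 0
      rw [Finset.sum_eq_zero, μ_e, mul_neg, neg_mul, e_mul_self, e_mul_self, add_zero]
      intro i _
      rw [μ_e, μ_e, mul_neg, mul_neg, neg_mul, neg_mul, W.e_mul_e (i + 1),
        if_neg (Nat.succ_ne_zero i), zero_mul, mul_assoc, W.e_mul_e 0,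
        if_neg (Nat.succ_ne_zero i).symm, mul_zero, neg_zero, add_zero])
    (by
      refine Finset.sum_eq_zero fun i _ => ?_
      rw [bi_smul_leftTwisted, bi_smul_leftTwisted, ← map_add, bi_smul_leftTwisted, ← map_zero
        W.leftTwistedEquiv]
      congr 1
      change W.μ (W.e i) * (W.μ W.D * -W.e 0 * 1 + W.μ 1 * -W.e 0 * W.D) * W.e i = 0
      rw [μ_e, μ_D, map_one, mul_one, one_mul, neg_mul_neg, neg_mul, mul_add, add_mul, mul_neg,
        neg_mul, ← mul_assoc, ← mul_assoc, e_mul_e, mul_assoc, e_mul_e]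
      by_cases h : i = 0
      · subst h; simp
      · rw [if_neg (Ne.symm h), if_neg h]; simp)
  let Δ' : A →+ A := Δ
  have hmul' : ∀ u v, Δ' (u * v) = W.μ u * Δ' v + Δ' u * v := fun u v => by
    refine (hmul u v).trans ?_
    change bi K u 1 • W.leftTwistedEquiv (Δ' v) + bi K 1 v • W.leftTwistedEquiv (Δ' u) = _
    rw [bi_smul_leftTwisted, bi_smul_leftTwisted, map_one, one_mul, mul_one]
    rfl
  have hK' : ∀ c : K, Δ' (algebraMap K A c) = 0 := hK
  let F : A →ₗ[K] A :=
    { Δ' with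
      map_smul' := fun c a => by
        change Δ' (c • a) = c • Δ' a
        rw [Algebra.smul_def, hmul', hK', zero_mul, add_zero, AlgHom.commutes, Algebra.smul_def] }
  have hF : ∀ a, F a = Δ' a := fun _ => rfl
  have he' : ∀ i, Δ' (W.e i) = 0 := he
  have hD' : Δ' W.D = -W.e 0 := hD
  refine ⟨W.μ.toLinearMap.comp F, fun u v => ?_, fun i => ?_, ?_⟩
  · simp only [LinearMap.comp_apply, AlgHom.toLinearMap_apply, hF, hmul', map_add, map_mul, μ_μ]
  · rw [LinearMap.comp_apply, hF, he', map_zero]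
  · rw [LinearMap.comp_apply, hF, hD', map_neg, AlgHom.toLinearMap_apply, μ_e]

/-- The chain map of degree four determined by a twisted derivation. -/
noncomputable def periodLift (F : A →ₗ[K] A) : ℕ → Env K A
  | 0 => bi K (W.e 0) (W.e 0)
  | 1 => -bi K (W.e 0) (W.e 0)
  | 2 => W.kernel F
  | k + 3 => W.twist (periodLift F k)

theorem E0_mul_kernel {F : A →ₗ[K] A} (hmul : ∀ u v, F (u * v) = u * F v + F u * W.μ v)
    (he : ∀ i, F (W.e i) = 0) : W.E0 * W.kernel F = W.kernel F := by
  refine W.contr_injective fun a => ?_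
  simp only [contr_E0_mul, contr_kernel, hmul, he, zero_mul, add_zero, ← mul_assoc, e_mul_self]
  exact (W.eq_sum_e_mul _).symm

theorem kernel_mul_E0 {F : A →ₗ[K] A} (hmul : ∀ u v, F (u * v) = u * F v + F u * W.μ v)
    (he : ∀ i, F (W.e i) = 0) : W.kernel F * W.E0 = W.kernel F := by
  refine W.contr_injective fun a => ?_
  simp only [contr_mul_E0, contr_kernel, hmul, he, mul_zero, zero_add, μ_e, mul_assoc, e_mul_self]
  exact (W.eq_sum_mul_e _).symm

theorem E0_mul_bi (u v : A) :
    W.E0 * bi K u v = ∑ i ∈ Finset.range n, bi K (W.e i * u) (v * W.e i) := by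
  rw [E0, Finset.sum_mul]
  simp only [bi_mul_bi]

theorem bi_mul_E0 (u v : A) :
    bi K u v * W.E0 = ∑ i ∈ Finset.range n, bi K (u * W.e i) (W.e i * v) := by
  rw [E0, Finset.mul_sum]
  simp only [bi_mul_bi]

theorem E0_mul_sub_mul_bi_e (i : ℕ) : W.E0 * ((W.dl - W.dr) * bi K (W.e i) (W.e i)) =
    bi K (W.e i) (W.e i) * ((W.dl - W.dr) * W.E0) := by
  rw [sub_mul, sub_mul, mul_sub, mul_sub, ← mul_assoc (bi K _ _), ← mul_assoc (bi K _ _), dl, dr,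
    bi_mul_bi, bi_mul_bi, bi_mul_bi, bi_mul_bi, E0_mul_bi, E0_mul_bi, bi_mul_E0, bi_mul_E0]
  simp only [one_mul, mul_one, e_mul_e]
  by_cases hi : i < n
  · congr 1 <;>
    · rw [Finset.sum_eq_single i, Finset.sum_eq_single i]
      · simp [e_mul_self, mul_assoc]
      · intro j _ hj
        simp [e_mul_e, hj, Ne.symm hj, bi_zero, zero_bi, mul_assoc]
      · intro hn
        exact absurd (Finset.mem_range.2 hi) hn
      · intro j _ hj
        simp [e_mul_e, hj, Ne.symm hj, bi_zero, zero_bi, mul_assoc]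
      · intro hn
        exact absurd (Finset.mem_range.2 hi) hn
  · rw [W.e_eq_zero (by omega)]
    simp [bi_zero, zero_bi]

/-- Under `contr`, the squares involving `ω` become the twisted Leibniz rule of `F` applied to `a *
D` and to `D * a`. The normalisation `F D = -e 0` matches them with the components `±e 0 ⊗ e 0`. -/
theorem isLift_period_lift {F : A →ₗ[K] A} (hmul : ∀ u v, F (u * v) = u * F v + F u * W.μ v)
    (he : ∀ i, F (W.e i) = 0) (hD : F W.D = -W.e 0) :
    W.resolution.IsLift 4 (W.periodLift F) where
  e_mul k := three_induction
    (p := fun k => W.idem (4 + k) * W.periodLift F k = W.periodLift F k)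
    (by
      change W.E1 * bi K (W.e 0) (W.e 0) = bi K (W.e 0) (W.e 0)
      rw [E1_mul_bi_e, if_pos (by unfold Nbr; omega)])
    (by
      change W.E0 * -bi K (W.e 0) (W.e 0) = -bi K (W.e 0) (W.e 0)
      rw [mul_neg, E0_mul_bi_e, if_pos rfl])
    (W.E0_mul_kernel hmul he)
    (fun k h => by
      change W.idem (4 + k) * W.twist (W.periodLift F k) = W.twist (W.periodLift F k)
      rw [← W.twist_idem (4 + k), ← map_mul, h]) k
  mul_e k := three_induction
    (p := fun k => W.periodLift F k * W.idem k = W.periodLift F k)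
    (by
      change bi K (W.e 0) (W.e 0) * W.E0 = bi K (W.e 0) (W.e 0)
      rw [bi_e_mul_E0, if_pos rfl])
    (by
      change -bi K (W.e 0) (W.e 0) * W.E1 = -bi K (W.e 0) (W.e 0)
      rw [neg_mul, bi_e_mul_E1, if_pos (by unfold Nbr; omega)])
    (W.kernel_mul_E0 hmul he)
    (fun k h => by
      change W.twist (W.periodLift F k) * W.idem k = W.twist (W.periodLift F k)
      rw [← W.twist_idem k, ← map_mul, h]) k
  comm k := three_induction
    (p := fun k => W.diff (4 + k) * W.periodLift F k = W.periodLift F (k + 1) * W.diff k)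
    (by
      change W.twist (W.E0 * (W.dl + W.dr)) * bi K (W.e 0) (W.e 0) =
        -bi K (W.e 0) (W.e 0) * ((W.dl - W.dr) * W.E0)
      rw [map_mul, twist_E0, map_add, twist_dl, twist_dr, neg_mul, ← E0_mul_sub_mul_bi_e,
        ← neg_sub W.dr W.dl, mul_assoc]
      rw [neg_mul, mul_neg, neg_neg, neg_add_eq_sub])
    (by
      change W.twist W.ω * -bi K (W.e 0) (W.e 0) = W.kernel F * (W.E0 * (W.dl + W.dr))
      rw [← mul_assoc, W.kernel_mul_E0 hmul he]
      refine W.contr_injective fun a => ?_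
      rw [mul_neg, map_neg, LinearMap.neg_apply, contr_mul_bi, contr_twist, contr_ω, μ_μ, mul_add,
        map_add, LinearMap.add_apply, contr_mul_dl, contr_mul_dr, contr_kernel, contr_kernel, hmul,
        hD, μ_D, mul_assoc, e_mul_self]
      simp)
    (by
      change W.twist (W.twist ((W.dl - W.dr) * W.E0)) * W.kernel F =
        W.twist (bi K (W.e 0) (W.e 0)) * W.ω
      rw [twist_twist, mul_assoc, W.E0_mul_kernel hmul he, twist_bi, μ_e]
      refine W.contr_injective fun a => ?_
      rw [contr_bi_mul, contr_ω, map_mul W.μ, μ_e, sub_mul, map_sub, LinearMap.sub_apply, contr_dl_mul,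
        contr_dr_mul, contr_kernel, contr_kernel, hmul, hD, ← mul_assoc, e_mul_self]
      simp)
    (fun k h => by
      change W.twist (W.diff (4 + k)) * W.twist (W.periodLift F k) =
        W.twist (W.periodLift F (k + 1)) * W.twist (W.diff k)
      rw [← map_mul, h, map_mul]) k

end WalkAlgebra

/-! ### The cohomology of the complex of cochains -/

namespace WalkAlgebra

variable {K : Type u} [Field K] {n : ℕ} {A : Type u} [Ring A] [Algebra K A]
  (W : WalkAlgebra K n A)

theorem env_smul_comm (s : Env K A) (c : K) (a : A) : s • c • a = c • s • a := by
  rw [← algebraMap_env_smul, ← algebraMap_env_smul, smul_smul, smul_smul, Algebra.commutes]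

/-- The action of an element of the enveloping algebra. -/
noncomputable def act (s : Env K A) : A →ₗ[K] A where
  toFun a := s • a
  map_add' := smul_add s
  map_smul' := env_smul_comm s

theorem act_apply (s : Env K A) (a : A) : act s a = s • a := rfl

/-- The image of a differential of the complex of cochains. -/
noncomputable def bdry (k : ℕ) : Submodule K A := LinearMap.range (act (W.diff k))

theorem smul_mem_bdry (k : ℕ) (g : A) : W.diff k • g ∈ W.bdry k := ⟨g, rfl⟩

theorem mem_bdry {k : ℕ} {f : A} : f ∈ W.bdry k ↔ ∃ g, f = W.diff k • g :=
  ⟨fun ⟨g, hg⟩ => ⟨g, hg.symm⟩, fun ⟨g, hg⟩ => ⟨g, hg.symm⟩⟩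

theorem diff_zero_smul (g : A) : W.diff 0 • g = W.D * (W.E0 • g) - (W.E0 • g) * W.D := by
  change ((W.dl - W.dr) * W.E0) • g = _
  rw [mul_smul, sub_smul, dl_smul, dr_smul]

theorem diff_one_smul (g : A) : W.diff 1 • g = W.E0 • (W.D * g + g * W.D) := by
  change (W.E0 * (W.dl + W.dr)) • g = _
  rw [mul_smul, add_smul, dl_smul, dr_smul]

theorem diff_three_smul (g : A) : W.diff 3 • g = -(W.D * (W.E0 • g) + (W.E0 • g) * W.D) := by
  change W.twist ((W.dl - W.dr) * W.E0) • g = _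
  rw [map_mul, map_sub, twist_dl, twist_dr, twist_E0, mul_smul, sub_smul, neg_smul, dl_smul,
    dr_smul, neg_add']

theorem diff_four_smul (g : A) : W.diff 4 • g = W.E0 • (g * W.D - W.D * g) := by
  change W.twist (W.E0 * (W.dl + W.dr)) • g = _
  rw [map_mul, map_add, twist_dl, twist_dr, twist_E0, mul_smul, add_smul, neg_smul, dl_smul,
    dr_smul, neg_add_eq_sub]

theorem bi_e_smul_B (i j d : ℕ) : bi K (W.e i) (W.e j) • W.B i j d = W.B i j d := by
  rw [bi_smul_eq, e_mul_B, if_pos rfl, B_mul_e, if_pos rfl]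

theorem E0_smul_B (i j d : ℕ) : W.E0 • W.B i j d = if i = j then W.B i j d else 0 := by
  rw [← bi_e_smul_B, ← mul_smul, E0_mul_bi_e]
  split_ifs
  · rfl
  · rw [zero_smul]

theorem E1_smul_B (i j d : ℕ) : W.E1 • W.B i j d = if Nbr i j then W.B i j d else 0 := by
  rw [← bi_e_smul_B, ← mul_smul, E1_mul_bi_e]
  split_ifs
  · rfl
  · rw [zero_smul]

theorem E0_smul_D_mul_B {i d : ℕ} (h : IsBasic n i (i + 1) d) :
    W.E0 • (W.D * W.B i (i + 1) d) = W.B (i + 1) (i + 1) (d + 1) := by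
  rw [W.D_mul_B h, smul_add, E0_smul_B (i := i + 1), if_pos rfl]
  split_ifs with hi
  · rw [E0_smul_B, if_neg (by omega), zero_add]
  · rw [env_smul_comm, E0_smul_B, if_neg (by omega), smul_zero, zero_add]

theorem E0_smul_B_mul_D {i d : ℕ} (h : IsBasic n i (i + 1) d) :
    W.E0 • (W.B i (i + 1) d * W.D) = W.B i i (d + 1) := by
  rw [W.B_mul_D h, smul_add, env_smul_comm, E0_smul_B (j := i + 1 + 1),
    if_neg (show i ≠ i + 1 + 1 by omega), smul_zero, add_zero, if_neg (Nat.succ_ne_zero i), Nat.add_sub_cancel, E0_smul_B, if_pos rfl]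

theorem E0_smul_D_mul_B_zero {d : ℕ} (h : IsBasic n 0 0 d) :
    W.E0 • (W.D * W.B 0 0 d) = W.B 0 0 (d + 1) := by
  rw [W.D_mul_B h, smul_add, E0_smul_B (i := 0 + 1), if_neg (Nat.succ_ne_zero 0), if_pos rfl,
    E0_smul_B, if_pos rfl, add_zero]

theorem E0_smul_B_mul_D_zero {d : ℕ} (h : IsBasic n 0 0 d) :
    W.E0 • (W.B 0 0 d * W.D) = W.B 0 0 (d + 1) := by
  rw [W.B_mul_D h, smul_add, env_smul_comm, E0_smul_B (j := 0 + 1), if_neg (Nat.succ_ne_zero 0).symm,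
    if_pos rfl, E0_smul_B, if_pos rfl, smul_zero, add_zero]

/-- At the loop the anticommutator yields twice the element, which is where `2` must be invertible.
Each edge then passes the property on to the next vertex. -/
theorem B_succ_mem_bdry_one (h2 : (2 : K) ≠ 0) (i d : ℕ) : W.B i i (d + 1) ∈ W.bdry 1 := by
  induction i with
  | zero =>
    by_cases h : IsBasic n 0 0 (d + 1)
    · have h' : IsBasic n 0 0 d := by unfold IsBasic at *; omega
      have := W.smul_mem_bdry 1 (W.B 0 0 d)
      rw [diff_one_smul, smul_add, W.E0_smul_D_mul_B_zero h', W.E0_smul_B_mul_D_zero h',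
        ← two_smul K] at this
      exact ((W.bdry 1).smul_mem_iff h2).1 this
    · rw [W.B_eq_zero _ _ _ h]
      exact zero_mem _
  | succ i ih =>
    by_cases h : IsBasic n (i + 1) (i + 1) (d + 1)
    · have h' : IsBasic n i (i + 1) d := by unfold IsBasic at *; omega
      have := W.smul_mem_bdry 1 (W.B i (i + 1) d)
      rw [diff_one_smul, smul_add, W.E0_smul_D_mul_B h', W.E0_smul_B_mul_D h'] at this
      exact ((W.bdry 1).add_mem_iff_left ih).1 this
    · rw [W.B_eq_zero _ _ _ h]
      exact zero_mem _

theorem B_sub_B_mem_bdry_four {i d : ℕ} (h : IsBasic n i (i + 1) d) :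
    W.B i i (d + 1) - W.B (i + 1) (i + 1) (d + 1) ∈ W.bdry 4 := by
  have := W.smul_mem_bdry 4 (W.B i (i + 1) d)
  rwa [diff_four_smul, smul_sub, W.E0_smul_D_mul_B h, W.E0_smul_B_mul_D h] at this

/-- Neighbouring vertices give the same class, and elements of even length vanish at vertices close
enough to the end of the line. -/
theorem B_even_mem_bdry_four (i m : ℕ) : W.B i i (2 * m + 2) ∈ W.bdry 4 := by
  have key : ∀ k i, n ≤ i + k → W.B i i (2 * m + 2) ∈ W.bdry 4 := by
    intro k
    induction k with
    | zero =>
      intro i hi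
      rw [W.B_eq_zero i i _ fun h => absurd h.1 (by omega)]
      exact zero_mem _
    | succ k ih =>
      intro i hi
      by_cases h : IsBasic n i i (2 * m + 2)
      · have h' : IsBasic n i (i + 1) (2 * m + 1) := by unfold IsBasic at *; omega
        exact ((W.bdry 4).sub_mem_iff_left (ih (i + 1) (by omega))).1 (W.B_sub_B_mem_bdry_four h')
      · rw [W.B_eq_zero _ _ _ h]
        exact zero_mem _
  exact key n i (by omega)

/-- Odd elements are moved down to the loop instead: basicness persists towards smaller vertices. -/
theorem B_odd_sub_mem_bdry_four (i m : ℕ) (h : IsBasic n i i (2 * m + 1)) :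
    W.B i i (2 * m + 1) - W.B 0 0 (2 * m + 1) ∈ W.bdry 4 := by
  induction i with
  | zero => rw [sub_self]; exact zero_mem _
  | succ i ih =>
    have h' : IsBasic n i (i + 1) (2 * m) := by unfold IsBasic at *; omega
    have h1 := ih (by unfold IsBasic at *; omega)
    have := (W.bdry 4).sub_mem h1 (W.B_sub_B_mem_bdry_four h')
    rwa [sub_sub_sub_cancel_left] at this

theorem diff_smul_idem_smul (k : ℕ) (g : A) : W.diff k • g = W.diff k • W.idem k • g := by
  rw [smul_smul, diff_mul_idem]

/-- A property of the elements of `E0 • A`. -/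
theorem E0_induction {p : A → Prop} (h0 : p 0) (hadd : ∀ a b, p a → p b → p (a + b))
    (hsmul : ∀ (c : K) a, p a → p (c • a)) (hB : ∀ i d, IsBasic n i i d → p (W.B i i d))
    {f : A} (hf : W.E0 • f = f) : p f := by
  rw [← hf]
  clear hf
  induction f using W.induction with
  | hB i j d h =>
    rw [E0_smul_B]
    split_ifs with hij
    · subst hij; exact hB i d h
    · exact h0
  | h0 => rwa [smul_zero]
  | hadd a b ha hb => rw [smul_add]; exact hadd _ _ ha hb
  | hsmul c a ha => rw [env_smul_comm]; exact hsmul _ _ ha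

theorem E1_induction {p : A → Prop} (h0 : p 0) (hadd : ∀ a b, p a → p b → p (a + b))
    (hsmul : ∀ (c : K) a, p a → p (c • a))
    (hB : ∀ i j d, Nbr i j → IsBasic n i j d → p (W.B i j d))
    {f : A} (hf : W.E1 • f = f) : p f := by
  rw [← hf]
  clear hf
  induction f using W.induction with
  | hB i j d h =>
    rw [E1_smul_B]
    split_ifs with hij
    · exact hB i j d hij h
    · exact h0
  | h0 => rwa [smul_zero]
  | hadd a b ha hb => rw [smul_add]; exact hadd _ _ ha hb
  | hsmul c a ha => rw [env_smul_comm]; exact hsmul _ _ ha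

theorem E0_smul_E0_smul (g : A) : W.E0 • W.E0 • g = W.E0 • g := by rw [smul_smul, E0_mul_E0]

/-- The coefficients are signed counts of basic walks, and complementary lengths cancel. -/
theorem diff_two_smul (g : A) : W.diff 2 • g = 0 := by
  rw [diff_smul_idem_smul]
  refine W.E0_induction (p := fun a => W.diff 2 • a = 0) (smul_zero _)
    (fun a b ha hb => by rw [smul_add, ha, hb, add_zero])
    (fun c a ha => by rw [env_smul_comm, ha, smul_zero]) (fun i d h => ?_) (W.E0_smul_E0_smul g)
  refine (W.kernel_scale_smul_B (fun d => (-1) ^ d) h).trans ?_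
  split_ifs with hd
  · refine Finset.sum_eq_zero fun l hl => ?_
    rw [sum_isBasic_sign (Finset.mem_range.1 hl) h.1, zero_smul]
  · rfl

/-- The twist removes the signs from `ω`, so here walks are counted without cancellation, in
contrast to `diff_two_smul`. -/
theorem diff_five_smul_B {i d : ℕ} (h : IsBasic n i i d) : W.diff 5 • W.B i i d =
    if d = 0 then ∑ l ∈ Finset.range n, (2 * ((n : K) - max l i)) • W.soc l else 0 := by
  change W.twist W.ω • W.B i i d = _
  rw [twist_ω, W.kernel_scale_smul_B _ h]
  refine if_congr Iff.rfl (Finset.sum_congr rfl fun l hl => ?_) rfl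
  rw [sum_isBasic_one (Finset.mem_range.1 hl) h.1]

theorem τ_mul_E0_smul (f a : A) : W.τ (f * W.E0 • a) = W.τ ((W.E0 • f) * a) := by
  rw [E0_smul, E0_smul, Finset.mul_sum, Finset.sum_mul, map_sum, map_sum]
  refine Finset.sum_congr rfl fun i _ => ?_
  rw [← mul_assoc, W.τ_mul_comm, ← mul_assoc, ← mul_assoc]

theorem τ_E0_smul_mul (f a : A) : W.τ ((W.E0 • f) * a) = W.τ (f * W.E0 • a) :=
  (W.τ_mul_E0_smul f a).symm

theorem τ_D_mul_mul (f a : A) : W.τ (W.D * f * a) = W.τ (f * (a * W.D)) := by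
  rw [mul_assoc, W.τ_mul_comm, mul_assoc]

theorem τ_soc_mul_B (i j d : ℕ) (h : d ≠ 0) : W.τ (W.soc i * W.B j j d) = 0 := by
  rw [soc_mul_B, if_neg (by omega), map_zero]

theorem τ_soc {i : ℕ} (h : i < n) : W.τ (W.soc i) = 1 := by
  rw [soc, τ_B, if_pos ⟨rfl, by omega, h⟩]

/-- Representatives of a basis of the cohomology in the degree `r`. -/
noncomputable def rep : ℕ → ℕ → A
  | 0, m => W.xpow m
  | 1, m => W.D * W.xpow m
  | 2, m => W.e m
  | 3, m => W.soc m
  | 4, m => W.e 0 * W.xpow m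
  | 5, m => W.B 0 0 1 * W.xpow m
  | r + 6, m => rep r m

/-- The dual basis of the basis of the cohomology in the degree `r`. -/
noncomputable def test : ℕ → ℕ → A
  | 0, m => W.B 0 0 (2 * (n - 1 - m) + 1)
  | 1, m => W.B 0 0 (2 * (n - 1 - m))
  | 2, m => W.soc m
  | 3, m => W.e m
  | 4, m => W.xpow (n - 1 - m) * W.D
  | 5, m => W.xpow (n - 1 - m)
  | r + 6, m => test r m

/-- An induction with the period six. -/
theorem six_induction {p : ℕ → Prop} (h0 : p 0) (h1 : p 1) (h2 : p 2) (h3 : p 3) (h4 : p 4)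
    (h5 : p 5) (h6 : ∀ k, p k → p (k + 6)) (k : ℕ) : p k := by
  induction k using Nat.strong_induction_on with
  | _ k ih =>
    match k, ih with
    | 0, _ => exact h0
    | 1, _ => exact h1
    | 2, _ => exact h2
    | 3, _ => exact h3
    | 4, _ => exact h4
    | 5, _ => exact h5
    | k + 6, ih => exact h6 k (ih k (by omega))

theorem B_zero_mul_xpow (hn : 0 < n) (d m : ℕ) : W.B 0 0 d * W.xpow m = W.B 0 0 (2 * m + d) := by
  by_cases h : IsBasic n 0 0 d
  · exact W.B_mul_xpow m h
  · rw [W.B_eq_zero _ _ _ h, zero_mul, W.B_of_two_mul_le]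
    unfold IsBasic at h
    omega

theorem e_zero_mul_xpow (hn : 0 < n) (m : ℕ) : W.e 0 * W.xpow m = W.B 0 0 (2 * m) := by
  rw [e, W.B_zero_mul_xpow hn, add_zero]

theorem τ_D_mul_B_zero (hn : 0 < n) (d : ℕ) : W.τ (W.D * W.B 0 0 d) =
    if d + 2 = 2 * n then 1 else 0 := by
  by_cases h : IsBasic n 0 0 d
  · rw [W.D_mul_B h, if_pos rfl, map_add, W.τ_B 0 0, W.τ_B (0 + 1),
      if_neg (fun h : 0 + 1 = 0 ∧ _ => Nat.succ_ne_zero 0 h.1), add_zero]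
    exact if_congr (by omega) rfl rfl
  · rw [W.B_eq_zero _ _ _ h, mul_zero, map_zero, if_neg]
    unfold IsBasic at h
    omega

theorem τ_xpow_mul_D_mul (hn : 0 < n) (m d : ℕ) : W.τ (W.D * W.xpow m * W.B 0 0 d) =
    if 2 * m + d + 2 = 2 * n then 1 else 0 := by
  rw [mul_assoc, xpow_mul, W.B_zero_mul_xpow hn, W.τ_D_mul_B_zero hn]

theorem τ_rep_mul_test (hn : 0 < n) (r : ℕ) : ∀ {m m' : ℕ}, m < n → m' < n →
    W.τ (W.rep r m * W.test r m') = if m = m' then 1 else 0 := by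
  refine six_induction (p := fun r => ∀ {m m' : ℕ}, m < n → m' < n →
    W.τ (W.rep r m * W.test r m') = if m = m' then 1 else 0) ?_ ?_ ?_ ?_ ?_ ?_ (fun _ h => h) r
  · intro m m' h h'
    change W.τ (W.xpow m * W.B 0 0 (2 * (n - 1 - m') + 1)) = _
    rw [xpow_mul, W.B_zero_mul_xpow hn, τ_B]
    exact if_congr (by omega) rfl rfl
  · intro m m' h h'
    change W.τ (W.D * W.xpow m * W.B 0 0 (2 * (n - 1 - m'))) = _
    rw [W.τ_xpow_mul_D_mul hn]
    exact if_congr (by omega) rfl rfl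
  · intro m m' h h'
    change W.τ (W.e m * W.soc m') = _
    rw [← soc_mul, soc_mul_e]
    by_cases hm : m = m'
    · rw [if_pos hm.symm, if_pos hm, W.τ_soc h']
    · rw [if_neg (Ne.symm hm), if_neg hm, map_zero]
  · intro m m' h h'
    change W.τ (W.soc m * W.e m') = _
    rw [soc_mul_e]
    split_ifs
    · exact W.τ_soc h
    · exact map_zero _
  · intro m m' h h'
    change W.τ (W.e 0 * W.xpow m * (W.xpow (n - 1 - m') * W.D)) = _
    rw [W.e_zero_mul_xpow hn, ← mul_assoc, W.B_zero_mul_xpow hn, W.τ_mul_comm, W.τ_D_mul_B_zero hn]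
    exact if_congr (by omega) rfl rfl
  · intro m m' h h'
    change W.τ (W.B 0 0 1 * W.xpow m * W.xpow (n - 1 - m')) = _
    rw [W.B_zero_mul_xpow hn, W.B_zero_mul_xpow hn, τ_B]
    exact if_congr (by omega) rfl rfl

/-- Moving the differential across `τ` turns a commutator into a commutator and an anticommutator
into an anticommutator, up to sign, and `test` is killed by the result. Together with
`τ_rep_mul_test` this makes the representatives independent modulo coboundaries. -/
theorem τ_bdry_mul_test (hn : 0 < n) (r : ℕ) : ∀ {m : ℕ} {f : A}, f ∈ W.bdry r →
    W.τ (f * W.test (r + 1) m) = 0 := by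
  refine six_induction (p := fun r => ∀ {m : ℕ} {f : A}, f ∈ W.bdry r →
    W.τ (f * W.test (r + 1) m) = 0) ?_ ?_ ?_ ?_ ?_ ?_ (fun k h m f hf => ?_) r
  · rintro m f hf
    obtain ⟨g, rfl⟩ := W.mem_bdry.1 hf
    change W.τ (_ * W.B 0 0 (2 * (n - 1 - m))) = 0
    have hb : IsBasic n 0 0 (2 * (n - 1 - m)) := by unfold IsBasic; omega
    rw [diff_zero_smul, sub_mul, map_sub, τ_D_mul_mul, mul_assoc, τ_E0_smul_mul, τ_E0_smul_mul,
      W.E0_smul_D_mul_B_zero hb, W.E0_smul_B_mul_D_zero hb, sub_self]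
  · rintro m f hf
    obtain ⟨g, rfl⟩ := W.mem_bdry.1 hf
    change W.τ (_ * W.soc m) = 0
    rw [diff_one_smul, τ_E0_smul_mul, soc, E0_smul_B, if_pos rfl, add_mul, map_add, τ_D_mul_mul,
      mul_assoc]
    change W.τ (g * (W.soc m * W.D)) + W.τ (g * (W.D * W.soc m)) = 0
    rw [W.soc_mul_D hn, W.D_mul_soc hn, mul_zero, map_zero, add_zero]
  · rintro m f hf
    obtain ⟨g, rfl⟩ := W.mem_bdry.1 hf
    rw [diff_two_smul, zero_mul, map_zero]
  · rintro m f hf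
    obtain ⟨g, rfl⟩ := W.mem_bdry.1 hf
    change W.τ (_ * (W.xpow (n - 1 - m) * W.D)) = 0
    have h0 : W.E0 • (W.D * W.D) = 0 := by
      rw [E0_smul]
      exact Finset.sum_eq_zero fun i _ => W.e_mul_D_mul_D_mul_e i
    have h1 : W.E0 • (W.xpow (n - 1 - m) * (W.D * W.D)) = 0 := by
      rw [E0_smul] at h0 ⊢
      rw [← mul_zero (W.xpow (n - 1 - m)), ← h0, Finset.mul_sum]
      refine Finset.sum_congr rfl fun i _ => ?_
      rw [← mul_assoc (W.e i), ← xpow_mul, mul_assoc, mul_assoc, ← mul_assoc (W.e i)]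
    rw [diff_three_smul, neg_mul, map_neg, add_mul, map_add, τ_D_mul_mul, mul_assoc, mul_assoc,
      ← mul_assoc W.D, ← xpow_mul, mul_assoc, τ_E0_smul_mul, h1, mul_zero, map_zero, add_zero,
      neg_zero]
  · rintro m f hf
    obtain ⟨g, rfl⟩ := W.mem_bdry.1 hf
    change W.τ (_ * W.xpow (n - 1 - m)) = 0
    have h1 : W.E0 • W.xpow (n - 1 - m) = W.xpow (n - 1 - m) := by
      rw [E0_smul]
      conv_rhs => rw [W.eq_sum_e_mul (W.xpow (n - 1 - m))]
      refine Finset.sum_congr rfl fun i _ => ?_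
      rw [mul_assoc, xpow_mul, ← mul_assoc, e_mul_self]
    rw [diff_four_smul, τ_E0_smul_mul, h1, sub_mul, map_sub, τ_D_mul_mul, mul_assoc, xpow_mul,
      sub_self]
  · rintro m f hf
    obtain ⟨g, rfl⟩ := W.mem_bdry.1 hf
    change W.τ (_ * W.B 0 0 (2 * (n - 1 - m) + 1)) = 0
    rw [diff_smul_idem_smul]
    refine W.E0_induction (p := fun a => W.τ (W.diff 5 • a * W.B 0 0 (2 * (n - 1 - m) + 1)) = 0)
      (by rw [smul_zero, zero_mul, map_zero])
      (fun a b ha hb => by rw [smul_add, add_mul, map_add, ha, hb, add_zero])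
      (fun c a ha => by rw [env_smul_comm, smul_mul_assoc, map_smul, ha, smul_zero])
      (fun i d h => ?_) (W.E0_smul_E0_smul g)
    rw [W.diff_five_smul_B h]
    split_ifs
    · rw [Finset.sum_mul, map_sum]
      refine Finset.sum_eq_zero fun l _ => ?_
      rw [smul_mul_assoc, map_smul, W.τ_soc_mul_B _ _ _ (by omega), smul_zero]
    · rw [zero_mul, map_zero]
  · refine h ?_
    rw [mem_bdry] at hf ⊢
    rwa [diff_add_six] at hf

end WalkAlgebra

/-! ### Spanning sets of the cohomology -/

theorem eq_zero_of_max_system {K : Type*} [Field K] {n : ℕ} {c : ℕ → K}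
    (h : ∀ l < n, ∑ i ∈ Finset.range n, c i * ((n : K) - max l i) = 0) : ∀ i < n, c i = 0 := by
  have h' : ∀ l ≤ n, ∑ i ∈ Finset.range n, c i * ((n : K) - (max l i : ℕ)) = 0 := by
    intro l hl
    rcases hl.lt_or_eq with hl | rfl
    · simpa using h l hl
    · refine Finset.sum_eq_zero fun i hi => ?_
      rw [max_eq_left (Finset.mem_range.1 hi).le, sub_self, mul_zero]
  -- The difference of rows `l` and `l + 1` is the partial sum of `c` up to `l`. The row for `l = n`
  -- is added because it holds trivially and supplies the last difference.
  have hp : ∀ l ≤ n, ∑ i ∈ Finset.range l, c i = 0 := by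
    intro l hl
    cases l with
    | zero => simp
    | succ l =>
      have h1 : ∑ i ∈ Finset.range n, (if i ∈ Finset.range (l + 1) then c i else 0) = 0 := by
        have h0 := sub_eq_zero_of_eq ((h' l (by omega)).trans (h' (l + 1) hl).symm)
        rw [← Finset.sum_sub_distrib] at h0
        refine Eq.trans (Finset.sum_congr rfl fun i _ => ?_) h0
        split_ifs with hi <;> rw [Finset.mem_range] at hi
        · rw [max_eq_left (show i ≤ l by omega), max_eq_left (show i ≤ l + 1 by omega)]
          push_cast
          ring
        · rw [max_eq_right (show l ≤ i by omega), max_eq_right (show l + 1 ≤ i by omega), sub_self]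
      rwa [← Finset.sum_filter, Finset.filter_mem_eq_inter, Finset.inter_eq_right.2] at h1
      exact Finset.range_subset_range.2 hl
  intro i hi
  have := hp (i + 1) hi
  rwa [Finset.sum_range_succ, hp i hi.le, zero_add] at this

namespace WalkAlgebra

variable {K : Type u} [Field K] {n : ℕ} {A : Type u} [Ring A] [Algebra K A]
  (W : WalkAlgebra K n A)

/-- The cocycles of degree `k`. -/
noncomputable def cocyc (k : ℕ) : Submodule K A where
  carrier := {f | W.idem k • f = f ∧ W.diff k • f = 0}
  add_mem' := fun ha hb => ⟨by rw [smul_add, ha.1, hb.1], by rw [smul_add, ha.2, hb.2, add_zero]⟩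
  zero_mem' := ⟨smul_zero _, smul_zero _⟩
  smul_mem' := fun c a ha =>
    ⟨by rw [env_smul_comm, ha.1], by rw [env_smul_comm, ha.2, smul_zero]⟩

theorem bdry_le_cocyc (k : ℕ) : W.bdry k ≤ W.cocyc (k + 1) := by
  rintro _ ⟨g, rfl⟩
  exact ⟨by rw [act_apply, smul_smul, idem_mul_diff],
    by rw [act_apply, smul_smul, diff_mul_diff, zero_smul]⟩

theorem mem_cocyc_of_isLift {j : ℕ} {G : ℕ → Env K A} (hG : W.resolution.IsLift j G) :
    G 0 • (1 : A) ∈ W.cocyc j := by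
  have h1 : W.idem (j + 0) * G 0 = G 0 := hG.e_mul 0
  have h2 : W.diff (j + 0) * G 0 = G (0 + 1) * W.diff 0 := hG.comm 0
  exact ⟨by rw [smul_smul]; exact congrArg (· • (1 : A)) h1,
    by
      rw [smul_smul]
      refine (congrArg (· • (1 : A)) h2).trans ?_
      rw [mul_smul, diff_zero_smul_one, smul_zero]⟩

theorem smul_mul_central (s : Env K A) {c : A} (hc : ∀ a, c * a = a * c) (f : A) :
    s • (f * c) = (s • f) * c := by
  induction s using env_induction with
  | h0 => rw [zero_smul, zero_smul, zero_mul]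
  | h1 u v => rw [bi_smul_eq, bi_smul_eq, ← mul_assoc, mul_assoc (u * f), hc, ← mul_assoc]
  | h2 s t hs ht => rw [add_smul, add_smul, hs, ht, add_mul]

theorem mul_central_mem_cocyc {k : ℕ} {f c : A} (hf : f ∈ W.cocyc k) (hc : ∀ a, c * a = a * c) :
    f * c ∈ W.cocyc k :=
  ⟨by rw [smul_mul_central _ hc, hf.1], by rw [smul_mul_central _ hc, hf.2, zero_mul]⟩

theorem central_mem_cocyc {c : A} (hc : ∀ a, c * a = a * c) : c ∈ W.cocyc 0 := by
  have h := W.mem_cocyc_of_isLift (W.isLift_central hc)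
  have h1 : (bi K c 1 * W.idem 0) • (1 : A) = c := by
    change (bi K c 1 * W.E0) • (1 : A) = c
    rw [mul_smul, E0_smul_one, bi_smul_eq, mul_one, mul_one]
  rwa [h1] at h

theorem soc_mem_cocyc (i : ℕ) : W.soc i ∈ W.cocyc 3 := by
  have h := W.mem_cocyc_of_isLift (W.isLift_soc i)
  have h1 : (bi K (W.soc i) 1 * W.idem 0) • (1 : A) = W.soc i := by
    change (bi K (W.soc i) 1 * W.E0) • (1 : A) = W.soc i
    rw [mul_smul, E0_smul_one, bi_smul_eq, mul_one, mul_one]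
  rwa [h1] at h

theorem eulerLift_zero_smul (c : A) (hc : ∀ a, c * a = a * c) :
    W.eulerLift 0 • c = W.D * c := by
  have h : W.eulerLift 0 = W.dl * W.E0 := by
    rw [eulerLift, pow_zero, one_smul]
    change W.leftEuler ((W.dl - W.dr) * W.E0) = _
    rw [leftEuler_mul, map_sub, leftEuler_dl, leftEuler_dr, leftEuler_E0, mul_zero, add_zero,
      sub_zero]
  rw [h, mul_smul, (W.central_mem_cocyc hc).1.symm]
  change W.dl • W.E0 • W.E0 • c = W.D * (W.E0 • c)
  rw [E0_smul_E0_smul, dl_smul]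

theorem eulerLift_zero_smul_one : W.eulerLift 0 • (1 : A) = W.D := by
  rw [W.eulerLift_zero_smul 1 (fun a => by rw [one_mul, mul_one]), mul_one]

theorem D_mem_cocyc : W.D ∈ W.cocyc 1 := by
  rw [← W.eulerLift_zero_smul_one]
  exact W.mem_cocyc_of_isLift W.isLift_euler

theorem e_mem_cocyc_two (i : ℕ) : W.e i ∈ W.cocyc 2 :=
  ⟨by change W.E0 • W.B i i 0 = _; rw [E0_smul_B, if_pos rfl]; rfl, W.diff_two_smul _⟩

theorem e_zero_mem_cocyc : W.e 0 ∈ W.cocyc 4 := by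
  obtain ⟨F, hmul, he, hD⟩ := W.exists_twisted_derivation
  have h := W.mem_cocyc_of_isLift (W.isLift_period_lift hmul he hD)
  have h1 : W.periodLift F 0 • (1 : A) = W.e 0 := by
    change bi K (W.e 0) (W.e 0) • (1 : A) = W.e 0
    rw [bi_smul_eq, mul_one, e_mul_self]
  rwa [h1] at h

theorem B_loop_mem_cocyc : W.B 0 0 1 ∈ W.cocyc 5 := by
  refine ⟨by change W.E0 • W.B 0 0 1 = _; rw [E0_smul_B, if_pos rfl], ?_⟩
  by_cases h : IsBasic n 0 0 1
  · rw [W.diff_five_smul_B h, if_neg one_ne_zero]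
  · rw [W.B_eq_zero _ _ _ h, smul_zero]

theorem rep_mem_cocyc (r m : ℕ) : W.rep r m ∈ W.cocyc r := by
  refine six_induction (p := fun r => W.rep r m ∈ W.cocyc r) ?_ ?_ ?_ ?_ ?_ ?_ (fun k h => ?_) r
  · exact W.central_mem_cocyc (W.xpow_mul m)
  · exact W.mul_central_mem_cocyc W.D_mem_cocyc (W.xpow_mul m)
  · exact W.e_mem_cocyc_two m
  · exact W.soc_mem_cocyc m
  · exact W.mul_central_mem_cocyc W.e_zero_mem_cocyc (W.xpow_mul m)
  · exact W.mul_central_mem_cocyc W.B_loop_mem_cocyc (W.xpow_mul m)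
  · refine ⟨h.1, ?_⟩
    rw [diff_add_six]
    exact h.2

/-- The span of the representatives of the cohomology in the degree `r`. -/
noncomputable def repSpan (r : ℕ) : Submodule K A :=
  Submodule.span K (Set.range fun m : Fin n => W.rep r m)

theorem rep_mem_repSpan (r : ℕ) {m : ℕ} (h : m < n) : W.rep r m ∈ W.repSpan r :=
  Submodule.subset_span ⟨⟨m, h⟩, rfl⟩

theorem repSpan_le_cocyc (r : ℕ) : W.repSpan r ≤ W.cocyc r := by
  refine Submodule.span_le.2 ?_
  rintro _ ⟨m, rfl⟩
  exact W.rep_mem_cocyc r m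

theorem τ_sub_sum_rep_mul_test (hn : 0 < n) (r : ℕ) (f : A) {m : ℕ} (hm : m < n) :
    W.τ ((f - ∑ k : Fin n, W.τ (f * W.test r k) • W.rep r k) * W.test r m) = 0 := by
  rw [sub_mul, map_sub, Finset.sum_mul, map_sum, sub_eq_zero]
  rw [Finset.sum_eq_single (⟨m, hm⟩ : Fin n)]
  · rw [smul_mul_assoc, map_smul, W.τ_rep_mul_test hn r hm hm, if_pos rfl, smul_eq_mul, mul_one]
  · intro k _ hk
    rw [smul_mul_assoc, map_smul, W.τ_rep_mul_test hn r k.2 hm, if_neg, smul_zero]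
    exact fun h => hk (Fin.ext h)
  · intro h
    exact absurd (Finset.mem_univ _) h

theorem sum_rep_mem_repSpan (r : ℕ) (c : Fin n → K) : ∑ k : Fin n, c k • W.rep r k ∈ W.repSpan r :=
  Submodule.sum_mem _ fun k _ => Submodule.smul_mem _ _ (W.rep_mem_repSpan r k.2)

theorem cocyc_two_le (h2 : (2 : K) ≠ 0) : W.cocyc 2 ≤ W.bdry 1 ⊔ W.repSpan 2 := by
  intro f hf
  refine W.E0_induction (p := (· ∈ W.bdry 1 ⊔ W.repSpan 2)) (zero_mem _)
    (fun a b => add_mem) (fun c a => Submodule.smul_mem _ c) (fun i d h => ?_) hf.1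
  cases d with
  | zero => exact Submodule.mem_sup_right (W.rep_mem_repSpan 2 h.1)
  | succ d => exact Submodule.mem_sup_left (W.B_succ_mem_bdry_one h2 i d)

/-- In the expansion by the dual basis only the pairings with vertices survive, and the duals of
vertices are socle elements. -/
theorem mem_repSpan_three {f : A} (he : W.E0 • f = f)
    (h : ∀ i d, IsBasic n i i d → d ≠ 0 → W.τ (f * W.B i i d) = 0) : f ∈ W.repSpan 3 := by
  rw [← W.sum_τ_smul_bd f]
  refine Submodule.sum_mem _ ?_
  rintro ⟨i, j, d⟩ ht
  have hb := mem_idx.1 ht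
  dsimp only at hb
  by_cases hij : i = j
  · subst hij
    by_cases hd : d = 0
    · subst hd
      exact Submodule.smul_mem _ _ (W.rep_mem_repSpan 3 hb.1)
    · rw [b, h i d hb hd, zero_smul]
      exact zero_mem _
  · rw [b, ← he, τ_E0_smul_mul, E0_smul_B, if_neg hij, mul_zero, map_zero, zero_smul]
    exact zero_mem _

/-- Up to sign `diff 3` is adjoint to `diff 1` for `τ`, so such a cocycle is orthogonal to all
closed walks of positive length. -/
theorem cocyc_three_le (h2 : (2 : K) ≠ 0) : W.cocyc 3 ≤ W.repSpan 3 := by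
  intro f hf
  have he : W.E0 • f = f := hf.1
  refine W.mem_repSpan_three he fun i d h hd => ?_
  obtain ⟨d, rfl⟩ := Nat.exists_eq_succ_of_ne_zero hd
  obtain ⟨g, hg⟩ := W.mem_bdry.1 (W.B_succ_mem_bdry_one h2 i d)
  have h0 : W.diff 3 • f = 0 := hf.2
  rw [diff_three_smul, he, neg_eq_zero] at h0
  rw [hg, diff_one_smul, τ_mul_E0_smul, he, mul_add, map_add, ← mul_assoc, ← mul_assoc f g,
    W.τ_mul_comm (f * g), ← mul_assoc, ← map_add, ← add_mul, add_comm, h0, zero_mul, map_zero]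

theorem τ_mul_bdry_four {f a : A} (hf : f ∈ W.cocyc 0) (ha : a ∈ W.bdry 4) : W.τ (f * a) = 0 := by
  obtain ⟨g, rfl⟩ := W.mem_bdry.1 ha
  have he : W.E0 • f = f := hf.1
  have h0 : W.diff 0 • f = 0 := hf.2
  rw [diff_zero_smul, he, sub_eq_zero] at h0
  rw [diff_four_smul, τ_mul_E0_smul, he, mul_sub, map_sub, ← mul_assoc, ← mul_assoc,
    W.τ_mul_comm (f * g), ← mul_assoc, h0, sub_self]

/-- Central elements are orthogonal to the image of `diff 4`, so they are determined modulo the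
socle by their pairings with odd powers of the loop. Subtracting the matching combination of the
`xpow m` leaves a socle element. -/
theorem cocyc_zero_le (hn : 0 < n) : W.cocyc 0 ≤ W.repSpan 3 ⊔ W.repSpan 0 := by
  intro f hf
  have h1 := W.sum_rep_mem_repSpan 0 fun m => W.τ (f * W.test 0 m)
  have h2 := sub_mem hf (W.repSpan_le_cocyc 0 h1)
  have h3 := fun m => W.τ_sub_sum_rep_mul_test hn 0 f (m := m)
  rw [← sub_add_cancel f (∑ k : Fin n, W.τ (f * W.test 0 k) • W.rep 0 k)]
  refine Submodule.add_mem_sup ?_ h1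
  generalize f - ∑ k : Fin n, W.τ (f * W.test 0 k) • W.rep 0 k = f' at h2 h3 ⊢
  refine W.mem_repSpan_three h2.1 fun i d h hd => ?_
  rcases Nat.even_or_odd' d with ⟨m, rfl | rfl⟩
  · obtain ⟨m, rfl⟩ := Nat.exists_eq_succ_of_ne_zero (show m ≠ 0 by omega)
    exact W.τ_mul_bdry_four h2 (W.B_even_mem_bdry_four i m)
  · have hlt := h.lt
    have h4 := W.τ_mul_bdry_four h2 (W.B_odd_sub_mem_bdry_four i m h)
    have h5 := h3 (n - 1 - m) (by omega)
    rw [mul_sub, map_sub, sub_eq_zero] at h4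
    rw [h4]
    change W.τ (f' * W.B 0 0 (2 * (n - 1 - (n - 1 - m)) + 1)) = 0 at h5
    rwa [show n - 1 - (n - 1 - m) = m by omega] at h5

/-- The coboundaries of vertices have coefficients `2 * (n - max l i)`. After division by `2`,
consecutive ones differ by a partial sum of the socle; for the last vertex the next one is taken to
be zero. -/
theorem sum_soc_mem_bdry_five (h2 : (2 : K) ≠ 0) {i : ℕ} (hi : i < n) :
    ∑ l ∈ Finset.range (i + 1), W.soc l ∈ W.bdry 5 := by
  have hv : ∀ i ≤ n, ∑ l ∈ Finset.range n, ((n : K) - (max l i : ℕ)) • W.soc l ∈ W.bdry 5 := by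
    intro i hi
    rcases hi.lt_or_eq with hi | rfl
    · have := W.smul_mem_bdry 5 (W.B i i 0)
      rw [W.diff_five_smul_B (isBasic_zero.2 hi), if_pos rfl] at this
      simp only [mul_smul, ← Finset.smul_sum] at this
      exact_mod_cast ((W.bdry 5).smul_mem_iff h2).1 this
    · rw [Finset.sum_eq_zero]
      · exact zero_mem _
      · intro l hl
        rw [max_eq_right (Finset.mem_range.1 hl).le, sub_self, zero_smul]
  have h := sub_mem (hv i hi.le) (hv (i + 1) hi)
  rw [← Finset.sum_sub_distrib] at h
  have key : ∀ l ∈ Finset.range n, ((n : K) - (max l i : ℕ)) • W.soc l -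
      ((n : K) - (max l (i + 1) : ℕ)) • W.soc l =
      if l ∈ Finset.range (i + 1) then W.soc l else 0 := by
    intro l _
    rw [← sub_smul]
    split_ifs with hl <;> rw [Finset.mem_range] at hl
    · rw [max_eq_right (show l ≤ i by omega), max_eq_right (show l ≤ i + 1 by omega)]
      push_cast
      rw [sub_sub_sub_cancel_left, add_sub_cancel_left, one_smul]
    · rw [max_eq_left (show i ≤ l by omega), max_eq_left (show i + 1 ≤ l by omega), sub_self,
        zero_smul]
  rwa [Finset.sum_congr rfl key, ← Finset.sum_filter, Finset.filter_mem_eq_inter,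
    Finset.inter_eq_right.2 (Finset.range_subset_range.2 hi)] at h

theorem soc_mem_bdry_five (h2 : (2 : K) ≠ 0) (i : ℕ) : W.soc i ∈ W.bdry 5 := by
  by_cases hi : i < n
  · have h := W.sum_soc_mem_bdry_five h2 hi
    rw [Finset.sum_range_succ] at h
    refine ((W.bdry 5).add_mem_iff_right ?_).1 h
    cases i with
    | zero => simp
    | succ i => exact W.sum_soc_mem_bdry_five h2 (by omega)
  · rw [soc, W.B_eq_zero _ _ _ fun h => hi h.1]
    exact zero_mem _

theorem repSpan_three_le (h2 : (2 : K) ≠ 0) : W.repSpan 3 ≤ W.bdry 5 := by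
  refine Submodule.span_le.2 ?_
  rintro _ ⟨m, rfl⟩
  exact W.soc_mem_bdry_five h2 m

theorem cocyc_six_le (h2 : (2 : K) ≠ 0) (hn : 0 < n) : W.cocyc 6 ≤ W.bdry 5 ⊔ W.repSpan 6 := by
  have h : W.cocyc 6 ≤ W.cocyc 0 := fun f hf => ⟨hf.1, by have := hf.2; rwa [W.diff_add_six 0] at this⟩
  exact (h.trans (W.cocyc_zero_le hn)).trans (sup_le_sup_right (W.repSpan_three_le h2) _)

theorem cocyc_five_le (h2 : (2 : K) ≠ 0) (hn : 0 < n) :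
    W.cocyc 5 ≤ W.bdry 4 ⊔ W.repSpan 5 := by
  intro f hf
  have h1 : f ∈ (W.bdry 4 ⊔ W.repSpan 5) ⊔ W.repSpan 2 := by
    refine W.E0_induction (p := (· ∈ (W.bdry 4 ⊔ W.repSpan 5) ⊔ W.repSpan 2)) (zero_mem _)
      (fun a b => add_mem) (fun c a => Submodule.smul_mem _ c) (fun i d h => ?_) hf.1
    have hlt := h.lt
    rcases Nat.even_or_odd' d with ⟨m, rfl | rfl⟩
    · by_cases hm : m = 0
      · subst hm
        exact Submodule.mem_sup_right (W.rep_mem_repSpan 2 h.1)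
      · obtain ⟨m, rfl⟩ := Nat.exists_eq_succ_of_ne_zero hm
        exact Submodule.mem_sup_left (Submodule.mem_sup_left (W.B_even_mem_bdry_four i m))
    · refine Submodule.mem_sup_left ?_
      rw [← sub_add_cancel (W.B i i (2 * m + 1)) (W.B 0 0 (2 * m + 1))]
      refine Submodule.add_mem_sup (W.B_odd_sub_mem_bdry_four i m h) ?_
      rw [← W.B_zero_mul_xpow hn]
      exact W.rep_mem_repSpan 5 (by omega)
  obtain ⟨a, ha, b, hb, rfl⟩ := Submodule.mem_sup.1 h1
  obtain ⟨c, rfl⟩ := (Submodule.mem_span_range_iff_exists_fun K).1 hb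
  have ha' : a ∈ W.cocyc 5 := sup_le (W.bdry_le_cocyc 4) (W.repSpan_le_cocyc 5) ha
  have h3 := (((W.cocyc 5).add_mem_iff_right ha').1 hf).2
  let c' : ℕ → K := fun i => if h : i < n then c ⟨i, h⟩ else 0
  have hc : ∑ i : Fin n, c i • W.rep 2 i = ∑ i ∈ Finset.range n, c' i • W.B i i 0 := by
    rw [Finset.sum_range]
    refine Finset.sum_congr rfl fun i _ => ?_
    simp only [c', dif_pos i.2]
    rfl
  -- Modulo coboundaries and representatives a cochain here is a combination of vertices, and `diff
  -- 5` is injective on those by the triangular system.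
  have h4 : ∀ i < n, c' i = 0 := by
    refine eq_zero_of_max_system fun l hl => ?_
    rw [hc, ← act_apply, map_sum] at h3
    have h5 := congrArg (fun a => W.τ (a * W.e l)) h3
    simp only [map_smul, act_apply, Finset.sum_mul, zero_mul, map_zero, map_sum, smul_mul_assoc]
      at h5
    refine (mul_eq_zero.1 (Eq.trans ?_ h5)).resolve_left h2
    rw [Finset.mul_sum]
    refine Finset.sum_congr rfl fun i hi => ?_
    rw [W.diff_five_smul_B (isBasic_zero.2 (Finset.mem_range.1 hi)), if_pos rfl, Finset.sum_mul,
      map_sum, Finset.sum_eq_single l]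
    · rw [smul_mul_assoc, map_smul, soc_mul_e, if_pos rfl, W.τ_soc hl, smul_eq_mul, smul_eq_mul]
      ring
    · intro k _ hk
      rw [smul_mul_assoc, soc_mul_e, if_neg hk, smul_zero, map_zero]
    · intro hn
      exact absurd (Finset.mem_range.2 hl) hn
  rw [hc, Finset.sum_eq_zero fun i hi => by rw [h4 i (Finset.mem_range.1 hi), zero_smul], add_zero]
  exact ha

end WalkAlgebra

/-! ### The cohomology in the degrees one and four -/

namespace WalkAlgebra

variable {K : Type u} [Field K] {n : ℕ} {A : Type u} [Ring A] [Algebra K A]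
  (W : WalkAlgebra K n A)

/-- The span of the basis elements which go down or around the loop. -/
noncomputable def downSpan : Submodule K A :=
  Submodule.span K {a | ∃ d, a = W.B 0 0 d ∨ ∃ i, a = W.B (i + 1) i d}

theorem loop_mem_downSpan (d : ℕ) : W.B 0 0 d ∈ W.downSpan :=
  Submodule.subset_span ⟨d, Or.inl rfl⟩

theorem down_mem_downSpan (i d : ℕ) : W.B (i + 1) i d ∈ W.downSpan :=
  Submodule.subset_span ⟨d, Or.inr ⟨i, rfl⟩⟩

theorem diff_zero_smul_B (i d : ℕ) :
    W.diff 0 • W.B i i d = W.D * W.B i i d - W.B i i d * W.D := by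
  rw [diff_zero_smul, E0_smul_B, if_pos rfl]

theorem diff_three_smul_B (i d : ℕ) :
    W.diff 3 • W.B i i d = -(W.D * W.B i i d + W.B i i d * W.D) := by
  rw [diff_three_smul, E0_smul_B, if_pos rfl]

/-- The coboundary of `B i i d` contains the upward element at `i` with a unit coefficient, besides
downward elements, the loop and the upward element at `i - 1`. So upward elements are eliminated
inductively from the loop onwards. -/
theorem up_mem {S : Submodule K A} (hS : W.downSpan ≤ S) {ε : K} (hε : ε ≠ 0)
    (h : ∀ i d, IsBasic n i i d → W.D * W.B i i d + ε • (W.B i i d * W.D) ∈ S) (i d : ℕ) :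
    W.B i (i + 1) d ∈ S := by
  by_cases hb : IsBasic n i (i + 1) d
  swap
  · rw [W.B_eq_zero _ _ _ hb]
    exact zero_mem _
  obtain ⟨d, rfl⟩ : ∃ d', d = d' + 1 := ⟨d - 1, by unfold IsBasic at hb; omega⟩
  induction i with
  | zero =>
    have hb' : IsBasic n 0 0 d := by unfold IsBasic at *; omega
    have h1 := h 0 d hb'
    rw [W.D_mul_B hb', W.B_mul_D hb', if_pos rfl, if_pos rfl, smul_add] at h1
    have h2 := (S.add_mem_iff_right (add_mem (hS (W.loop_mem_downSpan (d + 1)))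
      (hS (W.down_mem_downSpan 0 (d + 1))))).1 h1
    have h3 := (S.add_mem_iff_right (S.smul_mem ε (hS (W.loop_mem_downSpan (d + 1))))).1 h2
    exact (S.smul_mem_iff (pow_ne_zero _ (neg_ne_zero.2 one_ne_zero))).1 ((S.smul_mem_iff hε).1 h3)
  | succ i ih =>
    have hb' : IsBasic n (i + 1) (i + 1) d := by unfold IsBasic at *; omega
    have hi : W.B i (i + 1) (d + 1) ∈ S := ih (by unfold IsBasic at *; omega)
    have h1 := h (i + 1) d hb'
    rw [W.D_mul_B hb', W.B_mul_D hb', if_neg (Nat.succ_ne_zero i), if_neg (Nat.succ_ne_zero i),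
      Nat.add_sub_cancel, smul_add] at h1
    have h2 := (S.add_mem_iff_right (add_mem (S.smul_mem _ hi)
      (hS (W.down_mem_downSpan (i + 1) (d + 1))))).1 h1
    have h3 := (S.add_mem_iff_right (S.smul_mem ε (hS (W.down_mem_downSpan i (d + 1))))).1 h2
    exact (S.smul_mem_iff (pow_ne_zero _ (neg_ne_zero.2 one_ne_zero))).1 ((S.smul_mem_iff hε).1 h3)

theorem mem_of_E1_smul {S : Submodule K A} (hS : W.downSpan ≤ S) {ε : K} (hε : ε ≠ 0)
    (h : ∀ i d, IsBasic n i i d → W.D * W.B i i d + ε • (W.B i i d * W.D) ∈ S) {f : A}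
    (hf : W.E1 • f = f) : f ∈ S := by
  refine W.E1_induction (p := (· ∈ S)) (zero_mem _) (fun a b => add_mem)
    (fun c a => S.smul_mem c) (fun i j d hij _ => ?_) hf
  rcases hij with rfl | rfl | ⟨rfl, rfl⟩
  · exact W.up_mem hS hε h i d
  · exact hS (W.down_mem_downSpan j d)
  · exact hS (W.loop_mem_downSpan d)

theorem τ_mul_B_of_E1_smul {f : A} (hf : W.E1 • f = f) {i j : ℕ} (h : ¬ Nbr i j) (d : ℕ) :
    W.τ (f * W.B i j d) = 0 := by
  refine W.E1_induction (p := fun a => W.τ (a * W.B i j d) = 0) (by rw [zero_mul, map_zero])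
    (fun a b ha hb => by rw [add_mul, map_add, ha, hb, add_zero])
    (fun c a ha => by rw [smul_mul_assoc, map_smul, ha, smul_zero]) (fun k l d' hkl _ => ?_) hf
  rw [τ_B_mul_B, if_neg]
  rintro ⟨rfl, rfl, -⟩
  unfold Nbr at *
  omega

theorem τ_mul_down_of_mem_downSpan {f : A} (hf : f ∈ W.downSpan) (i d : ℕ) :
    W.τ (f * W.B (i + 1) i d) = 0 := by
  induction hf using Submodule.span_induction with
  | mem x hx =>
    obtain ⟨d', rfl | ⟨j, rfl⟩⟩ := hx
    · rw [τ_B_mul_B, if_neg]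
      omega
    · rw [τ_B_mul_B, if_neg]
      omega
  | zero => rw [zero_mul, map_zero]
  | add x y _ _ hx hy => rw [add_mul, map_add, hx, hy, add_zero]
  | smul c x _ hx => rw [smul_mul_assoc, map_smul, hx, smul_zero]

theorem E1_smul_of_mem_downSpan {f : A} (hf : f ∈ W.downSpan) : W.E1 • f = f := by
  induction hf using Submodule.span_induction with
  | mem x hx =>
    obtain ⟨d', rfl | ⟨j, rfl⟩⟩ := hx
    · rw [E1_smul_B, if_pos (by unfold Nbr; omega)]
    · rw [E1_smul_B, if_pos (by unfold Nbr; omega)]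
  | zero => rw [smul_zero]
  | add x y _ _ hx hy => rw [smul_add, hx, hy]
  | smul c x _ hx => rw [env_smul_comm, hx]

/-- The recursion for the coordinates of a cocycle which goes down. -/
theorem τ_mul_up_recursion {f : A} (hf : f ∈ W.downSpan) {ε : K}
    (h : ∀ g, W.E0 • g = g → W.τ (f * (g * W.D + ε • (W.D * g))) = 0) {i d : ℕ}
    (hb : IsBasic n (i + 1) (i + 1) d) : W.τ (f * W.B (i + 1) (i + 2) (d + 1)) =
      ε * W.τ (f * W.B i (i + 1) (d + 1)) := by
  have h1 := h (W.B (i + 1) (i + 1) d) (by rw [E0_smul_B, if_pos rfl])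
  rw [W.D_mul_B hb, W.B_mul_D hb, if_neg (Nat.succ_ne_zero i), if_neg (Nat.succ_ne_zero i),
    Nat.add_sub_cancel] at h1
  simp only [mul_add, smul_add, map_add, mul_smul_comm, map_smul,
    W.τ_mul_down_of_mem_downSpan hf, smul_zero, smul_eq_mul, add_zero, zero_add] at h1
  have h2 : ((-1 : K) ^ (i + 1)) * (-1) ^ (i + 1) = 1 := by rw [← mul_pow]; simp
  linear_combination (-1 : K) ^ (i + 1 + 1) * h1 + (ε * W.τ (f * W.B i (i + 1) (d + 1)) -
    W.τ (f * W.B (i + 1) (i + 2) (d + 1))) * h2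

/-- The start of the recursion at the loop. The factor `1 + ε` separates degree one, where it is
`2`, from degree four, where it is `0`. -/
theorem τ_mul_up_zero {f : A} (hf : f ∈ W.downSpan) {ε : K}
    (h : ∀ g, W.E0 • g = g → W.τ (f * (g * W.D + ε • (W.D * g))) = 0) {d : ℕ}
    (hb : IsBasic n 0 0 d) : W.τ (f * W.B 0 1 (d + 1)) =
      (1 + ε) * W.τ (f * W.B 0 0 (d + 1)) := by
  have h1 := h (W.B 0 0 d) (by rw [E0_smul_B, if_pos rfl])
  rw [W.D_mul_B hb, W.B_mul_D hb, if_pos rfl, if_pos rfl] at h1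
  simp only [mul_add, smul_add, map_add, mul_smul_comm, map_smul,
    W.τ_mul_down_of_mem_downSpan hf, smul_zero, smul_eq_mul, add_zero, zero_add, pow_one] at h1
  linear_combination -h1

theorem eq_zero_of_downSpan {f : A} (hf : f ∈ W.downSpan)
    (h0 : ∀ d, IsBasic n 0 0 d → W.τ (f * W.B 0 0 d) = 0)
    (h1 : ∀ i d, IsBasic n i (i + 1) d → W.τ (f * W.B i (i + 1) d) = 0) : f = 0 := by
  refine W.eq_zero_of_τ fun i j d hb => ?_
  by_cases hij : Nbr i j
  · rcases hij with rfl | rfl | ⟨rfl, rfl⟩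
    · exact h1 i d hb
    · exact W.τ_mul_down_of_mem_downSpan hf j d
    · exact h0 d hb
  · exact W.τ_mul_B_of_E1_smul (W.E1_smul_of_mem_downSpan hf) hij d

/-- All coordinates along the line are linked by the recursion. Those of even length are governed by
the loop, where they vanish by `hl`; those of odd length by the end of the line, where there is no
basic walk. -/
theorem eq_zero_of_cocyc_one (h2 : (2 : K) ≠ 0) {f : A} (hf : f ∈ W.downSpan)
    (hc : f ∈ W.cocyc 1) (hl : ∀ l < n, W.τ (f * W.B 0 0 (2 * l)) = 0) : f = 0 := by
  have h : ∀ g, W.E0 • g = g → W.τ (f * (g * W.D + (1 : K) • (W.D * g))) = 0 := by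
    intro g hg
    have h0 := hc.2
    rw [diff_one_smul] at h0
    rw [one_smul, mul_add, map_add, ← mul_assoc, W.τ_mul_comm (f * g), ← mul_assoc, ← mul_assoc,
      ← map_add, ← add_mul, ← hg, τ_mul_E0_smul, h0, zero_mul, map_zero]
  have hrec : ∀ {i d : ℕ}, IsBasic n (i + 1) (i + 1) d → W.τ (f * W.B (i + 1) (i + 2) (d + 1)) =
      W.τ (f * W.B i (i + 1) (d + 1)) := fun hb => by
    rw [W.τ_mul_up_recursion hf h hb, one_mul]
  have hzero : ∀ {d : ℕ}, IsBasic n 0 0 d → W.τ (f * W.B 0 1 (d + 1)) =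
      2 * W.τ (f * W.B 0 0 (d + 1)) := fun hb => by
    rw [W.τ_mul_up_zero hf h hb]
    ring
  have hodd : ∀ m k i, n ≤ i + k → W.τ (f * W.B i (i + 1) (2 * m + 1)) = 0 := by
    intro m k
    induction k with
    | zero =>
      intro i hi
      rw [W.B_eq_zero i _ _ fun hb => absurd hb.1 (by omega), mul_zero, map_zero]
    | succ k ih =>
      intro i hi
      by_cases hb : IsBasic n i (i + 1) (2 * m + 1)
      · rw [← hrec (by unfold IsBasic at *; omega)]
        exact ih (i + 1) (by omega)
      · rw [W.B_eq_zero _ _ _ hb, mul_zero, map_zero]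
  have heven : ∀ m i, W.τ (f * W.B i (i + 1) (2 * m + 2)) = 0 := by
    intro m i
    induction i with
    | zero =>
      by_cases hb : IsBasic n 0 1 (2 * m + 2)
      · have := hl (m + 1) (by unfold IsBasic at hb; omega)
        rw [hzero (by unfold IsBasic at *; omega), show 2 * m + 1 + 1 = 2 * (m + 1) by ring, this,
          mul_zero]
      · rw [W.B_eq_zero _ _ _ hb, mul_zero, map_zero]
    | succ i ih =>
      by_cases hb : IsBasic n (i + 1) (i + 1 + 1) (2 * m + 2)
      · rw [hrec (by unfold IsBasic at *; omega)]
        exact ih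
      · rw [W.B_eq_zero _ _ _ hb, mul_zero, map_zero]
  refine W.eq_zero_of_downSpan hf (fun d hb => ?_) (fun i d hb => ?_)
  · have := hb.lt
    rcases Nat.even_or_odd' d with ⟨m, rfl | rfl⟩
    · exact hl m (by omega)
    · refine (mul_eq_zero.1 ?_).resolve_left h2
      rw [← hzero (by unfold IsBasic at *; omega)]
      exact hodd m n 0 (by omega)
  · rcases Nat.even_or_odd' d with ⟨m, rfl | rfl⟩
    · obtain ⟨m, rfl⟩ := Nat.exists_eq_succ_of_ne_zero
        (show m ≠ 0 by unfold IsBasic at hb; omega)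
      exact heven m i
    · exact hodd m n i (by omega)

theorem cocyc_one_le (h2 : (2 : K) ≠ 0) (hn : 0 < n) : W.cocyc 1 ≤ W.bdry 0 ⊔ W.repSpan 1 := by
  intro f hf
  have h1 := W.sum_rep_mem_repSpan 1 fun m => W.τ (f * W.test 1 m)
  have h3 := sub_mem hf (W.repSpan_le_cocyc 1 h1)
  have h4 := fun m => W.τ_sub_sum_rep_mul_test hn 1 f (m := m)
  rw [← sub_add_cancel f (∑ k : Fin n, W.τ (f * W.test 1 k) • W.rep 1 k)]
  refine Submodule.add_mem_sup ?_ h1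
  generalize f - ∑ k : Fin n, W.τ (f * W.test 1 k) • W.rep 1 k = f' at h3 h4 ⊢
  have h5 : f' ∈ W.bdry 0 ⊔ W.downSpan := by
    refine W.mem_of_E1_smul le_sup_right (neg_ne_zero.2 one_ne_zero) (fun i d hb => ?_) h3.1
    rw [neg_one_smul, ← sub_eq_add_neg, ← W.diff_zero_smul_B _ _]
    exact Submodule.mem_sup_left (W.smul_mem_bdry 0 _)
  obtain ⟨a, ha, b, hb, rfl⟩ := Submodule.mem_sup.1 h5
  have hb0 : b = 0 := by
    refine W.eq_zero_of_cocyc_one h2 hb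
      (((W.cocyc 1).add_mem_iff_right (W.bdry_le_cocyc 0 ha)).1 h3) fun l hl => ?_
    have h6 := h4 (n - 1 - l) (by omega)
    rw [add_mul, map_add, W.τ_bdry_mul_test hn 0 ha, zero_add] at h6
    change W.τ (b * W.B 0 0 (2 * (n - 1 - (n - 1 - l)))) = 0 at h6
    rwa [show n - 1 - (n - 1 - l) = l by omega] at h6
  rwa [hb0, add_zero]

/-- The coboundaries of the elements `B i i (2 * m)` telescope from the end of the line to the loop,
where twice the loop element remains. -/
theorem B_odd_mem_bdry_three (h2 : (2 : K) ≠ 0) (m : ℕ) : W.B 0 0 (2 * m + 1) ∈ W.bdry 3 := by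
  have key : ∀ k i, n ≤ i + k → W.B i (i + 1) (2 * m + 1) -
      (-1 : K) ^ i • W.B (i + 1) i (2 * m + 1) ∈ W.bdry 3 := by
    intro k
    induction k with
    | zero =>
      intro i hi
      rw [W.B_eq_zero i _ _ fun hb => absurd hb.1 (by omega),
        W.B_eq_zero (i + 1) _ _ fun hb => absurd hb.1 (by omega), smul_zero, sub_zero]
      exact zero_mem _
    | succ k ih =>
      intro i hi
      by_cases hb : IsBasic n (i + 1) (i + 1) (2 * m)
      · have h1 := (W.bdry 3).smul_mem ((-1 : K) ^ i) (W.smul_mem_bdry 3 (W.B (i + 1) (i + 1) (2 * m)))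
        rw [W.diff_three_smul_B _ _, W.D_mul_B hb, W.B_mul_D hb, if_neg (Nat.succ_ne_zero i),
          if_neg (Nat.succ_ne_zero i), Nat.add_sub_cancel] at h1
        have h3 := (W.bdry 3).add_mem (ih (i + 1) (by omega)) h1
        have hs : ((-1 : K) ^ i) * (-1) ^ i = 1 := by rw [← mul_pow]; simp
        convert h3 using 1
        simp only [smul_neg, smul_add, smul_smul, pow_succ, mul_neg, mul_one, neg_mul, neg_neg, hs,
          neg_smul, one_smul]
        abel
      · rw [W.B_eq_zero i _ _ fun hb' => hb (by unfold IsBasic at *; omega),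
          W.B_eq_zero (i + 1) i _ fun hb' => hb (by unfold IsBasic at *; omega), smul_zero, sub_zero]
        exact zero_mem _
  by_cases hb : IsBasic n 0 0 (2 * m)
  · have h1 := W.smul_mem_bdry 3 (W.B 0 0 (2 * m))
    rw [W.diff_three_smul_B _ _, W.D_mul_B hb, W.B_mul_D hb, if_pos rfl, if_pos rfl,
      Submodule.neg_mem_iff] at h1
    have h3 := (W.bdry 3).add_mem (key n 0 (by omega)) h1
    refine ((W.bdry 3).smul_mem_iff h2).1 ?_
    convert h3 using 1
    rw [two_smul]
    simp only [pow_zero, one_smul, zero_add, pow_one, neg_smul]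
    abel
  · rw [W.B_eq_zero _ _ _ fun hb' => hb (by unfold IsBasic at *; omega)]
    exact zero_mem _

theorem cocyc_four_le (h2 : (2 : K) ≠ 0) (hn : 0 < n) : W.cocyc 4 ≤ W.bdry 3 ⊔ W.repSpan 4 := by
  intro f hf
  have h5 : f ∈ W.bdry 3 ⊔ W.downSpan := by
    refine W.mem_of_E1_smul (ε := 1) le_sup_right one_ne_zero (fun i d hb => ?_) hf.1
    rw [one_smul, ← neg_neg (W.D * _ + _), ← W.diff_three_smul_B _ _]
    exact Submodule.mem_sup_left (neg_mem (W.smul_mem_bdry 3 _))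
  obtain ⟨a, ha, b, hb, rfl⟩ := Submodule.mem_sup.1 h5
  have hc : b ∈ W.cocyc 4 := ((W.cocyc 4).add_mem_iff_right (W.bdry_le_cocyc 3 ha)).1 hf
  refine add_mem (Submodule.mem_sup_left ha) ?_
  have h : ∀ g, W.E0 • g = g → W.τ (b * (g * W.D + (-1 : K) • (W.D * g))) = 0 := by
    intro g hg
    have h0 := hc.2
    rw [diff_four_smul] at h0
    rw [neg_one_smul, ← sub_eq_add_neg, mul_sub, map_sub, ← mul_assoc, W.τ_mul_comm (b * g),
      ← mul_assoc, ← mul_assoc, ← map_sub, ← sub_mul, ← neg_sub (b * W.D), neg_mul, map_neg, ← hg,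
      τ_mul_E0_smul, h0, zero_mul, map_zero, neg_zero]
  -- The recursion now starts with the factor `1 + ε = 0`, so only loop components can remain; those
  -- of odd length are coboundaries and those of even length are representatives.
  have hup : ∀ i d, W.τ (b * W.B i (i + 1) d) = 0 := by
    intro i d
    by_cases hb1 : IsBasic n i (i + 1) d
    swap
    · rw [W.B_eq_zero _ _ _ hb1, mul_zero, map_zero]
    obtain ⟨d, rfl⟩ : ∃ d', d = d' + 1 := ⟨d - 1, by unfold IsBasic at hb1; omega⟩
    induction i with
    | zero => rw [W.τ_mul_up_zero hb h (by unfold IsBasic at *; omega)]; ring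
    | succ i ih =>
      rw [W.τ_mul_up_recursion hb h (by unfold IsBasic at *; omega),
        ih (by unfold IsBasic at *; omega), mul_zero]
  rw [← W.sum_τ_smul_bd b]
  refine Submodule.sum_mem _ ?_
  rintro ⟨i, j, d⟩ ht
  have hbt := mem_idx.1 ht
  dsimp only at hbt
  by_cases hij : Nbr i j
  · rcases hij with rfl | rfl | ⟨rfl, rfl⟩
    · rw [b_mk, hup i d, zero_smul]
      exact zero_mem _
    · rw [b_mk, W.τ_mul_down_of_mem_downSpan hb j d, zero_smul]
      exact zero_mem _
    · refine Submodule.smul_mem _ _ ?_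
      change W.B 0 0 (2 * n - 1 - d) ∈ _
      have hlt := hbt.lt
      rcases Nat.even_or_odd' (2 * n - 1 - d) with ⟨m, hm | hm⟩ <;> rw [hm]
      · rw [← W.e_zero_mul_xpow hn]
        exact Submodule.mem_sup_right (W.rep_mem_repSpan 4 (by omega))
      · exact Submodule.mem_sup_left (W.B_odd_mem_bdry_three h2 m)
  · rw [b_mk, W.τ_mul_B_of_E1_smul (W.E1_smul_of_mem_downSpan hb) hij d, zero_smul]
    exact zero_mem _

/-- The representatives span the cohomology in all positive degrees. -/
theorem cocyc_succ_le (h2 : (2 : K) ≠ 0) (hn : 0 < n) (r : ℕ) :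
    W.cocyc (r + 1) ≤ W.bdry r ⊔ W.repSpan (r + 1) := by
  refine six_induction (p := fun r => W.cocyc (r + 1) ≤ W.bdry r ⊔ W.repSpan (r + 1))
    (W.cocyc_one_le h2 hn) (W.cocyc_two_le h2) ((W.cocyc_three_le h2).trans le_sup_right)
    (W.cocyc_four_le h2 hn) (W.cocyc_five_le h2 hn) (W.cocyc_six_le h2 hn) (fun k h => ?_) r
  have h1 : W.cocyc (k + 6 + 1) ≤ W.cocyc (k + 1) := fun f hf =>
    ⟨hf.1, by have := hf.2; rwa [show k + 6 + 1 = k + 1 + 6 by ring, diff_add_six] at this⟩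
  have h3 : W.bdry (k + 6) = W.bdry k := by rw [bdry, bdry, diff_add_six]
  rw [h3]
  exact h1.trans h

end WalkAlgebra

/-! ### Classes in the Hochschild cohomology algebra -/

namespace WalkAlgebra

variable {K : Type u} [Field K] {n : ℕ} {A : Type u} [Ring A] [Algebra K A]
  (W : WalkAlgebra K n A)

/-- The inclusion of the homogeneous elements of degree `k`. -/
noncomputable def ofExt (k : ℕ) (ξ : Abelian.Ext.{u} (ModuleCat.of (Env K A) A) (ModuleCat.of (Env K A) A) k) :
    HHAlgebra K A :=
  DirectSum.of (HH K A) k ξ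

theorem ofExt_add (k : ℕ) (ξ ζ : Abelian.Ext.{u} (ModuleCat.of (Env K A) A) (ModuleCat.of (Env K A) A) k) :
    ofExt k (ξ + ζ) = ofExt (K := K) (A := A) k ξ + ofExt k ζ :=
  map_add (DirectSum.of (HH K A) k) ξ ζ

theorem ofExt_smul (k : ℕ) (c : K) (ξ : Abelian.Ext.{u} (ModuleCat.of (Env K A) A) (ModuleCat.of (Env K A) A) k) :
    ofExt k (c • ξ) = c • ofExt (K := K) (A := A) k ξ :=
  map_smul (DirectSum.lof K ℕ (HH K A) k) c ξ

theorem ofExt_injective (k : ℕ) : Function.Injective (ofExt (K := K) (A := A) k) :=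
  DirectSum.of_injective (β := HH K A) k

/-- The Yoneda product applies its right factor first, hence the reversed composition. In all later
computations it is therefore the right factor that must be lifted. -/
theorem ofExt_mul (i j : ℕ) (α : Abelian.Ext.{u} (ModuleCat.of (Env K A) A) (ModuleCat.of (Env K A) A) i)
    (β : Abelian.Ext.{u} (ModuleCat.of (Env K A) A) (ModuleCat.of (Env K A) A) j) :
    ofExt (K := K) i α * ofExt j β = ofExt (j + i) (β.comp α rfl) := by
  refine (DirectSum.of_mul_of (A := HH K A) α β).trans ?_
  exact DirectSum.of_eq_of_gradedMonoid_eq (HH.mk_comp K A (add_comm j i) rfl β α)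

open Classical in
/-- The class of a cocycle. -/
noncomputable def cl (k : ℕ) (f : A) : HHAlgebra K A :=
  if h : ∃ ξ, W.resolution.Represents k f ξ then ofExt k h.choose else 0

theorem cl_eq {k : ℕ} {f : A} {ξ} (h : W.resolution.Represents k f ξ) : W.cl k f = ofExt k ξ := by
  have h' : ∃ ξ, W.resolution.Represents k f ξ := ⟨ξ, h⟩
  rw [cl, dif_pos h', h'.choose_spec.unique h]

theorem exists_ext {k : ℕ} {f : A} (h : f ∈ W.cocyc k) : ∃ ξ, W.resolution.Represents k f ξ :=
  W.resolution.exists_represents h.1 h.2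

theorem exists_cl (k : ℕ) (ξ : HH K A k) :
    ∃ f ∈ W.cocyc k, DirectSum.of (HH K A) k ξ = W.cl k f := by
  obtain ⟨f, hf⟩ := W.resolution.exists_represents_class k ξ
  exact ⟨f, ⟨hf.e_smul, hf.d_smul⟩, (W.cl_eq hf).symm⟩

theorem cl_mem (k : ℕ) (f : A) : W.cl k f ∈ HHAlgebra.component K A k := by
  unfold cl
  split_ifs with h
  · exact ⟨h.choose, rfl⟩
  · exact zero_mem _

theorem cl_add {k : ℕ} {f g : A} (hf : f ∈ W.cocyc k) (hg : g ∈ W.cocyc k) :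
    W.cl k (f + g) = W.cl k f + W.cl k g := by
  obtain ⟨ξ, hξ⟩ := W.exists_ext hf
  obtain ⟨ζ, hζ⟩ := W.exists_ext hg
  rw [W.cl_eq hξ, W.cl_eq hζ, W.cl_eq (hξ.add hζ), ofExt_add]

theorem cl_smul {k : ℕ} {f : A} (hf : f ∈ W.cocyc k) (c : K) :
    W.cl k (c • f) = c • W.cl k f := by
  obtain ⟨ξ, hξ⟩ := W.exists_ext hf
  have h := hξ.smul c
  rw [algebraMap_env_smul] at h
  rw [W.cl_eq hξ, W.cl_eq h, ofExt_smul]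

theorem cl_zero (k : ℕ) : W.cl k 0 = 0 := by
  rw [W.cl_eq (IdempotentResolution.represents_zero k)]
  exact map_zero (DirectSum.of (HH K A) k)

theorem cl_neg {k : ℕ} {f : A} (hf : f ∈ W.cocyc k) : W.cl k (-f) = -W.cl k f := by
  rw [← neg_one_smul K, W.cl_smul hf, neg_one_smul]

theorem cl_sum {k : ℕ} {ι : Type*} (s : Finset ι) (f : ι → A) (c : ι → K)
    (hf : ∀ i, f i ∈ W.cocyc k) : W.cl k (∑ i ∈ s, c i • f i) = ∑ i ∈ s, c i • W.cl k (f i) := by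
  classical
  induction s using Finset.induction_on with
  | empty => rw [Finset.sum_empty, Finset.sum_empty, cl_zero]
  | insert i s hi ih =>
    rw [Finset.sum_insert hi, Finset.sum_insert hi,
      W.cl_add (Submodule.smul_mem _ _ (hf i))
        (Submodule.sum_mem _ fun j _ => Submodule.smul_mem _ _ (hf j)), ih, W.cl_smul (hf i)]

theorem cl_eq_zero_iff {k : ℕ} {f : A} (hf : f ∈ W.cocyc (k + 1)) :
    W.cl (k + 1) f = 0 ↔ f ∈ W.bdry k := by
  obtain ⟨ξ, hξ⟩ := W.exists_ext hf
  rw [W.cl_eq hξ, mem_bdry]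
  refine Iff.trans ?_ hξ.eq_zero_iff_succ
  exact map_eq_zero_iff (DirectSum.of (HH K A) (k + 1)) (ofExt_injective (k + 1))

theorem cl_zero_eq_zero_iff {f : A} (hf : f ∈ W.cocyc 0) : W.cl 0 f = 0 ↔ f = 0 := by
  obtain ⟨ξ, hξ⟩ := W.exists_ext hf
  rw [W.cl_eq hξ]
  refine Iff.trans ?_ hξ.eq_zero_iff_zero
  exact map_eq_zero_iff (DirectSum.of (HH K A) 0) (ofExt_injective 0)

theorem cl_mul {i j m : ℕ} (h : j + i = m) {f : A} (hf : f ∈ W.cocyc i) {G : ℕ → Env K A}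
    (hG : W.resolution.IsLift j G) : W.cl i f * W.cl j (G 0 • (1 : A)) = W.cl m (G i • f) := by
  subst h
  obtain ⟨ξ, hξ⟩ := W.exists_ext hf
  obtain ⟨ζ, hζ⟩ := W.exists_ext (W.mem_cocyc_of_isLift hG)
  rw [W.cl_eq hξ, W.cl_eq hζ, ofExt_mul, W.cl_eq (hζ.comp hξ hG)]

theorem smul_mem_cocyc {i j m : ℕ} (h : j + i = m) {f : A} (hf : f ∈ W.cocyc i)
    {G : ℕ → Env K A} (hG : W.resolution.IsLift j G) : G i • f ∈ W.cocyc m := by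
  subst h
  have h1 : W.idem (j + i) * G i = G i := hG.e_mul i
  have h2 : W.diff (j + i) * G i = G (i + 1) * W.diff i := hG.comm i
  exact ⟨by rw [smul_smul, h1], by rw [smul_smul, h2, mul_smul, hf.2, smul_zero]⟩

/-- The coordinates of a class. -/
theorem cl_eq_sum (h2 : (2 : K) ≠ 0) (hn : 0 < n) {k : ℕ} {f : A} (hf : f ∈ W.cocyc (k + 1)) :
    W.cl (k + 1) f =
      ∑ m : Fin n, W.τ (f * W.test (k + 1) m) • W.cl (k + 1) (W.rep (k + 1) m) := by
  obtain ⟨a, ha, b, hb, rfl⟩ := Submodule.mem_sup.1 (W.cocyc_succ_le h2 hn k hf)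
  obtain ⟨c, rfl⟩ := (Submodule.mem_span_range_iff_exists_fun K).1 hb
  rw [W.cl_add (W.bdry_le_cocyc k ha) (W.repSpan_le_cocyc _ hb),
    (W.cl_eq_zero_iff (W.bdry_le_cocyc k ha)).2 ha, zero_add,
    W.cl_sum Finset.univ (fun m : Fin n => W.rep (k + 1) m) c fun m => W.rep_mem_cocyc (k + 1) m]
  refine Finset.sum_congr rfl fun m _ => ?_
  rw [add_mul, map_add, W.τ_bdry_mul_test hn k ha, zero_add, Finset.sum_mul, map_sum,
    Finset.sum_eq_single m]
  · rw [smul_mul_assoc, map_smul, W.τ_rep_mul_test hn _ m.2 m.2, if_pos rfl, smul_eq_mul, mul_one]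
  · intro l _ hl
    rw [smul_mul_assoc, map_smul, W.τ_rep_mul_test hn _ l.2 m.2, if_neg (fun h => hl (Fin.ext h)),
      smul_zero]
  · intro h
    exact absurd (Finset.mem_univ _) h

theorem τ_mul_test_eq_zero (hn : 0 < n) {k : ℕ} {f : A} (hf : f ∈ W.cocyc (k + 1))
    (h : W.cl (k + 1) f = 0) (m : ℕ) : W.τ (f * W.test (k + 1) m) = 0 :=
  W.τ_bdry_mul_test hn k ((W.cl_eq_zero_iff hf).1 h)

theorem coeff_eq_of_sum_eq (hn : 0 < n) {k : ℕ} {c c' : Fin n → K}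
    (h : ∑ m : Fin n, c m • W.cl (k + 1) (W.rep (k + 1) m) =
      ∑ m : Fin n, c' m • W.cl (k + 1) (W.rep (k + 1) m)) (m : Fin n) : c m = c' m := by
  rw [← sub_eq_zero, ← Finset.sum_sub_distrib] at h
  simp only [← sub_smul] at h
  rw [← W.cl_sum Finset.univ (fun m : Fin n => W.rep (k + 1) m) (fun m => c m - c' m)
    fun m => W.rep_mem_cocyc (k + 1) m] at h
  have h1 := W.τ_mul_test_eq_zero hn
    (Submodule.sum_mem _ fun m _ => Submodule.smul_mem _ (c m - c' m)
      (W.rep_mem_cocyc (k + 1) m)) h m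
  rw [Finset.sum_mul, map_sum, Finset.sum_eq_single m] at h1
  · rwa [smul_mul_assoc, map_smul, W.τ_rep_mul_test hn _ m.2 m.2, if_pos rfl, smul_eq_mul, mul_one,
      sub_eq_zero] at h1
  · intro l _ hl
    rw [smul_mul_assoc, map_smul, W.τ_rep_mul_test hn _ l.2 m.2, if_neg (fun h => hl (Fin.ext h)),
      smul_zero]
  · intro h
    exact absurd (Finset.mem_univ _) h

theorem cl_rep_ne_zero (hn : 0 < n) (k : ℕ) {m : ℕ} (hm : m < n) :
    W.cl (k + 1) (W.rep (k + 1) m) ≠ 0 := by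
  intro h
  have h1 := W.τ_mul_test_eq_zero hn (W.rep_mem_cocyc (k + 1) m) h m
  rw [W.τ_rep_mul_test hn _ hm hm, if_pos rfl] at h1
  exact one_ne_zero h1

/-! ### Multiplication by central elements -/

theorem cl_mul_central {k : ℕ} {f c : A} (hf : f ∈ W.cocyc k) (hc : ∀ a, c * a = a * c) :
    W.cl k f * W.cl 0 c = W.cl k (f * c) := by
  have h := W.cl_mul (zero_add k) hf (W.isLift_central hc)
  have h1 : (bi K c 1 * W.idem 0) • (1 : A) = c := by
    rw [mul_smul]
    change bi K c 1 • W.E0 • (1 : A) = c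
    rw [E0_smul_one, bi_smul_eq, mul_one, mul_one]
  rwa [h1, mul_smul, hf.1, bi_smul_eq, mul_one, hc] at h

/-- Whatever cocycle represents the identity, multiplying its class by the class of the central
element `1` returns it unchanged. -/
theorem one_eq_cl : (1 : HHAlgebra K A) = W.cl 0 1 := by
  obtain ⟨f, hf, h⟩ := W.exists_cl 0 HH.one
  have h1 : (1 : HHAlgebra K A) = W.cl 0 f := h
  rw [← one_mul (W.cl 0 1)]
  conv_rhs => rw [h1]
  rw [W.cl_mul_central hf (fun a => by rw [one_mul, mul_one]), mul_one, h1]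

theorem cl_xpow_pow (m : ℕ) : W.cl 0 (W.xpow 1) ^ m = W.cl 0 (W.xpow m) := by
  induction m with
  | zero => rw [pow_zero, xpow_zero, one_eq_cl]
  | succ m ih =>
    rw [pow_succ, ih, W.cl_mul_central (W.central_mem_cocyc (W.xpow_mul m)) (W.xpow_mul 1), xpow_add]

/-- Central elements commute with all classes. -/
theorem central_mul_cl_comm {k : ℕ} {f c : A} (hf : f ∈ W.cocyc k) (hc : ∀ a, c * a = a * c) :
    W.cl 0 c * W.cl k f = W.cl k f * W.cl 0 c := by
  obtain ⟨G, hG, h⟩ := W.resolution.exists_isLift hf.1 hf.2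
  have h' : G 0 • (1 : A) = f := h
  rw [← h', W.cl_mul (add_zero k) (W.central_mem_cocyc hc) hG, W.cl_mul_central (h' ▸ hf) hc,
    ← smul_mul_central _ hc, one_mul]

theorem rep_mul_xpow_one (r : ℕ) (hr : r % 6 ≠ 2 ∧ r % 6 ≠ 3) (m : ℕ) :
    W.rep r m * W.xpow 1 = W.rep r (m + 1) := by
  revert hr
  refine six_induction (p := fun r => r % 6 ≠ 2 ∧ r % 6 ≠ 3 →
    W.rep r m * W.xpow 1 = W.rep r (m + 1)) ?_ ?_ ?_ ?_ ?_ ?_ (fun k h hk => ?_) r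
  · intro _
    exact W.xpow_add m 1
  · intro _
    change W.D * W.xpow m * W.xpow 1 = W.D * W.xpow (m + 1)
    rw [mul_assoc, xpow_add]
  · intro h; omega
  · intro h; omega
  · intro _
    change W.e 0 * W.xpow m * W.xpow 1 = W.e 0 * W.xpow (m + 1)
    rw [mul_assoc, xpow_add]
  · intro _
    change W.B 0 0 1 * W.xpow m * W.xpow 1 = W.B 0 0 1 * W.xpow (m + 1)
    rw [mul_assoc, xpow_add]
  · exact h (by omega)

theorem rep_eq_zero {r : ℕ} (hr : r % 6 ≠ 2 ∧ r % 6 ≠ 3) {m : ℕ} (hm : n ≤ m) :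
    W.rep r m = 0 := by
  have h0 := W.xpow_eq_zero hm
  revert hr
  refine six_induction (p := fun r => r % 6 ≠ 2 ∧ r % 6 ≠ 3 → W.rep r m = 0)
    (fun _ => h0) (fun _ => ?_) (fun h => by omega) (fun h => by omega) (fun _ => ?_) (fun _ => ?_)
    (fun k h hk => h (by omega)) r
  · change W.D * W.xpow m = 0
    rw [h0, mul_zero]
  · change W.e 0 * W.xpow m = 0
    rw [h0, mul_zero]
  · change W.B 0 0 1 * W.xpow m = 0
    rw [h0, mul_zero]

/-- A class killed by the generator of degree zero. -/
theorem cl_eq_smul_of_mul_eq_zero (h2 : (2 : K) ≠ 0) (hn : 0 < n) {k : ℕ}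
    (hk : (k + 1) % 6 ≠ 2 ∧ (k + 1) % 6 ≠ 3) {f : A} (hf : f ∈ W.cocyc (k + 1))
    (h : W.cl (k + 1) f * W.cl 0 (W.xpow 1) = 0) : W.cl (k + 1) f =
      W.τ (f * W.test (k + 1) (n - 1)) • W.cl (k + 1) (W.rep (k + 1) (n - 1)) := by
  have h0 := W.cl_eq_sum h2 hn hf
  rw [h0, Finset.sum_eq_single ⟨n - 1, by omega⟩]
  · intro m _ hm
    have hm' : (m : ℕ) + 1 < n := by
      have := m.2
      have : (m : ℕ) ≠ n - 1 := fun h => hm (Fin.ext h)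
      omega
    rw [h0, Finset.sum_mul] at h
    simp only [smul_mul_assoc, W.cl_mul_central (W.rep_mem_cocyc (k + 1) _) (W.xpow_mul 1),
      W.rep_mul_xpow_one (k + 1) hk] at h
    -- Multiplication by `xpow 1` shifts the representatives by one place, so all coordinates but
    -- the last must vanish.
    rw [← W.cl_sum Finset.univ (fun l : Fin n => W.rep (k + 1) (l + 1))
      (fun l => W.τ (f * W.test (k + 1) l)) fun l => W.rep_mem_cocyc (k + 1) _] at h
    have h1 := W.τ_mul_test_eq_zero hn
      (Submodule.sum_mem _ fun m _ => Submodule.smul_mem _ _ (W.rep_mem_cocyc (k + 1) _)) h (m + 1)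
    rw [Finset.sum_mul, map_sum, Finset.sum_eq_single m] at h1
    · rw [smul_mul_assoc, map_smul, W.τ_rep_mul_test hn _ hm' hm', if_pos rfl, smul_eq_mul,
        mul_one] at h1
      rw [h1, zero_smul]
    · intro l _ hl
      have hlm : (l : ℕ) + 1 ≠ m + 1 := fun h => hl (Fin.ext (by omega))
      by_cases hl' : (l : ℕ) + 1 < n
      · rw [smul_mul_assoc, map_smul, W.τ_rep_mul_test hn _ hl' hm', if_neg hlm, smul_zero]
      · rw [W.rep_eq_zero hk (by omega), smul_zero, zero_mul, map_zero]
    · intro h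
      exact absurd (Finset.mem_univ _) h
  · intro h
    exact absurd (Finset.mem_univ _) h

end WalkAlgebra

/-! ### Products -/

namespace WalkAlgebra

variable {K : Type u} [Field K] {n : ℕ} {A : Type u} [Ring A] [Algebra K A]
  (W : WalkAlgebra K n A)

theorem E0_smul_D_mul_D : W.E0 • (W.D * W.D) = 0 := by
  rw [E0_smul]
  exact Finset.sum_eq_zero fun i _ => W.e_mul_D_mul_D_mul_e i

theorem xpow_last (hn : 0 < n) : W.xpow (n - 1) = W.B 0 0 (2 * (n - 1)) := by
  rw [xpow, Finset.sum_eq_single 0]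
  · intro i _ hi
    exact W.B_eq_zero _ _ _ (by unfold IsBasic; omega)
  · intro h
    exact absurd (Finset.mem_range.2 hn) h

theorem D_mul_xpow_last (hn : 0 < n) : W.D * W.xpow (n - 1) = W.soc 0 := by
  rw [W.xpow_last hn, W.D_mul_B (by unfold IsBasic; omega), soc,
    show 2 * (n - 1) + 1 = 2 * n - 1 by omega]
  simp only [if_true, W.B_eq_zero (0 + 1) 0 (2 * n - 1) (by unfold IsBasic; omega)]
  simp

theorem B_loop_mul_xpow_last (hn : 0 < n) : W.B 0 0 1 * W.xpow (n - 1) = W.soc 0 := by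
  rw [W.B_zero_mul_xpow hn, soc, show 2 * (n - 1) + 1 = 2 * n - 1 by omega]

/-! #### The chain map induced by the Euler derivation -/

theorem eulerLift_one : W.eulerLift 1 = -(W.E0 * W.dl) := by
  change (-1 : K) ^ 1 • W.leftEuler (W.E0 * (W.dl + W.dr)) = _
  rw [pow_one, neg_one_smul, leftEuler_mul, map_add, leftEuler_dl, leftEuler_dr, leftEuler_E0,
    zero_mul, zero_add, add_zero]

theorem eulerLift_three : W.eulerLift 3 = W.dl * W.E0 := by
  change (-1 : K) ^ 3 • W.leftEuler (W.twist ((W.dl - W.dr) * W.E0)) = _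
  rw [map_mul, map_sub, twist_dl, twist_dr, twist_E0, leftEuler_mul, map_sub, map_neg, leftEuler_dl,
    leftEuler_dr, leftEuler_E0, mul_zero, add_zero, sub_zero, neg_mul]
  simp [pow_succ]

theorem eulerLift_four : W.eulerLift 4 = -(W.E0 * W.dl) := by
  change (-1 : K) ^ 4 • W.leftEuler (W.twist (W.E0 * (W.dl + W.dr))) = _
  rw [map_mul, map_add, twist_dl, twist_dr, twist_E0, leftEuler_mul, map_add, map_neg, leftEuler_dl,
    leftEuler_dr, leftEuler_E0, zero_mul, zero_add, add_zero, mul_neg]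
  simp [pow_succ]

theorem eulerLift_add_six (k : ℕ) : W.eulerLift (k + 6) = W.eulerLift k := by
  rw [eulerLift, eulerLift, diff_add_six, pow_add, show (-1 : K) ^ 6 = 1 by norm_num, mul_one]

/-- The signed odd numbers. -/
def signedOdd (K : Type*) [Field K] (i : ℕ) : K := (-1) ^ i * (2 * i + 1)

theorem signedOdd_zero : signedOdd K 0 = 1 := by simp [signedOdd]

/-- With `n = -1/2` the factor `n - max l j` becomes `-(2 * max l j + 1) / 2`. The product with `2 *
min l j + 1` no longer depends on the order of `l` and `j`, and the matrix acquires rank one. -/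
theorem eulerLift_two_smul_e (h2 : (2 : K) ≠ 0) (hchar : (2 * n + 1 : K) = 0) {j : ℕ} (hj : j < n) :
    W.eulerLift 2 • W.e j =
      ∑ l ∈ Finset.range n, (2⁻¹ * signedOdd K j * signedOdd K l) • W.soc l := by
  change ((-1 : K) ^ 2 • W.leftEuler W.ω) • W.B j j 0 = _
  rw [neg_one_sq, one_smul, leftEuler_ω, W.kernel_scale_smul_B _ (isBasic_zero.2 hj), if_pos rfl]
  refine Finset.sum_congr rfl fun l hl => ?_
  rw [sum_isBasic_sign_mul (Finset.mem_range.1 hl) hj]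
  congr 1
  have hn : (n : K) = -2⁻¹ := by
    field_simp
    linear_combination hchar
  have key : ∀ a b : K, -((-1 : K) ^ (l + j) * (-2⁻¹ - a) * (2 * b + 1)) =
      (-1 : K) ^ l * (-1) ^ j * (2⁻¹ * (2 * a + 1) * (2 * b + 1)) := by
    intro a b
    rw [pow_add]
    field_simp
    ring
  rw [hn, key, signedOdd, signedOdd]
  rcases le_total l j with h | h
  · rw [max_eq_right h, min_eq_left h]; ring
  · rw [max_eq_left h, min_eq_right h]; ring

theorem cl_mul_Y {k m : ℕ} (h : k + 1 = m) {f : A} (hf : f ∈ W.cocyc k) :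
    W.cl k f * W.cl 1 W.D = W.cl m (W.eulerLift k • f) := by
  rw [← W.cl_mul ((add_comm 1 k).trans h) hf W.isLift_euler, eulerLift_zero_smul_one]

theorem cl_mul_T {k m : ℕ} (h : k + 3 = m) {f : A} (hf : f ∈ W.cocyc k) (i : ℕ) :
    W.cl k f * W.cl 3 (W.soc i) = W.cl m (W.soc i * f) := by
  have h1 := W.cl_mul ((add_comm 3 k).trans h) hf (W.isLift_soc i)
  rwa [mul_smul, mul_smul, hf.1, bi_smul_eq, mul_one, show W.idem 0 = W.E0 from rfl, E0_smul_one,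
    bi_smul_eq, mul_one, mul_one] at h1

theorem cl_mul_H {k m : ℕ} (h : k + 6 = m) {f : A} (hf : f ∈ W.cocyc k) :
    W.cl k f * W.cl 6 1 = W.cl m f := by
  have h1 := W.cl_mul ((add_comm 6 k).trans h) hf W.isLift_period
  rwa [hf.1, show W.idem 0 = W.E0 from rfl, E0_smul_one] at h1

theorem exists_degree_four_lift : ∃ G : ℕ → Env K A, W.resolution.IsLift 4 G ∧
    G 0 = bi K (W.e 0) (W.e 0) ∧ G 1 = -bi K (W.e 0) (W.e 0) ∧ ∀ k, G (k + 3) = W.twist (G k) := by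
  obtain ⟨F, hmul, he, hD⟩ := W.exists_twisted_derivation
  exact ⟨_, W.isLift_period_lift hmul he hD, rfl, rfl, fun _ => rfl⟩

theorem bi_e_smul_one (i : ℕ) : bi K (W.e i) (W.e i) • (1 : A) = W.e i := by
  rw [bi_smul_eq, mul_one, e_mul_self]

theorem twist_bi_e (i j : ℕ) : W.twist (bi K (W.e i) (W.e j)) = bi K (W.e i) (W.e j) := by
  rw [twist_bi, μ_e]

/-! #### Products with the generators of degrees one, three and six -/

theorem Y_mul_Y : W.cl 1 W.D * W.cl 1 W.D = 0 := by
  rw [W.cl_mul_Y rfl W.D_mem_cocyc, eulerLift_one, neg_smul, mul_smul, dl_smul, E0_smul_D_mul_D,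
    neg_zero, cl_zero]

theorem Z_mul_Y (h2 : (2 : K) ≠ 0) (hchar : (2 * n + 1 : K) = 0) {j : ℕ} (hj : j < n) :
    W.cl 2 (W.e j) * W.cl 1 W.D =
      ∑ l : Fin n, (2⁻¹ * signedOdd K j * signedOdd K l) • W.cl 3 (W.soc l) := by
  rw [W.cl_mul_Y rfl (W.e_mem_cocyc_two j), W.eulerLift_two_smul_e h2 hchar hj,
    Finset.sum_range fun l => (2⁻¹ * signedOdd K j * signedOdd K l) • W.soc l,
    W.cl_sum Finset.univ (fun l : Fin n => W.soc l) _ fun l => W.soc_mem_cocyc l]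

theorem T_mul_Y (hn : 0 < n) (i : ℕ) : W.cl 3 (W.soc i) * W.cl 1 W.D = 0 := by
  rw [W.cl_mul_Y rfl (W.soc_mem_cocyc i), eulerLift_three, mul_smul,
    show W.E0 • W.soc i = W.soc i from (W.soc_mem_cocyc i).1, dl_smul, W.D_mul_soc hn, cl_zero]

theorem Y_mul_T (hn : 0 < n) (i : ℕ) : W.cl 1 W.D * W.cl 3 (W.soc i) = 0 := by
  rw [W.cl_mul_T rfl W.D_mem_cocyc, W.soc_mul_D hn, cl_zero]

theorem T_mul_T (hn : 0 < n) (i j : ℕ) : W.cl 3 (W.soc i) * W.cl 3 (W.soc j) = 0 := by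
  rw [W.cl_mul_T rfl (W.soc_mem_cocyc i), W.soc_mul_soc _ _ hn, cl_zero]

theorem E0_smul_D_mul_e_zero_mul (hn : 0 < n) {c : A} (hc : ∀ a, c * a = a * c) :
    W.E0 • (W.D * (W.e 0 * c)) = W.B 0 0 1 * c := by
  rw [← mul_assoc, smul_mul_central _ hc, e, W.E0_smul_D_mul_B_zero (isBasic_zero.2 hn)]

theorem e_zero_mul_Y (hn : 0 < n) {c : A} (hc : ∀ a, c * a = a * c) :
    W.cl 4 (W.e 0 * c) * W.cl 1 W.D = -W.cl 5 (W.B 0 0 1 * c) := by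
  rw [W.cl_mul_Y rfl (W.mul_central_mem_cocyc W.e_zero_mem_cocyc hc), eulerLift_four, neg_smul,
    mul_smul, dl_smul, W.E0_smul_D_mul_e_zero_mul hn hc,
    W.cl_neg (W.mul_central_mem_cocyc W.B_loop_mem_cocyc hc)]

theorem G_mul_Y (hn : 0 < n) : W.cl 4 (W.e 0) * W.cl 1 W.D = -W.cl 5 (W.B 0 0 1) := by
  have h := W.e_zero_mul_Y hn (c := 1) fun a => by rw [one_mul, mul_one]
  rwa [mul_one, mul_one] at h

theorem one_mem_cocyc_six : (1 : A) ∈ W.cocyc 6 := by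
  have h := W.rep_mem_cocyc 6 0
  rwa [show W.rep 6 0 = W.xpow 0 from rfl, xpow_zero] at h

theorem mem_cocyc_six {f : A} (hf : f ∈ W.cocyc 0) : f ∈ W.cocyc 6 :=
  ⟨hf.1, by rw [W.diff_add_six 0]; exact hf.2⟩

theorem cl_six_mul_Y {c : A} (hc : ∀ a, c * a = a * c) :
    W.cl 6 c * W.cl 1 W.D = W.cl 7 (W.D * c) := by
  rw [W.cl_mul_Y rfl (W.mem_cocyc_six (W.central_mem_cocyc hc)), W.eulerLift_add_six 0,
    W.eulerLift_zero_smul c hc]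

theorem H_mul_Y : W.cl 6 1 * W.cl 1 W.D = W.cl 7 W.D := by
  rw [W.cl_six_mul_Y fun a => by rw [one_mul, mul_one], mul_one]

theorem Y_mul_H : W.cl 1 W.D * W.cl 6 1 = W.cl 7 W.D := W.cl_mul_H rfl W.D_mem_cocyc

theorem H_mul_T (i : ℕ) : W.cl 6 1 * W.cl 3 (W.soc i) = W.cl 9 (W.soc i) := by
  rw [W.cl_mul_T rfl W.one_mem_cocyc_six, mul_one]

theorem T_mul_H (i : ℕ) : W.cl 3 (W.soc i) * W.cl 6 1 = W.cl 9 (W.soc i) :=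
  W.cl_mul_H rfl (W.soc_mem_cocyc i)

theorem G_mul_T (i : ℕ) : W.cl 4 (W.e 0) * W.cl 3 (W.soc i) =
    if i = 0 then W.cl 7 (W.soc 0) else 0 := by
  rw [W.cl_mul_T rfl W.e_zero_mem_cocyc, soc_mul_e]
  split_ifs with h
  · rw [h]
  · exact W.cl_zero 7

theorem Z_mul_T (k i : ℕ) : W.cl 2 (W.e k) * W.cl 3 (W.soc i) =
    if i = k then W.cl 5 (W.soc i) else 0 := by
  rw [W.cl_mul_T rfl (W.e_mem_cocyc_two k), soc_mul_e]
  split_ifs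
  · rfl
  · exact W.cl_zero 5

theorem Z_mul_H (j : ℕ) : W.cl 2 (W.e j) * W.cl 6 1 = W.cl 8 (W.e j) :=
  W.cl_mul_H rfl (W.e_mem_cocyc_two j)

theorem G_mul_H : W.cl 4 (W.e 0) * W.cl 6 1 = W.cl 10 (W.e 0) := W.cl_mul_H rfl W.e_zero_mem_cocyc

/-! #### Right products with the generator of degree four -/

theorem H_mul_G : W.cl 6 1 * W.cl 4 (W.e 0) = W.cl 10 (W.e 0) := by
  obtain ⟨G, hG, h0, _, h3⟩ := W.exists_degree_four_lift
  have h := W.cl_mul (m := 10) rfl W.one_mem_cocyc_six hG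
  rwa [h3 3, h3 0, h0, twist_bi_e, twist_bi_e, bi_e_smul_one] at h

theorem Y_mul_G (hn : 0 < n) : W.cl 1 W.D * W.cl 4 (W.e 0) = -W.cl 5 (W.B 0 0 1) := by
  obtain ⟨G, hG, h0, h1, _⟩ := W.exists_degree_four_lift
  have h := W.cl_mul (m := 5) rfl W.D_mem_cocyc hG
  rw [h0, h1, bi_e_smul_one, neg_smul, bi_smul_eq, mul_assoc] at h
  rw [h, ← W.cl_neg W.B_loop_mem_cocyc]
  congr 2
  have hD : W.D * W.e 0 = W.B 0 0 1 + W.B 1 0 1 := by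
    have h := W.D_mul_B (isBasic_zero.2 hn)
    rwa [if_pos rfl] at h
  rw [hD, mul_add, e_mul_B, if_pos rfl, e_mul_B, if_neg (Nat.succ_ne_zero 0).symm, add_zero]

theorem T_mul_G (i : ℕ) : W.cl 3 (W.soc i) * W.cl 4 (W.e 0) =
    if i = 0 then W.cl 7 (W.soc 0) else 0 := by
  obtain ⟨G, hG, h0, h1, h3⟩ := W.exists_degree_four_lift
  have h := W.cl_mul (m := 7) rfl (W.soc_mem_cocyc i) hG
  rw [h3 0, h0, twist_bi_e, bi_e_smul_one, bi_smul_eq, ← W.soc_mul, soc_mul_e] at h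
  rw [h]
  split_ifs with hi
  · rw [hi, soc_mul_e, if_pos rfl]
  · rw [zero_mul, cl_zero]

theorem G_mul_G : W.cl 4 (W.e 0) * W.cl 4 (W.e 0) = -W.cl 8 (W.e 0) := by
  obtain ⟨G, hG, h0, h1, h3⟩ := W.exists_degree_four_lift
  have h := W.cl_mul (m := 8) rfl W.e_zero_mem_cocyc hG
  rw [h3 1, h0, h1, map_neg, twist_bi_e, bi_e_smul_one, neg_smul, bi_smul_eq, e_mul_self,
    e_mul_self] at h
  rw [h, W.cl_neg]
  exact (W.rep_mem_cocyc 8 0)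

/-! #### Classes of socle elements -/

/-- Socle elements have odd length `2 * n - 1`, so they can be moved to the loop modulo the image of
`diff 4`. -/
theorem cl_five_soc {i : ℕ} (hi : i < n) : W.cl 5 (W.soc i) = W.cl 5 (W.soc 0) := by
  have hmem : ∀ j, j < n → W.soc j ∈ W.cocyc 5 := fun j hj =>
    W.smul_mem_cocyc (i := 2) rfl (W.e_mem_cocyc_two j) (W.isLift_soc j) |> fun h => by
      rwa [mul_smul, (W.e_mem_cocyc_two j).1, bi_smul_eq, mul_one, soc_mul_e, if_pos rfl] at h
  rw [← sub_eq_zero]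
  have h1 : W.soc i - W.soc 0 ∈ W.bdry 4 := by
    have h := W.B_odd_sub_mem_bdry_four i (n - 1) (by unfold IsBasic; omega)
    rwa [show 2 * (n - 1) + 1 = 2 * n - 1 by omega] at h
  have h2 := (W.cl_eq_zero_iff (W.bdry_le_cocyc 4 h1)).2 h1
  have h3 := W.cl_add (W.bdry_le_cocyc 4 h1) (hmem 0 (by omega))
  rw [sub_add_cancel] at h3
  rw [h3, h2, zero_add, sub_self]

end WalkAlgebra

namespace WalkAlgebra

variable {K : Type u} [Field K] {n : ℕ} {A : Type u} [Ring A] [Algebra K A]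
  (W : WalkAlgebra K n A)

/-! #### Products with the generators of degree two -/

theorem rep_five_last (hn : 0 < n) : W.rep 5 (n - 1) = W.soc 0 := W.B_loop_mul_xpow_last hn

theorem rep_seven_last (hn : 0 < n) : W.rep 7 (n - 1) = W.soc 0 := W.D_mul_xpow_last hn

theorem soc_zero_mem_cocyc_five (hn : 0 < n) : W.soc 0 ∈ W.cocyc 5 := by
  rw [← W.rep_five_last hn]
  exact W.rep_mem_cocyc 5 _

theorem soc_mul_twist_smul (i : ℕ) (s : Env K A) (a : A) :
    W.soc i * W.twist s • a = W.soc i * s • a := by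
  induction s using env_induction with
  | h0 => rw [map_zero]
  | h1 u v => rw [twist_bi, bi_smul_eq, bi_smul_eq, ← mul_assoc, ← mul_assoc, ← mul_assoc,
      ← mul_assoc, soc_mul_μ]
  | h2 s t hs ht => rw [map_add, add_smul, add_smul, mul_add, mul_add, hs, ht]

/-- If a chain map of degree five is null homotopic, then so is its twisted translate. -/
theorem τ_twist_smul_one_eq (hn : 0 < n) {L L' : ℕ → Env K A} (hL : W.resolution.IsLift 5 L)
    (hL' : W.resolution.IsLift 5 L') (h : L 0 • (1 : A) - L' 0 • (1 : A) ∈ W.bdry 4) :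
    W.τ (W.twist (L 3) • (1 : A)) = W.τ (W.twist (L' 3) • (1 : A)) := by
  obtain ⟨g, hg⟩ := W.mem_bdry.1 h
  obtain ⟨s, t, hst⟩ := hL.exists_homotopy hL' hg 3
  -- After twisting, `diff 3` becomes `diff 0`, which kills `1`, and `diff 7` becomes `diff 4`,
  -- whose image has trace zero.
  have hst' : L 3 - L' 3 = W.diff 7 * s + t * W.diff 3 := hst
  have h1 := congrArg (fun s => W.twist s • (1 : A)) hst'
  simp only [map_sub, map_add, map_mul, sub_smul, add_smul, mul_smul] at h1
  rw [show W.twist (W.diff 3) = W.diff 0 from W.twist_twist _, W.diff_zero_smul_one, smul_zero,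
    add_zero, show W.twist (W.diff 7) = W.diff 4 from W.twist_twist _] at h1
  have h2 := W.τ_bdry_mul_test hn 4 (m := n - 1) (W.smul_mem_bdry 4 (W.twist s • (1 : A)))
  rw [show W.test 5 (n - 1) = W.xpow (n - 1 - (n - 1)) from rfl, Nat.sub_self, xpow_zero, mul_one,
    ← h1, map_sub, sub_eq_zero] at h2
  exact h2

theorem μ_soc (hn : 0 < n) (i : ℕ) : W.μ (W.soc i) = -W.soc i := by
  rw [soc, μ_B, show 2 * n - 1 = 2 * (n - 1) + 1 by omega, pow_succ, pow_mul]
  simp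

theorem soc_mul_smul_one (i : ℕ) (s : Env K A) : W.soc i * s • (1 : A) = s • W.soc i := by
  have h := smul_mul_central s (W.soc_mul i) 1
  rw [one_mul] at h
  rw [h, W.soc_mul]

/-- The lift `G` is arbitrary. Composed with the lift of `soc i` it represents the known product
`z_j t_i`, which is also represented by an explicit composite of the lifts of degrees four, one and
zero. The two are homotopic, and comparing them three steps further on gives information about the
opposite product `t_i z_j`. -/
theorem τ_smul_soc_of_isLift (hn : 0 < n) {i j : ℕ} (hi : i < n) {G : ℕ → Env K A}
    (hG : W.resolution.IsLift 2 G) (h0 : G 0 • (1 : A) = W.e j) :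
    W.τ (G 3 • W.soc i) = if i = j then 1 else 0 := by
  obtain ⟨P, hP, hP0, hP1, hP3⟩ := W.exists_degree_four_lift
  have hL := (W.isLift_soc i).comp hG
  -- The sign compensates the minus sign of `P 1`; the last power of the central element turns `D`
  -- into `soc 0`.
  set c : A := (if i = j then (-1 : K) else 0) • W.xpow (n - 1) with hc
  have hcc : ∀ a, c * a = a * c := fun a => by
    rw [hc, smul_mul_assoc, mul_smul_comm, W.xpow_mul]
  have hL' := (hP.comp W.isLift_euler).comp (W.isLift_central hcc)
  have key := W.τ_twist_smul_one_eq hn hL hL' (by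
    have h1 : (bi K (W.soc i) 1 * W.idem 2 * G 0) • (1 : A) = if i = j then W.soc i else 0 := by
      rw [mul_smul, h0, mul_smul, (W.e_mem_cocyc_two j).1, bi_smul_eq, mul_one, soc_mul_e]
    have h2 : (P 1 * W.eulerLift 0 * (bi K c 1 * W.idem 0)) • (1 : A) =
        if i = j then W.soc 0 else 0 := by
      rw [mul_smul, mul_smul _ (W.idem 0), show W.idem 0 = W.E0 from rfl, E0_smul_one, bi_smul_eq,
        mul_one, mul_one, mul_smul, W.eulerLift_zero_smul c hcc, hP1, neg_smul, bi_smul_eq, hc,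
        mul_smul_comm, W.D_mul_xpow_last hn]
      split_ifs with h
      · rw [neg_one_smul, mul_neg, neg_mul, neg_neg, ← W.soc_mul, soc_mul_e, if_pos rfl, soc_mul_e,
          if_pos rfl]
      · rw [zero_smul, mul_zero, zero_mul, neg_zero]
    change (bi K (W.soc i) 1 * W.idem 2 * G 0) • (1 : A) -
      (P 1 * W.eulerLift 0 * (bi K c 1 * W.idem 0)) • (1 : A) ∈ W.bdry 4
    rw [h1, h2]
    split_ifs with h
    · have h := W.B_odd_sub_mem_bdry_four i (n - 1) (by unfold IsBasic; omega)
      rwa [show 2 * (n - 1) + 1 = 2 * n - 1 by omega] at h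
    · rw [sub_zero]
      exact zero_mem _)
  have h1 : W.twist (bi K (W.soc i) 1 * W.idem 5 * G 3) • (1 : A) = -(G 3 • W.soc i) := by
    have h2 : W.idem 5 * G 3 = G 3 := hG.e_mul 3
    rw [mul_assoc, h2, map_mul, mul_smul, twist_bi, W.μ_soc hn, bi_smul_eq, mul_one, neg_mul,
      soc_mul_twist_smul, soc_mul_smul_one]
  have h2 : W.twist (P 4 * W.eulerLift 3 * (bi K c 1 * W.idem 3)) • (1 : A) =
      if i = j then -W.soc 0 else 0 := by
    rw [hP3 1, hP1, eulerLift_three, map_mul, map_mul, map_mul, map_mul, twist_twist, twist_dl,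
      twist_E0, twist_bi, twist_idem, mul_smul, mul_smul _ (W.idem 3),
      show W.idem 3 = W.E0 from rfl, E0_smul_one, bi_smul_eq,
      mul_one, mul_one, mul_smul, mul_smul, hc, map_smul, μ_xpow, env_smul_comm,
      show W.E0 • W.xpow (n - 1) = W.xpow (n - 1) from (W.rep_mem_cocyc 0 _).1, neg_smul, neg_smul, dl_smul,
      mul_smul_comm, W.D_mul_xpow_last hn, smul_neg, neg_neg, bi_smul_eq]
    split_ifs with h
    · rw [neg_one_smul, mul_neg, neg_mul, ← W.soc_mul, soc_mul_e, if_pos rfl, soc_mul_e, if_pos rfl]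
    · rw [zero_smul, mul_zero, zero_mul]
  have key' : W.τ (W.twist (bi K (W.soc i) 1 * W.idem 5 * G 3) • (1 : A)) =
    W.τ (W.twist (P 4 * W.eulerLift 3 * (bi K c 1 * W.idem 3)) • (1 : A)) := key
  rw [h1, h2, map_neg] at key'
  rw [← neg_inj, key']
  split_ifs
  · rw [map_neg, W.τ_soc hn]
  · rw [map_zero, neg_zero]

theorem T_mul_X (i : ℕ) : W.cl 3 (W.soc i) * W.cl 0 (W.xpow 1) = 0 := by
  rw [W.cl_mul_central (W.soc_mem_cocyc i) (W.xpow_mul 1), W.soc_mul_xpow i 1 one_ne_zero, cl_zero]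

theorem Z_mul_X (h2 : (2 : K) ≠ 0) (j : ℕ) : W.cl 2 (W.e j) * W.cl 0 (W.xpow 1) = 0 := by
  have h1 := W.e_mem_cocyc_two j
  rw [W.cl_mul_central h1 (W.xpow_mul 1),
    W.cl_eq_zero_iff (k := 1) (W.mul_central_mem_cocyc h1 (W.xpow_mul 1))]
  by_cases hj : j < n
  · rw [e, W.B_mul_xpow 1 (isBasic_zero.2 hj)]
    exact W.B_succ_mem_bdry_one h2 j _
  · rw [W.e_eq_zero (by omega), zero_mul]
    exact zero_mem _

theorem mul_assoc_X {k : ℕ} {f : A} (hf : f ∈ W.cocyc k) (a : HHAlgebra K A) :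
    a * W.cl k f * W.cl 0 (W.xpow 1) = a * W.cl 0 (W.xpow 1) * W.cl k f := by
  rw [mul_assoc, ← W.central_mul_cl_comm hf (W.xpow_mul 1), mul_assoc]

/-- The product is killed by `x_0`, hence a multiple of the last class of degree five, and the
coefficient is a trace already computed. -/
theorem T_mul_Z (h2 : (2 : K) ≠ 0) (hn : 0 < n) {i : ℕ} (hi : i < n) (j : ℕ) :
    W.cl 3 (W.soc i) * W.cl 2 (W.e j) = if i = j then W.cl 5 (W.soc 0) else 0 := by
  have hj := W.e_mem_cocyc_two j
  obtain ⟨G, hG, h0⟩ := W.resolution.exists_isLift (j := 2) (f := W.e j) hj.1 hj.2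
  have h0' : G 0 • (1 : A) = W.e j := h0
  have h := W.cl_mul (m := 5) rfl (W.soc_mem_cocyc i) hG
  rw [h0'] at h
  have h3 : W.cl 5 (G 3 • W.soc i) * W.cl 0 (W.xpow 1) = 0 := by
    rw [← h, W.mul_assoc_X hj, T_mul_X, zero_mul]
  have h4 := W.cl_eq_smul_of_mul_eq_zero h2 hn (k := 4) (by omega)
    (W.smul_mem_cocyc (m := 5) rfl (W.soc_mem_cocyc i) hG) h3
  rw [h, h4, show W.test (4 + 1) (n - 1) = W.xpow (n - 1 - (n - 1)) from rfl, Nat.sub_self,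
    xpow_zero, mul_one, W.τ_smul_soc_of_isLift hn hi hG h0', W.rep_five_last hn]
  split_ifs
  · rw [one_smul]
  · rw [zero_smul]

theorem Z_mul_T_of_lt {i : ℕ} (hi : i < n) (k : ℕ) : W.cl 2 (W.e k) * W.cl 3 (W.soc i) =
    if i = k then W.cl 5 (W.soc 0) else 0 := by
  rw [Z_mul_T, W.cl_five_soc hi]

theorem exists_cl_mul {i j m : ℕ} (h : i + j = m) {f g : A} (hf : f ∈ W.cocyc i)
    (hg : g ∈ W.cocyc j) : ∃ a ∈ W.cocyc m, W.cl i f * W.cl j g = W.cl m a := by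
  obtain ⟨G, hG, h0⟩ := W.resolution.exists_isLift hg.1 hg.2
  have h0' : G 0 • (1 : A) = g := h0
  refine ⟨_, W.smul_mem_cocyc ((add_comm j i).trans h) hf hG, ?_⟩
  rw [← h0', W.cl_mul ((add_comm j i).trans h) hf hG]

theorem cl_five_ne_zero (hn : 0 < n) : W.cl 5 (W.soc 0) ≠ 0 := by
  rw [← W.rep_five_last hn]
  exact W.cl_rep_ne_zero hn 4 (by omega)

/-- The coordinate of `y z_j` at `l` is detected by `z_l (y z_j) = (z_l y) z_j`. The right side is
known, and the result agrees with `z_j y` because the matrix is symmetric. -/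
theorem Y_mul_Z (h2 : (2 : K) ≠ 0) (hn : 0 < n) (hchar : (2 * n + 1 : K) = 0) {j : ℕ}
    (hj : j < n) : W.cl 1 W.D * W.cl 2 (W.e j) = W.cl 2 (W.e j) * W.cl 1 W.D := by
  obtain ⟨a, ha, h⟩ := W.exists_cl_mul (m := 3) rfl W.D_mem_cocyc (W.e_mem_cocyc_two j)
  have h1 := W.cl_eq_sum h2 hn (k := 2) ha
  rw [h, W.Z_mul_Y h2 hchar hj, h1]
  refine Finset.sum_congr rfl fun l _ => ?_
  change _ • W.cl 3 (W.soc l) = _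
  congr 1
  have h3 : W.cl 2 (W.e l) * W.cl 3 a = W.τ (a * W.test 3 l) • W.cl 5 (W.soc 0) := by
    rw [h1, Finset.mul_sum, Finset.sum_eq_single l]
    · change _ * _ • W.cl 3 (W.soc l) = _
      rw [mul_smul_comm, W.Z_mul_T_of_lt l.2, if_pos rfl]
    · intro k _ hk
      change _ * _ • W.cl 3 (W.soc k) = _
      rw [mul_smul_comm, W.Z_mul_T_of_lt k.2, if_neg (fun h => hk (Fin.ext h)), smul_zero]
    · intro h
      exact absurd (Finset.mem_univ _) h
  rw [← h, ← mul_assoc, W.Z_mul_Y h2 hchar l.2, Finset.sum_mul,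
    Finset.sum_eq_single ⟨j, hj⟩] at h3
  · rw [smul_mul_assoc, W.T_mul_Z h2 hn hj, if_pos rfl] at h3
    have := smul_left_injective K (W.cl_five_ne_zero hn) h3
    rw [← this]
    ring
  · intro k _ hk
    rw [smul_mul_assoc, W.T_mul_Z h2 hn k.2, if_neg (fun h => hk (Fin.ext h)), smul_zero]
  · intro h
    exact absurd (Finset.mem_univ _) h

theorem sum_T_mul_G (hn : 0 < n) (c : ℕ → K) :
    (∑ l : Fin n, c l • W.cl 3 (W.soc l)) * W.cl 4 (W.e 0) = c 0 • W.cl 7 (W.soc 0) := by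
  rw [Finset.sum_mul, Finset.sum_eq_single ⟨0, hn⟩]
  · rw [smul_mul_assoc, T_mul_G, if_pos rfl]
  · intro k _ hk
    rw [smul_mul_assoc, T_mul_G, if_neg (fun h => hk (Fin.ext h)), smul_zero]
  · intro h
    exact absurd (Finset.mem_univ _) h

theorem G_mul_sum_T (hn : 0 < n) (c : ℕ → K) :
    W.cl 4 (W.e 0) * (∑ l : Fin n, c l • W.cl 3 (W.soc l)) = c 0 • W.cl 7 (W.soc 0) := by
  rw [Finset.mul_sum, Finset.sum_eq_single ⟨0, hn⟩]
  · rw [mul_smul_comm, G_mul_T, if_pos rfl]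
  · intro k _ hk
    rw [mul_smul_comm, G_mul_T, if_neg (fun h => hk (Fin.ext h)), smul_zero]
  · intro h
    exact absurd (Finset.mem_univ _) h

theorem cl_seven_ne_zero (hn : 0 < n) : W.cl 7 (W.soc 0) ≠ 0 := by
  rw [← W.rep_seven_last hn]
  exact W.cl_rep_ne_zero hn 6 (by omega)

/-- A class of degree six killed by `x₀` is determined by its product with the Euler class. -/
theorem cl_six_eq_of_mul_Y (h2 : (2 : K) ≠ 0) (hn : 0 < n) {a : A} (ha : a ∈ W.cocyc 6)
    (h : W.cl 6 a * W.cl 0 (W.xpow 1) = 0) {c : K}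
    (hY : W.cl 6 a * W.cl 1 W.D = c • W.cl 7 (W.soc 0)) :
    W.cl 6 a = c • W.cl 6 (W.xpow (n - 1)) := by
  have h1 := W.cl_eq_smul_of_mul_eq_zero h2 hn (k := 5) (by omega) ha h
  change W.cl 6 a = _ • W.cl 6 (W.xpow (n - 1)) at h1
  rw [h1, smul_mul_assoc, W.cl_six_mul_Y (W.xpow_mul _), W.D_mul_xpow_last hn] at hY
  rw [h1, smul_left_injective K (W.cl_seven_ne_zero hn) hY]

/-- Since `x_0` kills the product, only the last coordinate is unknown. Multiplication by `y`
detects it: `y` commutes with the class of degree four, and then meets `z_j` in a known product. -/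
theorem Z_mul_G (h2 : (2 : K) ≠ 0) (hn : 0 < n) (hchar : (2 * n + 1 : K) = 0) {j : ℕ}
    (hj : j < n) : W.cl 2 (W.e j) * W.cl 4 (W.e 0) =
      (2⁻¹ * signedOdd K j) • W.cl 6 (W.xpow (n - 1)) := by
  obtain ⟨a, ha, h⟩ := W.exists_cl_mul (m := 6) rfl (W.e_mem_cocyc_two j) W.e_zero_mem_cocyc
  rw [h]
  refine W.cl_six_eq_of_mul_Y h2 hn ha ?_ ?_
  · rw [← h, W.mul_assoc_X W.e_zero_mem_cocyc, W.Z_mul_X h2, zero_mul]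
  · rw [← h, mul_assoc, W.G_mul_Y hn, ← W.Y_mul_G hn, ← mul_assoc, W.Z_mul_Y h2 hchar hj,
      W.sum_T_mul_G hn fun l => 2⁻¹ * signedOdd K j * signedOdd K l, signedOdd_zero, mul_one]

theorem G_mul_Z (h2 : (2 : K) ≠ 0) (hn : 0 < n) (hchar : (2 * n + 1 : K) = 0) {j : ℕ}
    (hj : j < n) : W.cl 4 (W.e 0) * W.cl 2 (W.e j) =
      (2⁻¹ * signedOdd K j) • W.cl 6 (W.xpow (n - 1)) := by
  obtain ⟨a, ha, h⟩ := W.exists_cl_mul (m := 6) rfl W.e_zero_mem_cocyc (W.e_mem_cocyc_two j)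
  rw [h]
  refine W.cl_six_eq_of_mul_Y h2 hn ha ?_ ?_
  · rw [← h, mul_assoc, W.Z_mul_X h2, mul_zero]
  · rw [← h, mul_assoc, W.Z_mul_Y h2 hchar hj,
      W.G_mul_sum_T hn fun l => 2⁻¹ * signedOdd K j * signedOdd K l, signedOdd_zero, mul_one]

theorem Z_mul_Z (h2 : (2 : K) ≠ 0) (hn : 0 < n) (hchar : (2 * n + 1 : K) = 0) {i j : ℕ}
    (hi : i < n) (hj : j < n) : W.cl 2 (W.e i) * W.cl 2 (W.e j) =
      -(2⁻¹ * signedOdd K i * signedOdd K j) • W.cl 4 (W.e 0 * W.xpow (n - 1)) := by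
  obtain ⟨a, ha, h⟩ := W.exists_cl_mul (m := 4) rfl (W.e_mem_cocyc_two i) (W.e_mem_cocyc_two j)
  have h1 := W.cl_eq_smul_of_mul_eq_zero h2 hn (k := 3) (by omega) ha
    (by rw [← h, mul_assoc, W.Z_mul_X h2, mul_zero])
  change W.cl 4 a = _ • W.cl 4 (W.e 0 * W.xpow (n - 1)) at h1
  -- Multiplying by `y` on the right reduces `z_i z_j` to products `z_i t_l`, of which only `l = i`
  -- survives.
  have h3 : W.cl 4 a * W.cl 1 W.D = (2⁻¹ * signedOdd K i * signedOdd K j) • W.cl 5 (W.soc 0) := by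
    rw [← h, mul_assoc, W.Z_mul_Y h2 hchar hj, Finset.mul_sum, Finset.sum_eq_single ⟨i, hi⟩]
    · rw [mul_smul_comm, W.Z_mul_T_of_lt hi, if_pos rfl]
      congr 1
      ring
    · intro k _ hk
      rw [mul_smul_comm, W.Z_mul_T_of_lt k.2, if_neg (fun h => hk (Fin.ext h)), smul_zero]
    · intro h
      exact absurd (Finset.mem_univ _) h
  rw [h1, smul_mul_assoc, W.e_zero_mul_Y hn (W.xpow_mul _), W.B_loop_mul_xpow_last hn, smul_neg,
    ← neg_smul] at h3
  rw [h, h1, ← smul_left_injective K (W.cl_five_ne_zero hn) h3, neg_neg]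

theorem cl_five_eq (hn : 0 < n) : W.cl 5 (W.soc 0) =
    -(W.cl 0 (W.xpow (n - 1)) * W.cl 1 W.D * W.cl 4 (W.e 0)) := by
  rw [mul_assoc, W.Y_mul_G hn, mul_neg, neg_neg,
    W.central_mul_cl_comm W.B_loop_mem_cocyc (W.xpow_mul _),
    W.cl_mul_central W.B_loop_mem_cocyc (W.xpow_mul _), W.B_loop_mul_xpow_last hn]

/-- The class of degree five is, up to sign, a product of a central class and the classes of degrees
one and four, each of which commutes with the period. -/
theorem H_mul_cl_five (hn : 0 < n) : W.cl 6 1 * W.cl 5 (W.soc 0) = W.cl 11 (W.soc 0) := by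
  rw [← W.cl_mul_H (m := 11) rfl (W.soc_zero_mem_cocyc_five hn), W.cl_five_eq hn, mul_neg, neg_mul,
    ← mul_assoc, ← mul_assoc, ← W.central_mul_cl_comm W.one_mem_cocyc_six (W.xpow_mul _),
    mul_assoc _ (W.cl 6 1), H_mul_Y, ← Y_mul_H, mul_assoc, mul_assoc, mul_assoc, H_mul_G, ← G_mul_H]
  simp only [mul_assoc]

/-- The coordinates of the unknown class are read off by right multiplication with the `t_l`, for
which both `z_j t_l` and the commutation with the period are known. -/
theorem H_mul_Z (h2 : (2 : K) ≠ 0) (hn : 0 < n) {j : ℕ} (hj : j < n) :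
    W.cl 6 1 * W.cl 2 (W.e j) = W.cl 8 (W.e j) := by
  obtain ⟨a, ha, h⟩ := W.exists_cl_mul (m := 8) rfl W.one_mem_cocyc_six (W.e_mem_cocyc_two j)
  have h1 := W.cl_eq_sum h2 hn (k := 7) ha
  have h5 : W.cl 11 (W.soc 0) ≠ 0 := by
    rw [← W.rep_five_last hn]
    exact W.cl_rep_ne_zero hn 10 (by omega)
  have h3 : ∀ l : Fin n, W.cl 8 a * W.cl 3 (W.soc l) = W.τ (a * W.test 8 l) • W.cl 11 (W.soc 0) := by
    intro l
    have h4 : ∀ k : ℕ, W.cl 8 (W.e k) * W.cl 3 (W.soc l) =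
        if (l : ℕ) = k then W.cl 11 (W.soc 0) else 0 := by
      intro k
      rw [← Z_mul_H, mul_assoc, H_mul_T, ← T_mul_H, ← mul_assoc, W.Z_mul_T_of_lt l.2, ite_mul,
        zero_mul, W.cl_mul_H (m := 11) rfl (W.soc_zero_mem_cocyc_five hn)]
    rw [h1, Finset.sum_mul, Finset.sum_eq_single l]
    · change (_ • W.cl 8 (W.e l)) * _ = _
      rw [smul_mul_assoc, h4, if_pos rfl]
    · intro k _ hk
      change (_ • W.cl 8 (W.e k)) * _ = _
      rw [smul_mul_assoc, h4, if_neg (fun h => hk (Fin.ext h.symm)), smul_zero]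
    · intro h
      exact absurd (Finset.mem_univ _) h
  have h4 : ∀ l : Fin n, W.τ (a * W.test 8 l) = if (l : ℕ) = j then 1 else 0 := by
    intro l
    refine smul_left_injective K h5 (Eq.trans (h3 l).symm ?_)
    rw [← h, mul_assoc, W.Z_mul_T_of_lt l.2]
    split_ifs
    · exact (W.H_mul_cl_five hn).trans (one_smul K _).symm
    · exact (mul_zero _).trans (zero_smul K _).symm
  rw [h, h1, Finset.sum_eq_single ⟨j, hj⟩]
  · rw [h4, if_pos rfl, one_smul]
    rfl
  · intro k _ hk
    rw [h4, if_neg (fun h => hk (Fin.ext h)), zero_smul]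
  · intro h
    exact absurd (Finset.mem_univ _) h

/-! #### Products with the socle of the algebra -/

theorem soc_mem_center_cocyc (i : ℕ) : W.soc i ∈ W.cocyc 0 := W.central_mem_cocyc (W.soc_mul i)

theorem soc_mul_X (i : ℕ) : W.cl 0 (W.soc i) * W.cl 0 (W.xpow 1) = 0 := by
  rw [W.cl_mul_central (W.soc_mem_center_cocyc i) (W.xpow_mul 1), W.soc_mul_xpow i 1 one_ne_zero,
    cl_zero]

theorem soc_mul_soc_cl (hn : 0 < n) (i j : ℕ) : W.cl 0 (W.soc i) * W.cl 0 (W.soc j) = 0 := by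
  rw [W.cl_mul_central (W.soc_mem_center_cocyc i) (W.soc_mul j), W.soc_mul_soc i j hn, cl_zero]

theorem soc_mul_cl {k : ℕ} {f : A} (hf : f ∈ W.cocyc (k + 1)) (i : ℕ)
    (h : W.soc i * f ∈ W.bdry k) : W.cl 0 (W.soc i) * W.cl (k + 1) f = 0 := by
  rw [W.central_mul_cl_comm hf (W.soc_mul i), W.cl_mul_central hf (W.soc_mul i), ← W.soc_mul,
    W.cl_eq_zero_iff (by rw [W.soc_mul]; exact W.mul_central_mem_cocyc hf (W.soc_mul i))]
  exact h

theorem soc_mul_Y (hn : 0 < n) (i : ℕ) : W.cl 0 (W.soc i) * W.cl 1 W.D = 0 :=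
  W.soc_mul_cl W.D_mem_cocyc i (by rw [W.soc_mul_D hn]; exact zero_mem _)

theorem soc_mul_Z (h2 : (2 : K) ≠ 0) (hn : 0 < n) (i j : ℕ) :
    W.cl 0 (W.soc i) * W.cl 2 (W.e j) = 0 :=
  W.soc_mul_cl (W.e_mem_cocyc_two j) i (by
    rw [soc_mul_e]
    split_ifs
    · have h := W.B_succ_mem_bdry_one h2 i (2 * n - 1 - 1)
      rwa [show 2 * n - 1 - 1 + 1 = 2 * n - 1 by omega] at h
    · exact zero_mem _)

theorem soc_mul_T (hn : 0 < n) (i j : ℕ) : W.cl 0 (W.soc i) * W.cl 3 (W.soc j) = 0 :=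
  W.soc_mul_cl (W.soc_mem_cocyc j) i (by rw [W.soc_mul_soc i j hn]; exact zero_mem _)

theorem soc_mul_G (h2 : (2 : K) ≠ 0) (hn : 0 < n) (i : ℕ) :
    W.cl 0 (W.soc i) * W.cl 4 (W.e 0) = 0 :=
  W.soc_mul_cl W.e_zero_mem_cocyc i (by
    rw [soc_mul_e]
    split_ifs with h
    · have h1 := W.B_odd_mem_bdry_three h2 (n - 1)
      rwa [show 2 * (n - 1) + 1 = 2 * n - 1 by omega, ← soc, ← h] at h1
    · exact zero_mem _)

theorem soc_mul_H (h2 : (2 : K) ≠ 0) (i : ℕ) : W.cl 0 (W.soc i) * W.cl 6 1 = 0 :=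
  W.soc_mul_cl W.one_mem_cocyc_six i (by rw [mul_one]; exact W.soc_mem_bdry_five h2 i)

end WalkAlgebra

/-! ### Normal monomials in commutative algebras satisfying the relations -/

namespace WalkAlgebra

/-- Up to sign this is `2 * n - 1`, which equals `-2` in this characteristic. It is the coefficient
of `t_n` in `2 y z_1`, so `y z_1` can replace `t_n`. -/
theorem signedOdd_last_ne_zero {K : Type*} [Field K] {n : ℕ} (h2 : (2 : K) ≠ 0) (hn : 0 < n)
    (hchar : (2 * n + 1 : K) = 0) : signedOdd K (n - 1) ≠ 0 := by
  refine mul_ne_zero (pow_ne_zero _ (neg_ne_zero.2 one_ne_zero)) ?_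
  rw [Nat.cast_sub hn]
  intro h
  apply h2
  push_cast at h
  linear_combination hchar - h

end WalkAlgebra

namespace GenRel

open WalkAlgebra

section Definitions

variable {K : Type u} [Field K] {n : ℕ} {P : Type*} [Ring P] [Algebra K P]

/-- The generators satisfy the relations. -/
def Holds (K : Type u) [Field K] {n : ℕ} {P : Type*} [Ring P] [Algebra K P] (g : Gen n → P) :
    Prop :=
  ∀ a b, GenRel K n a b → FreeAlgebra.lift K g a = FreeAlgebra.lift K g b

/-- The values of the generators of degree two, continued by zero. -/
def zval (g : Gen n → P) (m : ℕ) : P := if h : m < n then g (.z ⟨m, h⟩) else 0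

/-- The values of the generators of degree three, continued by zero. -/
def tval (g : Gen n → P) (m : ℕ) : P := if h : m < n - 1 then g (.t ⟨m, h⟩) else 0

theorem lift_genι (g : Gen n → P) (a : Gen n) : FreeAlgebra.lift K g (genι K a) = g a :=
  FreeAlgebra.lift_ι_apply _ _

variable (K) in
/-- The generators of degree three together with a further element of degree three. -/
noncomputable def sval (g : Gen n → P) (m : ℕ) : P :=
  if m + 1 = n then (signedOdd K m)⁻¹ •
    ((2 : K) • (g .y * zval g 0) - ∑ l ∈ Finset.range m, signedOdd K l • tval g l) else tval g m

variable (K) in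
/-- The normal monomials, up to sign. -/
noncomputable def mon (g : Gen n → P) : ℕ → ℕ → P
  | 0, m => g (.x 0) ^ m
  | 1, m => g .y * g (.x 0) ^ m
  | 2, m => zval g m
  | 3, m => sval K g m
  | 4, m => -g .γ * g (.x 0) ^ m
  | 5, m => g .y * g .γ * g (.x 0) ^ m
  | r + 6, m => mon g r m * -g .h

/-- The index set for the homogeneous basis in a given degree. -/
def Idx (n : ℕ) : ℕ → Type
  | 0 => Fin n ⊕ Fin n
  | _ + 1 => Fin n

variable (K) in
/-- The homogeneous basis. -/
noncomputable def idxMon (g : Gen n → P) : ∀ k, Idx n k → P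
  | 0 => Sum.elim (fun m => mon K g 0 m) fun i => g (.x i.succ)
  | k + 1 => fun m => mon K g (k + 1) (Fin.val (n := n) m)

variable (K) in
/-- The span of the normal monomials. -/
noncomputable def monSpan (g : Gen n → P) : Submodule K P :=
  Submodule.span K (Set.range fun i : Σ k, Idx n k => idxMon K g i.1 i.2)

end Definitions

section Monomials

variable {K : Type u} [Field K] {n : ℕ} {P : Type*} [CommRing P] [Algebra K P]

variable {g : Gen n → P}

theorem Holds.x_mul (hg : Holds K g) {i : Fin (n + 1)} (hi : 1 ≤ (i : ℕ)) (ξ : Gen n) :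
    g (.x i) * g ξ = 0 := by
  simpa only [map_mul, lift_genι, map_zero] using hg _ _ (.x_mul i hi ξ)

theorem Holds.x_pow (hg : Holds K g) : g (.x 0) ^ n = 0 := by
  simpa only [map_pow, lift_genι, map_zero] using hg _ _ .x_zero_pow

theorem Holds.x_pow_of_le (hg : Holds K g) {m : ℕ} (hm : n ≤ m) : g (.x 0) ^ m = 0 :=
  pow_eq_zero_of_le hm hg.x_pow

theorem Holds.y_mul_y (hg : Holds K g) : g .y * g .y = 0 := by
  rw [← sq]
  simpa only [map_pow, lift_genι, map_zero] using hg _ _ .y_sq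

theorem Holds.x_mul_zval (hg : Holds K g) (j : ℕ) : g (.x 0) * zval g j = 0 := by
  unfold zval
  split_ifs
  · simpa only [map_mul, lift_genι, map_zero] using hg _ _ (.x_zero_mul_z _)
  · exact mul_zero _

theorem Holds.x_mul_tval (hg : Holds K g) (j : ℕ) : g (.x 0) * tval g j = 0 := by
  unfold tval
  split_ifs
  · simpa only [map_mul, lift_genι, map_zero] using hg _ _ (.x_zero_mul_t _)
  · exact mul_zero _

theorem Holds.y_mul_tval (hg : Holds K g) (j : ℕ) : g .y * tval g j = 0 := by
  unfold tval
  split_ifs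
  · simpa only [map_mul, lift_genι, map_zero] using hg _ _ (.y_mul_t _)
  · exact mul_zero _

theorem Holds.tval_mul_tval (hg : Holds K g) (i j : ℕ) : tval g i * tval g j = 0 := by
  unfold tval
  split_ifs
  · simpa only [map_mul, lift_genι, map_zero] using hg _ _ (.t_mul_t _ _)
  all_goals simp

theorem Holds.zval_mul_zval (hg : Holds K g) (i j : ℕ) :
    ∃ c : K, zval g i * zval g j = c • (g (.x 0) ^ (n - 1) * g .γ) := by
  wlog h : i ≤ j generalizing i j
  · rw [mul_comm]
    exact this j i (by omega)
  unfold zval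
  split_ifs with hi hj
  · have h1 := hg _ _ (.z_mul_z ⟨i, hi⟩ ⟨j, hj⟩ h)
    simp only [map_mul, map_smul, map_pow, lift_genι] at h1
    exact ⟨_, h1⟩
  all_goals exact ⟨0, by simp⟩

theorem Holds.zval_mul_γ (hg : Holds K g) (j : ℕ) :
    ∃ c : K, zval g j * g .γ = c • (g (.x 0) ^ (n - 1) * g .h) := by
  unfold zval
  split_ifs with hj
  · have h1 := hg _ _ (.z_mul_γ ⟨j, hj⟩)
    simp only [map_mul, map_smul, map_pow, lift_genι] at h1
    exact ⟨_, h1⟩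
  · exact ⟨0, by simp⟩

theorem Holds.γ_mul_γ (hg : Holds K g) (hn : 0 < n) : g .γ * g .γ = zval g 0 * g .h := by
  rw [zval, dif_pos hn, ← sq]
  simpa only [map_mul, map_pow, lift_genι] using hg _ _ (.γ_sq ⟨0, hn⟩ rfl)

theorem Holds.y_mul_zval (hg : Holds K g) (hn : 0 < n) (j : ℕ) :
    ∃ c : K, g .y * zval g j = c • (g .y * zval g 0) := by
  rw [zval, zval, dif_pos hn]
  split_ifs with hj
  · have h1 := hg _ _ (.y_mul_z ⟨0, hn⟩ ⟨j, hj⟩ rfl)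
    simp only [map_mul, map_smul, lift_genι] at h1
    exact ⟨_, h1⟩
  · exact ⟨0, by simp⟩

theorem Holds.zval_mul_tval (hg : Holds K g) (k j : ℕ) :
    ∃ c : K, zval g k * tval g j = c • (g (.x 0) ^ (n - 1) * g .y * g .γ) := by
  unfold zval tval
  split_ifs with hk hj
  · have h1 := hg _ _ (.z_mul_t ⟨k, hk⟩ ⟨j, hj⟩)
    simp only [map_mul, map_smul, map_pow, lift_genι] at h1
    exact ⟨_, h1⟩
  all_goals exact ⟨0, by simp⟩

theorem Holds.tval_mul_γ (hg : Holds K g) (j : ℕ) :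
    ∃ c : K, tval g j * g .γ = c • (g (.x 0) ^ (n - 1) * g .y * g .h) := by
  unfold tval
  split_ifs with hj
  · have h1 := hg _ _ (.t_mul_γ ⟨j, hj⟩)
    simp only [map_mul, map_smul, map_pow, lift_genι] at h1
    exact ⟨_, h1⟩
  · exact ⟨0, by simp⟩

theorem mon_mem_of_lt (g : Gen n → P) (k : ℕ) {m : ℕ} (hm : m < n) : mon K g k m ∈ monSpan K g := by
  cases k with
  | zero => exact Submodule.subset_span ⟨⟨0, Sum.inl ⟨m, hm⟩⟩, rfl⟩
  | succ k => exact Submodule.subset_span ⟨⟨k + 1, (⟨m, hm⟩ : Fin n)⟩, rfl⟩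

theorem x_mem (g : Gen n → P) {i : Fin (n + 1)} (hi : 1 ≤ (i : ℕ)) : g (.x i) ∈ monSpan K g := by
  obtain ⟨j, rfl⟩ := Fin.exists_succ_eq.2 (show i ≠ 0 from fun h => by subst h; exact absurd hi (by simp))
  exact Submodule.subset_span ⟨⟨0, Sum.inr j⟩, rfl⟩

theorem Holds.mon_eq_zero (hg : Holds K g) {m : ℕ} (hm : n ≤ m) (k : ℕ) : mon K g k m = 0 := by
  have h0 := hg.x_pow_of_le hm
  refine six_induction (p := fun k => mon K g k m = 0) h0 ?_ (dif_neg (by omega)) ?_ ?_ ?_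
    (fun k h => ?_) k
  · exact (congrArg _ h0).trans (mul_zero _)
  · exact (if_neg (by omega)).trans (dif_neg (by omega))
  · exact (congrArg _ h0).trans (mul_zero _)
  · exact (congrArg _ h0).trans (mul_zero _)
  · change mon K g k m * _ = 0
    rw [h, zero_mul]

theorem Holds.mon_mem (hg : Holds K g) (k m : ℕ) : mon K g k m ∈ monSpan K g := by
  by_cases hm : m < n
  · exact mon_mem_of_lt g k hm
  · rw [hg.mon_eq_zero (by omega)]
    exact zero_mem _

theorem Holds.mul_h_mem (hg : Holds K g) {a : P} (ha : a ∈ monSpan K g) :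
    a * g .h ∈ monSpan K g := by
  induction ha using Submodule.span_induction with
  | mem a h =>
    obtain ⟨⟨k, i⟩, rfl⟩ := h
    have key : ∀ k m, mon K g k m * g .h ∈ monSpan K g := fun k m => by
      have := neg_mem (hg.mon_mem (k + 6) m)
      rwa [show mon K g (k + 6) m = mon K g k m * -g .h from rfl, mul_neg, neg_neg] at this
    cases k with
    | zero =>
      rcases i with m | i
      · exact key 0 m
      · change g (.x i.succ) * g .h ∈ _
        rw [hg.x_mul (by simp)]
        exact zero_mem _
    | succ k => exact key (k + 1) (Fin.val (n := n) i)
  | zero => rw [zero_mul]; exact zero_mem _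
  | add a b _ _ ha hb => rw [add_mul]; exact add_mem ha hb
  | smul c a _ ha => rw [smul_mul_assoc]; exact Submodule.smul_mem _ _ ha

theorem Holds.sval_of_lt (m : ℕ) (hm : m + 1 < n) (g : Gen n → P) : sval K g m = tval g m :=
  if_neg (by omega)

theorem tval_mem (g : Gen n → P) (m : ℕ) : tval g m ∈ monSpan K g := by
  by_cases hm : m + 1 < n
  · rw [← Holds.sval_of_lt (K := K) m hm]
    exact mon_mem_of_lt g 3 (by omega)
  · rw [tval, dif_neg (by omega)]
    exact zero_mem _

/-- The definition of the last `sval` is solved for `y z_1`; both coefficients involved are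
invertible. -/
theorem y_mul_zval_zero_mem (h2 : (2 : K) ≠ 0) (hn : 0 < n) (hchar : (2 * n + 1 : K) = 0)
    (g : Gen n → P) : g .y * zval g 0 ∈ monSpan K g := by
  have h1 := Submodule.smul_mem _ (signedOdd K (n - 1)) (mon_mem_of_lt (K := K) g 3 (m := n - 1) (by omega))
  change _ • sval K g (n - 1) ∈ _ at h1
  rw [sval, if_pos (by omega), smul_inv_smul₀ (signedOdd_last_ne_zero h2 hn hchar)] at h1
  have h3 := add_mem h1 (Submodule.sum_mem _ fun l (_ : l ∈ Finset.range (n - 1)) =>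
    Submodule.smul_mem _ (signedOdd K l) (tval_mem (K := K) g l))
  rw [sub_add_cancel] at h3
  exact (Submodule.smul_mem_iff _ h2).1 h3

/-- The products of an element with the elements of degree three, from the products with the
generators. -/
theorem mul_sval_mem (S : Submodule K P) (a : P) (g : Gen n → P)
    (h1 : a * (g .y * zval g 0) ∈ S) (h2 : ∀ l, a * tval g l ∈ S) (m : ℕ) : a * sval K g m ∈ S := by
  unfold sval
  split_ifs
  · rw [mul_smul_comm, mul_sub, Finset.mul_sum, mul_smul_comm]
    refine S.smul_mem _ (sub_mem (S.smul_mem _ h1) (Submodule.sum_mem _ fun l _ => ?_))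
    rw [mul_smul_comm]
    exact S.smul_mem _ (h2 l)
  · exact h2 m

theorem x_pow_cases {S : Submodule K P} {a x : P} (h0 : a ∈ S) (h : a * x = 0) (m : ℕ) :
    a * x ^ m ∈ S := by
  cases m with
  | zero => rwa [pow_zero, mul_one]
  | succ m =>
    rw [pow_succ', ← mul_assoc, h, zero_mul]
    exact zero_mem _

/-- Powers of `h` can be split off, so closure under multiplication by `a` has to be checked only on
the monomials of degrees zero to five. -/
theorem Holds.mul_mon_mem_of (hg : Holds K g) {a : P}
    (h0 : ∀ m, a * g (.x 0) ^ m ∈ monSpan K g) (h1 : ∀ m, a * g .y * g (.x 0) ^ m ∈ monSpan K g)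
    (h2 : ∀ j, a * zval g j ∈ monSpan K g) (h3 : ∀ j, a * tval g j ∈ monSpan K g)
    (h3' : a * (g .y * zval g 0) ∈ monSpan K g)
    (h4 : ∀ m, a * g .γ * g (.x 0) ^ m ∈ monSpan K g)
    (h5 : ∀ m, a * (g .y * g .γ) * g (.x 0) ^ m ∈ monSpan K g) (k : ℕ) :
    ∀ m, a * mon K g k m ∈ monSpan K g := by
  refine six_induction (p := fun k => ∀ m, a * mon K g k m ∈ monSpan K g) h0 (fun m => ?_) h2
    (mul_sval_mem _ a g h3' h3) (fun m => ?_) (fun m => ?_) (fun k h m => ?_) k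
  · change a * (g .y * g (.x 0) ^ m) ∈ _
    rw [← mul_assoc]
    exact h1 m
  · change a * (-g .γ * g (.x 0) ^ m) ∈ _
    rw [neg_mul, mul_neg, ← mul_assoc]
    exact neg_mem (h4 m)
  · change a * (g .y * g .γ * g (.x 0) ^ m) ∈ _
    rw [← mul_assoc]
    exact h5 m
  · change a * (mon K g k m * -g .h) ∈ _
    rw [mul_neg, mul_neg, ← mul_assoc]
    exact neg_mem (hg.mul_h_mem (h m))

theorem Holds.γ_mul_x_pow_mem (hg : Holds K g) (m : ℕ) : g .γ * g (.x 0) ^ m ∈ monSpan K g := by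
  have := neg_mem (hg.mon_mem 4 m)
  rwa [show mon K g 4 m = -g .γ * g (.x 0) ^ m from rfl, neg_mul, neg_neg] at this

theorem Holds.y_mul_zval_mem (hg : Holds K g) (h2 : (2 : K) ≠ 0) (hn : 0 < n)
    (hchar : (2 * n + 1 : K) = 0) (j : ℕ) : g .y * zval g j ∈ monSpan K g := by
  obtain ⟨c, hc⟩ := hg.y_mul_zval hn j
  rw [hc]
  exact Submodule.smul_mem _ _ (y_mul_zval_zero_mem h2 hn hchar g)

theorem Holds.y_mul_zval_mul_γ_mem (hg : Holds K g) (j : ℕ) :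
    g .y * (zval g j * g .γ) ∈ monSpan K g := by
  obtain ⟨c, hc⟩ := hg.zval_mul_γ j
  rw [hc, mul_smul_comm, ← mul_assoc]
  exact Submodule.smul_mem _ _ (hg.mul_h_mem (hg.mon_mem 1 _))

theorem Holds.zval_mul_tval_mem (hg : Holds K g) (i j : ℕ) :
    zval g i * tval g j ∈ monSpan K g := by
  obtain ⟨c, hc⟩ := hg.zval_mul_tval i j
  rw [hc, mul_assoc, mul_comm (_ ^ _)]
  exact Submodule.smul_mem _ _ (hg.mon_mem 5 _)

theorem Holds.tval_mul_γ_mem (hg : Holds K g) (j : ℕ) : tval g j * g .γ ∈ monSpan K g := by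
  obtain ⟨c, hc⟩ := hg.tval_mul_γ j
  rw [hc, mul_assoc (_ ^ _), mul_comm (_ ^ _), mul_right_comm]
  exact Submodule.smul_mem _ _ (hg.mul_h_mem (hg.mon_mem 1 _))

theorem Holds.xval_mul_mon_mem (hg : Holds K g) {i : Fin (n + 1)} (hi : 1 ≤ (i : ℕ)) :
    ∀ k m, g (.x i) * mon K g k m ∈ monSpan K g := by
  have h := hg.x_mul hi
  have h0 : ∀ a : P, a = 0 → a ∈ monSpan K g := fun a h => by rw [h]; exact zero_mem _
  refine hg.mul_mon_mem_of (x_pow_cases (x_mem g hi) (h _)) (fun m => h0 _ ?_) (fun j => h0 _ ?_)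
    (fun j => h0 _ ?_) (h0 _ ?_) (fun m => h0 _ ?_) (fun m => h0 _ ?_)
  · rw [h, zero_mul]
  · unfold zval
    split_ifs
    · exact h _
    · exact mul_zero _
  · unfold tval
    split_ifs
    · exact h _
    · exact mul_zero _
  · rw [← mul_assoc, h, zero_mul]
  · rw [h, zero_mul]
  · rw [← mul_assoc, h, zero_mul, zero_mul]

theorem Holds.x_zero_mul_mon_mem (hg : Holds K g) :
    ∀ k m, g (.x 0) * mon K g k m ∈ monSpan K g := by
  have h0 : ∀ a : P, a = 0 → a ∈ monSpan K g := fun a h => by rw [h]; exact zero_mem _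
  refine hg.mul_mon_mem_of (fun m => ?_) (fun m => ?_) (fun j => h0 _ (hg.x_mul_zval j))
    (fun j => h0 _ (hg.x_mul_tval j)) (h0 _ ?_) (fun m => ?_) (fun m => ?_)
  · rw [← pow_succ']
    exact hg.mon_mem 0 _
  · rw [mul_comm (g (.x 0)), mul_assoc, ← pow_succ']
    exact hg.mon_mem 1 _
  · rw [mul_left_comm, hg.x_mul_zval, mul_zero]
  · rw [mul_comm (g (.x 0)), mul_assoc, ← pow_succ']
    exact hg.γ_mul_x_pow_mem _
  · rw [mul_comm (g (.x 0)), mul_assoc, ← pow_succ']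
    exact hg.mon_mem 5 _

theorem Holds.y_mul_mon_mem (hg : Holds K g) (h2 : (2 : K) ≠ 0) (hn : 0 < n)
    (hchar : (2 * n + 1 : K) = 0) : ∀ k m, g .y * mon K g k m ∈ monSpan K g := by
  have h0 : ∀ a : P, a = 0 → a ∈ monSpan K g := fun a h => by rw [h]; exact zero_mem _
  refine hg.mul_mon_mem_of (hg.mon_mem 1) (fun m => h0 _ ?_) (hg.y_mul_zval_mem h2 hn hchar)
    (fun j => h0 _ (hg.y_mul_tval j)) (h0 _ ?_) (hg.mon_mem 5) (fun m => h0 _ ?_)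
  · rw [hg.y_mul_y, zero_mul]
  · rw [← mul_assoc, hg.y_mul_y, zero_mul]
  · rw [← mul_assoc, hg.y_mul_y, zero_mul, zero_mul]

theorem Holds.zval_mul_mon_mem (hg : Holds K g) (h2 : (2 : K) ≠ 0) (hn : 0 < n)
    (hchar : (2 * n + 1 : K) = 0) (i : ℕ) : ∀ k m, zval g i * mon K g k m ∈ monSpan K g := by
  have hx : zval g i * g (.x 0) = 0 := by rw [mul_comm, hg.x_mul_zval]
  refine hg.mul_mon_mem_of (x_pow_cases (hg.mon_mem 2 i) hx) (x_pow_cases ?_ ?_) (fun j => ?_)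
    (hg.zval_mul_tval_mem i) ?_ (x_pow_cases ?_ ?_) (x_pow_cases ?_ ?_)
  · rw [mul_comm]
    exact hg.y_mul_zval_mem h2 hn hchar i
  · rw [mul_right_comm, hx, zero_mul]
  · obtain ⟨c, hc⟩ := hg.zval_mul_zval i j
    rw [hc, mul_comm (_ ^ _)]
    exact Submodule.smul_mem _ _ (hg.γ_mul_x_pow_mem _)
  · obtain ⟨c, hc⟩ := hg.zval_mul_zval i 0
    rw [mul_left_comm, hc, mul_smul_comm, mul_comm (_ ^ _), ← mul_assoc]
    exact Submodule.smul_mem _ _ (hg.mon_mem 5 _)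
  · obtain ⟨c, hc⟩ := hg.zval_mul_γ i
    rw [hc]
    exact Submodule.smul_mem _ _ (hg.mul_h_mem (hg.mon_mem 0 _))
  · rw [mul_right_comm, hx, zero_mul]
  · rw [mul_left_comm]
    exact hg.y_mul_zval_mul_γ_mem i
  · rw [mul_right_comm, hx, zero_mul]

theorem Holds.tval_mul_mon_mem (hg : Holds K g) (i : ℕ) :
    ∀ k m, tval g i * mon K g k m ∈ monSpan K g := by
  have hx : tval g i * g (.x 0) = 0 := by rw [mul_comm, hg.x_mul_tval]
  have hy : tval g i * g .y = 0 := by rw [mul_comm, hg.y_mul_tval]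
  have h0 : ∀ a : P, a = 0 → a ∈ monSpan K g := fun a h => by rw [h]; exact zero_mem _
  refine hg.mul_mon_mem_of (x_pow_cases (tval_mem g i) hx) (fun m => h0 _ ?_) (fun j => ?_)
    (fun j => h0 _ (hg.tval_mul_tval i j)) (h0 _ ?_) (x_pow_cases (hg.tval_mul_γ_mem i) ?_)
    (fun m => h0 _ ?_)
  · rw [hy, zero_mul]
  · rw [mul_comm]
    exact hg.zval_mul_tval_mem j i
  · rw [← mul_assoc, hy, zero_mul]
  · rw [mul_right_comm, hx, zero_mul]
  · rw [← mul_assoc, hy, zero_mul, zero_mul]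

theorem Holds.γ_mul_mon_mem (hg : Holds K g) (h2 : (2 : K) ≠ 0) (hn : 0 < n)
    (hchar : (2 * n + 1 : K) = 0) : ∀ k m, g .γ * mon K g k m ∈ monSpan K g := by
  have hx : zval g 0 * g (.x 0) = 0 := by rw [mul_comm, hg.x_mul_zval]
  refine hg.mul_mon_mem_of hg.γ_mul_x_pow_mem (fun m => ?_) (fun j => ?_) (fun j => ?_) ?_
    (x_pow_cases ?_ ?_) (x_pow_cases ?_ ?_)
  · rw [mul_comm (g .γ)]
    exact hg.mon_mem 5 m
  · obtain ⟨c, hc⟩ := hg.zval_mul_γ j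
    rw [mul_comm, hc]
    exact Submodule.smul_mem _ _ (hg.mul_h_mem (hg.mon_mem 0 _))
  · rw [mul_comm]
    exact hg.tval_mul_γ_mem j
  · rw [mul_left_comm, mul_comm (g .γ)]
    exact hg.y_mul_zval_mul_γ_mem 0
  · rw [hg.γ_mul_γ hn]
    exact hg.mul_h_mem (hg.mon_mem 2 0)
  · rw [hg.γ_mul_γ hn, mul_right_comm, hx, zero_mul]
  · rw [mul_left_comm, hg.γ_mul_γ hn, ← mul_assoc]
    exact hg.mul_h_mem (hg.y_mul_zval_mem h2 hn hchar 0)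
  · rw [mul_left_comm, hg.γ_mul_γ hn, mul_assoc, mul_right_comm (zval g 0), hx, zero_mul, mul_zero]

theorem Holds.gen_mul_mem (hg : Holds K g) (h2 : (2 : K) ≠ 0) (hn : 0 < n)
    (hchar : (2 * n + 1 : K) = 0) (ξ : Gen n) {a : P} (ha : a ∈ monSpan K g) :
    g ξ * a ∈ monSpan K g := by
  have key : ∀ k m, g ξ * mon K g k m ∈ monSpan K g := by
    intro k m
    match ξ with
    | .x i =>
      by_cases hi : i = 0
      · rw [hi]
        exact hg.x_zero_mul_mon_mem k m
      · exact hg.xval_mul_mon_mem (Nat.one_le_iff_ne_zero.2 fun h => hi (Fin.ext h)) k m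
    | .y => exact hg.y_mul_mon_mem h2 hn hchar k m
    | .z j =>
      have := hg.zval_mul_mon_mem h2 hn hchar j k m
      rwa [zval, dif_pos j.2] at this
    | .t j =>
      have := hg.tval_mul_mon_mem j k m
      rwa [tval, dif_pos j.2] at this
    | .γ => exact hg.γ_mul_mon_mem h2 hn hchar k m
    | .h =>
      rw [mul_comm]
      exact hg.mul_h_mem (hg.mon_mem k m)
  induction ha using Submodule.span_induction with
  | mem a h =>
    obtain ⟨⟨k, i⟩, rfl⟩ := h
    cases k with
    | zero =>
      rcases i with m | i
      · exact key 0 m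
      · change g ξ * g (.x i.succ) ∈ _
        rw [mul_comm, hg.x_mul (by simp)]
        exact zero_mem _
    | succ k => exact key (k + 1) (Fin.val (n := n) i)
  | zero => rw [mul_zero]; exact zero_mem _
  | add a b _ _ ha hb => rw [mul_add]; exact add_mem ha hb
  | smul c a _ ha => rw [mul_smul_comm]; exact Submodule.smul_mem _ _ ha

/-- The normal monomials span. -/
theorem Holds.lift_mem_monSpan (hg : Holds K g) (h2 : (2 : K) ≠ 0) (hn : 0 < n)
    (hchar : (2 * n + 1 : K) = 0) (a : FreeAlgebra K (Gen n)) :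
    FreeAlgebra.lift K g a ∈ monSpan K g := by
  suffices ∀ b ∈ monSpan K g, FreeAlgebra.lift K g a * b ∈ monSpan K g by
    have h := this 1 (by
      have := hg.mon_mem 0 0
      rwa [show mon K g 0 0 = g (.x 0) ^ 0 from rfl, pow_zero] at this)
    rwa [mul_one] at h
  induction a using FreeAlgebra.induction with
  | grade0 c =>
    intro b hb
    rw [AlgHom.commutes, ← Algebra.smul_def]
    exact Submodule.smul_mem _ _ hb
  | grade1 ξ =>
    intro b hb
    rw [FreeAlgebra.lift_ι_apply]
    exact hg.gen_mul_mem h2 hn hchar ξ hb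
  | mul a a' ha ha' =>
    intro b hb
    rw [map_mul, mul_assoc]
    exact ha _ (ha' _ hb)
  | add a a' ha ha' =>
    intro b hb
    rw [map_add, add_mul]
    exact add_mem (ha _ hb) (ha' _ hb)

end Monomials

end GenRel

/-! ### The homomorphism from the presented algebra -/

namespace PresentedAlgebra

open GenRel

variable {K : Type u} [Field K] {n : ℕ}

theorem lift_gen :
    FreeAlgebra.lift K (PresentedAlgebra.gen K (n := n)) = RingQuot.mkAlgHom K (GenRel K n) := by
  ext a
  exact FreeAlgebra.lift_ι_apply _ _

theorem holds_gen : Holds K (PresentedAlgebra.gen K (n := n)) := by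
  intro a b hab
  rw [lift_gen]
  exact RingQuot.mkAlgHom_rel K hab

/-- A sign in graded commutativity occurs only between generators of odd degree, and all of their
products vanish by the relations. So the presented algebra is strictly commutative. -/
theorem gen_mul_gen (a b : Gen n) : gen K a * gen K b = gen K b * gen K a := by
  have h := holds_gen _ _ (GenRel.graded_comm (K := K) a b)
  simp only [map_mul, map_smul, lift_genι] at h
  have h0 : ∀ a b : Gen n, (a = .y ∨ ∃ i, a = .t i) → (b = .y ∨ ∃ i, b = .t i) →
      gen K a * gen K b = 0 := by
    have hyt : ∀ i : Fin (n - 1), gen K (n := n) .y * gen K (.t i) = 0 := fun i => by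
      simpa only [map_mul, map_zero, lift_genι] using holds_gen _ _ (GenRel.y_mul_t (K := K) i)
    rintro a b (rfl | ⟨i, rfl⟩) (rfl | ⟨j, rfl⟩)
    · have := holds_gen _ _ (GenRel.y_sq (K := K) (n := n))
      simp only [map_pow, map_zero, lift_genι] at this
      rwa [sq] at this
    · exact hyt j
    · have := holds_gen _ _ (GenRel.graded_comm (K := K) (.t i) .y)
      simp only [map_mul, map_smul, lift_genι] at this
      rw [this, hyt, smul_zero]
    · simpa only [map_mul, map_zero, lift_genι] using holds_gen _ _ (GenRel.t_mul_t (K := K) i j)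
  have hodd : ∀ a : Gen n, Odd a.deg → a = .y ∨ ∃ i, a = .t i := by
    rintro (i | _ | j | i | _ | _) h
    · exact absurd (show Odd 0 from h) (by decide)
    · exact Or.inl rfl
    · exact absurd (show Odd 2 from h) (by decide)
    · exact Or.inr ⟨i, rfl⟩
    · exact absurd (show Odd 4 from h) (by decide)
    · exact absurd (show Odd 6 from h) (by decide)
  rcases Nat.even_or_odd (a.deg * b.deg) with he | ho
  · rw [h, he.neg_one_pow, one_smul]
  · obtain ⟨ha, hb⟩ := Nat.odd_mul.1 ho
    rw [h0 a b (hodd a ha) (hodd b hb), h0 b a (hodd b hb) (hodd a ha)]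

theorem induction {p : PresentedAlgebra K n → Prop} (h0 : ∀ c, p (algebraMap K _ c))
    (h1 : ∀ a, p (gen K a)) (hmul : ∀ a b, p a → p b → p (a * b))
    (hadd : ∀ a b, p a → p b → p (a + b)) (a : PresentedAlgebra K n) : p a := by
  obtain ⟨a, rfl⟩ := RingQuot.mkAlgHom_surjective K (GenRel K n) a
  induction a using FreeAlgebra.induction with
  | grade0 c => rw [AlgHom.commutes]; exact h0 c
  | grade1 a => exact h1 a
  | mul a b ha hb => rw [map_mul]; exact hmul _ _ ha hb
  | add a b ha hb => rw [map_add]; exact hadd _ _ ha hb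

theorem commute (a b : PresentedAlgebra K n) : Commute a b := by
  induction a using PresentedAlgebra.induction with
  | h0 c => exact Algebra.commutes c b
  | h1 x =>
    induction b using PresentedAlgebra.induction with
    | h0 c => exact (Algebra.commutes c _).symm
    | h1 y => exact gen_mul_gen x y
    | hmul a b ha hb => exact ha.mul_right hb
    | hadd a b ha hb => exact ha.add_right hb
  | hmul a b ha hb => exact ha.mul_left hb
  | hadd a b ha hb => exact ha.add_left hb

theorem monSpan_gen (h2 : (2 : K) ≠ 0) (hn : 0 < n) (hchar : (2 * n + 1 : K) = 0) :
    monSpan K (PresentedAlgebra.gen K (n := n)) = ⊤ := by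
  letI : CommRing (PresentedAlgebra K n) :=
    { (inferInstance : Ring (PresentedAlgebra K n)) with mul_comm := commute }
  refine eq_top_iff.2 fun a _ => ?_
  obtain ⟨a, rfl⟩ := RingQuot.mkAlgHom_surjective K (GenRel K n) a
  rw [← lift_gen]
  exact Holds.lift_mem_monSpan (P := PresentedAlgebra K n) holds_gen h2 hn hchar a

theorem gen_mem (a : Gen n) : gen K a ∈ component K n a.deg :=
  Submodule.subset_span ⟨[a], by simp, by simp⟩

theorem one_mem : (1 : PresentedAlgebra K n) ∈ component K n 0 :=
  Submodule.subset_span ⟨[], by simp, by simp⟩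

theorem mul_mem {d e f : ℕ} (h : d + e = f) {a b : PresentedAlgebra K n} (ha : a ∈ component K n d)
    (hb : b ∈ component K n e) : a * b ∈ component K n f := by
  subst h
  induction ha using Submodule.span_induction with
  | mem a ha =>
    obtain ⟨l, hl, rfl⟩ := ha
    induction hb using Submodule.span_induction with
    | mem b hb =>
      obtain ⟨l', hl', rfl⟩ := hb
      exact Submodule.subset_span ⟨l ++ l', by rw [List.map_append, List.sum_append, hl, hl'],
        by rw [List.map_append, List.prod_append]⟩
    | zero => rw [mul_zero]; exact zero_mem _
    | add b b' _ _ hb hb' => rw [mul_add]; exact add_mem hb hb'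
    | smul c b _ hb => rw [mul_smul_comm]; exact Submodule.smul_mem _ _ hb
  | zero => rw [zero_mul]; exact zero_mem _
  | add a a' _ _ ha ha' => rw [add_mul]; exact add_mem ha ha'
  | smul c a _ ha => rw [smul_mul_assoc]; exact Submodule.smul_mem _ _ ha

theorem mon_mem_component (k m : ℕ) :
    mon K (PresentedAlgebra.gen K (n := n)) k m ∈ component K n k := by
  have hx : ∀ m, gen K (n := n) (.x 0) ^ m ∈ component K n 0 := fun m => by
    induction m with
    | zero => rw [pow_zero]; exact one_mem
    | succ m ih => rw [pow_succ]; exact mul_mem (d := 0) (e := 0) rfl ih (gen_mem (.x 0))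
  have hz : ∀ m, zval (gen K (n := n)) m ∈ component K n 2 := fun m => by
    unfold zval
    split_ifs with h
    · exact gen_mem (.z ⟨m, h⟩)
    · exact zero_mem _
  have ht : ∀ m, tval (gen K (n := n)) m ∈ component K n 3 := fun m => by
    unfold tval
    split_ifs with h
    · exact gen_mem (.t ⟨m, h⟩)
    · exact zero_mem _
  refine WalkAlgebra.six_induction (p := fun k => mon K (gen K (n := n)) k m ∈ component K n k)
    (hx m) ?_ (hz m) ?_ ?_ ?_ (fun k h => ?_) k
  · exact mul_mem (d := 1) (e := 0) rfl (gen_mem .y) (hx m)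
  swap
  · exact mul_mem (d := 4) (e := 0) rfl (neg_mem (gen_mem .γ)) (hx m)
  swap
  · exact mul_mem (d := 5) (e := 0) rfl (mul_mem (d := 1) (e := 4) rfl (gen_mem .y) (gen_mem .γ))
      (hx m)
  swap
  · exact mul_mem (d := k) (e := 6) rfl h (neg_mem (gen_mem .h))
  change sval K _ m ∈ _
  unfold sval
  split_ifs
  · exact Submodule.smul_mem _ _ (sub_mem (Submodule.smul_mem _ _
      (mul_mem (d := 1) (e := 2) rfl (gen_mem .y) (hz 0)))
      (Submodule.sum_mem _ fun l _ => Submodule.smul_mem _ _ (ht l)))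
  · exact ht m

theorem idxMon_mem_component (k : ℕ) (i : Idx n k) :
    idxMon K (PresentedAlgebra.gen K (n := n)) k i ∈ component K n k := by
  cases k with
  | zero =>
    rcases i with m | i
    · exact mon_mem_component 0 m
    · exact gen_mem (.x i.succ)
  | succ k => exact mon_mem_component (k + 1) (Fin.val (n := n) i)

end PresentedAlgebra

/-! ### Verification of the relations in the Hochschild cohomology algebra -/

namespace WalkAlgebra

open GenRel

variable {K : Type u} [Field K] {n : ℕ} {A : Type u} [Ring A] [Algebra K A]
  (W : WalkAlgebra K n A)

/-- The classes which correspond to the generators of the presented algebra. -/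
noncomputable def img : Gen n → HHAlgebra K A
  | .x i => if (i : ℕ) = 0 then W.cl 0 (W.xpow 1) else W.cl 0 (W.soc (i - 1))
  | .y => W.cl 1 W.D
  | .z j => W.cl 2 (W.e j)
  | .t j => W.cl 3 (W.soc j)
  -- The minus sign makes `z_j t_j` equal to `+x_0^(n-1) y γ`. The one at `h` is then forced by `γ²
  -- = z_1 h`, because the square of the class of degree four is minus that of `e 0` in degree
  -- eight.
  | .γ => -W.cl 4 (W.e 0)
  | .h => -W.cl 6 1

theorem exists_img_x (i : Fin (n + 1)) : ∃ c, (∀ a, c * a = a * c) ∧ W.img (.x i) = W.cl 0 c := by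
  by_cases h : (i : ℕ) = 0
  · exact ⟨_, W.xpow_mul 1, if_pos h⟩
  · exact ⟨_, W.soc_mul _, if_neg h⟩

theorem exists_img (a : Gen n) : ∃ f ∈ W.cocyc a.deg, W.img a = W.cl a.deg f := by
  match a with
  | .x i =>
    obtain ⟨c, hc, h⟩ := W.exists_img_x i
    exact ⟨c, W.central_mem_cocyc hc, h⟩
  | .y => exact ⟨_, W.D_mem_cocyc, rfl⟩
  | .z j => exact ⟨_, W.e_mem_cocyc_two j, rfl⟩
  | .t j => exact ⟨_, W.soc_mem_cocyc j, rfl⟩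
  | .γ => exact ⟨_, neg_mem W.e_zero_mem_cocyc, (W.cl_neg W.e_zero_mem_cocyc).symm⟩
  | .h => exact ⟨_, neg_mem W.one_mem_cocyc_six, (W.cl_neg W.one_mem_cocyc_six).symm⟩

theorem commute_img_x (i : Fin (n + 1)) (a : Gen n) : Commute (W.img (.x i)) (W.img a) := by
  obtain ⟨c, hc, h⟩ := W.exists_img_x i
  obtain ⟨f, hf, h'⟩ := W.exists_img a
  rw [h, h']
  exact W.central_mul_cl_comm hf hc

theorem commute_img (h2 : (2 : K) ≠ 0) (hn : 0 < n) (hchar : (2 * n + 1 : K) = 0) :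
    ∀ a b, Commute (W.img a) (W.img b) := by
  have hYZ : ∀ j : Fin n, Commute (W.cl 1 W.D) (W.cl 2 (W.e j)) := fun j =>
    W.Y_mul_Z h2 hn hchar j.2
  have hYT : ∀ j : Fin (n - 1), Commute (W.cl 1 W.D) (W.cl 3 (W.soc j)) := fun j =>
    (W.Y_mul_T hn j).trans (W.T_mul_Y hn j).symm
  have hYG : Commute (W.cl 1 W.D) (W.cl 4 (W.e 0)) := (W.Y_mul_G hn).trans (W.G_mul_Y hn).symm
  have hYH : Commute (W.cl 1 W.D) (W.cl 6 1) := W.Y_mul_H.trans W.H_mul_Y.symm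
  have hZZ : ∀ i j : Fin n, Commute (W.cl 2 (W.e i)) (W.cl 2 (W.e j)) := fun i j => by
    refine (W.Z_mul_Z h2 hn hchar i.2 j.2).trans (Eq.trans ?_ (W.Z_mul_Z h2 hn hchar j.2 i.2).symm)
    rw [mul_right_comm]
  have hZT : ∀ (i : Fin n) (j : Fin (n - 1)), Commute (W.cl 2 (W.e i)) (W.cl 3 (W.soc j)) :=
    fun i j => (W.Z_mul_T_of_lt (by omega) i).trans (W.T_mul_Z h2 hn (by omega) i).symm
  have hZG : ∀ j : Fin n, Commute (W.cl 2 (W.e j)) (W.cl 4 (W.e 0)) := fun j =>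
    (W.Z_mul_G h2 hn hchar j.2).trans (W.G_mul_Z h2 hn hchar j.2).symm
  have hZH : ∀ j : Fin n, Commute (W.cl 2 (W.e j)) (W.cl 6 1) := fun j =>
    (W.Z_mul_H j).trans (W.H_mul_Z h2 hn j.2).symm
  have hTT : ∀ i j : Fin (n - 1), Commute (W.cl 3 (W.soc i)) (W.cl 3 (W.soc j)) := fun i j =>
    (W.T_mul_T hn i j).trans (W.T_mul_T hn j i).symm
  have hTG : ∀ j : Fin (n - 1), Commute (W.cl 3 (W.soc j)) (W.cl 4 (W.e 0)) := fun j =>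
    (W.T_mul_G j).trans (W.G_mul_T j).symm
  have hTH : ∀ j : Fin (n - 1), Commute (W.cl 3 (W.soc j)) (W.cl 6 1) := fun j =>
    (W.T_mul_H j).trans (W.H_mul_T j).symm
  have hGH : Commute (W.cl 4 (W.e 0)) (W.cl 6 1) := W.G_mul_H.trans W.H_mul_G.symm
  intro a b
  match a, b with
  | .x i, b => exact W.commute_img_x i b
  | a, .x i => exact (W.commute_img_x i a).symm
  | .y, .y => exact Commute.refl _
  | .y, .z j => exact hYZ j
  | .z j, .y => exact (hYZ j).symm
  | .y, .t j => exact hYT j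
  | .t j, .y => exact (hYT j).symm
  | .y, .γ => exact hYG.neg_right
  | .γ, .y => exact hYG.symm.neg_left
  | .y, .h => exact hYH.neg_right
  | .h, .y => exact hYH.symm.neg_left
  | .z i, .z j => exact hZZ i j
  | .z i, .t j => exact hZT i j
  | .t j, .z i => exact (hZT i j).symm
  | .z j, .γ => exact (hZG j).neg_right
  | .γ, .z j => exact (hZG j).symm.neg_left
  | .z j, .h => exact (hZH j).neg_right
  | .h, .z j => exact (hZH j).symm.neg_left
  | .t i, .t j => exact hTT i j
  | .t j, .γ => exact (hTG j).neg_right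
  | .γ, .t j => exact (hTG j).symm.neg_left
  | .t j, .h => exact (hTH j).neg_right
  | .h, .t j => exact (hTH j).symm.neg_left
  | .γ, .γ => exact Commute.refl _
  | .γ, .h => exact hGH.neg_left.neg_right
  | .h, .γ => exact hGH.symm.neg_left.neg_right
  | .h, .h => exact Commute.refl _

theorem img_mul_img (h2 : (2 : K) ≠ 0) (hn : 0 < n) (hchar : (2 * n + 1 : K) = 0) (a b : Gen n) :
    W.img a * W.img b = (-1 : K) ^ (a.deg * b.deg) • (W.img b * W.img a) := by
  rcases Nat.even_or_odd (a.deg * b.deg) with he | ho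
  · rw [he.neg_one_pow, one_smul]
    exact W.commute_img h2 hn hchar a b
  · suffices W.img a * W.img b = 0 by
      rw [← (W.commute_img h2 hn hchar a b).eq, this, smul_zero]
    match a, b with
    | .y, .y => exact W.Y_mul_Y
    | .y, .t j => exact W.Y_mul_T hn j
    | .t j, .y => exact W.T_mul_Y hn j
    | .t i, .t j => exact W.T_mul_T hn i j
    | .x i, b => exact absurd (Nat.odd_mul.1 ho).1 (by simp [Gen.deg])
    | .z i, b => exact absurd (Nat.odd_mul.1 ho).1 (by simp [Gen.deg])
    | .γ, b => exact absurd (Nat.odd_mul.1 ho).1 (by simp [Gen.deg]; decide)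
    | .h, b => exact absurd (Nat.odd_mul.1 ho).1 (by simp [Gen.deg]; decide)
    | a, .x i => exact absurd (Nat.odd_mul.1 ho).2 (by simp [Gen.deg])
    | a, .z i => exact absurd (Nat.odd_mul.1 ho).2 (by simp [Gen.deg])
    | a, .γ => exact absurd (Nat.odd_mul.1 ho).2 (by simp [Gen.deg]; decide)
    | a, .h => exact absurd (Nat.odd_mul.1 ho).2 (by simp [Gen.deg]; decide)

theorem img_x_of_ne {i : Fin (n + 1)} (hi : 1 ≤ (i : ℕ)) : W.img (.x i) = W.cl 0 (W.soc (i - 1)) :=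
  if_neg (by omega)

theorem img_x_mul (h2 : (2 : K) ≠ 0) (hn : 0 < n) {i : Fin (n + 1)} (hi : 1 ≤ (i : ℕ)) (a : Gen n) :
    W.img (.x i) * W.img a = 0 := by
  rw [W.img_x_of_ne hi]
  match a with
  | .x j =>
    by_cases h : (j : ℕ) = 0
    · rw [show W.img (.x j) = W.cl 0 (W.xpow 1) from if_pos h, soc_mul_X]
    · rw [W.img_x_of_ne (by omega), W.soc_mul_soc_cl hn]
  | .y => exact W.soc_mul_Y hn _
  | .z j => exact W.soc_mul_Z h2 hn _ _
  | .t j => exact W.soc_mul_T hn _ _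
  | .γ => exact (mul_neg _ _).trans (neg_eq_zero.2 (W.soc_mul_G h2 hn _))
  | .h => exact (mul_neg _ _).trans (neg_eq_zero.2 (W.soc_mul_H h2 _))

theorem img_x_zero_pow (m : ℕ) : W.img (.x 0) ^ m = W.cl 0 (W.xpow m) := W.cl_xpow_pow m

theorem cast_eq_neg_half (h2 : (2 : K) ≠ 0) (hchar : (2 * n + 1 : K) = 0) : (n : K) = -2⁻¹ := by
  field_simp
  linear_combination hchar

theorem img_rel (h2 : (2 : K) ≠ 0) (hn : 0 < n) (hchar : (2 * n + 1 : K) = 0)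
    {a b : FreeAlgebra K (Gen n)} (h : GenRel K n a b) :
    FreeAlgebra.lift K W.img a = FreeAlgebra.lift K W.img b := by
  have hX : ∀ {k : ℕ} {f : A}, f ∈ W.cocyc k →
      W.cl 0 (W.xpow (n - 1)) * W.cl k f = W.cl k (f * W.xpow (n - 1)) := fun hf => by
    rw [W.central_mul_cl_comm hf (W.xpow_mul _), W.cl_mul_central hf (W.xpow_mul _)]
  cases h with
  | graded_comm a b =>
    simp only [map_mul, map_smul, lift_genι]
    exact W.img_mul_img h2 hn hchar a b
  | x_mul i hi ξ =>
    simp only [map_mul, map_zero, lift_genι]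
    exact W.img_x_mul h2 hn hi ξ
  | x_zero_pow =>
    rw [map_pow, map_zero, lift_genι, img_x_zero_pow, W.xpow_eq_zero le_rfl, cl_zero]
  | y_sq =>
    rw [map_pow, map_zero, lift_genι, sq]
    exact W.Y_mul_Y
  | x_zero_mul_z j =>
    rw [map_mul, map_zero, lift_genι, lift_genι, (W.commute_img_x 0 _).eq]
    exact W.Z_mul_X h2 j
  | x_zero_mul_t j =>
    rw [map_mul, map_zero, lift_genι, lift_genι, (W.commute_img_x 0 _).eq]
    exact W.T_mul_X j
  | y_mul_t i =>
    rw [map_mul, map_zero, lift_genι, lift_genι]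
    exact W.Y_mul_T hn i
  | t_mul_t i k =>
    rw [map_mul, map_zero, lift_genι, lift_genι]
    exact W.T_mul_T hn i k
  | z_mul_z j k hjk =>
    simp only [map_mul, map_smul, map_pow, lift_genι, img_x_zero_pow]
    change W.cl 2 (W.e j) * W.cl 2 (W.e k) = _ • (_ * -W.cl 4 (W.e 0))
    rw [W.Z_mul_Z h2 hn hchar j.2 k.2, mul_neg, smul_neg, neg_smul, hX W.e_zero_mem_cocyc,
      cast_eq_neg_half h2 hchar]
    congr 2
    have h : (-1 : K) ^ (k : ℕ) = (-1) ^ ((k : ℕ) - j) * (-1) ^ (j : ℕ) := by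
      rw [← pow_add, Nat.sub_add_cancel hjk]
    have h1 : (-1 : K) ^ (j : ℕ) * (-1) ^ (j : ℕ) = 1 := by rw [← mul_pow]; simp
    rw [signedOdd, signedOdd, h, Fin.pos1, Fin.pos1, Nat.add_sub_add_right, pow_succ]
    push_cast
    field_simp
    -- With `n = -1/2` the coefficient `n - k + 1` of the relation, for `k` counted from one,
    -- becomes minus half an odd number, as in `Z_mul_Z`.
    linear_combination (2 * (j : K) + 1) * (2 * k + 1) * h1
  | z_mul_γ j =>
    simp only [map_mul, map_smul, map_pow, lift_genι, img_x_zero_pow]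
    change W.cl 2 (W.e j) * -W.cl 4 (W.e 0) = _ • (_ * -W.cl 6 1)
    rw [mul_neg, W.Z_mul_G h2 hn hchar j.2, mul_neg, smul_neg, hX W.one_mem_cocyc_six, one_mul,
      cast_eq_neg_half h2 hchar]
    congr 2
    rw [signedOdd, Fin.pos1, pow_succ]
    push_cast
    field_simp
    ring
  | γ_sq j hj =>
    have hj' : (j : ℕ) = 0 := Nat.succ_injective hj
    simp only [map_mul, map_pow, lift_genι]
    change (-W.cl 4 (W.e 0)) ^ 2 = W.cl 2 (W.e j) * -W.cl 6 1
    rw [neg_sq, sq, G_mul_G, mul_neg, Z_mul_H, hj']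
  | y_mul_z i j hi =>
    have hi' : (i : ℕ) = 0 := Nat.succ_injective hi
    simp only [map_mul, map_smul, lift_genι]
    change W.cl 1 W.D * W.cl 2 (W.e j) = _ • (W.cl 1 W.D * W.cl 2 (W.e i))
    rw [W.Y_mul_Z h2 hn hchar j.2, W.Y_mul_Z h2 hn hchar i.2, W.Z_mul_Y h2 hchar j.2,
      W.Z_mul_Y h2 hchar i.2, Finset.smul_sum]
    refine Finset.sum_congr rfl fun l _ => ?_
    rw [smul_smul, hi', signedOdd_zero, Fin.pos1, Nat.add_sub_cancel]
    congr 1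
    rw [signedOdd]
    push_cast
    ring
  | z_mul_t k j =>
    simp only [map_mul, map_smul, map_pow, lift_genι, img_x_zero_pow]
    change W.cl 2 (W.e k) * W.cl 3 (W.soc j) = _ • (_ * W.cl 1 W.D * -W.cl 4 (W.e 0))
    rw [W.Z_mul_T_of_lt (by omega), mul_neg, ← W.cl_five_eq hn, ite_smul, one_smul, zero_smul]
    simp only [Fin.pos1, Nat.add_right_cancel_iff]
  | t_mul_γ j =>
    simp only [map_mul, map_smul, map_pow, lift_genι, img_x_zero_pow]
    change W.cl 3 (W.soc j) * -W.cl 4 (W.e 0) = _ • (_ * W.cl 1 W.D * -W.cl 6 1)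
    rw [mul_neg, T_mul_G, mul_neg, mul_assoc, Y_mul_H, hX (W.rep_mem_cocyc 7 0 |> fun h => by
      rwa [show W.rep 7 0 = W.D * W.xpow 0 from rfl, xpow_zero, mul_one] at h),
      W.D_mul_xpow_last hn, ite_smul, one_smul, zero_smul]
    simp only [Fin.pos1, Nat.add_eq_right]
    split_ifs <;> simp

end WalkAlgebra

namespace WalkAlgebra

open GenRel

variable {K : Type u} [Field K] {n : ℕ} {A : Type u} [Ring A] [Algebra K A]
  (W : WalkAlgebra K n A)

/-! ### Bases of the Hochschild cohomology spaces -/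

/-- Cocycles which represent a basis of the Hochschild cohomology. -/
noncomputable def idxRep : ∀ k, Idx n k → A
  | 0 => Sum.elim (fun m => W.xpow m) fun i => W.soc i
  | k + 1 => fun m => W.rep (k + 1) (Fin.val (n := n) m)

theorem idxRep_mem (k : ℕ) (i : Idx n k) : W.idxRep k i ∈ W.cocyc k := by
  cases k with
  | zero =>
    rcases i with m | i
    · exact W.rep_mem_cocyc 0 m
    · exact W.soc_mem_center_cocyc i
  | succ k => exact W.rep_mem_cocyc (k + 1) _

theorem eq_zero_of_sum_eq_zero (hn : 0 < n) (a b : Fin n → K)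
    (h : ∑ m, a m • W.xpow m + ∑ i, b i • W.soc i = 0) : a = 0 ∧ b = 0 := by
  have ha : a = 0 := by
    funext m
    have h1 := congrArg (fun f => W.τ (f * W.test 0 m)) h
    simp only [add_mul, Finset.sum_mul, map_add, map_sum, smul_mul_assoc, map_smul, zero_mul,
      map_zero] at h1
    rw [Finset.sum_eq_single m, Finset.sum_eq_zero, add_zero] at h1
    · have h2 := W.τ_rep_mul_test hn 0 m.2 m.2
      rw [if_pos rfl] at h2
      rwa [show W.xpow m = W.rep 0 m from rfl, h2, smul_eq_mul, mul_one] at h1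
    -- Socle elements pair to zero with the odd powers of the loop used as tests, so the central
    -- powers separate first; pairing with the vertices then separates the socle.
    · intro i _
      change b i • W.τ (W.soc i * W.B 0 0 (2 * (n - 1 - m) + 1)) = 0
      rw [soc_mul_B, if_neg (by omega), map_zero, smul_zero]
    · intro l _ hl
      have h2 := W.τ_rep_mul_test hn 0 l.2 m.2
      rw [if_neg fun h => hl (Fin.ext h)] at h2
      rw [show W.xpow l = W.rep 0 l from rfl, h2, smul_zero]
    · intro h
      exact absurd (Finset.mem_univ _) h
  refine ⟨ha, ?_⟩
  funext i
  have h1 := congrArg (fun f => W.τ (f * W.e i)) h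
  simp only [ha, Pi.zero_apply, zero_smul, Finset.sum_const_zero, zero_add, Finset.sum_mul, map_sum,
    smul_mul_assoc, map_smul, zero_mul, map_zero, soc_mul_e] at h1
  rw [Finset.sum_eq_single i] at h1
  · rwa [if_pos rfl, W.τ_soc i.2, smul_eq_mul, mul_one] at h1
  · intro l _ hl
    rw [if_neg fun h => hl (Fin.ext h), map_zero, smul_zero]
  · intro h
    exact absurd (Finset.mem_univ _) h

theorem linearIndependent_cl (hn : 0 < n) (k : ℕ) :
    LinearIndependent K fun i : Idx n k => W.cl k (W.idxRep k i) := by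
  cases k with
  | zero =>
    change LinearIndependent K fun i : Fin n ⊕ Fin n => W.cl 0 (W.idxRep 0 i)
    rw [Fintype.linearIndependent_iff]
    intro c hc
    rw [← W.cl_sum Finset.univ (fun i : Fin n ⊕ Fin n => W.idxRep 0 i) c fun i => W.idxRep_mem 0 i,
      W.cl_zero_eq_zero_iff
        (Submodule.sum_mem _ fun i _ => Submodule.smul_mem _ (c i) (W.idxRep_mem 0 i)),
      Fintype.sum_sum_type] at hc
    obtain ⟨h1, h2⟩ := W.eq_zero_of_sum_eq_zero hn (fun m => c (Sum.inl m)) (fun i => c (Sum.inr i)) hc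
    rintro (m | i)
    · exact congrFun h1 m
    · exact congrFun h2 i
  | succ k =>
    change LinearIndependent K fun i : Fin n => W.cl (k + 1) (W.rep (k + 1) i)
    rw [Fintype.linearIndependent_iff]
    intro c hc
    exact W.coeff_eq_of_sum_eq hn (c' := 0) (by simpa using hc)

theorem cl_mem_span (h2 : (2 : K) ≠ 0) (hn : 0 < n) {k : ℕ} {f : A} (hf : f ∈ W.cocyc k) :
    W.cl k f ∈ Submodule.span K (Set.range fun i : Idx n k => W.cl k (W.idxRep k i)) := by
  cases k with
  | zero =>
    obtain ⟨a, ha, b, hb, rfl⟩ := Submodule.mem_sup.1 (W.cocyc_zero_le hn hf)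
    obtain ⟨c, rfl⟩ := (Submodule.mem_span_range_iff_exists_fun K).1 ha
    obtain ⟨d, rfl⟩ := (Submodule.mem_span_range_iff_exists_fun K).1 hb
    have h1 : ∀ i : Fin n, W.rep 3 i ∈ W.cocyc 0 := fun i => W.soc_mem_center_cocyc i
    rw [W.cl_add (Submodule.sum_mem _ fun i _ => Submodule.smul_mem _ (c i) (h1 i))
      (Submodule.sum_mem _ fun i _ => Submodule.smul_mem _ (d i) (W.rep_mem_cocyc 0 i)),
      W.cl_sum Finset.univ (fun i : Fin n => W.rep 3 i) c h1,
      W.cl_sum Finset.univ (fun i : Fin n => W.rep 0 i) d fun i => W.rep_mem_cocyc 0 i]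
    exact add_mem
      (Submodule.sum_mem _ fun i _ => Submodule.smul_mem _ _ (Submodule.subset_span ⟨Sum.inr i, rfl⟩))
      (Submodule.sum_mem _ fun i _ => Submodule.smul_mem _ _ (Submodule.subset_span ⟨Sum.inl i, rfl⟩))
  | succ k =>
    rw [W.cl_eq_sum h2 hn hf]
    exact Submodule.sum_mem _ fun i _ => Submodule.smul_mem _ _ (Submodule.subset_span ⟨i, rfl⟩)

theorem exists_basis (h2 : (2 : K) ≠ 0) (hn : 0 < n) (k : ℕ) :
    ∃ b : Module.Basis (Idx n k) K (HH K A k), ∀ i,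
      DirectSum.lof K ℕ (HH K A) k (b i) = W.cl k (W.idxRep k i) := by
  have hv : ∀ i : Idx n k, ∃ v, DirectSum.lof K ℕ (HH K A) k v = W.cl k (W.idxRep k i) := fun i =>
    W.cl_mem k _
  choose v hv using hv
  have hinj : Function.Injective (DirectSum.lof K ℕ (HH K A) k) := ofExt_injective k
  have hli : LinearIndependent K v := by
    refine LinearIndependent.of_comp (DirectSum.lof K ℕ (HH K A) k) ?_
    rw [show (DirectSum.lof K ℕ (HH K A) k) ∘ v = fun i => W.cl k (W.idxRep k i) from funext hv]
    exact W.linearIndependent_cl hn k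
  have hsp : ⊤ ≤ Submodule.span K (Set.range v) := by
    intro ξ _
    obtain ⟨f, hf, h⟩ := W.exists_cl k ξ
    have h1 := W.cl_mem_span h2 hn hf
    rw [← h, ← (show (DirectSum.lof K ℕ (HH K A) k) ∘ v = fun i => W.cl k (W.idxRep k i) from funext hv),
      Set.range_comp, Submodule.span_image] at h1
    obtain ⟨ζ, hζ, h2⟩ := h1
    rwa [← hinj h2]
  refine ⟨Module.Basis.mk hli hsp, fun i => ?_⟩
  rw [Module.Basis.mk_apply, hv]

/-! ### The isomorphism -/

/-- The homomorphism from the presented algebra to the Hochschild cohomology algebra. -/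
noncomputable def presentedHom (h2 : (2 : K) ≠ 0) (hn : 0 < n) (hchar : (2 * n + 1 : K) = 0) :
    PresentedAlgebra K n →ₐ[K] HHAlgebra K A :=
  RingQuot.liftAlgHom K ⟨FreeAlgebra.lift K W.img, fun _ _ h => W.img_rel h2 hn hchar h⟩

section

variable (h2 : (2 : K) ≠ 0) (hn : 0 < n) (hchar : (2 * n + 1 : K) = 0)

theorem presentedHom_gen (a : Gen n) :
    W.presentedHom h2 hn hchar (PresentedAlgebra.gen K a) = W.img a := by
  rw [PresentedAlgebra.gen, presentedHom, RingQuot.liftAlgHom_mkAlgHom_apply, lift_genι]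

theorem presentedHom_zval {m : ℕ} (hm : m < n) :
    W.presentedHom h2 hn hchar (zval (PresentedAlgebra.gen K) m) = W.cl 2 (W.e m) := by
  rw [zval, dif_pos hm, presentedHom_gen]
  rfl

theorem presentedHom_tval {m : ℕ} (hm : m + 1 < n) :
    W.presentedHom h2 hn hchar (tval (PresentedAlgebra.gen K) m) = W.cl 3 (W.soc m) := by
  rw [tval, dif_pos (by omega), presentedHom_gen]
  rfl

/-- The formula for `z_1 y` expresses `2 y z_1` as the sum of all `signedOdd l • t_l`; removing the
terms with `l < n - 1` and dividing isolates the last socle class. -/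
theorem presentedHom_sval {m : ℕ} (hm : m < n) :
    W.presentedHom h2 hn hchar (sval K (PresentedAlgebra.gen K) m) = W.cl 3 (W.soc m) := by
  unfold sval
  split_ifs with h
  · subst h
    have h1 := signedOdd_last_ne_zero h2 hn hchar
    rw [Nat.add_sub_cancel] at h1
    rw [map_smul, map_sub, map_smul, map_mul, presentedHom_gen, W.presentedHom_zval h2 hn hchar hn,
      map_sum]
    change _ • ((2 : K) • (W.cl 1 W.D * _) - _) = _
    rw [W.Y_mul_Z h2 hn hchar hn, W.Z_mul_Y h2 hchar hn, Finset.smul_sum,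
      ← Finset.sum_range fun l => (2 : K) • (2⁻¹ * signedOdd K 0 * signedOdd K l) • W.cl 3 (W.soc l),
      Finset.sum_range_succ, Finset.sum_congr rfl fun l hl => show
        W.presentedHom h2 hn hchar (signedOdd K l • tval (PresentedAlgebra.gen K) l) =
        (2 : K) • (2⁻¹ * signedOdd K 0 * signedOdd K l) • W.cl 3 (W.soc l) by
          rw [map_smul, W.presentedHom_tval h2 hn hchar (by
            have := Finset.mem_range.1 hl; omega), smul_smul, signedOdd_zero, mul_one,
            mul_inv_cancel_left₀ h2],
      add_sub_cancel_left, smul_smul, smul_smul, signedOdd_zero, mul_one, mul_assoc,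
      mul_inv_cancel_left₀ h2, inv_mul_cancel₀ h1, one_smul]
  · exact W.presentedHom_tval h2 hn hchar (by omega)

theorem presentedHom_mon (k : ℕ) : ∀ m, m < n →
    W.presentedHom h2 hn hchar (mon K (PresentedAlgebra.gen K) k m) = W.cl k (W.rep k m) := by
  have hx : ∀ m, W.presentedHom h2 hn hchar (PresentedAlgebra.gen K (.x 0) ^ m) =
      W.cl 0 (W.xpow m) := fun m => by
    rw [map_pow, presentedHom_gen, img_x_zero_pow]
  refine six_induction (p := fun k => ∀ m, m < n →
    W.presentedHom h2 hn hchar (mon K (PresentedAlgebra.gen K) k m) = W.cl k (W.rep k m))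
    (fun m _ => hx m) (fun m _ => ?_) (fun m hm => W.presentedHom_zval h2 hn hchar hm)
    (fun m hm => W.presentedHom_sval h2 hn hchar hm) (fun m _ => ?_) (fun m _ => ?_)
    (fun k h m hm => ?_) k
  · change W.presentedHom h2 hn hchar (PresentedAlgebra.gen K .y * PresentedAlgebra.gen K (.x 0) ^ m) = _
    rw [map_mul, hx, presentedHom_gen]
    exact W.cl_mul_central W.D_mem_cocyc (W.xpow_mul m)
  · change W.presentedHom h2 hn hchar (-PresentedAlgebra.gen K .γ * PresentedAlgebra.gen K (.x 0) ^ m) = _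
    rw [map_mul, map_neg, hx, presentedHom_gen]
    change - -W.cl 4 (W.e 0) * _ = _
    rw [neg_neg]
    exact W.cl_mul_central W.e_zero_mem_cocyc (W.xpow_mul m)
  · change W.presentedHom h2 hn hchar
      (PresentedAlgebra.gen K .y * PresentedAlgebra.gen K .γ * PresentedAlgebra.gen K (.x 0) ^ m) = _
    rw [map_mul, map_mul, hx, presentedHom_gen, presentedHom_gen]
    change W.cl 1 W.D * -W.cl 4 (W.e 0) * _ = _
    rw [mul_neg, W.Y_mul_G hn, neg_neg]
    exact W.cl_mul_central W.B_loop_mem_cocyc (W.xpow_mul m)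
  · change W.presentedHom h2 hn hchar
      (mon K (PresentedAlgebra.gen K) k m * -PresentedAlgebra.gen K .h) = _
    rw [map_mul, map_neg, h m hm, presentedHom_gen]
    change _ * - -W.cl 6 1 = _
    rw [neg_neg]
    exact W.cl_mul_H rfl (W.rep_mem_cocyc k m)

theorem presentedHom_idxMon (k : ℕ) (i : Idx n k) :
    W.presentedHom h2 hn hchar (idxMon K (PresentedAlgebra.gen K) k i) = W.cl k (W.idxRep k i) := by
  cases k with
  | zero =>
    rcases i with m | i
    · exact W.presentedHom_mon h2 hn hchar 0 m m.2
    · change W.presentedHom h2 hn hchar (PresentedAlgebra.gen K (.x i.succ)) = _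
      rw [presentedHom_gen, W.img_x_of_ne (by simp)]
      rfl
  | succ k => exact W.presentedHom_mon h2 hn hchar (k + 1) _ (Fin.is_lt (n := n) i)

/-- A linear map `ψ` back is defined on the basis of the cohomology by the normal monomials. It is a
section of the homomorphism, and it is surjective because normal monomials span; hence both are
bijective, and no independence of monomials has to be proved in the presented algebra. -/
theorem presentedHom_bijective : Function.Bijective (W.presentedHom h2 hn hchar) := by
  classical
  choose b hb using W.exists_basis h2 hn
  let ψ : HHAlgebra K A →ₗ[K] PresentedAlgebra K n :=
    DirectSum.toModule K ℕ _ fun k => (b k).constr K (idxMon K (PresentedAlgebra.gen K) k)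
  have hψ : ∀ k i, ψ (DirectSum.lof K ℕ (HH K A) k (b k i)) =
      idxMon K (PresentedAlgebra.gen K) k i := fun k i => by
    rw [DirectSum.toModule_lof, Module.Basis.constr_basis]
  have h1 : (W.presentedHom h2 hn hchar).toLinearMap ∘ₗ ψ = LinearMap.id := by
    refine DirectSum.linearMap_ext K fun k => (b k).ext fun i => ?_
    rw [LinearMap.comp_apply, LinearMap.comp_apply, hψ, LinearMap.comp_apply, LinearMap.id_apply, hb]
    exact W.presentedHom_idxMon h2 hn hchar k i
  have h3 : Function.Surjective ψ := by
    rw [← LinearMap.range_eq_top, eq_top_iff, ← PresentedAlgebra.monSpan_gen h2 hn hchar, monSpan,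
      Submodule.span_le]
    rintro _ ⟨⟨k, i⟩, rfl⟩
    exact ⟨_, hψ k i⟩
  have h4 : ∀ ξ, W.presentedHom h2 hn hchar (ψ ξ) = ξ := LinearMap.congr_fun h1
  refine ⟨fun a a' h => ?_, fun ξ => ⟨ψ ξ, h4 ξ⟩⟩
  obtain ⟨ξ, rfl⟩ := h3 a
  obtain ⟨ξ', rfl⟩ := h3 a'
  rw [h4, h4] at h
  rw [h]

theorem mul_mem_component {i j k : ℕ} (h : i + j = k) {a b : HHAlgebra K A}
    (ha : a ∈ HHAlgebra.component K A i) (hb : b ∈ HHAlgebra.component K A j) :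
    a * b ∈ HHAlgebra.component K A k := by
  subst h
  obtain ⟨α, rfl⟩ := ha
  obtain ⟨β, rfl⟩ := hb
  exact ⟨_, (DirectSum.of_mul_of (A := HH K A) α β).symm⟩

theorem prod_mem_component (l : List (Gen n)) :
    W.presentedHom h2 hn hchar (l.map (PresentedAlgebra.gen K)).prod ∈
      HHAlgebra.component K A (l.map Gen.deg).sum := by
  induction l with
  | nil =>
    rw [List.map_nil, List.map_nil, List.prod_nil, map_one, one_eq_cl]
    exact W.cl_mem 0 1
  | cons a l ih =>
    rw [List.map_cons, List.map_cons, List.prod_cons, map_mul, presentedHom_gen]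
    obtain ⟨f, _, hf⟩ := W.exists_img a
    refine mul_mem_component rfl ?_ ih
    rw [hf]
    exact W.cl_mem _ _

theorem map_component (d : ℕ) :
    (PresentedAlgebra.component K n d).map (W.presentedHom h2 hn hchar).toLinearMap =
      HHAlgebra.component K A d := by
  refine le_antisymm ?_ ?_
  · rw [PresentedAlgebra.component, Submodule.map_span_le]
    rintro _ ⟨l, rfl, rfl⟩
    exact W.prod_mem_component h2 hn hchar l
  · rintro _ ⟨ξ, rfl⟩
    obtain ⟨f, hf, h⟩ := W.exists_cl d ξ
    have h1 := W.cl_mem_span h2 hn hf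
    rw [← h] at h1
    refine Submodule.span_le.2 ?_ h1
    rintro _ ⟨i, rfl⟩
    exact ⟨_, PresentedAlgebra.idxMon_mem_component d i, W.presentedHom_idxMon h2 hn hchar d i⟩

end

end WalkAlgebra

theorem theorem1p2 (K : Type u) [Field K] [IsAlgClosed K] (n : ℕ) (hn : 1 ≤ n)
    (hchar2 : ringChar K ≠ 2) (hchar : ringChar K ∣ 2 * n + 1) :
    ∃ φ : PresentedAlgebra K n ≃ₐ[K] HHAlgebra K (PreprojectiveAlgebra K (graphL n)),
      ∀ d : ℕ, (PresentedAlgebra.component K n d).map φ.toLinearMap =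
        HHAlgebra.component K (PreprojectiveAlgebra K (graphL n)) d := by
  have h2 : (2 : K) ≠ 0 := Ring.two_ne_zero hchar2
  have hchar' : (2 * n + 1 : K) = 0 := by
    have h := (ringChar.spec K (2 * n + 1)).2 hchar
    push_cast at h
    exact h
  let W := AlgL.walkAlgebra K n
  exact ⟨AlgEquiv.ofBijective (W.presentedHom h2 hn hchar') (W.presentedHom_bijective h2 hn hchar'),
    W.map_component h2 hn hchar'⟩
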